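/- **Notation.** Let $\mathbb S_+\subset\mathbb N_+$ be finite and non-empty, $\mathbb S^\bot:=\mathbb Z\setminus(\mathbb S_+\cup(-\mathbb S_+)\cup\{0\})$, $\tau>0$, and $$s_0:=\big[\tfrac{|\mathbb S_+|+1}2\big]+1,\quad \tau_1:=2\tau+1,\quad \mathtt a:=3\tau_1+1,\quad \mathtt b:=[\mathtt a]+2,\quad M:=2(s_0+\mathtt b)+4,\quad \mathfrak s_M:=\max\{s_0,M+1\},$$ $\mu(\mathtt b):=s_0+\mathtt b+\sigma+1$ with a given $\sigma\ge 0$; $N_{-1}:=1$, $N_\nu:=N_0^{(3/2)^\nu}$ for $\nu\ge0$; $\langle \ell\rangle:=\max\{1,|\ell|\}$, $\langle\ell,j\rangle:=\max\{1,|\ell|,|j|\}$, where $|\ell|$ is the maximum norm on $\mathbb Z^{\mathbb S_+}$. $H^s_\bot$ is the space of $u=\sum_{\ell\in\mathbb Z^{\mathbb S_+},j\in\mathbb S^\bot}u_{\ell,j}e^{\mathrm i(\ell\cdot\varphi+2\pi jx)}$ with $\|u\|_s^2:=\sum|u_{\ell,j}|^2\langle\ell,j\rangle^{2s}<\infty$.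 A $\varphi$-dependent operator $A$ is identified with its matrix, $(Au)_{\ell,j}=\sum A_j^{j'}(\ell-\ell')u_{\ell',j'}$. $|A|$ has the matrix $|A_j^{j'}(\ell)|$, $\langle\partial_\varphi\rangle^{\mathtt b}A$ the matrix $\langle\ell\rangle^{\mathtt b}A_j^{j'}(\ell)$, $\partial_{\varphi_m}^kA$ the matrix $(\mathrm i\ell_m)^kA_j^{j'}(\ell)$, and $\|\cdot\|_{\mathcal B(H^s)}$ is the operator norm on $H^s_\bot$. For a function $f$ on a set $O\subset\mathbb R^{\mathbb S_+}$ and a norm $N$ put $N^{\mathrm{Lip}(\gamma)}(f):=\sup_{O}N(f(\omega))+\gamma\sup_{\omega_1\ne\omega_2}N(f(\omega_1)-f(\omega_2))/|\omega_1-\omega_2|$. A non-decreasing $\mathfrak M:[\mathfrak s_M,S]\to[0,\infty)$ is a *tame constant* of $A=A(\omega)$, $\omega\in O$, if for all $s\in[\mathfrak s_M,S]$, $u\in H^s_\bot$, $$\sup_\omega\|A(\omega)u\|_s+\gamma\sup_{\omega_1\neq\omega_2}\Big\|\tfrac{A(\omega_1)-A(\omega_2)}{|\omega_1-\omega_2|}u\Big\|_s\le\mathfrak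 M(\mathfrak s_M)\|u\|_s+\mathfrak M(s)\|u\|_{\mathfrak s_M},$$ and a *modulo-tame constant* if this holds with $|A(\omega)|$, $|A(\omega_1)-A(\omega_2)|$ in place of $A(\omega)$, $A(\omega_1)-A(\omega_2)$; $A$ is then $\mathrm{Lip}(\gamma)$-(modulo-)tame. $A$ is *Hamiltonian* if $A=\partial_xG$ with $G$ real and self-adjoint, and $\omega\cdot\partial_\varphi+A$ is then Hamiltonian too; $A$ is *symplectic* if each $A(\varphi)$ preserves $\int(\partial_x^{-1}u)v\,dx$ on $L^2_\bot(\mathbb T_1)=\{\sum_{j\in\mathbb S^\bot}u_je^{2\pi\mathrm i jx}\}$. For $\Omega\subset\mathbb R^{\mathbb S_+}$, $\mathtt{DC}(\gamma,\tau):=\{\omega\in\Omega:|\omega\cdot\ell|\ge\gamma\langle\ell\rangle^{-\tau}\ \forall\ell\ne0\}$. A torus $\iota=(\Theta,y,w)$ consists of real functions $\Theta,y:\mathbb T^{\mathbb S_+}\to\mathbb R^{\mathbb S_+}$ and $w:\mathbb T^{\mathbb S_+}\to L^2_\bot(\mathbb T_1)$ depending on $\omega$; $\|\iota\|_s$ is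 the sum of the Sobolev norms of its components, and $\|\iota\|_s^{\mathrm{Lip}(\gamma)}$ the sum of their $\mathrm{Lip}(\gamma)$ norms over $\mathtt{DC}(\gamma/2,\tau)$. **Initial operators.** Let $K,K_S>0$, $S>\mathfrak s_M$, $0<\gamma<1$, $\varepsilon>0$ with $\varepsilon\gamma^{-3}\le1$, and $\mu_0\ge\mathfrak s_M+\mu(\mathtt b)$. Call $\iota$ *allowed* if $\|\iota\|_{\mu_0}^{\mathrm{Lip}(\gamma)}\le K\varepsilon\gamma^{-2}$. Consider a family, indexed by tori $\iota$, of operators $$\mathtt L_0=\omega\cdot\partial_\varphi+\mathrm i\mathtt D_0+\mathtt R_0,\quad \mathtt D_0=\mathrm{diag}_{j\in\mathbb S^\bot}\mu_j^0,\quad \mu_j^0=m_3(2\pi j)^3-m_1\,2\pi j-q_j(\omega),$$ with real $q_j$ (independent of $\iota$) and $m_3=m_3(\iota;\omega)$ defined on $\Omega$, and with $m_1=m_1(\iota;\omega)\in\mathbb R$ and $\mathtt R_0=\mathtt R_0(\iota;\omega)$ defined on $\mathtt{DC}(\gamma/2,\tau)$. Assume $q_{-j}=-q_j$, $|j||q_j|^{\sup}\le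 K$, $|j||q_j|^{\mathrm{lip}}\le K$ on $\Omega$ and, for all allowed $\iota,\iota_1,\iota_2$, with all norms and pointwise estimates involving $m_1$, $\mathtt R_0$ or a difference of tori over $\mathtt{DC}(\gamma/2,\tau)$: (a) $|m_3+1|^{\mathrm{Lip}(\gamma)}\le K\varepsilon$ on $\Omega$, $|m_1|^{\mathrm{Lip}(\gamma)}\le K\varepsilon\gamma^{-2}$, and $|m_k(\iota_1)-m_k(\iota_2)|\le K\|\iota_1-\iota_2\|_{\mathfrak s_M+\mu(\mathtt b)}$ for $k=1,3$; (b) $\mathtt R_0$ is Hamiltonian, and for $T\in\{\mathtt R_0,[\mathtt R_0,\partial_x]\}$ the operators $T$, $\partial_{\varphi_m}^{s_0}T$, $\partial_{\varphi_m}^{s_0+\mathtt b}T$ ($m\in\mathbb S_+$) are $\mathrm{Lip}(\gamma)$-tame with a common tame constant $\mathfrak M_0(s,\mathtt b)=\mathfrak M_0(\iota;s,\mathtt b)\le K_S(\varepsilon+\|\iota\|_{s+\mu(\mathtt b)}^{\mathrm{Lip}(\gamma)})$ on $[\mathfrak s_M,S]$; (c) with $\Delta_{12}\mathtt R_0:=\mathtt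 R_0(\iota_1)-\mathtt R_0(\iota_2)$, the norms $\|\partial_{\varphi_m}^\lambda\Delta_{12}\mathtt R_0\|_{\mathcal B(H^{\mathfrak s_M})}$ and $\|\partial_{\varphi_m}^\lambda[\Delta_{12}\mathtt R_0,\partial_x]\|_{\mathcal B(H^{\mathfrak s_M})}$ are $\le K_S\|\iota_1-\iota_2\|_{\mathfrak s_M+\mu(\mathtt b)}$ for $m\in\mathbb S_+$, $0\le\lambda\le s_0+\mathtt b$. **Theorem.** There is $\overline\tau>0$ depending only on $\tau,\mathbb S_+$; for all $\sigma\ge0$, $K>0$ there is $C>0$; and for all $S>\mathfrak s_M$, $K_S>0$ there are $\underline N\in\mathbb N$, $C_S>0$, $\delta_0\in(0,1)$ (none of these depending on $\varepsilon,\gamma,\mu_0,\Omega$ or the family) such that for every integer $N_0\ge\underline N$, all $\varepsilon,\gamma,\mu_0$ and every family as above there are real functions $r_j^\nu$ with $r_j^0=0$, operators $\mathtt R_\nu$ (with $\mathtt R_0$ the given one) and $\Psi_\nu$, depending on $\iota$ and $\omega$, and functions $\mathfrak M_\nu^\sharp(s)$, $\mathfrak M^\sharp_\nu(s,\mathtt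 b)$, depending on $\iota$, such that the following holds with $\mu_j^\nu:=\mu_j^0+r_j^\nu$, $\mathtt D_\nu:=\mathrm{diag}_{j\in\mathbb S^\bot}\mu_j^\nu$, $\mathtt L_\nu:=\omega\cdot\partial_\varphi+\mathrm i\mathtt D_\nu+\mathtt R_\nu$, $\mathtt\Omega_0^g(\iota):=\mathtt{DC}(g,\tau)$ and $$\mathtt\Omega_{\nu+1}^g(\iota):=\Big\{\omega\in\mathtt\Omega_\nu^g(\iota):|\omega\cdot\ell+\mu_j^\nu-\mu_{j'}^\nu|\ge g\frac{|j^3-j'^3|}{\langle\ell\rangle^\tau}\ \ \forall|\ell|\le N_\nu,\ j,j'\in\mathbb S^\bot\Big\}.$$ **(I) Almost reducibility.** Let $\iota$ be allowed with $N_0^{\overline\tau}\,\mathfrak M_0(\mathfrak s_M,\mathtt b)\gamma^{-1}\le1$. For all $g\in[\gamma/2,2\gamma]$ and $\nu\in\mathbb N$: (S1) On $\mathtt\Omega_\nu^g(\iota)$, $\mathtt L_\nu$ is Hamiltonian, $\mu_j^\nu$ is a real $\mathrm{Lip}(\gamma)$ function, $\mu_{-j}^\nu=-\mu_j^\nu$,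 $|r_j^\nu|^{\mathrm{Lip}(\gamma)}\le C_S\varepsilon\gamma^{-2}$; $\mathfrak M_\nu^\sharp(s)$ and $\mathfrak M_\nu^\sharp(s,\mathtt b)$ are modulo-tame constants of $\mathtt R_\nu$ and $\langle\partial_\varphi\rangle^{\mathtt b}\mathtt R_\nu$ and, for $s\in[\mathfrak s_M,S]$, $$\mathfrak M_\nu^\sharp(s)\le C\,\mathfrak M_0(s,\mathtt b)N_{\nu-1}^{-\mathtt a},\qquad \mathfrak M_\nu^\sharp(s,\mathtt b)\le C\,\mathfrak M_0(s,\mathtt b)N_{\nu-1}.$$ On $\mathtt\Omega_{\nu+1}^g(\iota)$, $\Psi_\nu$ is Hamiltonian, $\Phi_\nu:=\exp(\Psi_\nu)$ is symplectic and invertible with inverse $\exp(-\Psi_\nu)$, and $\mathtt L_{\nu+1}=\Phi_\nu\mathtt L_\nu\Phi_\nu^{-1}$ (as operators in $H^s_\bot$, $s\in[\mathfrak s_M,S]$, with maximal domains); $\Psi_\nu$ and $\langle\partial_\varphi\rangle^{\mathtt b}\Psi_\nu$ are $\mathrm{Lip}(\gamma)$-modulo-tame with modulo-tame constants $\frac C\gamma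 N_\nu^{\tau_1}N_{\nu-1}^{-\mathtt a}\mathfrak M_0(s,\mathtt b)$ and $\frac C\gamma N_\nu^{\tau_1}N_{\nu-1}\mathfrak M_0(s,\mathtt b)$. (S2) There are Lipschitz extensions $\widetilde\mu_j^\nu:\Omega\to\mathbb R$ of $\mu_j^\nu:\mathtt\Omega_\nu^g(\iota)\to\mathbb R$ with $\widetilde\mu_j^0=m_3(2\pi j)^3-\widetilde m_1\,2\pi j-q_j$, where $\widetilde m_1:\Omega\to\mathbb R$ extends $m_1|_{\mathtt{DC}(g,\tau)}$ and $|\widetilde m_1|^{\mathrm{Lip}(\gamma)}\le C\varepsilon\gamma^{-2}$, and $$|\widetilde\mu_j^{\nu+1}-\widetilde\mu_j^\nu|^{\mathrm{Lip}(\gamma)}\le C\,\mathfrak M_\nu^\sharp(\mathfrak s_M)\le C^2\,\mathfrak M_0(\mathfrak s_M,\mathtt b)N_{\nu-1}^{-\mathtt a}.$$ Let $\iota_1,\iota_2$ be allowed, both satisfying the smallness condition in (I). For all $\nu\in\mathbb N$: (S3) For all $\gamma_1,\gamma_2\in[\gamma/2,2\gamma]$ and $\omega\in\mathtt\Omega_\nu^{\gamma_1}(\iota_1)\cap\mathtt\Omega_\nu^{\gamma_2}(\iota_2)$,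 $$\||\mathtt R_\nu(\iota_1)-\mathtt R_\nu(\iota_2)|\|_{\mathcal B(H^{\mathfrak s_M})}\le C_SN_{\nu-1}^{-\mathtt a}\|\iota_1-\iota_2\|_{\mathfrak s_M+\mu(\mathtt b)},\quad \||\langle\partial_\varphi\rangle^{\mathtt b}(\mathtt R_\nu(\iota_1)-\mathtt R_\nu(\iota_2))|\|_{\mathcal B(H^{\mathfrak s_M})}\le C_SN_{\nu-1}\|\iota_1-\iota_2\|_{\mathfrak s_M+\mu(\mathtt b)},$$ and for all $\omega\in\mathtt\Omega_{\nu+1}^{\gamma_1}(\iota_1)\cap\mathtt\Omega_{\nu+1}^{\gamma_2}(\iota_2)$, $j\in\mathbb S^\bot$, $$\big|(r_j^{\nu+1}(\iota_1)-r_j^{\nu+1}(\iota_2))-(r_j^\nu(\iota_1)-r_j^\nu(\iota_2))\big|\le C\||\mathtt R_\nu(\iota_1)-\mathtt R_\nu(\iota_2)|\|_{\mathcal B(H^{\mathfrak s_M})},\quad |r_j^{\nu+1}(\iota_1)-r_j^{\nu+1}(\iota_2)|\le C_S\|\iota_1-\iota_2\|_{\mathfrak s_M+\mu(\mathtt b)}.$$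 (S4) If $0<\rho<\gamma/2$ and $C_SN_{\nu-1}^\tau\sup_{\omega\in\mathtt{DC}(\gamma,\tau)}\|\iota_1-\iota_2\|_{\mathfrak s_M+\mu(\mathtt b)}\le\rho$, then $\mathtt\Omega_\nu^\gamma(\iota_1)\subseteq\mathtt\Omega_\nu^{\gamma-\rho}(\iota_2)$. **(II) KAM almost-reducibility.** If $N_0^{\overline\tau}\varepsilon\gamma^{-3}\le\delta_0$, then for every allowed $\iota$, $g\in[\gamma/2,2\gamma]$, $n\in\mathbb N$ and on $\mathtt\Omega_{n+1}^g(\iota)$: the operator $U_n:=\Phi_{n-1}\circ\cdots\circ\Phi_0$ ($U_0=\mathrm{Id}$) is well defined and invertible, $\mathtt L_n=U_n\mathtt L_0U_n^{-1}$ (in the same sense), $\mathtt L_n$ is Hamiltonian, $U_n^{\pm1}$ are symplectic, $\mathtt R_n$ and $U_n^{\pm1}-\mathrm{Id}$ are $\mathrm{Lip}(\gamma)$-modulo-tame, and for $s\in[\mathfrak s_M,S]$, with $\mathfrak M^\sharp_{\mathtt R_n}=\mathfrak M_n^\sharp$, $$\mathfrak M^\sharp_{\mathtt R_n}(s)\le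 C_SN_{n-1}^{-\mathtt a}\big(\varepsilon+\|\iota\|_{s+\mu(\mathtt b)}^{\mathrm{Lip}(\gamma)}\big),\qquad \mathfrak M^\sharp_{U_n^{\pm1}-\mathrm{Id}}(s)\le C_S\gamma^{-1}N_0^{\tau_1}\big(\varepsilon+\|\iota\|_{s+\mu(\mathtt b)}^{\mathrm{Lip}(\gamma)}\big).$$ -/

import Mathlib

open scoped ENNReal

noncomputable section

namespace KamRed

/-! ### Index sets -/

/-- Frequency vectors `ω ∈ ℝ^{𝕊₊}` (Euclidean norm). -/
abbrev Freq (P : Finset ℕ) : Type := EuclideanSpace ℝ P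

/-- Fourier indices `ℓ ∈ ℤ^{𝕊₊}`; `‖ℓ‖` is the maximum norm `|ℓ|`. -/
abbrev Mode (P : Finset ℕ) : Type := P → ℤ

/-- `𝕊^⊥ = ℤ \ (𝕊₊ ∪ (-𝕊₊) ∪ {0})`. -/
abbrev Site (P : Finset ℕ) : Type := {j : ℤ // j ≠ 0 ∧ j.natAbs ∉ P}

instance siteNeg (P : Finset ℕ) : Neg (Site P) :=
  ⟨fun j => ⟨-j.1, by simpa using j.2⟩⟩

/-- Space-time Fourier indices `(ℓ, j)`. -/
abbrev Idx (P : Finset ℕ) : Type := Mode P × Site P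

/-- `⟨ℓ⟩ = max {1, |ℓ|}`. -/
def jap {P : Finset ℕ} (l : Mode P) : ℝ := max 1 ‖l‖

/-- `⟨ℓ, j⟩ = max {1, |ℓ|, |j|}`. -/
def japIdx {P : Finset ℕ} (k : Idx P) : ℝ := max (jap k.1) |(k.2.1 : ℝ)|

/-- `ω · ℓ`. -/
def dot {P : Finset ℕ} (ω : Freq P) (l : Mode P) : ℝ := ∑ n, ω n * (l n : ℝ)

/-! ### Sobolev norms (functions are represented by their Fourier coefficients) -/

/-- The norm `‖u‖_s` of `H^s_⊥`, with value `∞` when `u ∉ H^s_⊥`. -/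
def sob {P : Finset ℕ} (s : ℝ) (u : Idx P → ℂ) : ℝ≥0∞ :=
  (∑' k, (ENNReal.ofReal (japIdx k ^ s) * ‖u k‖ₑ) ^ 2) ^ (1 / 2 : ℝ)

/-- The norm of `H^s(𝕋^{𝕊₊}, ℂ^{𝕊₊})`. -/
def sobVec {P : Finset ℕ} (s : ℝ) (u : Mode P → P → ℂ) : ℝ≥0∞ :=
  (∑' l, ∑ n, (ENNReal.ofReal (jap l ^ s) * ‖u l n‖ₑ) ^ 2) ^ (1 / 2 : ℝ)

/-- `sup_{ω ∈ O} N (f ω)`. -/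
def supNorm {P : Finset ℕ} {X : Type*} (N : X → ℝ≥0∞) (O : Set (Freq P)) (f : Freq P → X) :
    ℝ≥0∞ :=
  ⨆ ω ∈ O, N (f ω)

/-- `sup_{ω₁ ≠ ω₂ ∈ O} N (f ω₁ - f ω₂) / |ω₁ - ω₂|`. -/
def lipSemi {P : Finset ℕ} {X : Type*} [Sub X] (N : X → ℝ≥0∞) (O : Set (Freq P))
    (f : Freq P → X) : ℝ≥0∞ :=
  ⨆ ω₁ ∈ O, ⨆ ω₂ ∈ O, ⨆ _ : ω₁ ≠ ω₂, N (f ω₁ - f ω₂) / ENNReal.ofReal ‖ω₁ - ω₂‖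

/-- The norm `Lip(γ)` over the parameter set `O`. -/
def lipNorm {P : Finset ℕ} {X : Type*} [Sub X] (N : X → ℝ≥0∞) (γ : ℝ) (O : Set (Freq P))
    (f : Freq P → X) : ℝ≥0∞ :=
  supNorm N O f + ENNReal.ofReal γ * lipSemi N O f

/-- `|f|^{Lip(γ)}` for real valued functions. -/
def lipR {P : Finset ℕ} (γ : ℝ) (O : Set (Freq P)) (f : Freq P → ℝ) : ℝ≥0∞ :=
  lipNorm (fun x : ℝ => ‖x‖ₑ) γ O f

/-! ### Torus embeddings -/

/-- The periodic part `ι(φ; ω) = (Θ(φ; ω), y(φ; ω), w(φ, ·; ω))` of a torus embedding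
`φ ↦ (φ, 0, 0) + ι(φ)`, given by Fourier coefficients; the components are real valued and `w`
takes values in `L²_⊥`. -/
structure Torus (P : Finset ℕ) where
  Th : Freq P → Mode P → P → ℂ
  y : Freq P → Mode P → P → ℂ
  w : Freq P → Idx P → ℂ
  Th_real : ∀ ω l n, star (Th ω l n) = Th ω (-l) n
  y_real : ∀ ω l n, star (y ω l n) = y ω (-l) n
  w_real : ∀ ω l j, star (w ω (l, j)) = w ω (-l, -j)

/-- `‖ι‖_s^{Lip(γ)}` over the parameter set `O`. -/
def Torus.lip {P : Finset ℕ} (s γ : ℝ) (O : Set (Freq P)) (i : Torus P) : ℝ≥0∞ :=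
  lipNorm (sobVec s) γ O i.Th + lipNorm (sobVec s) γ O i.y + lipNorm (sob s) γ O i.w

/-- `‖ι₁ - ι₂‖_s` at the parameter `ω`. -/
def Torus.dist {P : Finset ℕ} (s : ℝ) (i₁ i₂ : Torus P) (ω : Freq P) : ℝ≥0∞ :=
  sobVec s (i₁.Th ω - i₂.Th ω) + sobVec s (i₁.y ω - i₂.y ω) + sob s (i₁.w ω - i₂.w ω)

/-! ### Linear operators, identified with their matrices -/

/-- A `φ`-dependent operator on `L²_⊥`; `A ℓ j j'` is the matrix element `A_j^{j'}(ℓ)`, so that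
`A(φ)` has the matrix `A_j^{j'}(φ) = ∑_ℓ A_j^{j'}(ℓ) e^{iℓ·φ}`. -/
abbrev Op (P : Finset ℕ) : Type := Mode P → Site P → Site P → ℂ

/-- `(A u)_{ℓ,j} = ∑_{ℓ',j'} A_j^{j'}(ℓ - ℓ') u_{ℓ',j'}`. -/
def app {P : Finset ℕ} (A : Op P) (u : Idx P → ℂ) : Idx P → ℂ :=
  fun k => ∑' k' : Idx P, A (k.1 - k'.1) k.2 k'.2 * u k'

/-- The series defining `A u` converge absolutely. -/
def Acts {P : Finset ℕ} (A : Op P) (u : Idx P → ℂ) : Prop :=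
  ∀ k : Idx P, Summable fun k' : Idx P => A (k.1 - k'.1) k.2 k'.2 * u k'

open Classical in
/-- `‖A u‖_s`, with value `∞` when `A u` is not defined. -/
def appNorm {P : Finset ℕ} (s : ℝ) (u : Idx P → ℂ) (A : Op P) : ℝ≥0∞ :=
  if Acts A u then sob s (app A u) else ⊤

/-- The operator norm of `A` in `B(H^s_⊥)`. -/
def opNorm {P : Finset ℕ} (s : ℝ) (A : Op P) : ℝ≥0∞ :=
  ⨆ (u : Idx P → ℂ) (_ : sob s u ≤ 1), appNorm s u A

/-- The majorant operator `|A|`. -/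
def maj {P : Finset ℕ} (A : Op P) : Op P := fun l j j' => ((‖A l j j'‖ : ℝ) : ℂ)

/-- `⟨∂_φ⟩^b A`. -/
def japD {P : Finset ℕ} (b : ℕ) (A : Op P) : Op P :=
  fun l j j' => ((jap l ^ b : ℝ) : ℂ) * A l j j'

/-- `∂_{φ_m}^k A`. -/
def dPhi {P : Finset ℕ} (m : P) (k : ℕ) (A : Op P) : Op P :=
  fun l j j' => (Complex.I * (l m : ℂ)) ^ k * A l j j'

/-- The commutator `[A, ∂_x]`. -/
def commDx {P : Finset ℕ} (A : Op P) : Op P :=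
  fun l j j' => A l j j' * (2 * Real.pi * Complex.I * (j'.1 : ℂ))
    - (2 * Real.pi * Complex.I * (j.1 : ℂ)) * A l j j'

/-- The identity operator on `L²_⊥`. -/
def idOp {P : Finset ℕ} : Op P := fun l j j' => if l = 0 ∧ j = j' then 1 else 0

/-- The composition `A ∘ B`. -/
def comp {P : Finset ℕ} (A B : Op P) : Op P :=
  fun l j j' => ∑' k : Idx P, A (l - k.1) j k.2 * B k.1 k.2 j'

/-- `A^n`. -/
def powOp {P : Finset ℕ} (A : Op P) : ℕ → Op P
  | 0 => idOp
  | n + 1 => comp A (powOp A n)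

/-- `exp A = ∑ A^n / n!`. -/
def expOp {P : Finset ℕ} (A : Op P) : Op P :=
  fun l j j' => ∑' n : ℕ, ((n.factorial : ℂ))⁻¹ * powOp A n l j j'

/-- The operator `i diag_j (μ_j)`. -/
def diagOp {P : Finset ℕ} (μ : Site P → ℝ) : Op P :=
  fun l j j' => if l = 0 ∧ j = j' then Complex.I * (μ j : ℂ) else 0

/-- `(ω·∂_φ + i diag(μ) + R) u`. -/
def linOp {P : Finset ℕ} (ω : Freq P) (μ : Site P → ℝ) (R : Op P) (u : Idx P → ℂ) :
    Idx P → ℂ :=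
  fun k => Complex.I * ((dot ω k.1 + μ k.2 : ℝ) : ℂ) * u k + app R u k

/-! ### Hamiltonian and symplectic operators -/

/-- `A` maps real valued functions to real valued functions. -/
def IsRealOp {P : Finset ℕ} (A : Op P) : Prop :=
  ∀ l j j', star (A l j j') = A (-l) (-j) (-j')

/-- `A(φ)` is self-adjoint in `L²` for all `φ`. -/
def IsSelfAdj {P : Finset ℕ} (A : Op P) : Prop :=
  ∀ l j j', star (A l j j') = A (-l) j' j

/-- `A = ∂_x G` with `G` real and self-adjoint. -/
def IsHam {P : Finset ℕ} (A : Op P) : Prop :=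
  ∃ G : Op P, IsRealOp G ∧ IsSelfAdj G ∧
    ∀ l j j', A l j j' = 2 * Real.pi * Complex.I * (j.1 : ℂ) * G l j j'

/-- The matrix element `A_j^{j'}(φ)`. -/
def evalPhi {P : Finset ℕ} (A : Op P) (φ : P → ℝ) (j j' : Site P) : ℂ :=
  ∑' l : Mode P, A l j j' * Complex.exp (Complex.I * ((∑ n, (l n : ℝ) * φ n : ℝ) : ℂ))

/-- The symplectic form `W(u, v) = ∫ (∂_x^{-1} u) v dx` on `L²_⊥(𝕋₁)`. -/
def sympForm {P : Finset ℕ} (u v : Site P → ℂ) : ℂ :=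
  ∑' j : Site P, (2 * Real.pi * Complex.I * (j.1 : ℂ))⁻¹ * u j * v (-j)

/-- `W(A(φ)u, A(φ)v) = W(u, v)` for all `φ` and all `u, v ∈ L²_⊥(𝕋₁)`; all the series involved
are required to converge absolutely, and `A(φ)` to map `L²_⊥(𝕋₁)` to itself. -/
def IsSymp {P : Finset ℕ} (A : Op P) : Prop :=
  (∀ j j', Summable fun l => A l j j') ∧
  ∀ φ : P → ℝ,
    (∀ u : Site P → ℂ, (Summable fun j => ‖u j‖ ^ 2) →
      (∀ j, Summable fun j' => evalPhi A φ j j' * u j') ∧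
      Summable fun j => ‖∑' j', evalPhi A φ j j' * u j'‖ ^ 2) ∧
    ∀ u v : Site P → ℂ, (Summable fun j => ‖u j‖ ^ 2) → (Summable fun j => ‖v j‖ ^ 2) →
      sympForm (fun j => ∑' j', evalPhi A φ j j' * u j')
        (fun j => ∑' j', evalPhi A φ j j' * v j') = sympForm u v

/-! ### Tame and modulo-tame operators -/

/-- `M` is a tame constant on `[s₁, S]` of the `Lip(γ)`-tame family `A(ω)`, `ω ∈ O`. -/
def LipTame {P : Finset ℕ} (γ : ℝ) (O : Set (Freq P)) (s₁ S : ℝ) (A : Freq P → Op P)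
    (M : ℝ → ℝ) : Prop :=
  MonotoneOn M (Set.Icc s₁ S) ∧ (∀ s ∈ Set.Icc s₁ S, 0 ≤ M s) ∧
  ∀ s ∈ Set.Icc s₁ S, ∀ u : Idx P → ℂ, sob s u < ⊤ →
    lipNorm (fun B => appNorm s u B) γ O A
      ≤ ENNReal.ofReal (M s₁) * sob s u + ENNReal.ofReal (M s) * sob s₁ u

/-- `M` is a modulo-tame constant on `[s₁, S]` of the `Lip(γ)`-modulo-tame family `A(ω)`,
`ω ∈ O`. -/
def LipModTame {P : Finset ℕ} (γ : ℝ) (O : Set (Freq P)) (s₁ S : ℝ) (A : Freq P → Op P)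
    (M : ℝ → ℝ) : Prop :=
  MonotoneOn M (Set.Icc s₁ S) ∧ (∀ s ∈ Set.Icc s₁ S, 0 ≤ M s) ∧
  ∀ s ∈ Set.Icc s₁ S, ∀ u : Idx P → ℂ, sob s u < ⊤ →
    lipNorm (fun B => appNorm s u (maj B)) γ O A
      ≤ ENNReal.ofReal (M s₁) * sob s u + ENNReal.ofReal (M s) * sob s₁ u

/-! ### Conjugation -/

/-- `B` is the two-sided inverse of `A`. -/
def IsInv {P : Finset ℕ} (A B : Op P) : Prop := comp A B = idOp ∧ comp B A = idOp

/-- `L' = Φ L Φ^{-1}` where `L = ω·∂_φ + i diag(μ) + R` and `L' = ω·∂_φ + i diag(μ') + R'` are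
considered on their maximal domains in `H^s_⊥`, `s ∈ [s₁, S]`, and `Φi` is the inverse of `Φ`:
the two conditions together say that `Φ` maps the domain of `L` onto that of `L'` and intertwines
the two operators. -/
def Conj {P : Finset ℕ} (s₁ S : ℝ) (ω : Freq P) (μ : Site P → ℝ) (R : Op P)
    (μ' : Site P → ℝ) (R' : Op P) (Φ Φi : Op P) : Prop :=
  IsInv Φ Φi ∧
  ∀ s ∈ Set.Icc s₁ S, ∀ u : Idx P → ℂ, sob s u < ⊤ →
    (sob s (linOp ω μ R u) < ⊤ → linOp ω μ' R' (app Φ u) = app Φ (linOp ω μ R u)) ∧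
    (sob s (linOp ω μ' R' u) < ⊤ → linOp ω μ R (app Φi u) = app Φi (linOp ω μ' R' u))

/-! ### Constants -/

/-- `s₀ = [(|𝕊₊| + 1)/2] + 1`. -/
def sZero (P : Finset ℕ) : ℕ := (P.card + 1) / 2 + 1

/-- `τ₁ = 2τ + 1`. -/
def tauOne (τ : ℝ) : ℝ := 2 * τ + 1

/-- `a = 3τ₁ + 1`. -/
def aExp (τ : ℝ) : ℝ := 3 * tauOne τ + 1

/-- `b = [a] + 2`. -/
def bExp (τ : ℝ) : ℕ := ⌊aExp τ⌋₊ + 2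

/-- `M = 2(s₀ + b) + 4`. -/
def Mord (P : Finset ℕ) (τ : ℝ) : ℕ := 2 * (sZero P + bExp τ) + 4

/-- `s_M = max {s₀, M + 1}`. -/
def sM (P : Finset ℕ) (τ : ℝ) : ℝ := max (sZero P : ℝ) ((Mord P τ : ℝ) + 1)

/-- `μ(b) = s₀ + b + σ + 1`, where `σ` is the loss of derivatives of the initial data. -/
def muB (P : Finset ℕ) (τ σ : ℝ) : ℝ := (sZero P : ℝ) + (bExp τ : ℝ) + σ + 1

/-- `N_ν = N₀^{(3/2)^ν}` for `ν ≥ 0`, and `N_{-1} = 1`. -/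
def scaleN (N₀ : ℕ) (ν : ℤ) : ℝ :=
  if ν < 0 then 1 else (N₀ : ℝ) ^ ((3 / 2 : ℝ) ^ ν.toNat)

/-! ### The initial operators -/

/-- Diophantine frequencies in `Ω`. -/
def DC {P : Finset ℕ} (Ω : Set (Freq P)) (γ τ : ℝ) : Set (Freq P) :=
  {ω ∈ Ω | ∀ l : Mode P, l ≠ 0 → γ / jap l ^ τ ≤ |dot ω l|}

/-- The data of a family of operators `L₀(ι) = ω·∂_φ + i D₀(ι) + R₀(ι)` indexed by tori `ι`:
`D₀ = diag_j (m₃ (2πj)³ - m₁ 2πj - q_j)`, together with a tame constant `M₀(ι)`. -/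
structure InitData (P : Finset ℕ) where
  Om : Set (Freq P)
  q : Site P → Freq P → ℝ
  m3 : Torus P → Freq P → ℝ
  m1 : Torus P → Freq P → ℝ
  R0 : Torus P → Freq P → Op P
  M0 : Torus P → ℝ → ℝ

/-- `m₃ (2πj)³ - m₁ 2πj - q_j`. -/
def eigZero {P : Finset ℕ} (m₃ m₁ : ℝ) (q : Site P → ℝ) (j : Site P) : ℝ :=
  m₃ * (2 * Real.pi * (j.1 : ℝ)) ^ 3 - m₁ * (2 * Real.pi * (j.1 : ℝ)) - q j

/-- `μ_j^0(ι; ω)`. -/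
def InitData.mu0 {P : Finset ℕ} (d : InitData P) (i : Torus P) (ω : Freq P) : Site P → ℝ :=
  eigZero (d.m3 i ω) (d.m1 i ω) (fun j => d.q j ω)

/-- The torus `ι` satisfies `‖ι‖_{μ₀}^{Lip(γ)} ≤ K ε γ^{-2}`. -/
def Ansatz {P : Finset ℕ} (d : InitData P) (τ μ₀ ε γ K : ℝ) (i : Torus P) : Prop :=
  i.lip μ₀ γ (DC d.Om (γ / 2) τ) ≤ ENNReal.ofReal (K * ε * γ⁻¹ ^ 2)

/-- The assumptions on the initial operators `L₀(ι)`, for the tori satisfying the ansatz. They are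
required on `DC(γ/2, τ)`, which contains `DC(g, τ)` for all `g ∈ [γ/2, 2γ]`. -/
structure Admissible {P : Finset ℕ} (d : InitData P) (τ σ μ₀ ε γ K S KS : ℝ) : Prop where
  q_odd : ∀ j, ∀ ω ∈ d.Om, d.q (-j) ω = -d.q j ω
  q_sup : ∀ j : Site P, ENNReal.ofReal |(j.1 : ℝ)| * supNorm (fun x : ℝ => ‖x‖ₑ) d.Om (d.q j)
    ≤ ENNReal.ofReal K
  q_lip : ∀ j : Site P, ENNReal.ofReal |(j.1 : ℝ)| * lipSemi (fun x : ℝ => ‖x‖ₑ) d.Om (d.q j)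
    ≤ ENNReal.ofReal K
  m3_lip : ∀ i, Ansatz d τ μ₀ ε γ K i →
    lipR γ d.Om (fun ω => d.m3 i ω + 1) ≤ ENNReal.ofReal (K * ε)
  m1_lip : ∀ i, Ansatz d τ μ₀ ε γ K i →
    lipR γ (DC d.Om (γ / 2) τ) (d.m1 i) ≤ ENNReal.ofReal (K * ε * γ⁻¹ ^ 2)
  m3_diff : ∀ i₁ i₂, Ansatz d τ μ₀ ε γ K i₁ → Ansatz d τ μ₀ ε γ K i₂ →
    ∀ ω ∈ DC d.Om (γ / 2) τ, ENNReal.ofReal |d.m3 i₁ ω - d.m3 i₂ ω|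
      ≤ ENNReal.ofReal K * Torus.dist (sM P τ + muB P τ σ) i₁ i₂ ω
  m1_diff : ∀ i₁ i₂, Ansatz d τ μ₀ ε γ K i₁ → Ansatz d τ μ₀ ε γ K i₂ →
    ∀ ω ∈ DC d.Om (γ / 2) τ, ENNReal.ofReal |d.m1 i₁ ω - d.m1 i₂ ω|
      ≤ ENNReal.ofReal K * Torus.dist (sM P τ + muB P τ σ) i₁ i₂ ω
  R0_ham : ∀ i, Ansatz d τ μ₀ ε γ K i → ∀ ω ∈ DC d.Om (γ / 2) τ, IsHam (d.R0 i ω)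
  R0_tame : ∀ i, Ansatz d τ μ₀ ε γ K i → ∀ T : Op P → Op P, (T = id ∨ T = commDx) →
    LipTame γ (DC d.Om (γ / 2) τ) (sM P τ) S (fun ω => T (d.R0 i ω)) (d.M0 i) ∧
    ∀ m : P,
      LipTame γ (DC d.Om (γ / 2) τ) (sM P τ) S
        (fun ω => dPhi m (sZero P) (T (d.R0 i ω))) (d.M0 i) ∧
      LipTame γ (DC d.Om (γ / 2) τ) (sM P τ) S
        (fun ω => dPhi m (sZero P + bExp τ) (T (d.R0 i ω))) (d.M0 i)
  M0_le : ∀ i, Ansatz d τ μ₀ ε γ K i → ∀ s ∈ Set.Icc (sM P τ) S,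
    ENNReal.ofReal (d.M0 i s) ≤ ENNReal.ofReal KS *
      (ENNReal.ofReal ε + i.lip (s + muB P τ σ) γ (DC d.Om (γ / 2) τ))
  R0_diff : ∀ i₁ i₂, Ansatz d τ μ₀ ε γ K i₁ → Ansatz d τ μ₀ ε γ K i₂ →
    ∀ ω ∈ DC d.Om (γ / 2) τ, ∀ T : Op P → Op P, (T = id ∨ T = commDx) →
      opNorm (sM P τ) (T (d.R0 i₁ ω - d.R0 i₂ ω))
        ≤ ENNReal.ofReal KS * Torus.dist (sM P τ + muB P τ σ) i₁ i₂ ω ∧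
      ∀ (m : P) (k : ℕ), k ≤ sZero P + bExp τ →
        opNorm (sM P τ) (dPhi m k (T (d.R0 i₁ ω - d.R0 i₂ ω)))
          ≤ ENNReal.ofReal KS * Torus.dist (sM P τ + muB P τ σ) i₁ i₂ ω

/-! ### The reduction scheme -/

/-- The objects produced by the scheme, as functions of the step `ν`, the torus `ι` and `ω`:
the corrections `r_j^ν` of the eigenvalues, the remainders `R_ν`, the generators `Ψ_ν`, and the
modulo-tame constants `M_ν^♯(s)`, `M_ν^♯(s, b)`. -/
structure Scheme (P : Finset ℕ) where
  r : ℕ → Torus P → Freq P → Site P → ℝ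
  R : ℕ → Torus P → Freq P → Op P
  Psi : ℕ → Torus P → Freq P → Op P
  Ms : ℕ → Torus P → ℝ → ℝ
  Msb : ℕ → Torus P → ℝ → ℝ

/-- `μ_j^ν = μ_j^0 + r_j^ν`. -/
def Scheme.mu {P : Finset ℕ} (X : Scheme P) (d : InitData P) (ν : ℕ) (i : Torus P)
    (ω : Freq P) (j : Site P) : ℝ :=
  d.mu0 i ω j + X.r ν i ω j

/-- The sets `Ω_ν^g(ι)` given by the second order Melnikov conditions. -/
def Scheme.set {P : Finset ℕ} (X : Scheme P) (d : InitData P) (τ : ℝ) (N₀ : ℕ) (g : ℝ)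
    (i : Torus P) : ℕ → Set (Freq P)
  | 0 => DC d.Om g τ
  | ν + 1 => {ω ∈ X.set d τ N₀ g i ν | ∀ l : Mode P, ‖l‖ ≤ scaleN N₀ ν → ∀ j j' : Site P,
      g * |(j.1 : ℝ) ^ 3 - (j'.1 : ℝ) ^ 3| / jap l ^ τ
        ≤ |dot ω l + X.mu d ν i ω j - X.mu d ν i ω j'|}

/-- `U_n = Φ_{n-1} ∘ ⋯ ∘ Φ_0`, `Φ_ν = exp Ψ_ν`. -/
def Scheme.U {P : Finset ℕ} (X : Scheme P) (i : Torus P) (ω : Freq P) : ℕ → Op P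
  | 0 => idOp
  | n + 1 => comp (expOp (X.Psi n i ω)) (X.U i ω n)

/-- `U_n^{-1} = Φ_0^{-1} ∘ ⋯ ∘ Φ_{n-1}^{-1}`. -/
def Scheme.Ui {P : Finset ℕ} (X : Scheme P) (i : Torus P) (ω : Freq P) : ℕ → Op P
  | 0 => idOp
  | n + 1 => comp (X.Ui i ω n) (expOp (-X.Psi n i ω))

/-- The operator `L_ν` on `Ω_ν^g(ι)`: it is Hamiltonian, `r_j^ν` and `μ_j^ν` satisfy their bounds,
and `R_ν`, `⟨∂_φ⟩^b R_ν` are modulo-tame. -/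
structure Scheme.S1 {P : Finset ℕ} (X : Scheme P) (d : InitData P) (τ : ℝ) (N₀ : ℕ)
    (ε γ S C CS g : ℝ) (i : Torus P) (ν : ℕ) : Prop where
  ham : ∀ ω ∈ X.set d τ N₀ g i ν, IsHam (diagOp (X.mu d ν i ω) + X.R ν i ω)
  mu_lip : ∀ j, lipR γ (X.set d τ N₀ g i ν) (fun ω => X.mu d ν i ω j) < ⊤
  mu_odd : ∀ ω ∈ X.set d τ N₀ g i ν, ∀ j, X.mu d ν i ω (-j) = -X.mu d ν i ω j
  r_lip : ∀ j, lipR γ (X.set d τ N₀ g i ν) (fun ω => X.r ν i ω j)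
    ≤ ENNReal.ofReal (CS * ε * γ⁻¹ ^ 2)
  R_tame : LipModTame γ (X.set d τ N₀ g i ν) (sM P τ) S (X.R ν i) (X.Ms ν i)
  Rb_tame : LipModTame γ (X.set d τ N₀ g i ν) (sM P τ) S
    (fun ω => japD (bExp τ) (X.R ν i ω)) (X.Msb ν i)
  Ms_le : ∀ s ∈ Set.Icc (sM P τ) S,
    X.Ms ν i s ≤ C * d.M0 i s * scaleN N₀ ((ν : ℤ) - 1) ^ (-aExp τ)
  Msb_le : ∀ s ∈ Set.Icc (sM P τ) S,
    X.Msb ν i s ≤ C * d.M0 i s * scaleN N₀ ((ν : ℤ) - 1)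

/-- The conjugation of `L_ν` to `L_{ν+1}` by `Φ_ν = exp Ψ_ν` on `Ω_{ν+1}^g(ι)`. -/
structure Scheme.S1step {P : Finset ℕ} (X : Scheme P) (d : InitData P) (τ : ℝ) (N₀ : ℕ)
    (γ S C g : ℝ) (i : Torus P) (ν : ℕ) : Prop where
  ham : ∀ ω ∈ X.set d τ N₀ g i (ν + 1), IsHam (X.Psi ν i ω)
  symp : ∀ ω ∈ X.set d τ N₀ g i (ν + 1), IsSymp (expOp (X.Psi ν i ω))
  conj : ∀ ω ∈ X.set d τ N₀ g i (ν + 1),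
    Conj (sM P τ) S ω (X.mu d ν i ω) (X.R ν i ω) (X.mu d (ν + 1) i ω) (X.R (ν + 1) i ω)
      (expOp (X.Psi ν i ω)) (expOp (-X.Psi ν i ω))
  Psi_tame : LipModTame γ (X.set d τ N₀ g i (ν + 1)) (sM P τ) S (X.Psi ν i)
    (fun s => C / γ * scaleN N₀ ν ^ tauOne τ * scaleN N₀ ((ν : ℤ) - 1) ^ (-aExp τ) * d.M0 i s)
  Psib_tame : LipModTame γ (X.set d τ N₀ g i (ν + 1)) (sM P τ) S
    (fun ω => japD (bExp τ) (X.Psi ν i ω))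
    (fun s => C / γ * scaleN N₀ ν ^ tauOne τ * scaleN N₀ ((ν : ℤ) - 1) * d.M0 i s)

/-- Lipschitz extensions to `Ω` of the eigenvalues `μ_j^ν : Ω_ν^g(ι) → ℝ`. -/
def Scheme.S2 {P : Finset ℕ} (X : Scheme P) (d : InitData P) (τ : ℝ) (N₀ : ℕ)
    (ε γ C g : ℝ) (i : Torus P) : Prop :=
  ∃ (m1t : Freq P → ℝ) (mue : ℕ → Freq P → Site P → ℝ),
    (∀ ω ∈ X.set d τ N₀ g i 0, m1t ω = d.m1 i ω) ∧
    lipR γ d.Om m1t ≤ ENNReal.ofReal (C * ε * γ⁻¹ ^ 2) ∧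
    (∀ ω ∈ d.Om, mue 0 ω = eigZero (d.m3 i ω) (m1t ω) (fun j => d.q j ω)) ∧
    ∀ (ν : ℕ) (j : Site P),
      (∀ ω ∈ X.set d τ N₀ g i ν, mue ν ω j = X.mu d ν i ω j) ∧
      lipR γ d.Om (fun ω => mue ν ω j) < ⊤ ∧
      lipR γ d.Om (fun ω => mue (ν + 1) ω j - mue ν ω j)
        ≤ ENNReal.ofReal (C * X.Ms ν i (sM P τ)) ∧
      X.Ms ν i (sM P τ) ≤ C * d.M0 i (sM P τ) * scaleN N₀ ((ν : ℤ) - 1) ^ (-aExp τ)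

/-- Dependence of `R_ν` and `r_j^ν` on the torus. -/
def Scheme.S3 {P : Finset ℕ} (X : Scheme P) (d : InitData P) (τ σ : ℝ) (N₀ : ℕ)
    (γ C CS : ℝ) (i₁ i₂ : Torus P) (ν : ℕ) : Prop :=
  ∀ g₁ ∈ Set.Icc (γ / 2) (2 * γ), ∀ g₂ ∈ Set.Icc (γ / 2) (2 * γ),
    (∀ ω ∈ X.set d τ N₀ g₁ i₁ ν ∩ X.set d τ N₀ g₂ i₂ ν,
      opNorm (sM P τ) (maj (X.R ν i₁ ω - X.R ν i₂ ω))
        ≤ ENNReal.ofReal (CS * scaleN N₀ ((ν : ℤ) - 1) ^ (-aExp τ))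
          * Torus.dist (sM P τ + muB P τ σ) i₁ i₂ ω ∧
      opNorm (sM P τ) (maj (japD (bExp τ) (X.R ν i₁ ω - X.R ν i₂ ω)))
        ≤ ENNReal.ofReal (CS * scaleN N₀ ((ν : ℤ) - 1))
          * Torus.dist (sM P τ + muB P τ σ) i₁ i₂ ω) ∧
    ∀ ω ∈ X.set d τ N₀ g₁ i₁ (ν + 1) ∩ X.set d τ N₀ g₂ i₂ (ν + 1), ∀ j,
      ENNReal.ofReal |(X.r (ν + 1) i₁ ω j - X.r (ν + 1) i₂ ω j)
          - (X.r ν i₁ ω j - X.r ν i₂ ω j)|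
        ≤ ENNReal.ofReal C * opNorm (sM P τ) (maj (X.R ν i₁ ω - X.R ν i₂ ω)) ∧
      ENNReal.ofReal |X.r (ν + 1) i₁ ω j - X.r (ν + 1) i₂ ω j|
        ≤ ENNReal.ofReal CS * Torus.dist (sM P τ + muB P τ σ) i₁ i₂ ω

/-- Inclusion of the Melnikov sets of nearby tori. -/
def Scheme.S4 {P : Finset ℕ} (X : Scheme P) (d : InitData P) (τ σ : ℝ) (N₀ : ℕ)
    (γ CS : ℝ) (i₁ i₂ : Torus P) (ν : ℕ) : Prop :=
  ∀ ρ : ℝ, 0 < ρ → ρ < γ / 2 →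
    ENNReal.ofReal (CS * scaleN N₀ ((ν : ℤ) - 1) ^ τ)
        * (⨆ ω ∈ DC d.Om γ τ, Torus.dist (sM P τ + muB P τ σ) i₁ i₂ ω) ≤ ENNReal.ofReal ρ →
    X.set d τ N₀ γ i₁ ν ⊆ X.set d τ N₀ (γ - ρ) i₂ ν

/-- The almost diagonalization of `L₀` by `U_n` on `Ω_{n+1}^g(ι)`. -/
structure Scheme.AlmostRed {P : Finset ℕ} (X : Scheme P) (d : InitData P) (τ σ : ℝ) (N₀ : ℕ)
    (ε γ S CS g : ℝ) (i : Torus P) (n : ℕ) : Prop where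
  conj : ∀ ω ∈ X.set d τ N₀ g i (n + 1),
    Conj (sM P τ) S ω (d.mu0 i ω) (d.R0 i ω) (X.mu d n i ω) (X.R n i ω)
      (X.U i ω n) (X.Ui i ω n)
  ham : ∀ ω ∈ X.set d τ N₀ g i (n + 1), IsHam (diagOp (X.mu d n i ω) + X.R n i ω)
  symp : ∀ ω ∈ X.set d τ N₀ g i (n + 1), IsSymp (X.U i ω n) ∧ IsSymp (X.Ui i ω n)
  R_tame : LipModTame γ (X.set d τ N₀ g i (n + 1)) (sM P τ) S (X.R n i) (X.Ms n i)
  R_le : ∀ s ∈ Set.Icc (sM P τ) S, ENNReal.ofReal (X.Ms n i s)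
    ≤ ENNReal.ofReal (CS * scaleN N₀ ((n : ℤ) - 1) ^ (-aExp τ))
      * (ENNReal.ofReal ε + i.lip (s + muB P τ σ) γ (DC d.Om (γ / 2) τ))
  U_tame : ∃ MU : ℝ → ℝ,
    LipModTame γ (X.set d τ N₀ g i (n + 1)) (sM P τ) S (fun ω => X.U i ω n - idOp) MU ∧
    LipModTame γ (X.set d τ N₀ g i (n + 1)) (sM P τ) S (fun ω => X.Ui i ω n - idOp) MU ∧
    ∀ s ∈ Set.Icc (sM P τ) S, ENNReal.ofReal (MU s)
      ≤ ENNReal.ofReal (CS * γ⁻¹ * (N₀ : ℝ) ^ tauOne τ)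
        * (ENNReal.ofReal ε + i.lip (s + muB P τ σ) γ (DC d.Om (γ / 2) τ))

end KamRed

end

/-! The whole iteration is run once, in a Banach algebra whose elements are pairs of operators. For
a weight `w` on the indices and a weight `θ` on the time frequencies, `kn` is the norm on `ℓ²(w)` of
the majorant kernel `θ(ℓ)|A_j^{j'}(ℓ)|`, and `pn` measures a pair `(A₁, A₂)` by the largest of
`|A₁|`, `|A₂|` and `κ⁻¹|A₁ - A₂|`. Since `2θ(ℓ+ℓ') ≤ θ(ℓ)θ(ℓ')`, this norm is submultiplicative
(`pn_comp_le`), and the algebra `BA W` is complete. A single estimate therefore yields sup bounds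
and bounds of increments. With two frequencies, one torus and `κ = |ω₁-ω₂|/γ` it gives `Lip(γ)`
bounds; with one frequency, two tori and `κ` proportional to their distance it gives the dependence
on the torus; with a constant pair it gives the algebraic statements.

Three choices of weight reduce everything to operator norms. Tame estimates become bounds in `ℓ²`
with the weight `⟨k⟩^{s₁} + t⟨k⟩^s`, `t = M(s₁)/M(s)`: tame bounds of `R₀`, its commutator with
`∂_x` and their time derivatives bound the columns (`LipTame.col`), Cauchy-Schwarz turns column
bounds into bounds of the majorant (`kop_le_of_col`), and `lipModTame_of_kop` goes back to
modulo-tame constants. The low norm and the norm with `⟨∂_φ⟩^b` are treated together by the weight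
`1 + t⟨ℓ⟩^b` with `t = N_{ν-1}^{-(a+1)}`, which balances their sizes `N_{ν-1}^{-a}` and `N_{ν-1}`.

One step conjugates by `Φ = exp Ψ`, where `Ψ` solves the homological equation `[D, Ψ] = R -
(ultraviolet tail) - (diagonal)`. The commutator with the unbounded `D` is a derivation, and on `exp
Ψ` it equals the bounded element `dexp`. The new remainder is `(-[D,Φ] + ΦR - ZΦ)Φ⁻¹`;
`norm_newRemainder_sub_tail_le` shows that it is the tail up to `14|Ψ||R|`. The Melnikov conditions
bound the divisors from below, and the cubic factor also dominates their variation, so solving the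
homological equation costs `γ⁻¹N^{2τ+1}` in the pair norm (`pn_psiOp_le`). The tail gains `N^{-b}`
from the high norm, the quadratic part gains from `a > 3τ₁`, and `pairInv_of_mel` closes the
induction.

The Hamiltonian structure is encoded by an adjoint `sharp` and a conjugation `conjOp`: an operator
is Hamiltonian iff `sharp A = -A` and `conjOp A = A` (`isHam_iff`). Hence `sharp (exp Ψ) = exp
(-Ψ)`, and the new remainder is Hamiltonian because `[D, exp Ψ exp(-Ψ)] = 0`. To pass from
space-time operators to the operators at each `φ`, a Sobolev bound of a majorant Toeplitz kernel is
transferred to an `ℓ²` bound of the kernel summed over `ℓ`, by testing on functions that vary slowly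
in `ℓ` (`section_bound_finset`).

The scheme is given by explicit formulas for every `ω`; the Melnikov sets enter only through the
estimates. Eigenvalue extensions are sums of extensions of the individual corrections, the inclusion
of Melnikov sets is an induction based on the torus-difference bounds, and the total transformation
is a product of exponentials with summable generators. -/

open scoped ENNReal

noncomputable section

namespace KamRed

variable {P : Finset ℕ}

/-! ### Weighted `ℓ²` norms of `[0, ∞]`-valued sequences -/

/-- The weighted `ℓ²` norm `(∑ (w_k u_k)²)^{1/2}`. -/
def wn {ι : Type*} (w u : ι → ℝ≥0∞) : ℝ≥0∞ := (∑' k, (w k * u k) ^ 2) ^ (1 / 2 : ℝ)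

section wn

variable {ι : Type*}

lemma wn_sq (w u : ι → ℝ≥0∞) : wn w u ^ 2 = ∑' k, (w k * u k) ^ 2 := by
  rw [wn, ← ENNReal.rpow_natCast, ← ENNReal.rpow_mul]; norm_num

lemma wn_le_iff {w u : ι → ℝ≥0∞} {c : ℝ≥0∞} : wn w u ≤ c ↔ ∑' k, (w k * u k) ^ 2 ≤ c ^ 2 := by
  rw [← wn_sq]
  exact (ENNReal.pow_right_strictMono two_ne_zero).le_iff_le.symm

lemma wn_mono {w w' u v : ι → ℝ≥0∞} (h : ∀ k, w k * u k ≤ w' k * v k) : wn w u ≤ wn w' v := by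
  exact ENNReal.rpow_le_rpow (ENNReal.tsum_le_tsum fun k => pow_le_pow_left' (h k) 2) (by norm_num)

/-- Minkowski's inequality in `L²` of the counting measure; with the largest σ-algebra every
function is measurable. -/
lemma wn_add_le (w u v : ι → ℝ≥0∞) : wn w (u + v) ≤ wn w u + wn w v := by
  let _ : MeasurableSpace ι := ⊤
  have h := ENNReal.lintegral_Lp_add_le (μ := MeasureTheory.Measure.count)
    (f := fun k => w k * u k) (g := fun k => w k * v k) (p := 2)
    (measurable_from_top).aemeasurable (measurable_from_top).aemeasurable (by norm_num)
  simp only [MeasureTheory.lintegral_count, Pi.add_apply, ← mul_add, ENNReal.rpow_ofNat] at h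
  exact h

lemma wn_comm (w u : ι → ℝ≥0∞) : wn w u = wn u w := by simp only [wn, mul_comm]

lemma wn_add_weight_le (w w' u : ι → ℝ≥0∞) : wn (w + w') u ≤ wn w u + wn w' u := by
  rw [wn_comm, wn_comm w, wn_comm w']; exact wn_add_le _ _ _

lemma wn_const_mul (w u : ι → ℝ≥0∞) (c : ℝ≥0∞) : wn w (fun k => c * u k) = c * wn w u := by
  unfold wn
  have : ∀ k, (w k * (c * u k)) ^ 2 = c ^ 2 * (w k * u k) ^ 2 := fun k => by ring
  simp_rw [this, ENNReal.tsum_mul_left]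
  rw [ENNReal.mul_rpow_of_nonneg _ _ (by norm_num), ← ENNReal.rpow_natCast, ← ENNReal.rpow_mul]
  norm_num

lemma wn_const_mul_weight (w u : ι → ℝ≥0∞) (c : ℝ≥0∞) :
    wn (fun k => c * w k) u = c * wn w u := by
  rw [wn_comm, wn_const_mul, wn_comm]

lemma wn_zero (w : ι → ℝ≥0∞) : wn w 0 = 0 := by simp [wn]

lemma mul_le_wn (w u : ι → ℝ≥0∞) (k : ι) : w k * u k ≤ wn w u := by
  rw [← (ENNReal.pow_right_strictMono two_ne_zero).le_iff_le]
  simp only [wn_sq]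
  exact ENNReal.le_tsum (f := fun k => (w k * u k) ^ 2) k

/-- The countable version of Minkowski's inequality follows by truncating the outer sum to a finite
set and passing to the limit over finite partial sums of the inner one, so no measurability or
summability is involved. -/
lemma wn_tsum_le {α : Type*} (w : ι → ℝ≥0∞) (u : α → ι → ℝ≥0∞) :
    wn w (fun k => ∑' n, u n k) ≤ ∑' n, wn w (u n) := by
  rw [wn_le_iff, ENNReal.tsum_eq_iSup_sum]
  refine iSup_le fun K => ?_
  have hlim : Filter.Tendsto (fun F : Finset α => ∑ k ∈ K, (w k * ∑ n ∈ F, u n k) ^ 2)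
      Filter.atTop (nhds (∑ k ∈ K, (w k * ∑' n, u n k) ^ 2)) := by
    simp_rw [← ENNReal.tsum_mul_left, Finset.mul_sum]
    exact tendsto_finsetSum _ fun k _ =>
      ((ENNReal.continuous_pow 2).tendsto _).comp ENNReal.summable.hasSum
  refine le_of_tendsto' hlim fun F => ?_
  have hF : wn w (fun k => ∑ n ∈ F, u n k) ≤ ∑ n ∈ F, wn w (u n) := by
    classical
    induction F using Finset.induction_on with
    | empty => simp [wn]
    | insert a F ha ih =>
      simp only [Finset.sum_insert ha]
      exact (wn_add_le w (u a) fun k => ∑ n ∈ F, u n k).trans (by gcongr)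
  calc ∑ k ∈ K, (w k * ∑ n ∈ F, u n k) ^ 2 ≤ ∑' k, (w k * ∑ n ∈ F, u n k) ^ 2 :=
        ENNReal.sum_le_tsum K
    _ ≤ (∑ n ∈ F, wn w (u n)) ^ 2 := wn_le_iff.1 hF
    _ ≤ _ := pow_le_pow_left' (ENNReal.sum_le_tsum F) 2

end wn

/-- A weight with values in `(0, ∞)`. -/
structure PosFin {ι : Type*} (w : ι → ℝ≥0∞) : Prop where
  ne_zero : ∀ k, w k ≠ 0
  ne_top : ∀ k, w k ≠ ⊤

lemma PosFin.eq_zero_of_wn {ι : Type*} {w u : ι → ℝ≥0∞} (hw : PosFin w) (h : wn w u = 0) :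
    u = 0 := by
  funext k
  have := mul_le_wn w u k
  rw [h, nonpos_iff_eq_zero, mul_eq_zero] at this
  exact this.resolve_left (hw.ne_zero k)

lemma PosFin.lt_top_of_wn {ι : Type*} {w u : ι → ℝ≥0∞} (hw : PosFin w) (h : wn w u ≠ ⊤) (k : ι) :
    u k ≠ ⊤ := by
  intro hk
  have := mul_le_wn w u k
  rw [hk, ENNReal.mul_top (hw.ne_zero k)] at this
  exact h (top_le_iff.1 this)

/-! ### Non-negative kernels, Toeplitz in the time Fourier index -/

/-- Kernels with values in `[0, ∞]`. -/
abbrev Ker (P : Finset ℕ) : Type := Mode P → Site P → Site P → ℝ≥0∞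


/-- The action of a kernel. -/
def kapp (E : Ker P) (u : Idx P → ℝ≥0∞) : Idx P → ℝ≥0∞ :=
  fun k => ∑' k' : Idx P, E (k.1 - k'.1) k.2 k'.2 * u k'

/-- The composition of kernels. -/
def kcomp (E F : Ker P) : Ker P :=
  fun l j j' => ∑' k : Idx P, E (l - k.1) j k.2 * F k.1 k.2 j'

/-- The operator norm of a kernel on the weighted `ℓ²` space. -/
def kop (w : Idx P → ℝ≥0∞) (E : Ker P) : ℝ≥0∞ := ⨆ u, wn w (kapp E u) / wn w u

/-- Translation of the time index. -/
def shiftIdx (l : Mode P) : Idx P ≃ Idx P := (Equiv.subRight l).prodCongr (Equiv.refl _)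

@[simp] lemma shiftIdx_fst (l : Mode P) (k : Idx P) : (shiftIdx l k).1 = k.1 - l := rfl
@[simp] lemma shiftIdx_snd (l : Mode P) (k : Idx P) : (shiftIdx l k).2 = k.2 := rfl

lemma kapp_mono {E F : Ker P} {u v : Idx P → ℝ≥0∞} (h : ∀ l j j', E l j j' ≤ F l j j')
    (h' : ∀ k, u k ≤ v k) (k : Idx P) : kapp E u k ≤ kapp F v k :=
  ENNReal.tsum_le_tsum fun k' => mul_le_mul' (h _ _ _) (h' k')

lemma kapp_zero (E : Ker P) : kapp E 0 = 0 := by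
  funext k; simp [kapp]

lemma kapp_add (E F : Ker P) (u : Idx P → ℝ≥0∞) : kapp (E + F) u = kapp E u + kapp F u := by
  funext k
  simp only [kapp, Pi.add_apply, add_mul]
  exact ENNReal.tsum_add

/-- Tonelli and a translation of the time index. The Toeplitz form in `ℓ` is what makes composition
of kernels match composition of actions; all terms lie in `[0, ∞]`, so no convergence is needed. -/
lemma kapp_kcomp (E F : Ker P) (u : Idx P → ℝ≥0∞) : kapp (kcomp E F) u = kapp E (kapp F u) := by
  funext k
  simp only [kapp, kcomp, ← ENNReal.tsum_mul_left, ← ENNReal.tsum_mul_right]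
  rw [ENNReal.tsum_comm]
  have h : ∀ k' : Idx P, ∑' m : Idx P, E (k.1 - k'.1 - m.1) k.2 m.2 * F m.1 m.2 k'.2 * u k'
      = ∑' m : Idx P, E (k.1 - m.1) k.2 m.2 * (F (m.1 - k'.1) m.2 k'.2 * u k') := fun k' => by
    rw [← (shiftIdx k'.1).tsum_eq]
    refine tsum_congr fun m => ?_
    simp [mul_assoc]
  rw [ENNReal.tsum_comm]
  simp_rw [h]
  rw [ENNReal.tsum_comm]

/-- The quotient in `kop` needs no case distinction in its definition: inputs of infinite norm
contribute `x / ⊤ = 0`, and an input of norm zero vanishes for a positive weight, where the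
inequality is trivial. -/
lemma wn_kapp_le {w : Idx P → ℝ≥0∞} (hw : PosFin w) (E : Ker P) {u : Idx P → ℝ≥0∞}
    (hu : wn w u ≠ ⊤) : wn w (kapp E u) ≤ kop w E * wn w u := by
  by_cases h0 : wn w u = 0
  · rw [hw.eq_zero_of_wn h0, kapp_zero, wn_zero]; exact zero_le
  · exact (ENNReal.div_le_iff h0 hu).1 (le_iSup (fun u => wn w (kapp E u) / wn w u) u)

lemma kop_le {w : Idx P → ℝ≥0∞} {E : Ker P} {c : ℝ≥0∞}
    (h : ∀ u, wn w u ≠ ⊤ → wn w (kapp E u) ≤ c * wn w u) : kop w E ≤ c := by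
  refine iSup_le fun u => ?_
  by_cases hu : wn w u = ⊤
  · simp [hu]
  · exact ENNReal.div_le_of_le_mul (h u hu)

lemma kop_mono {w : Idx P → ℝ≥0∞} {E F : Ker P} (h : ∀ l j j', E l j j' ≤ F l j j') :
    kop w E ≤ kop w F :=
  iSup_mono fun _ => ENNReal.div_le_div_right
    (wn_mono fun k => by gcongr; exact kapp_mono h (fun _ => le_rfl) k) _

lemma kop_add_le {w : Idx P → ℝ≥0∞} (hw : PosFin w) (E F : Ker P) :
    kop w (E + F) ≤ kop w E + kop w F := by
  refine kop_le fun u hu => ?_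
  rw [kapp_add, add_mul]
  exact (wn_add_le _ _ _).trans (add_le_add (wn_kapp_le hw E hu) (wn_kapp_le hw F hu))

lemma kop_const_mul_le {w : Idx P → ℝ≥0∞} (hw : PosFin w) (c : ℝ≥0∞) (E : Ker P) :
    kop w (fun l j j' => c * E l j j') ≤ c * kop w E := by
  refine kop_le fun u hu => ?_
  have : kapp (fun l j j' => c * E l j j') u = fun k => c * kapp E u k := by
    funext k; simp only [kapp, mul_assoc, ENNReal.tsum_mul_left]
  rw [this, wn_const_mul, mul_assoc]
  gcongr
  exact wn_kapp_le hw E hu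

lemma kop_tsum_le {α : Type*} {w : Idx P → ℝ≥0∞} (hw : PosFin w) (E : α → Ker P) :
    kop w (fun l j j' => ∑' n, E n l j j') ≤ ∑' n, kop w (E n) := by
  refine kop_le fun u hu => ?_
  have : kapp (fun l j j' => ∑' n, E n l j j') u = fun k => ∑' n, kapp (E n) u k := by
    funext k
    simp only [kapp, ← ENNReal.tsum_mul_right]
    exact ENNReal.tsum_comm
  rw [this, ← ENNReal.tsum_mul_right]
  exact (wn_tsum_le _ _).trans (ENNReal.tsum_le_tsum fun n => wn_kapp_le hw (E n) hu)

lemma kop_kcomp_le {w : Idx P → ℝ≥0∞} (hw : PosFin w) (E : Ker P) {F : Ker P}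
    (hF : kop w F ≠ ⊤) : kop w (kcomp E F) ≤ kop w E * kop w F := by
  refine kop_le fun u hu => ?_
  have h := wn_kapp_le hw F hu
  have h' : wn w (kapp F u) ≠ ⊤ := ne_top_of_le_ne_top (ENNReal.mul_ne_top hF hu) h
  rw [kapp_kcomp, mul_assoc]
  exact (wn_kapp_le hw E h').trans (by gcongr)

open Classical in
lemma wn_single (w : Idx P → ℝ≥0∞) (k : Idx P) : wn w (Pi.single k 1) = w k := by
  unfold wn
  rw [tsum_eq_single k fun k' hk' => by simp [Pi.single_eq_of_ne hk']]
  rw [Pi.single_eq_same, mul_one, ← ENNReal.rpow_natCast, ← ENNReal.rpow_mul]; norm_num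

open Classical in
lemma kapp_single (E : Ker P) (k k' : Idx P) :
    kapp E (Pi.single k' 1) k = E (k.1 - k'.1) k.2 k'.2 := by
  unfold kapp
  rw [tsum_eq_single k' fun m hm => by simp [Pi.single_eq_of_ne hm]]
  simp

/-- Test the kernel on the unit vector at `(0, j')`. This is how operator norms control single
matrix elements, in particular the eigenvalue corrections. -/
lemma weight_mul_entry_le {w : Idx P → ℝ≥0∞} (hw : PosFin w) (E : Ker P) (l : Mode P)
    (j j' : Site P) : w (l, j) * E l j j' ≤ kop w E * w (0, j') := by
  classical
  have h := wn_kapp_le hw E (u := Pi.single (0, j') 1) (by rw [wn_single]; exact hw.ne_top _)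
  rw [wn_single] at h
  refine le_trans ?_ ((mul_le_wn w _ (l, j)).trans h)
  rw [kapp_single]; simp

lemma entry_le {w : Idx P → ℝ≥0∞} (hw : PosFin w) (E : Ker P) (l : Mode P)
    (j j' : Site P) : E l j j' ≤ kop w E * (w (0, j') / w (l, j)) := by
  rw [← mul_div_assoc, ENNReal.le_div_iff_mul_le (Or.inl (hw.ne_zero _)) (Or.inl (hw.ne_top _)),
    mul_comm]
  exact weight_mul_entry_le hw E l j j'

lemma diag_entry_le {w : Idx P → ℝ≥0∞} (hw : PosFin w) (E : Ker P) (j : Site P) :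
    E 0 j j ≤ kop w E := by
  have := entry_le hw E 0 j j
  rwa [ENNReal.div_self (hw.ne_zero _) (hw.ne_top _), mul_one] at this

lemma eq_zero_of_kop {w : Idx P → ℝ≥0∞} (hw : PosFin w) {E : Ker P} (h : kop w E = 0)
    (l : Mode P) (j j' : Site P) : E l j j' = 0 := by
  have := entry_le hw E l j j'
  rwa [h, zero_mul, nonpos_iff_eq_zero] at this

lemma entry_ne_top {w : Idx P → ℝ≥0∞} (hw : PosFin w) {E : Ker P} (h : kop w E ≠ ⊤)
    (l : Mode P) (j j' : Site P) : E l j j' ≠ ⊤ :=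
  ne_top_of_le_ne_top (ENNReal.mul_ne_top h (ENNReal.div_ne_top (hw.ne_top _) (hw.ne_zero _)))
    (entry_le hw E l j j')

/-! ### Operators and their majorant kernels -/

/-- The kernel `|A_j^{j'}(ℓ)|`. -/
def ak (A : Op P) : Ker P := fun l j j' => ‖A l j j'‖ₑ

lemma summable_of_tsum_enorm {ι : Type*} {f : ι → ℂ} (h : ∑' i, ‖f i‖ₑ ≠ ⊤) : Summable f :=
  (tsum_enorm_ne_top_iff_summable_norm.1 h).of_norm

lemma enorm_app_le (A : Op P) (u : Idx P → ℂ) (k : Idx P) :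
    ‖app A u k‖ₑ ≤ kapp (ak A) (fun k => ‖u k‖ₑ) k := by
  refine enorm_tsum_le_tsum_enorm.trans (le_of_eq ?_)
  simp [kapp, ak, enorm_mul]

lemma enorm_comp_le (A B : Op P) (l : Mode P) (j j' : Site P) :
    ‖comp A B l j j'‖ₑ ≤ kcomp (ak A) (ak B) l j j' := by
  refine enorm_tsum_le_tsum_enorm.trans (le_of_eq ?_)
  simp [kcomp, ak, enorm_mul]

lemma summable_app {A : Op P} {u : Idx P → ℂ} {k : Idx P}
    (h : kapp (ak A) (fun k => ‖u k‖ₑ) k ≠ ⊤) :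
    Summable fun k' : Idx P => A (k.1 - k'.1) k.2 k'.2 * u k' := by
  apply summable_of_tsum_enorm
  simpa [kapp, ak, enorm_mul] using h

/-- Finiteness of the iterated majorant at the single index `k` is exactly the absolute convergence
needed to exchange the two sums. -/
lemma app_comp {A B : Op P} {u : Idx P → ℂ} {k : Idx P}
    (h : kapp (ak A) (kapp (ak B) fun k => ‖u k‖ₑ) k ≠ ⊤) :
    app (comp A B) u k = app A (app B u) k := by
  have hs : Summable (Function.uncurry fun m k' : Idx P =>
      A (k.1 - m.1) k.2 m.2 * (B (m.1 - k'.1) m.2 k'.2 * u k')) := by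
    apply summable_of_tsum_enorm
    rw [ENNReal.tsum_prod']
    simpa [kapp, ak, enorm_mul, ENNReal.tsum_mul_left] using h
  simp only [app, comp, ← tsum_mul_left, ← tsum_mul_right]
  rw [← hs.tsum_comm]
  refine tsum_congr fun k' => ?_
  rw [← (shiftIdx k'.1).tsum_eq]
  refine tsum_congr fun m => ?_
  simp [mul_assoc]

lemma app_add_op {A B : Op P} {u : Idx P → ℂ} {k : Idx P}
    (hA : kapp (ak A) (fun k => ‖u k‖ₑ) k ≠ ⊤) (hB : kapp (ak B) (fun k => ‖u k‖ₑ) k ≠ ⊤) :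
    app (A + B) u k = app A u k + app B u k := by
  simp only [app, Pi.add_apply, add_mul]
  exact (summable_app hA).tsum_add (summable_app hB)

lemma app_add_fun {A : Op P} {u v : Idx P → ℂ} {k : Idx P}
    (hu : kapp (ak A) (fun k => ‖u k‖ₑ) k ≠ ⊤) (hv : kapp (ak A) (fun k => ‖v k‖ₑ) k ≠ ⊤) :
    app A (u + v) k = app A u k + app A v k := by
  simp only [app, Pi.add_apply, mul_add]
  exact (summable_app hu).tsum_add (summable_app hv)

lemma comp_eq_app (A B : Op P) (l : Mode P) (j j' : Site P) :
    comp A B l j j' = app A (fun k => B k.1 k.2 j') (l, j) := rfl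

lemma comp_assoc_entry {A B C : Op P} {l : Mode P} {j j' : Site P}
    (h : kcomp (ak A) (kcomp (ak B) (ak C)) l j j' ≠ ⊤) :
    comp (comp A B) C l j j' = comp A (comp B C) l j j' :=
  app_comp (u := fun k => C k.1 k.2 j') (k := (l, j)) h

open Classical in
lemma app_idOp (u : Idx P → ℂ) : app idOp u = u := by
  funext k
  unfold app
  rw [tsum_eq_single k fun k' hk' => ?_]
  · simp [idOp]
  · have : ¬(k.1 - k'.1 = 0 ∧ k.2 = k'.2) := fun h =>
      hk' (Prod.ext (sub_eq_zero.1 h.1).symm h.2.symm)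
    simp [idOp, this]

lemma idOp_comp (A : Op P) : comp idOp A = A := by
  funext l j j'
  rw [comp_eq_app, app_idOp]

lemma comp_idOp (A : Op P) : comp A idOp = A := by
  classical
  funext l j j'
  unfold comp
  rw [tsum_eq_single (0, j') fun k' hk' => ?_]
  · simp [idOp]
  · have : ¬(k'.1 = 0 ∧ k'.2 = j') := fun h => hk' (Prod.ext h.1 h.2)
    simp [idOp, this]

/-! ### The norm of an operator and of a pair of operators -/

/-- The operator norm on `ℓ²(w)` of the kernel `θ(ℓ) |A_j^{j'}(ℓ)|`. -/
def kn (w : Idx P → ℝ≥0∞) (θ : Mode P → ℝ≥0∞) (A : Op P) : ℝ≥0∞ :=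
  kop w fun l j j' => θ l * ‖A l j j'‖ₑ

/-- The norm of a pair of operators which are `κ`-close to each other. -/
def pn (w : Idx P → ℝ≥0∞) (θ : Mode P → ℝ≥0∞) (κ : ℝ≥0∞) (A : Op P × Op P) : ℝ≥0∞ :=
  kn w θ A.1 ⊔ kn w θ A.2 ⊔ κ⁻¹ * kn w θ (A.1 - A.2)

section norms

variable {w : Idx P → ℝ≥0∞} {θ θ' : Mode P → ℝ≥0∞} {κ : ℝ≥0∞}

lemma kn_mono {A B : Op P} (h : ∀ l j j', θ l * ‖A l j j'‖ₑ ≤ θ' l * ‖B l j j'‖ₑ) :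
    kn w θ A ≤ kn w θ' B := kop_mono h

lemma kn_le_mul (hw : PosFin w) {c : ℝ≥0∞} {A B : Op P}
    (h : ∀ l j j', θ l * ‖A l j j'‖ₑ ≤ c * (θ' l * ‖B l j j'‖ₑ)) :
    kn w θ A ≤ c * kn w θ' B := (kop_mono h).trans (kop_const_mul_le hw _ _)

lemma kn_le_add (hw : PosFin w) {c c' : ℝ≥0∞} {A B C : Op P} {θ₁ θ₂ : Mode P → ℝ≥0∞}
    (h : ∀ l j j', θ l * ‖A l j j'‖ₑ ≤ c * (θ₁ l * ‖B l j j'‖ₑ) + c' * (θ₂ l * ‖C l j j'‖ₑ)) :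
    kn w θ A ≤ c * kn w θ₁ B + c' * kn w θ₂ C :=
  (kop_mono h).trans ((kop_add_le hw (fun l j j' => c * (θ₁ l * ‖B l j j'‖ₑ))
    fun l j j' => c' * (θ₂ l * ‖C l j j'‖ₑ)).trans
    (add_le_add (kop_const_mul_le hw _ _) (kop_const_mul_le hw _ _)))

lemma kn_add_le (hw : PosFin w) (A B : Op P) : kn w θ (A + B) ≤ kn w θ A + kn w θ B := by
  have := kn_le_add (θ := θ) (θ₁ := θ) (θ₂ := θ) hw (c := 1) (c' := 1) (A := A + B) (B := A) (C := B)
    fun l j j' => by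
      simp only [one_mul, ← mul_add]
      gcongr
      exact enorm_add_le _ _
  simpa using this

lemma kn_neg (A : Op P) : kn w θ (-A) = kn w θ A := by simp [kn]

lemma kn_sub_le (hw : PosFin w) (A B : Op P) : kn w θ (A - B) ≤ kn w θ A + kn w θ B := by
  rw [sub_eq_add_neg]
  exact (kn_add_le hw _ _).trans (by rw [kn_neg])

lemma kn_zero : kn w θ (0 : Op P) = 0 := by
  refine le_antisymm (kop_le fun u _ => ?_) zero_le
  have : kapp (fun l j j' => θ l * ‖(0 : Op P) l j j'‖ₑ) u = 0 := by funext k; simp [kapp]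
  rw [this, wn_zero]; exact zero_le

lemma kn_smul_le (hw : PosFin w) (c : ℂ) (A : Op P) : kn w θ (c • A) ≤ ‖c‖ₑ * kn w θ A :=
  kn_le_mul hw fun l j j' => by
    simp only [Pi.smul_apply, smul_eq_mul, enorm_mul]
    exact le_of_eq (by ring)

lemma kn_tsum_le {α : Type*} (hw : PosFin w) (A : α → Op P) :
    kn w θ (fun l j j' => ∑' n, A n l j j') ≤ ∑' n, kn w θ (A n) := by
  refine (kop_mono (F := fun l j j' => ∑' n, θ l * ‖A n l j j'‖ₑ) fun l j j' => ?_).trans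
    (kop_tsum_le hw fun n l j j' => θ l * ‖A n l j j'‖ₑ)
  rw [ENNReal.tsum_mul_left]
  gcongr
  exact enorm_tsum_le_tsum_enorm

lemma kop_ak_le (hθ : ∀ l, 1 ≤ θ l) (A : Op P) : kop w (ak A) ≤ kn w θ A :=
  kop_mono fun l _ _ => le_mul_of_one_le_left' (hθ l)

/-- The factor `2` in the condition on `θ` is returned as a factor `1/2`; it pays for the two terms
of the product rule for differences in `pn_comp_le`. -/
lemma kn_comp_le (hw : PosFin w) (hθ : ∀ l l', 2 * θ (l + l') ≤ θ l * θ l') (A : Op P) {B : Op P}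
    (hB : kn w θ B ≠ ⊤) : kn w θ (comp A B) ≤ 2⁻¹ * (kn w θ A * kn w θ B) := by
  refine le_trans ((kop_mono fun l j j' => ?_).trans (kop_const_mul_le hw 2⁻¹
    (kcomp (fun l j j' => θ l * ‖A l j j'‖ₑ) fun l j j' => θ l * ‖B l j j'‖ₑ)))
    (mul_le_mul_right (kop_kcomp_le hw _ hB) _)
  refine (mul_le_mul_right (enorm_comp_le A B l j j') (θ l)).trans ?_
  simp only [kcomp, ← ENNReal.tsum_mul_left, ak]
  refine ENNReal.tsum_le_tsum fun k => ?_
  have h := hθ (l - k.1) k.1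
  rw [sub_add_cancel, mul_comm, ← ENNReal.le_div_iff_mul_le (by simp) (by simp),
    div_eq_mul_inv, mul_comm] at h
  calc θ l * (‖A (l - k.1) j k.2‖ₑ * ‖B k.1 k.2 j'‖ₑ)
      ≤ (2⁻¹ * (θ (l - k.1) * θ k.1)) * (‖A (l - k.1) j k.2‖ₑ * ‖B k.1 k.2 j'‖ₑ) := by gcongr
    _ = _ := by ring

lemma kn_idOp_le : kn w θ (idOp : Op P) ≤ θ 0 := by
  refine kop_le fun u _ => ?_
  have : kapp (fun l j j' => θ l * ‖(idOp : Op P) l j j'‖ₑ) u = fun k => θ 0 * u k := by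
    classical
    funext k
    unfold kapp
    rw [tsum_eq_single k fun k' hk' => ?_]
    · simp [idOp]
    · have : ¬(k.1 - k'.1 = 0 ∧ k.2 = k'.2) := fun h =>
        hk' (Prod.ext (sub_eq_zero.1 h.1).symm h.2.symm)
      simp [idOp, this]
  rw [this, wn_const_mul]

lemma pn_le_iff {A : Op P × Op P} {c : ℝ≥0∞} : pn w θ κ A ≤ c ↔
    kn w θ A.1 ≤ c ∧ kn w θ A.2 ≤ c ∧ κ⁻¹ * kn w θ (A.1 - A.2) ≤ c := by
  simp [pn, and_assoc]

lemma kn_fst_le (A : Op P × Op P) : kn w θ A.1 ≤ pn w θ κ A := (pn_le_iff.1 le_rfl).1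
lemma kn_snd_le (A : Op P × Op P) : kn w θ A.2 ≤ pn w θ κ A := (pn_le_iff.1 le_rfl).2.1
lemma kn_diff_le (A : Op P × Op P) : κ⁻¹ * kn w θ (A.1 - A.2) ≤ pn w θ κ A :=
  (pn_le_iff.1 le_rfl).2.2

lemma pn_add_le (hw : PosFin w) (A B : Op P × Op P) :
    pn w θ κ (A + B) ≤ pn w θ κ A + pn w θ κ B := by
  refine pn_le_iff.2 ⟨(kn_add_le hw _ _).trans (add_le_add (kn_fst_le A) (kn_fst_le B)),
    (kn_add_le hw _ _).trans (add_le_add (kn_snd_le A) (kn_snd_le B)), ?_⟩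
  have : (A + B).1 - (A + B).2 = (A.1 - A.2) + (B.1 - B.2) := by simp; abel
  rw [this]
  refine (mul_le_mul_right (kn_add_le hw _ _) _).trans ?_
  rw [mul_add]
  exact add_le_add (kn_diff_le A) (kn_diff_le B)

lemma pn_neg (A : Op P × Op P) : pn w θ κ (-A) = pn w θ κ A := by
  have : -A.1 - -A.2 = -(A.1 - A.2) := by abel
  simp only [pn, Prod.fst_neg, Prod.snd_neg, this, kn_neg]

lemma pn_zero : pn w θ κ (0 : Op P × Op P) = 0 := by simp [pn, kn_zero]

lemma pn_smul_le (hw : PosFin w) (c : ℂ) (A : Op P × Op P) :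
    pn w θ κ (c • A) ≤ ‖c‖ₑ * pn w θ κ A := by
  refine pn_le_iff.2 ⟨(kn_smul_le hw _ _).trans (mul_le_mul_right (kn_fst_le A) _),
    (kn_smul_le hw _ _).trans (mul_le_mul_right (kn_snd_le A) _), ?_⟩
  have : (c • A).1 - (c • A).2 = c • (A.1 - A.2) := by simp [smul_sub]
  rw [this]
  refine (mul_le_mul_right (kn_smul_le hw _ _) _).trans ?_
  rw [mul_left_comm]
  exact mul_le_mul_right (kn_diff_le A) _

lemma pn_idOp_le : pn w θ κ ((idOp : Op P), (idOp : Op P)) ≤ θ 0 :=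
  pn_le_iff.2 ⟨kn_idOp_le, kn_idOp_le, by simp [kn_zero]⟩

lemma entry_eq_zero_of_kn (hw : PosFin w) (hθ : ∀ l, 1 ≤ θ l) {A : Op P} (h : kn w θ A = 0) :
    A = 0 := by
  funext l j j'
  have := eq_zero_of_kop hw (E := ak A) (le_antisymm ((kop_ak_le hθ A).trans h.le) zero_le) l j j'
  simpa [ak] using this

lemma kcomp_ne_top (hw : PosFin w) (hθ : ∀ l, 1 ≤ θ l) {A B : Op P} (hA : kn w θ A ≠ ⊤)
    (hB : kn w θ B ≠ ⊤) : kop w (kcomp (ak A) (ak B)) ≠ ⊤ := by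
  have hB' := ne_top_of_le_ne_top hB (kop_ak_le hθ B)
  exact ne_top_of_le_ne_top (ENNReal.mul_ne_top (ne_top_of_le_ne_top hA (kop_ak_le hθ A)) hB')
    (kop_kcomp_le hw _ hB')

lemma comp_assoc (hw : PosFin w) (hθ : ∀ l, 1 ≤ θ l) {A B C : Op P} (hA : kn w θ A ≠ ⊤)
    (hB : kn w θ B ≠ ⊤) (hC : kn w θ C ≠ ⊤) : comp (comp A B) C = comp A (comp B C) := by
  have hBC := kcomp_ne_top hw hθ hB hC
  have h : kop w (kcomp (ak A) (kcomp (ak B) (ak C))) ≠ ⊤ :=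
    ne_top_of_le_ne_top (ENNReal.mul_ne_top (ne_top_of_le_ne_top hA (kop_ak_le hθ A)) hBC)
      (kop_kcomp_le hw _ hBC)
  funext l j j'
  exact comp_assoc_entry (entry_ne_top hw h l j j')

lemma summable_comp (hw : PosFin w) (hθ : ∀ l, 1 ≤ θ l) {A B : Op P} (hA : kn w θ A ≠ ⊤)
    (hB : kn w θ B ≠ ⊤) (l : Mode P) (j j' : Site P) :
    Summable fun k : Idx P => A (l - k.1) j k.2 * B k.1 k.2 j' :=
  summable_app (u := fun k => B k.1 k.2 j') (k := (l, j))
    (entry_ne_top hw (kcomp_ne_top hw hθ hA hB) l j j')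

lemma comp_add (hw : PosFin w) (hθ : ∀ l, 1 ≤ θ l) {A B C : Op P} (hA : kn w θ A ≠ ⊤)
    (hB : kn w θ B ≠ ⊤) (hC : kn w θ C ≠ ⊤) : comp A (B + C) = comp A B + comp A C := by
  funext l j j'
  simp only [comp, Pi.add_apply, mul_add]
  exact (summable_comp hw hθ hA hB l j j').tsum_add (summable_comp hw hθ hA hC l j j')

lemma add_comp (hw : PosFin w) (hθ : ∀ l, 1 ≤ θ l) {A B C : Op P} (hA : kn w θ A ≠ ⊤)
    (hB : kn w θ B ≠ ⊤) (hC : kn w θ C ≠ ⊤) : comp (A + B) C = comp A C + comp B C := by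
  funext l j j'
  simp only [comp, Pi.add_apply, add_mul]
  exact (summable_comp hw hθ hA hC l j j').tsum_add (summable_comp hw hθ hB hC l j j')

lemma comp_neg (A B : Op P) : comp A (-B) = -comp A B := by
  funext l j j'
  simp [comp, tsum_neg]

lemma neg_comp (A B : Op P) : comp (-A) B = -comp A B := by
  funext l j j'
  simp [comp, tsum_neg]

lemma comp_smul (c : ℂ) (A B : Op P) : comp A (c • B) = c • comp A B := by
  funext l j j'
  simp only [comp, Pi.smul_apply, smul_eq_mul, ← tsum_mul_left]
  exact tsum_congr fun k => by ring

lemma smul_comp (c : ℂ) (A B : Op P) : comp (c • A) B = c • comp A B := by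
  funext l j j'
  simp only [comp, Pi.smul_apply, smul_eq_mul, ← tsum_mul_left]
  exact tsum_congr fun k => by ring

lemma zero_comp (A : Op P) : comp 0 A = 0 := by funext l j j'; simp [comp]
lemma comp_zero (A : Op P) : comp A 0 = 0 := by funext l j j'; simp [comp]

/-- The difference of two products is `(A₁-A₂)B₁ + A₂(B₁-B₂)`; each term carries a factor `1/2`, so
the pair norm is submultiplicative with constant one and increments propagate through any product
like the operators themselves. -/
lemma pn_comp_le (hw : PosFin w) (hθ1 : ∀ l, 1 ≤ θ l)
    (hθ : ∀ l l', 2 * θ (l + l') ≤ θ l * θ l') {A B : Op P × Op P}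
    (hA : pn w θ κ A ≠ ⊤) (hB : pn w θ κ B ≠ ⊤) :
    pn w θ κ (comp A.1 B.1, comp A.2 B.2) ≤ pn w θ κ A * pn w θ κ B := by
  have hA1 := ne_top_of_le_ne_top hA (kn_fst_le A)
  have hA2 := ne_top_of_le_ne_top hA (kn_snd_le A)
  have hB1 := ne_top_of_le_ne_top hB (kn_fst_le B)
  have hB2 := ne_top_of_le_ne_top hB (kn_snd_le B)
  have half : ∀ x : ℝ≥0∞, 2⁻¹ * x ≤ x := fun x => mul_le_of_le_one_left' (by simp)
  have hdA : kn w θ (A.1 - A.2) ≠ ⊤ :=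
    ne_top_of_le_ne_top (ENNReal.add_ne_top.2 ⟨hA1, hA2⟩) (kn_sub_le hw _ _)
  have hdB : kn w θ (B.1 - B.2) ≠ ⊤ :=
    ne_top_of_le_ne_top (ENNReal.add_ne_top.2 ⟨hB1, hB2⟩) (kn_sub_le hw _ _)
  refine pn_le_iff.2 ⟨?_, ?_, ?_⟩
  · exact (kn_comp_le hw hθ _ hB1).trans ((half _).trans (mul_le_mul' (kn_fst_le A) (kn_fst_le B)))
  · exact (kn_comp_le hw hθ _ hB2).trans ((half _).trans (mul_le_mul' (kn_snd_le A) (kn_snd_le B)))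
  · have e : comp A.1 B.1 - comp A.2 B.2 = comp (A.1 - A.2) B.1 + comp A.2 (B.1 - B.2) := by
      have hn : kn w θ (-A.2) ≠ ⊤ := by rwa [kn_neg]
      have hm : kn w θ (-B.2) ≠ ⊤ := by rwa [kn_neg]
      rw [sub_eq_add_neg A.1, sub_eq_add_neg B.1, add_comp hw hθ1 hA1 hn hB1,
        comp_add hw hθ1 hA2 hB1 hm, neg_comp, comp_neg]
      abel
    simp only [e]
    calc κ⁻¹ * kn w θ (comp (A.1 - A.2) B.1 + comp A.2 (B.1 - B.2))
        ≤ κ⁻¹ * (2⁻¹ * (kn w θ (A.1 - A.2) * kn w θ B.1)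
          + 2⁻¹ * (kn w θ A.2 * kn w θ (B.1 - B.2))) := by
          gcongr
          exact (kn_add_le hw _ _).trans
            (add_le_add (kn_comp_le hw hθ _ hB1) (kn_comp_le hw hθ _ hdB))
      _ = 2⁻¹ * ((κ⁻¹ * kn w θ (A.1 - A.2)) * kn w θ B.1)
          + 2⁻¹ * (kn w θ A.2 * (κ⁻¹ * kn w θ (B.1 - B.2))) := by ring
      _ ≤ 2⁻¹ * (pn w θ κ A * pn w θ κ B) + 2⁻¹ * (pn w θ κ A * pn w θ κ B) := by
          gcongr
          exacts [kn_diff_le A, kn_fst_le B, kn_snd_le A, kn_diff_le B]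
      _ = pn w θ κ A * pn w θ κ B := by
          rw [← add_mul, ENNReal.inv_two_add_inv_two, one_mul]

end norms

/-! ### The Banach algebra of pairs of operators -/

/-- The parameters of the norm: a weight on the indices, a submultiplicative weight on the time
frequencies, and a scale `κ` for the distance of the two operators of a pair. -/
structure Wt (P : Finset ℕ) where
  w : Idx P → ℝ≥0∞
  θ : Mode P → ℝ≥0∞
  κ : ℝ≥0∞
  hw : PosFin w
  one_le : ∀ l, 1 ≤ θ l
  ne_top : ∀ l, θ l ≠ ⊤
  submul : ∀ l l', 2 * θ (l + l') ≤ θ l * θ l'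

/-- Pairs of operators with finite norm. -/
def BS (W : Wt P) : Submodule ℂ (Op P × Op P) where
  carrier := {A | pn W.w W.θ W.κ A ≠ ⊤}
  add_mem' {A B} hA hB :=
    ne_top_of_le_ne_top (ENNReal.add_ne_top.2 ⟨hA, hB⟩) (pn_add_le W.hw A B)
  zero_mem' := by simp [pn_zero]
  smul_mem' c A hA := ne_top_of_le_ne_top (ENNReal.mul_ne_top (by simp) hA) (pn_smul_le W.hw c A)

/-- The algebra of pairs of operators with finite norm. -/
def BA (W : Wt P) : Type := BS W

namespace BA

variable {W : Wt P}

instance : AddCommGroup (BA W) := inferInstanceAs (AddCommGroup (BS W))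
instance : Module ℂ (BA W) := inferInstanceAs (Module ℂ (BS W))

/-- The first operator of a pair. -/
def fst (A : BA W) : Op P := A.1.1
/-- The second operator of a pair. -/
def snd (A : BA W) : Op P := A.1.2
/-- The norm of a pair, in `[0, ∞]`. -/
def en (A : BA W) : ℝ≥0∞ := pn W.w W.θ W.κ (A.fst, A.snd)

lemma en_ne_top (A : BA W) : A.en ≠ ⊤ := A.2

/-- The element of the algebra given by two operators. -/
def mk (A B : Op P) (h : pn W.w W.θ W.κ (A, B) ≠ ⊤) : BA W := ⟨(A, B), h⟩

@[simp] lemma fst_mk (A B : Op P) (h : pn W.w W.θ W.κ (A, B) ≠ ⊤) : (mk A B h : BA W).fst = A := rfl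
@[simp] lemma snd_mk (A B : Op P) (h : pn W.w W.θ W.κ (A, B) ≠ ⊤) : (mk A B h : BA W).snd = B := rfl

@[ext] lemma ext {A B : BA W} (h₁ : A.fst = B.fst) (h₂ : A.snd = B.snd) : A = B :=
  Subtype.ext (Prod.ext h₁ h₂)

lemma kn_fst_ne_top (A : BA W) : kn W.w W.θ A.fst ≠ ⊤ :=
  ne_top_of_le_ne_top A.en_ne_top (kn_fst_le (κ := W.κ) (A.fst, A.snd))
lemma kn_snd_ne_top (A : BA W) : kn W.w W.θ A.snd ≠ ⊤ :=
  ne_top_of_le_ne_top A.en_ne_top (kn_snd_le (κ := W.κ) (A.fst, A.snd))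

@[simp] lemma fst_add (A B : BA W) : (A + B).fst = A.fst + B.fst := rfl
@[simp] lemma snd_add (A B : BA W) : (A + B).snd = A.snd + B.snd := rfl
@[simp] lemma fst_sub (A B : BA W) : (A - B).fst = A.fst - B.fst := rfl
@[simp] lemma snd_sub (A B : BA W) : (A - B).snd = A.snd - B.snd := rfl
@[simp] lemma fst_neg (A : BA W) : (-A).fst = -A.fst := rfl
@[simp] lemma snd_neg (A : BA W) : (-A).snd = -A.snd := rfl
@[simp] lemma fst_zero : (0 : BA W).fst = 0 := rfl
@[simp] lemma snd_zero : (0 : BA W).snd = 0 := rfl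
@[simp] lemma fst_smul (c : ℂ) (A : BA W) : (c • A).fst = c • A.fst := rfl
@[simp] lemma snd_smul (c : ℂ) (A : BA W) : (c • A).snd = c • A.snd := rfl

instance : Mul (BA W) := ⟨fun A B => mk (comp A.fst B.fst) (comp A.snd B.snd)
  (ne_top_of_le_ne_top (ENNReal.mul_ne_top A.en_ne_top B.en_ne_top)
    (pn_comp_le W.hw W.one_le W.submul A.en_ne_top B.en_ne_top))⟩

instance : One (BA W) := ⟨mk idOp idOp (ne_top_of_le_ne_top (W.ne_top 0) pn_idOp_le)⟩

@[simp] lemma fst_mul (A B : BA W) : (A * B).fst = comp A.fst B.fst := rfl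
@[simp] lemma snd_mul (A B : BA W) : (A * B).snd = comp A.snd B.snd := rfl
@[simp] lemma fst_one : (1 : BA W).fst = idOp := rfl
@[simp] lemma snd_one : (1 : BA W).snd = idOp := rfl

instance : Ring (BA W) where
  __ := (inferInstance : AddCommGroup (BA W))
  mul_assoc A B C := BA.ext
    (comp_assoc W.hw W.one_le A.kn_fst_ne_top B.kn_fst_ne_top C.kn_fst_ne_top)
    (comp_assoc W.hw W.one_le A.kn_snd_ne_top B.kn_snd_ne_top C.kn_snd_ne_top)
  one_mul A := BA.ext (idOp_comp _) (idOp_comp _)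
  mul_one A := BA.ext (comp_idOp _) (comp_idOp _)
  left_distrib A B C := BA.ext
    (comp_add W.hw W.one_le A.kn_fst_ne_top B.kn_fst_ne_top C.kn_fst_ne_top)
    (comp_add W.hw W.one_le A.kn_snd_ne_top B.kn_snd_ne_top C.kn_snd_ne_top)
  right_distrib A B C := BA.ext
    (add_comp W.hw W.one_le A.kn_fst_ne_top B.kn_fst_ne_top C.kn_fst_ne_top)
    (add_comp W.hw W.one_le A.kn_snd_ne_top B.kn_snd_ne_top C.kn_snd_ne_top)
  zero_mul A := BA.ext (zero_comp _) (zero_comp _)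
  mul_zero A := BA.ext (comp_zero _) (comp_zero _)

instance : Algebra ℂ (BA W) := Algebra.ofModule
  (fun c _ _ => BA.ext (smul_comp c _ _) (smul_comp c _ _))
  (fun c _ _ => BA.ext (comp_smul c _ _) (comp_smul c _ _))

lemma en_add_le (A B : BA W) : (A + B).en ≤ A.en + B.en :=
  pn_add_le W.hw (A.fst, A.snd) (B.fst, B.snd)

lemma en_smul_le (c : ℂ) (A : BA W) : (c • A).en ≤ ‖c‖ₑ * A.en :=
  pn_smul_le W.hw c (A.fst, A.snd)

lemma en_mul_le (A B : BA W) : (A * B).en ≤ A.en * B.en :=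
  pn_comp_le W.hw W.one_le W.submul A.en_ne_top B.en_ne_top

lemma en_neg (A : BA W) : (-A).en = A.en := pn_neg (A.fst, A.snd)

lemma eq_zero_of_en {A : BA W} (h : A.en = 0) : A = 0 :=
  BA.ext
    (entry_eq_zero_of_kn W.hw W.one_le (le_antisymm
      ((kn_fst_le (κ := W.κ) (A.fst, A.snd)).trans h.le) zero_le))
    (entry_eq_zero_of_kn W.hw W.one_le (le_antisymm
      ((kn_snd_le (κ := W.κ) (A.fst, A.snd)).trans h.le) zero_le))

/-- The norm of the algebra. -/
def groupNorm : AddGroupNorm (BA W) where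
  toFun A := A.en.toReal
  map_zero' := by
    have : (0 : BA W).en = 0 := pn_zero
    simp [this]
  add_le' A B := by
    rw [← ENNReal.toReal_add A.en_ne_top B.en_ne_top]
    exact ENNReal.toReal_mono (ENNReal.add_ne_top.2 ⟨A.en_ne_top, B.en_ne_top⟩) (en_add_le A B)
  neg' A := by rw [en_neg]
  eq_zero_of_map_eq_zero' A h :=
    eq_zero_of_en ((ENNReal.toReal_eq_zero_iff _).1 h |>.resolve_right A.en_ne_top)

instance : NormedAddCommGroup (BA W) := groupNorm.toNormedAddCommGroup

lemma norm_def (A : BA W) : ‖A‖ = A.en.toReal := rfl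

lemma en_eq (A : BA W) : A.en = ENNReal.ofReal ‖A‖ := by
  rw [norm_def, ENNReal.ofReal_toReal A.en_ne_top]

lemma norm_le_iff {A : BA W} {c : ℝ} (hc : 0 ≤ c) :
    ‖A‖ ≤ c ↔ pn W.w W.θ W.κ (A.fst, A.snd) ≤ ENNReal.ofReal c := by
  change _ ↔ A.en ≤ _
  rw [en_eq, ENNReal.ofReal_le_ofReal_iff hc]

instance : NormedRing (BA W) where
  __ := (inferInstance : NormedAddCommGroup (BA W))
  __ := (inferInstance : Ring (BA W))
  norm_mul_le A B := by
    rw [norm_def, norm_def, norm_def, ← ENNReal.toReal_mul]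
    exact ENNReal.toReal_mono (ENNReal.mul_ne_top A.en_ne_top B.en_ne_top) (en_mul_le A B)

instance : NormedAlgebra ℂ (BA W) where
  norm_smul_le c A := by
    rw [norm_def, norm_def, ← toReal_enorm, ← ENNReal.toReal_mul]
    exact ENNReal.toReal_mono (ENNReal.mul_ne_top (by simp) A.en_ne_top) (en_smul_le c A)

lemma enorm_eq_en (A : BA W) : ‖A‖ₑ = A.en := by
  rw [en_eq, ofReal_norm]

lemma enorm_entry_fst_le (A : BA W) (l : Mode P) (j j' : Site P) :
    ‖A.fst l j j'‖ₑ ≤ A.en * (W.w (0, j') / W.w (l, j)) :=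
  (entry_le W.hw (ak A.fst) l j j').trans (mul_le_mul_left
    ((kop_ak_le W.one_le _).trans (kn_fst_le (κ := W.κ) (A.fst, A.snd))) _)

lemma enorm_entry_snd_le (A : BA W) (l : Mode P) (j j' : Site P) :
    ‖A.snd l j j'‖ₑ ≤ A.en * (W.w (0, j') / W.w (l, j)) :=
  (entry_le W.hw (ak A.snd) l j j').trans (mul_le_mul_left
    ((kop_ak_le W.one_le _).trans (kn_snd_le (κ := W.κ) (A.fst, A.snd))) _)

/-- The matrix elements of the first operator, as continuous linear functionals. -/
def entryFst (W : Wt P) (l : Mode P) (j j' : Site P) : BA W →L[ℂ] ℂ :=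
  LinearMap.mkContinuous
    { toFun := fun A => A.fst l j j'
      map_add' := fun _ _ => rfl
      map_smul' := fun _ _ => rfl } (W.w (0, j') / W.w (l, j)).toReal fun A => by
    have h := enorm_entry_fst_le A l j j'
    rw [mul_comm] at h
    have := ENNReal.toReal_mono (ENNReal.mul_ne_top
      (ENNReal.div_ne_top (W.hw.ne_top _) (W.hw.ne_zero _)) A.en_ne_top) h
    rwa [ENNReal.toReal_mul, toReal_enorm] at this

/-- The matrix elements of the second operator, as continuous linear functionals. -/
def entrySnd (W : Wt P) (l : Mode P) (j j' : Site P) : BA W →L[ℂ] ℂ :=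
  LinearMap.mkContinuous
    { toFun := fun A => A.snd l j j'
      map_add' := fun _ _ => rfl
      map_smul' := fun _ _ => rfl } (W.w (0, j') / W.w (l, j)).toReal fun A => by
    have h := enorm_entry_snd_le A l j j'
    rw [mul_comm] at h
    have := ENNReal.toReal_mono (ENNReal.mul_ne_top
      (ENNReal.div_ne_top (W.hw.ne_top _) (W.hw.ne_zero _)) A.en_ne_top) h
    rwa [ENNReal.toReal_mul, toReal_enorm] at this

lemma hasSum_fst {α : Type*} {u : α → BA W} {a : BA W} (h : HasSum u a) (l : Mode P)
    (j j' : Site P) : HasSum (fun n => (u n).fst l j j') (a.fst l j j') :=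
  (entryFst W l j j').hasSum h

lemma hasSum_snd {α : Type*} {u : α → BA W} {a : BA W} (h : HasSum u a) (l : Mode P)
    (j j' : Site P) : HasSum (fun n => (u n).snd l j j') (a.snd l j j') :=
  (entrySnd W l j j').hasSum h

/-- Matrix elements are bounded functionals, so an absolutely convergent series has an entrywise
sum; norms of majorants are countably subadditive entry by entry. This provides both the limit and
the rate in the completeness proof. -/
lemma pn_tsum_le {u : ℕ → BA W} (hu : ∑' n, (u n).en ≠ ⊤) :
    pn W.w W.θ W.κ (fun l j j' => ∑' n, (u n).fst l j j', fun l j j' => ∑' n, (u n).snd l j j')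
      ≤ ∑' n, (u n).en := by
  have s1 : ∀ l j j', Summable fun n => (u n).fst l j j' := fun l j j' =>
    summable_of_tsum_enorm (ne_top_of_le_ne_top (ENNReal.mul_ne_top hu
      (ENNReal.div_ne_top (W.hw.ne_top (0, j')) (W.hw.ne_zero (l, j))))
      ((ENNReal.tsum_le_tsum fun n => enorm_entry_fst_le (u n) l j j').trans
        ENNReal.tsum_mul_right.le))
  have s2 : ∀ l j j', Summable fun n => (u n).snd l j j' := fun l j j' =>
    summable_of_tsum_enorm (ne_top_of_le_ne_top (ENNReal.mul_ne_top hu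
      (ENNReal.div_ne_top (W.hw.ne_top (0, j')) (W.hw.ne_zero (l, j))))
      ((ENNReal.tsum_le_tsum fun n => enorm_entry_snd_le (u n) l j j').trans
        ENNReal.tsum_mul_right.le))
  refine pn_le_iff.2 ⟨?_, ?_, ?_⟩
  · exact (kn_tsum_le W.hw fun n => (u n).fst).trans
      (ENNReal.tsum_le_tsum fun n => kn_fst_le (κ := W.κ) ((u n).fst, (u n).snd))
  · exact (kn_tsum_le W.hw fun n => (u n).snd).trans
      (ENNReal.tsum_le_tsum fun n => kn_snd_le (κ := W.κ) ((u n).fst, (u n).snd))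
  · have e : ((fun l j j' => ∑' n, (u n).fst l j j') - fun l j j' => ∑' n, (u n).snd l j j' : Op P)
        = fun l j j' => ∑' n, ((u n).fst - (u n).snd) l j j' := by
      funext l j j'
      exact ((s1 l j j').tsum_sub (s2 l j j')).symm
    simp only [e]
    refine (mul_le_mul_right (kn_tsum_le W.hw fun n => (u n).fst - (u n).snd) _).trans ?_
    rw [← ENNReal.tsum_mul_left]
    exact ENNReal.tsum_le_tsum fun n => kn_diff_le (κ := W.κ) ((u n).fst, (u n).snd)

/-- It suffices to sum absolutely convergent series. The candidate limit is the entrywise sum, and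
its distance to a partial sum is bounded by the norms of the remaining terms. -/
instance : CompleteSpace (BA W) := by
  refine NormedAddCommGroup.completeSpace_of_summable_imp_tendsto fun u hu => ?_
  have hu' : ∀ m, ∑' n, (u (n + m)).en ≠ ⊤ := fun m => by
    simp_rw [← enorm_eq_en]
    exact tsum_enorm_ne_top_iff_summable_norm.2 ((summable_nat_add_iff m).2 hu)
  have hent1 : ∀ l j j', Summable fun n => (u n).fst l j j' := fun l j j' =>
    .of_norm_bounded (hu.mul_left ‖entryFst W l j j'‖) fun n => (entryFst W l j j').le_opNorm (u n)
  have hent2 : ∀ l j j', Summable fun n => (u n).snd l j j' := fun l j j' =>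
    .of_norm_bounded (hu.mul_left ‖entrySnd W l j j'‖) fun n => (entrySnd W l j j').le_opNorm (u n)
  let a : BA W := mk (fun l j j' => ∑' n, (u n).fst l j j') (fun l j j' => ∑' n, (u n).snd l j j')
    (ne_top_of_le_ne_top (hu' 0) (pn_tsum_le (hu' 0)))
  refine ⟨a, ?_⟩
  rw [tendsto_iff_norm_sub_tendsto_zero]
  have hle : ∀ m, ‖∑ i ∈ Finset.range m, u i - a‖ ≤ ∑' n, ‖u (n + m)‖ := fun m => by
    rw [norm_sub_rev]
    have hs := (summable_nat_add_iff m).2 hu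
    rw [norm_le_iff (tsum_nonneg fun _ => norm_nonneg _)]
    have e1 : ∀ l j j', (a - ∑ i ∈ Finset.range m, u i).fst l j j' = ∑' n, (u (n + m)).fst l j j' :=
      fun l j j' => by
        have h1 := (hent1 l j j').sum_add_tsum_nat_add m
        have h2 : (∑ i ∈ Finset.range m, u i).fst l j j'
            = ∑ i ∈ Finset.range m, (u i).fst l j j' := map_sum (entryFst W l j j') u _
        simp only [fst_sub, Pi.sub_apply, h2, a, fst_mk, ← h1, add_sub_cancel_left]
    have e2 : ∀ l j j', (a - ∑ i ∈ Finset.range m, u i).snd l j j' = ∑' n, (u (n + m)).snd l j j' :=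
      fun l j j' => by
        have h1 := (hent2 l j j').sum_add_tsum_nat_add m
        have h2 : (∑ i ∈ Finset.range m, u i).snd l j j'
            = ∑ i ∈ Finset.range m, (u i).snd l j j' := map_sum (entrySnd W l j j') u _
        simp only [snd_sub, Pi.sub_apply, h2, a, snd_mk, ← h1, add_sub_cancel_left]
    have E1 : (a - ∑ i ∈ Finset.range m, u i).fst = fun l j j' => ∑' n, (u (n + m)).fst l j j' := by
      funext l j j'; exact e1 l j j'
    have E2 : (a - ∑ i ∈ Finset.range m, u i).snd = fun l j j' => ∑' n, (u (n + m)).snd l j j' := by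
      funext l j j'; exact e2 l j j'
    rw [E1, E2]
    refine (pn_tsum_le (u := fun n => u (n + m)) (hu' m)).trans (le_of_eq ?_)
    rw [ENNReal.ofReal_tsum_of_nonneg (fun _ => norm_nonneg _) hs]
    exact tsum_congr fun n => en_eq _
  exact squeeze_zero (fun _ => norm_nonneg _) hle (tendsto_sum_nat_add fun n => ‖u n‖)

end BA

/-! ### Exponentials in Banach algebras -/

section Banach

lemma norm_inv_factorial_le (n : ℕ) : ‖((n.factorial : ℂ))⁻¹‖ ≤ 1 := by
  rw [norm_inv, Complex.norm_natCast]
  exact inv_le_one_of_one_le₀ (by exact_mod_cast n.factorial_pos)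

variable {𝔸 : Type*} [NormedRing 𝔸]

/-- The derivative of `x ^ n` in the direction `x'`. -/
def dpow (x x' : 𝔸) : ℕ → 𝔸
  | 0 => 0
  | n + 1 => x' * x ^ n + x * dpow x x' n

/-- By induction from the Leibniz rule. Exponents start at one because the unit of `BA W` has no
norm bound by one: the weight at `ℓ = 0` is at least two, so estimates must never pass through
`‖1‖`. -/
lemma norm_dpow_le (x x' : 𝔸) (n : ℕ) : ‖dpow x x' (n + 1)‖ ≤ (n + 1) * (‖x'‖ * ‖x‖ ^ n) := by
  induction n with
  | zero => simp [dpow]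
  | succ n ih =>
    rw [dpow]
    calc ‖x' * x ^ (n + 1) + x * dpow x x' (n + 1)‖
        ≤ ‖x'‖ * ‖x‖ ^ (n + 1) + ‖x‖ * ((n + 1) * (‖x'‖ * ‖x‖ ^ n)) := by
          refine (norm_add_le _ _).trans (add_le_add ((norm_mul_le _ _).trans ?_)
            ((norm_mul_le _ _).trans ?_))
          · gcongr; exact norm_pow_le' x n.succ_pos
          · gcongr
      _ = _ := by push_cast; ring

variable [NormedAlgebra ℂ 𝔸]

/-- The derivative of `exp` at `x` in the direction `x'`. -/
def dexp (x x' : 𝔸) : 𝔸 := ∑' n : ℕ, ((n.factorial : ℂ))⁻¹ • dpow x x' n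

lemma norm_dexp_term_le {x : 𝔸} (hx : ‖x‖ ≤ 1 / 2) (x' : 𝔸) (n : ℕ) :
    ‖(((n + 2).factorial : ℂ))⁻¹ • dpow x x' (n + 2)‖ ≤ ‖x‖ * ‖x'‖ * (1 / 2 : ℝ) ^ n := by
  have h1 : ‖(((n + 2).factorial : ℂ))⁻¹‖ * ((n + 1 : ℕ) + 1) ≤ 1 := by
    rw [norm_inv, Complex.norm_natCast, inv_mul_le_iff₀ (by exact_mod_cast Nat.factorial_pos _),
      mul_one, Nat.factorial_succ]
    push_cast
    have : (1 : ℝ) ≤ ((n + 1).factorial : ℝ) := by exact_mod_cast Nat.factorial_pos _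
    nlinarith
  calc ‖(((n + 2).factorial : ℂ))⁻¹ • dpow x x' (n + 2)‖
      ≤ ‖(((n + 2).factorial : ℂ))⁻¹‖ * (((n + 1 : ℕ) + 1) * (‖x'‖ * ‖x‖ ^ (n + 1))) :=
        (norm_smul_le _ _).trans (by gcongr; exact norm_dpow_le x x' (n + 1))
    _ = (‖(((n + 2).factorial : ℂ))⁻¹‖ * ((n + 1 : ℕ) + 1)) * (‖x'‖ * ‖x‖ ^ (n + 1)) := by ring
    _ ≤ 1 * (‖x'‖ * ‖x‖ ^ (n + 1)) := by gcongr
    _ = ‖x‖ * ‖x'‖ * ‖x‖ ^ n := by ring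
    _ ≤ _ := by gcongr

variable [CompleteSpace 𝔸]

lemma exp_mul_exp_neg (x : 𝔸) : NormedSpace.exp x * NormedSpace.exp (-x) = 1 := by
  have h := NormedSpace.exp_add_of_commute_of_mem_ball (𝕂 := ℂ) (x := x) (y := -x)
    (Commute.refl x).neg_right (by simp [NormedSpace.expSeries_radius_eq_top])
    (by simp [NormedSpace.expSeries_radius_eq_top])
  rw [← h, add_neg_cancel, NormedSpace.exp_zero]

lemma exp_neg_mul_exp (x : 𝔸) : NormedSpace.exp (-x) * NormedSpace.exp x = 1 := by
  simpa using exp_mul_exp_neg (-x)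

/-- Compare the series without its constant term to a geometric series of ratio `1/2`; bounding `exp
x - 1` rather than `exp x` avoids the norm of the unit. -/
lemma norm_exp_sub_one_le {x : 𝔸} (hx : ‖x‖ ≤ 1 / 2) : ‖NormedSpace.exp x - 1‖ ≤ 2 * ‖x‖ := by
  have h := (hasSum_nat_add_iff' 1).2 (NormedSpace.exp_series_hasSum_exp' (𝕂 := ℂ) x)
  simp only [Finset.range_one, Finset.sum_singleton, Nat.factorial_zero, Nat.cast_one, inv_one,
    pow_zero, one_smul] at h
  have hg : HasSum (fun n : ℕ => ‖x‖ * (1 / 2 : ℝ) ^ n) (‖x‖ * 2) := hasSum_geometric_two.mul_left _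
  rw [mul_comm]
  refine h.norm_le_of_bounded hg fun n => ?_
  calc ‖(((n + 1).factorial : ℂ))⁻¹ • x ^ (n + 1)‖ ≤ ‖(((n + 1).factorial : ℂ))⁻¹‖ * ‖x ^ (n + 1)‖ :=
        norm_smul_le _ _
    _ ≤ 1 * ‖x‖ ^ (n + 1) := by
        gcongr
        exacts [norm_inv_factorial_le _, norm_pow_le' x n.succ_pos]
    _ = ‖x‖ * ‖x‖ ^ n := by ring
    _ ≤ _ := by gcongr

lemma hasSum_dexp {x : 𝔸} (hx : ‖x‖ ≤ 1 / 2) (x' : 𝔸) :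
    HasSum (fun n : ℕ => ((n.factorial : ℂ))⁻¹ • dpow x x' n) (dexp x x') := by
  refine Summable.hasSum ((summable_nat_add_iff 2).1 ?_)
  exact .of_norm_bounded (summable_geometric_two.mul_left (‖x‖ * ‖x'‖))
    fun n => norm_dexp_term_le hx x' n

/-- The first two terms of the series are `0` and `x'`; the rest is quadratic and geometric. -/
lemma norm_dexp_sub_le {x : 𝔸} (hx : ‖x‖ ≤ 1 / 2) (x' : 𝔸) :
    ‖dexp x x' - x'‖ ≤ 2 * (‖x‖ * ‖x'‖) := by
  have h := (hasSum_nat_add_iff' 2).2 (hasSum_dexp hx x')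
  have e : ∑ i ∈ Finset.range 2, ((i.factorial : ℂ))⁻¹ • dpow x x' i = x' := by
    simp [Finset.sum_range_succ, dpow]
  rw [e] at h
  rw [mul_comm]
  exact h.norm_le_of_bounded (hasSum_geometric_two.mul_left (‖x‖ * ‖x'‖))
    fun n => norm_dexp_term_le hx x' n

/-- The new remainder of a reduction step is the ultraviolet tail of the old one, up to quadratic
terms. -/
lemma norm_newRemainder_sub_tail_le {x x' R Z T : 𝔸} (hx : ‖x‖ ≤ 1 / 2) (hx' : x' = R - T - Z)
    (hR' : ‖x'‖ ≤ ‖R‖) (hZ : ‖Z‖ ≤ ‖R‖) (hT : ‖T‖ ≤ ‖R‖) :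
    ‖(-dexp x x' + NormedSpace.exp x * R - Z * NormedSpace.exp x) * NormedSpace.exp (-x) - T‖
      ≤ 14 * (‖x‖ * ‖R‖) := by
  set y := NormedSpace.exp x - 1 with hy
  set z := NormedSpace.exp (-x) - 1 with hz
  set q := dexp x x' - x' with hq
  have hyn : ‖y‖ ≤ 2 * ‖x‖ := norm_exp_sub_one_le hx
  have hzn : ‖z‖ ≤ 2 * ‖x‖ := by
    have := norm_exp_sub_one_le (x := -x) (by rwa [norm_neg])
    rwa [norm_neg] at this
  have hqn : ‖q‖ ≤ 2 * (‖x‖ * ‖R‖) := (norm_dexp_sub_le hx x').trans (by gcongr)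
  have e1 : NormedSpace.exp x = 1 + y := by rw [hy]; abel
  have e2 : NormedSpace.exp (-x) = 1 + z := by rw [hz]; abel
  have e3 : dexp x x' = x' + q := by rw [hq]; abel
  -- Since `x' = R - T - Z`, the first-order terms `-x' + R - Z` add up to `T`; every remaining term
  -- contains one of the small factors `y`, `z`, `q`. The constant is `2 + 6 + 6`.
  have e : (-dexp x x' + NormedSpace.exp x * R - Z * NormedSpace.exp x) * NormedSpace.exp (-x) - T
      = T * z + (-q + y * R - Z * y) + (-q + y * R - Z * y) * z := by
    rw [e1, e2, e3, hx']; noncomm_ring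
  have hE : ‖-q + y * R - Z * y‖ ≤ 6 * (‖x‖ * ‖R‖) := by
    calc ‖-q + y * R - Z * y‖ ≤ ‖q‖ + ‖y‖ * ‖R‖ + ‖Z‖ * ‖y‖ := by
          refine (norm_sub_le _ _).trans (add_le_add ((norm_add_le _ _).trans ?_) (norm_mul_le _ _))
          rw [norm_neg]
          exact add_le_add le_rfl (norm_mul_le _ _)
      _ ≤ 2 * (‖x‖ * ‖R‖) + (2 * ‖x‖) * ‖R‖ + ‖R‖ * (2 * ‖x‖) := by gcongr
      _ = _ := by ring
  have hz1 : ‖z‖ ≤ 1 := by linarith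
  rw [e]
  calc ‖T * z + (-q + y * R - Z * y) + (-q + y * R - Z * y) * z‖
      ≤ ‖T‖ * ‖z‖ + ‖-q + y * R - Z * y‖ + ‖-q + y * R - Z * y‖ * ‖z‖ :=
        (norm_add_le _ _).trans (add_le_add ((norm_add_le _ _).trans
          (add_le_add (norm_mul_le _ _) le_rfl)) (norm_mul_le _ _))
    _ ≤ ‖R‖ * (2 * ‖x‖) + 6 * (‖x‖ * ‖R‖) + 6 * (‖x‖ * ‖R‖) * 1 := by gcongr
    _ = _ := by ring

end Banach

/-! ### Symplectic adjoint and complex conjugation of operators -/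

lemma site_neg_neg (j : Site P) : -(-j) = j := Subtype.ext (neg_neg j.1)

@[simp] lemma site_neg_val (j : Site P) : (-j).1 = -j.1 := rfl

lemma site_cast_ne_zero (j : Site P) : (j.1 : ℂ) ≠ 0 := by exact_mod_cast j.2.1

lemma site_neg_inj {j j' : Site P} : -j = -j' ↔ j = j' :=
  ⟨fun h => by rw [← site_neg_neg j, h, site_neg_neg], fun h => by rw [h]⟩

/-- Negation on the sites. -/
def negSite : Site P ≃ Site P := ⟨Neg.neg, Neg.neg, site_neg_neg, site_neg_neg⟩

@[simp] lemma negSite_apply (j : Site P) : negSite j = -j := rfl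

/-- The adjoint with respect to the symplectic form. -/
def sharp (A : Op P) : Op P := fun l a b => ((a.1 : ℂ) / (b.1 : ℂ)) * A l (-b) (-a)

/-- The operator `u ↦ conj (A (conj u))`. -/
def conjOp (A : Op P) : Op P := fun l j j' => star (A (-l) (-j) (-j'))

lemma sharp_add (A B : Op P) : sharp (A + B) = sharp A + sharp B := by
  funext l a b; simp [sharp, mul_add]
lemma sharp_neg (A : Op P) : sharp (-A) = -sharp A := by funext l a b; simp [sharp]
lemma sharp_sub (A B : Op P) : sharp (A - B) = sharp A - sharp B := by
  rw [sub_eq_add_neg, sharp_add, sharp_neg, ← sub_eq_add_neg]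
lemma conjOp_add (A B : Op P) : conjOp (A + B) = conjOp A + conjOp B := by
  funext l a b; simp [conjOp]
lemma conjOp_neg (A : Op P) : conjOp (-A) = -conjOp A := by funext l a b; simp [conjOp]
lemma conjOp_sub (A B : Op P) : conjOp (A - B) = conjOp A - conjOp B := by
  rw [sub_eq_add_neg, conjOp_add, conjOp_neg, ← sub_eq_add_neg]

lemma idOp_neg (l : Mode P) (a b : Site P) : (idOp : Op P) l (-b) (-a) = idOp l a b := by
  simp only [idOp, site_neg_inj, eq_comm (a := b)]

lemma sharp_idOp : sharp (idOp : Op P) = idOp := by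
  funext l a b
  rw [sharp, idOp_neg]
  by_cases h : l = 0 ∧ a = b
  · rw [h.2, div_self (site_cast_ne_zero b), one_mul]
  · simp [idOp, h]

lemma conjOp_idOp : conjOp (idOp : Op P) = idOp := by
  funext l a b
  by_cases h : l = 0 ∧ a = b <;> simp [conjOp, idOp, site_neg_inj, h]

lemma sharp_comp (A B : Op P) : sharp (comp A B) = comp (sharp B) (sharp A) := by
  funext l a b
  simp only [sharp, comp, ← tsum_mul_left]
  rw [← ((Equiv.subLeft l).prodCongr negSite).tsum_eq]
  refine tsum_congr fun k => ?_
  simp only [Equiv.prodCongr_apply, Prod.map, Equiv.subLeft_apply, negSite_apply, sub_sub_cancel]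
  have := site_cast_ne_zero k.2
  have := site_cast_ne_zero b
  field_simp

lemma conjOp_comp (A B : Op P) : conjOp (comp A B) = comp (conjOp A) (conjOp B) := by
  funext l a b
  simp only [conjOp, comp]
  rw [← ((Equiv.neg _).prodCongr negSite).tsum_eq, tsum_star]
  refine tsum_congr fun k => ?_
  simp only [Equiv.prodCongr_apply, Prod.map, Equiv.neg_apply, negSite_apply, star_mul']
  rw [show -(l - k.1) = -l - -k.1 by abel]

/-- With `A = ∂_x G`, reality of `G` is invariance of `A` under `conjOp`. Reality and
self-adjointness together make `G` symmetric under `(j, j') ↦ (-j', -j)` at fixed `ℓ`, which after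
multiplication by `j` is antisymmetry under `sharp`. Both conditions are linear and compatible with
composition, unlike the existence of `G`. -/
lemma isHam_iff {A : Op P} : IsHam A ↔ sharp A = -A ∧ conjOp A = A := by
  have hpi : (2 * Real.pi * Complex.I : ℂ) ≠ 0 := by simp [Real.pi_ne_zero]
  have key : ∀ j : Site P, (2 * Real.pi * Complex.I * (j.1 : ℂ)) ≠ 0 := fun j =>
    mul_ne_zero hpi (site_cast_ne_zero j)
  constructor
  · rintro ⟨G, hr, hs, hA⟩
    constructor
    · funext l a b
      have h1 : G l (-b) (-a) = G l a b := by
        have := hr (-l) b a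
        rw [neg_neg] at this
        rw [← this, hs, neg_neg]
      have hb := site_cast_ne_zero b
      simp only [sharp, hA, Pi.neg_apply, h1, site_neg_val, Int.cast_neg]
      field_simp
    · funext l a b
      have h1 := hr (-l) (-a) (-b)
      simp only [neg_neg, site_neg_neg] at h1
      simp [conjOp, hA, ← h1]
  · rintro ⟨h1, h2⟩
    refine ⟨fun l j j' => (2 * Real.pi * Complex.I * (j.1 : ℂ))⁻¹ * A l j j', ?_, ?_, ?_⟩
    · intro l j j'
      have := congrFun (congrFun (congrFun h2 (-l)) (-j)) (-j')
      simp only [conjOp, neg_neg, site_neg_neg] at this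
      beta_reduce
      rw [← this]
      simp
    · intro l j j'
      have e1 := congrFun (congrFun (congrFun h2 (-l)) (-j)) (-j')
      simp only [conjOp, neg_neg, site_neg_neg] at e1
      have e2 := congrFun (congrFun (congrFun h1 (-l)) j') j
      simp only [sharp, Pi.neg_apply] at e2
      have hj := site_cast_ne_zero j
      have hj' := site_cast_ne_zero j'
      beta_reduce
      rw [star_mul', e1, ← neg_eq_iff_eq_neg.2 e2]
      simp
      field_simp
    · intro l j j'
      rw [mul_inv_cancel_left₀ (key j)]

lemma isHam_add {A B : Op P} (hA : IsHam A) (hB : IsHam B) : IsHam (A + B) := by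
  rw [isHam_iff] at *
  rw [sharp_add, conjOp_add, hA.1, hA.2, hB.1, hB.2]
  exact ⟨by abel, rfl⟩

/-! ### The commutator with the diagonal part -/

/-- The divisor `ω·ℓ + μ_j - μ'_{j'}`. -/
def del (ω : Freq P) (μ μ' : Site P → ℝ) (l : Mode P) (j j' : Site P) : ℝ := dot ω l + μ j - μ' j'

/-- The operator `D A - A D'` with `D = ω·∂_φ + i diag(μ)`, `D' = ω·∂_φ + i diag(μ')`. -/
def adD (ω : Freq P) (μ μ' : Site P → ℝ) (A : Op P) : Op P :=
  fun l j j' => Complex.I * (del ω μ μ' l j j' : ℂ) * A l j j'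

lemma dot_add (ω : Freq P) (l l' : Mode P) : dot ω (l + l') = dot ω l + dot ω l' := by
  simp [dot, mul_add, Finset.sum_add_distrib]

lemma dot_neg (ω : Freq P) (l : Mode P) : dot ω (-l) = -dot ω l := by
  simp [dot]

lemma dot_zero (ω : Freq P) : dot ω (0 : Mode P) = 0 := by simp [dot]

/-- The cocycle identity of the divisors; it is the reason why the commutator with the diagonal part
is a derivation. -/
lemma del_add (ω : Freq P) (μ μ' μ'' : Site P → ℝ) (l m : Mode P) (j i j' : Site P) :
    del ω μ μ' (l - m) j i + del ω μ' μ'' m i j' = del ω μ μ'' l j j' := by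
  have : dot ω l = dot ω (l - m) + dot ω m := by rw [← dot_add, sub_add_cancel]
  rw [del, del, del, this]; ring

lemma adD_idOp (ω : Freq P) (μ : Site P → ℝ) : adD ω μ μ (idOp : Op P) = 0 := by
  funext l j j'
  by_cases h : l = 0 ∧ j = j'
  · simp [adD, del, h.1, h.2, dot_zero]
  · simp [adD, idOp, h]

/-- The Leibniz rule, with possibly different diagonal parts on the three spaces. The diagonal part
is unbounded, so finiteness of the two derivatives is assumed separately. -/
lemma adD_comp {w : Idx P → ℝ≥0∞} {θ : Mode P → ℝ≥0∞} (hw : PosFin w) (hθ : ∀ l, 1 ≤ θ l)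
    {A B : Op P} (ω : Freq P) (μ μ' μ'' : Site P → ℝ) (hA : kn w θ A ≠ ⊤) (hB : kn w θ B ≠ ⊤)
    (hA' : kn w θ (adD ω μ μ' A) ≠ ⊤) (hB' : kn w θ (adD ω μ' μ'' B) ≠ ⊤) :
    adD ω μ μ'' (comp A B) = comp (adD ω μ μ' A) B + comp A (adD ω μ' μ'' B) := by
  funext l j j'
  simp only [Pi.add_apply]
  rw [comp, comp, ← (summable_comp hw hθ hA' hB l j j').tsum_add (summable_comp hw hθ hA hB' l j j'),
    adD, comp, ← tsum_mul_left]
  refine tsum_congr fun k => ?_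
  rw [← del_add ω μ μ' μ'' l k.1 j k.2 j', adD, adD]
  push_cast
  ring

lemma sharp_adD (ω : Freq P) {μ : Site P → ℝ} (hμ : ∀ j, μ (-j) = -μ j) (A : Op P) :
    sharp (adD ω μ μ A) = adD ω μ μ (sharp A) := by
  funext l a b
  simp only [sharp, adD, del, hμ]
  push_cast
  ring

lemma conjOp_adD (ω : Freq P) {μ : Site P → ℝ} (hμ : ∀ j, μ (-j) = -μ j) (A : Op P) :
    conjOp (adD ω μ μ A) = adD ω μ μ (conjOp A) := by
  funext l a b
  simp only [conjOp, adD, del, hμ, dot_neg]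
  simp
  ring

/-! ### Components of elements of the algebra of pairs -/

namespace BA

variable {W : Wt P} (b : Bool)

/-- The two components of a pair. -/
def pr (A : BA W) : Op P := bif b then A.fst else A.snd

lemma pr_true (A : BA W) : A.pr true = A.fst := rfl
lemma pr_false (A : BA W) : A.pr false = A.snd := rfl
lemma pr_add (A B : BA W) : (A + B).pr b = A.pr b + B.pr b := by cases b <;> rfl
lemma pr_sub (A B : BA W) : (A - B).pr b = A.pr b - B.pr b := by cases b <;> rfl
lemma pr_neg (A : BA W) : (-A).pr b = -A.pr b := by cases b <;> rfl
lemma pr_zero : (0 : BA W).pr b = 0 := by cases b <;> rfl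
lemma pr_mul (A B : BA W) : (A * B).pr b = comp (A.pr b) (B.pr b) := by cases b <;> rfl
lemma pr_one : (1 : BA W).pr b = idOp := by cases b <;> rfl
lemma pr_smul (c : ℂ) (A : BA W) : (c • A).pr b = c • A.pr b := by cases b <;> rfl

lemma kn_pr_le (A : BA W) : kn W.w W.θ (A.pr b) ≤ A.en := by
  cases b
  exacts [kn_snd_le (κ := W.κ) (A.fst, A.snd), kn_fst_le (κ := W.κ) (A.fst, A.snd)]

lemma kn_pr_ne_top (A : BA W) : kn W.w W.θ (A.pr b) ≠ ⊤ :=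
  ne_top_of_le_ne_top A.en_ne_top (kn_pr_le b A)

lemma hasSum_pr {α : Type*} {u : α → BA W} {a : BA W} (h : HasSum u a) (l : Mode P)
    (j j' : Site P) : HasSum (fun n => (u n).pr b l j j') (a.pr b l j j') := by
  cases b
  exacts [hasSum_snd h l j j', hasSum_fst h l j j']

lemma pr_pow (x : BA W) (n : ℕ) : (x ^ n).pr b = powOp (x.pr b) n := by
  induction n with
  | zero => rw [pow_zero, pr_one, powOp]
  | succ n ih => rw [pow_succ', pr_mul, ih, powOp]

lemma pr_exp (x : BA W) : (NormedSpace.exp x).pr b = expOp (x.pr b) := by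
  funext l j j'
  have h := hasSum_pr b (NormedSpace.exp_series_hasSum_exp' (𝕂 := ℂ) x) l j j'
  rw [expOp, ← h.tsum_eq]
  refine tsum_congr fun n => ?_
  rw [pr_smul, pr_pow]
  rfl

lemma pr_exp_neg (x : BA W) : (NormedSpace.exp (-x)).pr b = expOp (-x.pr b) := by
  rw [pr_exp, pr_neg]

variable {b} {ω : Freq P} {μ : Site P → ℝ}

lemma pr_dpow {x x' : BA W} (h : x'.pr b = adD ω μ μ (x.pr b)) (n : ℕ) :
    (dpow x x' n).pr b = adD ω μ μ ((x ^ n).pr b) := by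
  induction n with
  | zero => rw [dpow, pow_zero, pr_zero, pr_one, adD_idOp]
  | succ n ih =>
    have h1 : kn W.w W.θ (adD ω μ μ (x.pr b)) ≠ ⊤ := by rw [← h]; exact kn_pr_ne_top b x'
    have h2 : kn W.w W.θ (adD ω μ μ ((x ^ n).pr b)) ≠ ⊤ := by rw [← ih]; exact kn_pr_ne_top b _
    rw [dpow, pow_succ', pr_add, pr_mul, pr_mul, pr_mul, ih, h,
      adD_comp W.hw W.one_le ω μ μ μ (kn_pr_ne_top b x) (kn_pr_ne_top b _) h1 h2]

/-- The unbounded derivation applied to `exp x` is identified with an element of the algebra: it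
acts term by term on the matrix elements, and the resulting series converges in norm as soon as the
derivative of `x` itself is bounded. -/
lemma pr_dexp {x x' : BA W} (hx : ‖x‖ ≤ 1 / 2) (h : x'.pr b = adD ω μ μ (x.pr b)) :
    (dexp x x').pr b = adD ω μ μ (expOp (x.pr b)) := by
  funext l j j'
  have h1 := hasSum_pr b (hasSum_dexp hx x') l j j'
  rw [adD, expOp, ← h1.tsum_eq, ← tsum_mul_left]
  refine tsum_congr fun n => ?_
  rw [pr_smul, pr_dpow h, pr_pow]
  simp only [Pi.smul_apply, smul_eq_mul, adD]
  ring

lemma sharp_pr_pow {x y : BA W} (h : sharp (x.pr b) = y.pr b) (n : ℕ) :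
    sharp ((x ^ n).pr b) = (y ^ n).pr b := by
  induction n with
  | zero => rw [pow_zero, pow_zero, pr_one, sharp_idOp]
  | succ n ih => rw [pow_succ, pow_succ', pr_mul, pr_mul, sharp_comp, h, ih]

/-- An anti-homomorphism preserves powers of a single element, hence the exponential series; since
`sharp` is a multiplication and relabelling of entries, it passes through the entrywise sum. -/
lemma sharp_pr_exp {x y : BA W} (h : sharp (x.pr b) = y.pr b) :
    sharp ((NormedSpace.exp x).pr b) = (NormedSpace.exp y).pr b := by
  rw [pr_exp, pr_exp]
  funext l a c
  rw [sharp, expOp, expOp, ← tsum_mul_left]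
  refine tsum_congr fun n => ?_
  have := congrFun (congrFun (congrFun (sharp_pr_pow h n) l) a) c
  rw [pr_pow, pr_pow, sharp] at this
  rw [← this]; ring

end BA

lemma conjOp_powOp (A : Op P) (n : ℕ) : conjOp (powOp A n) = powOp (conjOp A) n := by
  induction n with
  | zero => exact conjOp_idOp
  | succ n ih => rw [powOp, powOp, conjOp_comp, ih]

lemma conjOp_expOp (A : Op P) : conjOp (expOp A) = expOp (conjOp A) := by
  funext l j j'
  rw [conjOp, expOp, expOp, tsum_star]
  refine tsum_congr fun n => ?_
  rw [← conjOp_powOp, conjOp]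
  simp

/-! ### One step of the reduction -/

open Classical in
/-- The solution `Ψ` of the homological equation. -/
def psiOp (N : ℝ) (ω : Freq P) (μ : Site P → ℝ) (R : Op P) : Op P := fun l j j' =>
  if ‖l‖ ≤ N ∧ ¬(l = 0 ∧ j = j') then R l j j' / (Complex.I * (del ω μ μ l j j' : ℂ)) else 0

open Classical in
/-- The ultraviolet tail of an operator. -/
def tailOp (N : ℝ) (R : Op P) : Op P := fun l j j' => if ‖l‖ ≤ N then 0 else R l j j'

open Classical in
/-- The time average of the diagonal of an operator. -/
def diagPart (R : Op P) : Op P := fun l j j' => if l = 0 ∧ j = j' then R l j j' else 0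

/-- The correction of the eigenvalues. -/
def corr (R : Op P) (j : Site P) : ℝ := (R 0 j j).im

/-- The remainder after one step. -/
def newR (N : ℝ) (ω : Freq P) (μ : Site P → ℝ) (R : Op P) : Op P :=
  comp (-adD ω μ μ (expOp (psiOp N ω μ R)) + comp (expOp (psiOp N ω μ R)) R
    - comp (diagPart R) (expOp (psiOp N ω μ R))) (expOp (-psiOp N ω μ R))

/-- The hypotheses on the operator `ω·∂_φ + i diag(μ) + R` for a step at scale `N`. -/
structure NonRes (N : ℝ) (ω : Freq P) (μ : Site P → ℝ) (R : Op P) : Prop where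
  nonneg : 0 ≤ N
  odd : ∀ j, μ (-j) = -μ j
  ham : IsHam R
  ne_zero : ∀ l j j', ‖l‖ ≤ N → ¬(l = 0 ∧ j = j') → del ω μ μ l j j' ≠ 0

/-- The homological equation: inside the truncation and off the diagonal average the division undoes
the multiplication by the divisor, and elsewhere both sides vanish. -/
lemma adD_psiOp {N : ℝ} {ω : Freq P} {μ : Site P → ℝ} {R : Op P} (h : NonRes N ω μ R) :
    adD ω μ μ (psiOp N ω μ R) = R - tailOp N R - diagPart R := by
  funext l j j'
  simp only [adD, psiOp, tailOp, diagPart, Pi.sub_apply]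
  by_cases h1 : ‖l‖ ≤ N
  · by_cases h2 : l = 0 ∧ j = j'
    · rw [if_pos h1, if_pos h2, if_neg (by simp [h2])]; simp
    · have : (del ω μ μ l j j' : ℂ) ≠ 0 := by exact_mod_cast h.ne_zero l j j' h1 h2
      simp only [h1, h2, not_false_eq_true, and_self, if_true, if_false, sub_zero]
      field_simp [Complex.I_ne_zero]
  · have h2 : ¬(l = 0 ∧ j = j') := fun h2 => h1 (by rw [h2.1, norm_zero]; exact h.nonneg)
    simp [h1, h2]

/-- For odd eigenvalues the divisor is invariant under `(j, j') ↦ (-j', -j)` and changes sign when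
`ℓ`, `j`, `j'` are all negated. The first symmetry preserves antisymmetry under `sharp`; the second
compensates the conjugation of `i`. -/
lemma isHam_psiOp {N : ℝ} {ω : Freq P} {μ : Site P → ℝ} {R : Op P} (h : NonRes N ω μ R) :
    IsHam (psiOp N ω μ R) := by
  obtain ⟨h1, h2⟩ := isHam_iff.1 h.ham
  refine isHam_iff.2 ⟨?_, ?_⟩
  · funext l a b
    have e := congrFun (congrFun (congrFun h1 l) a) b
    simp only [sharp, Pi.neg_apply] at e
    have hd : del ω μ μ l (-b) (-a) = del ω μ μ l a b := by simp only [del, h.odd]; ring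
    simp only [sharp, psiOp, Pi.neg_apply, site_neg_inj, hd, eq_comm (a := b)]
    split_ifs with hc
    · rw [← mul_div_assoc, e, neg_div]
    · simp
  · funext l a b
    have e := congrFun (congrFun (congrFun h2 l) a) b
    simp only [conjOp] at e
    have hd : del ω μ μ (-l) (-a) (-b) = -del ω μ μ l a b := by
      simp only [del, h.odd, dot_neg]; ring
    simp only [conjOp, psiOp, site_neg_inj, hd, norm_neg, neg_eq_zero]
    split_ifs with hc
    · rw [star_div₀, e]; simp
    · simp

lemma sharp_diagPart {R : Op P} (h : IsHam R) : sharp (diagPart R) = -diagPart R := by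
  funext l a b
  have e := congrFun (congrFun (congrFun (isHam_iff.1 h).1 l) a) b
  simp only [sharp, Pi.neg_apply] at e
  simp only [sharp, diagPart, Pi.neg_apply, site_neg_inj, eq_comm (a := b)]
  split_ifs with hc
  · exact e
  · simp

lemma conjOp_diagPart {R : Op P} (h : IsHam R) : conjOp (diagPart R) = diagPart R := by
  funext l a b
  have e := congrFun (congrFun (congrFun (isHam_iff.1 h).2 l) a) b
  simp only [conjOp] at e
  simp only [conjOp, diagPart, site_neg_inj, neg_eq_zero]
  split_ifs with hc
  · exact e
  · simp

lemma ham_diag_neg {R : Op P} (h : IsHam R) (j : Site P) : R 0 (-j) (-j) = -R 0 j j := by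
  have e := congrFun (congrFun (congrFun (isHam_iff.1 h).1 0) j) j
  simpa [sharp, div_self (site_cast_ne_zero j)] using e

lemma corr_neg {R : Op P} (h : IsHam R) (j : Site P) : corr R (-j) = -corr R j := by
  simp [corr, ham_diag_neg h]

lemma ham_diag_eq {R : Op P} (h : IsHam R) (j : Site P) : R 0 j j = Complex.I * (corr R j : ℂ) := by
  have e := congrFun (congrFun (congrFun (isHam_iff.1 h).2 0) j) j
  simp only [conjOp, neg_zero, ham_diag_neg h, star_neg] at e
  have hre : (R 0 j j).re = 0 := by
    have := congrArg Complex.re e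
    simp at this
    linarith
  rw [corr]
  apply Complex.ext <;> simp [hre]

lemma diagPart_eq {R : Op P} (h : IsHam R) : diagPart R = diagOp (corr R) := by
  funext l j j'
  simp only [diagPart, diagOp]
  by_cases hc : l = 0 ∧ j = j'
  · rw [if_pos hc, if_pos hc, ← hc.2, hc.1, ham_diag_eq h]
  · rw [if_neg hc, if_neg hc]

lemma diagOp_comp (ρ : Site P → ℝ) (A : Op P) (l : Mode P) (j j' : Site P) :
    comp (diagOp ρ) A l j j' = Complex.I * (ρ j : ℂ) * A l j j' := by
  classical
  unfold comp
  rw [tsum_eq_single (l, j) fun k hk => ?_]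
  · simp [diagOp]
  · have : ¬(l - k.1 = 0 ∧ j = k.2) := fun h => hk (Prod.ext (sub_eq_zero.1 h.1).symm h.2.symm)
    simp [diagOp, this]

lemma comp_diagOp (ρ : Site P → ℝ) (A : Op P) (l : Mode P) (j j' : Site P) :
    comp A (diagOp ρ) l j j' = Complex.I * (ρ j' : ℂ) * A l j j' := by
  classical
  unfold comp
  rw [tsum_eq_single (0, j') fun k hk => ?_]
  · simp [diagOp]; ring
  · have : ¬(k.1 = 0 ∧ k.2 = j') := fun h => hk (Prod.ext h.1 h.2)
    simp [diagOp, this]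

lemma adD_add_left (ω : Freq P) (μ μ' ρ : Site P → ℝ) (A : Op P) :
    adD ω (μ + ρ) μ' A = adD ω μ μ' A + comp (diagOp ρ) A := by
  funext l j j'
  simp only [Pi.add_apply, diagOp_comp, adD, del]
  push_cast; ring

lemma adD_add_right (ω : Freq P) (μ μ' ρ : Site P → ℝ) (A : Op P) :
    adD ω μ (μ' + ρ) A = adD ω μ μ' A - comp A (diagOp ρ) := by
  funext l j j'
  simp only [Pi.sub_apply, comp_diagOp, adD, del, Pi.add_apply]
  push_cast; ring

lemma isHam_diagOp {μ : Site P → ℝ} (h : ∀ j, μ (-j) = -μ j) : IsHam (diagOp μ) := by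
  refine isHam_iff.2 ⟨?_, ?_⟩
  · funext l a b
    simp only [sharp, diagOp, Pi.neg_apply, site_neg_inj, eq_comm (a := b)]
    split_ifs with hc
    · rw [← hc.2, div_self (site_cast_ne_zero a), h]; simp
    · simp
  · funext l a b
    simp only [conjOp, diagOp, site_neg_inj, neg_eq_zero]
    split_ifs with hc
    · rw [h]; simp
    · simp

/-- Finite norm of `A u`. -/
lemma wn_app_ne_top {w : Idx P → ℝ≥0∞} (hw : PosFin w) {A : Op P} (hA : kop w (ak A) ≠ ⊤)
    {u : Idx P → ℂ} (hu : wn w (fun k => ‖u k‖ₑ) ≠ ⊤) :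
    wn w (kapp (ak A) fun k => ‖u k‖ₑ) ≠ ⊤ :=
  ne_top_of_le_ne_top (ENNReal.mul_ne_top hA hu) (wn_kapp_le hw _ hu)

lemma wn_enorm_app_le {w : Idx P → ℝ≥0∞} (hw : PosFin w) (A : Op P)
    {u : Idx P → ℂ} (hu : wn w (fun k => ‖u k‖ₑ) ≠ ⊤) :
    wn w (fun k => ‖app A u k‖ₑ) ≤ kop w (ak A) * wn w fun k => ‖u k‖ₑ :=
  (wn_mono fun k => mul_le_mul_right (enorm_app_le A u k) _).trans (wn_kapp_le hw _ hu)

lemma app_comp_of_kop {w : Idx P → ℝ≥0∞} (hw : PosFin w) {A B : Op P} (hA : kop w (ak A) ≠ ⊤)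
    (hB : kop w (ak B) ≠ ⊤) {u : Idx P → ℂ} (hu : wn w (fun k => ‖u k‖ₑ) ≠ ⊤) :
    app (comp A B) u = app A (app B u) := by
  funext k
  refine app_comp (hw.lt_top_of_wn (ne_top_of_le_ne_top (ENNReal.mul_ne_top hA ?_)
    (wn_kapp_le hw _ ?_)) k) <;>
  exact wn_app_ne_top hw hB hu

/-- An operator `A` intertwines `ω·∂_φ + i diag(μ) + R` and `ω·∂_φ + i diag(μ') + R'`. -/
lemma linOp_app {w : Idx P → ℝ≥0∞} (hw : PosFin w) {ω : Freq P} {μ μ' : Site P → ℝ}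
    {A R R' : Op P} (hA : kop w (ak A) ≠ ⊤) (hA' : kop w (ak (adD ω μ' μ A)) ≠ ⊤)
    (hR : kop w (ak R) ≠ ⊤) (hR' : kop w (ak R') ≠ ⊤)
    (h : adD ω μ' μ A + comp R' A = comp A R) {u : Idx P → ℂ}
    (hu : wn w (fun k => ‖u k‖ₑ) ≠ ⊤) (hLu : wn w (fun k => ‖linOp ω μ R u k‖ₑ) ≠ ⊤) :
    linOp ω μ' R' (app A u) = app A (linOp ω μ R u) := by
  set v : Idx P → ℂ := fun k => Complex.I * ((dot ω k.1 + μ k.2 : ℝ) : ℂ) * u k with hv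
  have hRu : wn w (fun k => ‖app R u k‖ₑ) ≠ ⊤ :=
    ne_top_of_le_ne_top (ENNReal.mul_ne_top hR hu) (wn_enorm_app_le hw R hu)
  -- The diagonal part alone is recovered as `Lu - Ru`, so it lies in the space although it is
  -- unbounded. This is what places `u` in the domain and legitimizes the rearrangements below.
  have hvt : wn w (fun k => ‖v k‖ₑ) ≠ ⊤ := by
    refine ne_top_of_le_ne_top (ENNReal.add_ne_top.2 ⟨hLu, hRu⟩)
      ((wn_mono fun k => ?_).trans (wn_add_le w _ _))
    gcongr
    have : v k = linOp ω μ R u k - app R u k := by simp [hv, linOp]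
    rw [this]
    exact enorm_sub_le
  have hLin : linOp ω μ R u = v + app R u := rfl
  funext k
  have t1 := hw.lt_top_of_wn (wn_app_ne_top hw hA hu) k
  have t2 := hw.lt_top_of_wn (wn_app_ne_top hw hA hvt) k
  have t3 := hw.lt_top_of_wn (wn_app_ne_top hw hA hRu) k
  have t4 := hw.lt_top_of_wn (wn_app_ne_top hw hA' hu) k
  have e1 : Complex.I * ((dot ω k.1 + μ' k.2 : ℝ) : ℂ) * app A u k
      = app (adD ω μ' μ A) u k + app A v k := by
    rw [app, app, app, ← (summable_app t4).tsum_add (summable_app t2), ← tsum_mul_left]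
    refine tsum_congr fun k' => ?_
    have hd : dot ω k.1 = dot ω (k.1 - k'.1) + dot ω k'.1 := by rw [← dot_add, sub_add_cancel]
    simp only [adD, del, hv, hd]
    push_cast; ring
  have hRA : kop w (ak (comp R' A)) ≠ ⊤ :=
    ne_top_of_le_ne_top (ENNReal.mul_ne_top hR' hA)
      ((kop_mono (enorm_comp_le R' A)).trans (kop_kcomp_le hw _ hA))
  have e2 : app (adD ω μ' μ A) u k + app R' (app A u) k = app A (app R u) k := by
    rw [← app_comp_of_kop hw hR' hA hu, ← app_comp_of_kop hw hA hR hu, ← h]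
    exact (app_add_op t4 (hw.lt_top_of_wn (wn_app_ne_top hw hRA hu) k)).symm
  rw [hLin, app_add_fun t2 t3, ← e2, linOp, e1]
  ring

/-- Elements of the algebra of pairs one of whose components describes a reduction step. -/
structure StepElt {W : Wt P} (b : Bool) (N : ℝ) (ω : Freq P) (μ : Site P → ℝ) (R : Op P)
    (x x' r z : BA W) : Prop where
  nonres : NonRes N ω μ R
  x_eq : x.pr b = psiOp N ω μ R
  r_eq : r.pr b = R
  z_eq : z.pr b = diagPart R
  x'_eq : x'.pr b = adD ω μ μ (x.pr b)
  x_le : ‖x‖ ≤ 1 / 2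

/-- The remainder after one step, in a Banach algebra. -/
def newElt {𝔸 : Type*} [NormedRing 𝔸] [NormedAlgebra ℂ 𝔸] (x x' r z : 𝔸) : 𝔸 :=
  (-dexp x x' + NormedSpace.exp x * r - z * NormedSpace.exp x) * NormedSpace.exp (-x)

namespace StepElt

variable {W : Wt P} {b : Bool} {N : ℝ} {ω : Freq P} {μ : Site P → ℝ} {R : Op P} {x x' r z : BA W}

lemma pr_dexp (h : StepElt b N ω μ R x x' r z) :
    (dexp x x').pr b = adD ω μ μ ((NormedSpace.exp x).pr b) := by
  rw [BA.pr_dexp h.x_le h.x'_eq, BA.pr_exp]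

lemma pr_dexp_neg (h : StepElt b N ω μ R x x' r z) :
    (dexp (-x) (-x')).pr b = adD ω μ μ ((NormedSpace.exp (-x)).pr b) := by
  rw [BA.pr_dexp (ω := ω) (μ := μ) (by rw [norm_neg]; exact h.x_le) ?_, BA.pr_exp]
  rw [BA.pr_neg, BA.pr_neg, h.x'_eq]
  funext l j j'
  simp [adD]

lemma pr_newElt (h : StepElt b N ω μ R x x' r z) : (newElt x x' r z).pr b = newR N ω μ R := by
  rw [newElt, newR, BA.pr_mul, BA.pr_sub, BA.pr_add, BA.pr_neg, BA.pr_mul, BA.pr_mul, h.pr_dexp,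
    BA.pr_exp_neg, BA.pr_exp, h.x_eq, h.r_eq, h.z_eq]

/-- This is the derivative of the constant `exp x · exp(-x) = 1`. It replaces any explicit formula
for the derivative of the inverse. -/
lemma pr_deriv_inv (h : StepElt b N ω μ R x x' r z) :
    (dexp x x' * NormedSpace.exp (-x) + NormedSpace.exp x * dexp (-x) (-x')).pr b = 0 := by
  rw [BA.pr_add, BA.pr_mul, BA.pr_mul, h.pr_dexp, h.pr_dexp_neg,
    ← adD_comp W.hw W.one_le ω μ μ μ (BA.kn_pr_ne_top b _) (BA.kn_pr_ne_top b _)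
    (by rw [← h.pr_dexp]; exact BA.kn_pr_ne_top b _)
    (by rw [← h.pr_dexp_neg]; exact BA.kn_pr_ne_top b _),
    ← BA.pr_mul, exp_mul_exp_neg, BA.pr_one, adD_idOp]

lemma isHam_psi (h : StepElt b N ω μ R x x' r z) : IsHam (x.pr b) := by
  rw [h.x_eq]; exact isHam_psiOp h.nonres

lemma sharp_exp (h : StepElt b N ω μ R x x' r z) :
    sharp ((NormedSpace.exp x).pr b) = (NormedSpace.exp (-x)).pr b :=
  BA.sharp_pr_exp (by rw [BA.pr_neg]; exact (isHam_iff.1 h.isHam_psi).1)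

lemma sharp_exp_neg (h : StepElt b N ω μ R x x' r z) :
    sharp ((NormedSpace.exp (-x)).pr b) = (NormedSpace.exp x).pr b :=
  BA.sharp_pr_exp (by rw [BA.pr_neg, sharp_neg, (isHam_iff.1 h.isHam_psi).1, neg_neg])

/-- The adjoint of the new remainder is the same expression with factors reversed and signs changed;
its sum with the new remainder collapses to minus the derivative of `exp x · exp(-x)`, which is
zero. Reality holds because `conjOp` is multiplicative, commutes with the derivation and fixes every
ingredient. -/
lemma isHam_newR (h : StepElt b N ω μ R x x' r z) : IsHam (newR N ω μ R) := by
  have hodd := h.nonres.odd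
  have hR := isHam_iff.1 h.nonres.ham
  refine isHam_iff.2 ⟨?_, ?_⟩
  · rw [← add_eq_zero_iff_eq_neg]
    have e : sharp ((newElt x x' r z).pr b) = (NormedSpace.exp x *
        (-dexp (-x) (-x') - r * NormedSpace.exp (-x) + NormedSpace.exp (-x) * z)).pr b := by
      rw [newElt, BA.pr_mul, sharp_comp, h.sharp_exp_neg, BA.pr_sub, BA.pr_add, BA.pr_neg,
        sharp_sub, sharp_add, sharp_neg, h.pr_dexp, sharp_adD ω hodd, h.sharp_exp, BA.pr_mul,
        BA.pr_mul, sharp_comp, sharp_comp, h.sharp_exp, h.r_eq, h.z_eq, hR.1,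
        sharp_diagPart h.nonres.ham, BA.pr_mul, BA.pr_add, BA.pr_sub, BA.pr_neg, h.pr_dexp_neg,
        BA.pr_mul, BA.pr_mul, h.r_eq, h.z_eq, neg_comp, comp_neg]
      congr 1
      abel
    rw [← h.pr_newElt, e, ← BA.pr_add]
    have h1 := exp_mul_exp_neg x
    have e2 : NormedSpace.exp x * (-dexp (-x) (-x') - r * NormedSpace.exp (-x)
          + NormedSpace.exp (-x) * z) + newElt x x' r z
        = -(dexp x x' * NormedSpace.exp (-x) + NormedSpace.exp x * dexp (-x) (-x')) := by
      calc _ = -(dexp x x' * NormedSpace.exp (-x) + NormedSpace.exp x * dexp (-x) (-x'))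
          + ((NormedSpace.exp x * NormedSpace.exp (-x)) * z
            - z * (NormedSpace.exp x * NormedSpace.exp (-x))) := by
            rw [newElt]; noncomm_ring
        _ = _ := by rw [h1]; noncomm_ring
    rw [e2, BA.pr_neg, h.pr_deriv_inv, neg_zero]
  · have hΨ := (isHam_iff.1 (isHam_psiOp h.nonres)).2
    rw [newR, conjOp_comp, conjOp_sub, conjOp_add, conjOp_neg, conjOp_adD ω hodd, conjOp_comp,
      conjOp_comp, conjOp_expOp, conjOp_expOp, conjOp_neg, hΨ, hR.2, conjOp_diagPart h.nonres.ham]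

lemma isInv (h : StepElt b N ω μ R x x' r z) :
    IsInv (expOp (psiOp N ω μ R)) (expOp (-psiOp N ω μ R)) := by
  rw [← h.x_eq, ← BA.pr_exp_neg, ← BA.pr_exp, IsInv, ← BA.pr_mul, ← BA.pr_mul, exp_mul_exp_neg,
    exp_neg_mul_exp, BA.pr_one]
  exact ⟨rfl, rfl⟩

lemma kop_ak_pr_ne_top (A : BA W) : kop W.w (ak (A.pr b)) ≠ ⊤ :=
  ne_top_of_le_ne_top (BA.kn_pr_ne_top b A) (kop_ak_le W.one_le _)

/-- The remainder is defined so that the intertwining relation between `exp x` and the two operators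
is an identity in the Banach algebra; `linOp_app` transports it to functions. The diagonal average
becomes the shift `corr R` of the eigenvalues, being purely imaginary for a Hamiltonian remainder.
-/
lemma linOp_exp (h : StepElt b N ω μ R x x' r z) {u : Idx P → ℂ}
    (hu : wn W.w (fun k => ‖u k‖ₑ) ≠ ⊤) (hLu : wn W.w (fun k => ‖linOp ω μ R u k‖ₑ) ≠ ⊤) :
    linOp ω (μ + corr R) (newR N ω μ R) (app (expOp (psiOp N ω μ R)) u)
      = app (expOp (psiOp N ω μ R)) (linOp ω μ R u) := by
  have hD : adD ω (μ + corr R) μ ((NormedSpace.exp x).pr b)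
      = (dexp x x' + z * NormedSpace.exp x).pr b := by
    rw [adD_add_left, ← diagPart_eq h.nonres.ham, BA.pr_add, BA.pr_mul, h.pr_dexp, h.z_eq]
  have hrel : adD ω (μ + corr R) μ ((NormedSpace.exp x).pr b)
      + comp ((newElt x x' r z).pr b) ((NormedSpace.exp x).pr b)
      = comp ((NormedSpace.exp x).pr b) (r.pr b) := by
    rw [hD, ← BA.pr_mul, ← BA.pr_mul, ← BA.pr_add]
    congr 1
    rw [newElt, mul_assoc, exp_neg_mul_exp]
    noncomm_ring
  have hA := kop_ak_pr_ne_top (b := b) (NormedSpace.exp x)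
  have hA' : kop W.w (ak (adD ω (μ + corr R) μ ((NormedSpace.exp x).pr b))) ≠ ⊤ := by
    rw [hD]; exact kop_ak_pr_ne_top _
  have hr := kop_ak_pr_ne_top (b := b) r
  have hn := kop_ak_pr_ne_top (b := b) (newElt x x' r z)
  have key := fun hLu' => linOp_app W.hw hA hA' hr hn hrel hu hLu'
  rw [h.r_eq, h.pr_newElt, BA.pr_exp, h.x_eq] at key
  exact key hLu

lemma linOp_exp_neg (h : StepElt b N ω μ R x x' r z) {u : Idx P → ℂ}
    (hu : wn W.w (fun k => ‖u k‖ₑ) ≠ ⊤)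
    (hLu : wn W.w (fun k => ‖linOp ω (μ + corr R) (newR N ω μ R) u k‖ₑ) ≠ ⊤) :
    linOp ω μ R (app (expOp (-psiOp N ω μ R)) u)
      = app (expOp (-psiOp N ω μ R)) (linOp ω (μ + corr R) (newR N ω μ R) u) := by
  have hD : adD ω μ (μ + corr R) ((NormedSpace.exp (-x)).pr b)
      = (dexp (-x) (-x') - NormedSpace.exp (-x) * z).pr b := by
    rw [adD_add_right, ← diagPart_eq h.nonres.ham, BA.pr_sub, BA.pr_mul, h.pr_dexp_neg, h.z_eq]
  have hrel : adD ω μ (μ + corr R) ((NormedSpace.exp (-x)).pr b)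
      + comp (r.pr b) ((NormedSpace.exp (-x)).pr b)
      = comp ((NormedSpace.exp (-x)).pr b) ((newElt x x' r z).pr b) := by
    rw [hD, ← BA.pr_mul, ← BA.pr_mul, ← BA.pr_add, ← sub_eq_zero, ← BA.pr_sub]
    have e : dexp (-x) (-x') - NormedSpace.exp (-x) * z + r * NormedSpace.exp (-x)
        - NormedSpace.exp (-x) * newElt x x' r z
        = NormedSpace.exp (-x) * (dexp x x' * NormedSpace.exp (-x)
          + NormedSpace.exp x * dexp (-x) (-x')) := by
      have h1 := exp_neg_mul_exp x
      have h2 := exp_mul_exp_neg x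
      have s1 : NormedSpace.exp (-x) * newElt x x' r z
          = -(NormedSpace.exp (-x) * dexp x x' * NormedSpace.exp (-x))
            + (NormedSpace.exp (-x) * NormedSpace.exp x) * r * NormedSpace.exp (-x)
            - NormedSpace.exp (-x) * z * (NormedSpace.exp x * NormedSpace.exp (-x)) := by
        rw [newElt]; noncomm_ring
      have s2 : NormedSpace.exp (-x) * (dexp x x' * NormedSpace.exp (-x)
          + NormedSpace.exp x * dexp (-x) (-x'))
          = NormedSpace.exp (-x) * dexp x x' * NormedSpace.exp (-x)
            + (NormedSpace.exp (-x) * NormedSpace.exp x) * dexp (-x) (-x') := by noncomm_ring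
      rw [s1, s2, h1, h2]
      noncomm_ring
    rw [e, BA.pr_mul, h.pr_deriv_inv, comp_zero]
  have hA := kop_ak_pr_ne_top (b := b) (NormedSpace.exp (-x))
  have hA' : kop W.w (ak (adD ω μ (μ + corr R) ((NormedSpace.exp (-x)).pr b))) ≠ ⊤ := by
    rw [hD]; exact kop_ak_pr_ne_top _
  have hr := kop_ak_pr_ne_top (b := b) r
  have hn := kop_ak_pr_ne_top (b := b) (newElt x x' r z)
  rw [h.pr_newElt] at hn hrel
  have key := linOp_app W.hw hA hA' hn hr hrel hu hLu
  rw [h.r_eq, BA.pr_exp_neg, h.x_eq] at key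
  exact key

end StepElt

/-! ### Estimates for one step -/

section estimates

variable {w : Idx P → ℝ≥0∞} {θ θ' : Mode P → ℝ≥0∞} {κ : ℝ}

/-- Entrywise multiplication. -/
def mulEntry (m : Mode P → Site P → Site P → ℂ) (A : Op P) : Op P :=
  fun l j j' => m l j j' * A l j j'

/-- Entrywise multipliers act on majorants by their sup norm. For the increment of the pair one uses
the discrete product rule, so a multiplier that moves by `κB'` costs `B'` in addition to its size
`B`. -/
lemma pn_mulEntry_le (hw : PosFin w) (hκ : 0 < κ) {m₁ m₂ : Mode P → Site P → Site P → ℂ}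
    {B B' : ℝ≥0∞} (h₁ : ∀ l j j', θ' l * ‖m₁ l j j'‖ₑ ≤ B * θ l)
    (h₂ : ∀ l j j', θ' l * ‖m₂ l j j'‖ₑ ≤ B * θ l)
    (h : ∀ l j j', θ' l * ‖m₁ l j j' - m₂ l j j'‖ₑ ≤ ENNReal.ofReal κ * B' * θ l) (A₁ A₂ : Op P) :
    pn w θ' (ENNReal.ofReal κ) (mulEntry m₁ A₁, mulEntry m₂ A₂)
      ≤ (B + B') * pn w θ (ENNReal.ofReal κ) (A₁, A₂) := by
  have hk0 : ENNReal.ofReal κ ≠ 0 := by simpa using hκ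
  have single : ∀ (m : Mode P → Site P → Site P → ℂ) (A : Op P),
      (∀ l j j', θ' l * ‖m l j j'‖ₑ ≤ B * θ l) → kn w θ' (mulEntry m A) ≤ B * kn w θ A :=
    fun m A hm => kn_le_mul hw fun l j j' => by
      rw [mulEntry, enorm_mul, ← mul_assoc, ← mul_assoc]
      exact mul_le_mul_left (hm l j j') _
  have hB : B ≤ B + B' := le_self_add
  refine pn_le_iff.2 ⟨(single m₁ A₁ h₁).trans (mul_le_mul' hB (kn_fst_le (A₁, A₂))),
    (single m₂ A₂ h₂).trans (mul_le_mul' hB (kn_snd_le (A₁, A₂))), ?_⟩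
  have hd : kn w θ' (mulEntry m₁ A₁ - mulEntry m₂ A₂)
      ≤ B * kn w θ (A₁ - A₂) + (ENNReal.ofReal κ * B') * kn w θ A₂ :=
    kn_le_add hw fun l j j' => by
      have e : (mulEntry m₁ A₁ - mulEntry m₂ A₂) l j j'
          = m₁ l j j' * (A₁ - A₂) l j j' + (m₁ l j j' - m₂ l j j') * A₂ l j j' := by
        simp only [mulEntry, Pi.sub_apply]; ring
      rw [e]
      refine (mul_le_mul_right (enorm_add_le _ _) _).trans ?_
      rw [mul_add, enorm_mul, enorm_mul, ← mul_assoc, ← mul_assoc, ← mul_assoc, ← mul_assoc]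
      exact add_le_add (mul_le_mul_left (h₁ l j j') _) (mul_le_mul_left (h l j j') _)
  calc (ENNReal.ofReal κ)⁻¹ * kn w θ' (mulEntry m₁ A₁ - mulEntry m₂ A₂)
      ≤ (ENNReal.ofReal κ)⁻¹ * (B * kn w θ (A₁ - A₂) + (ENNReal.ofReal κ * B') * kn w θ A₂) := by
        gcongr
    _ = B * ((ENNReal.ofReal κ)⁻¹ * kn w θ (A₁ - A₂))
        + ((ENNReal.ofReal κ)⁻¹ * ENNReal.ofReal κ) * B' * kn w θ A₂ := by ring
    _ ≤ B * pn w θ (ENNReal.ofReal κ) (A₁, A₂) + 1 * B' * pn w θ (ENNReal.ofReal κ) (A₁, A₂) := by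
        rw [ENNReal.inv_mul_cancel hk0 ENNReal.ofReal_ne_top]
        gcongr
        exacts [kn_diff_le (A₁, A₂), kn_snd_le (A₁, A₂)]
    _ = _ := by ring

lemma pn_mask_le (hw : PosFin w) (hκ : 0 < κ) {m : Mode P → Site P → Site P → ℂ}
    {B : ℝ≥0∞} (h₁ : ∀ l j j', θ' l * ‖m l j j'‖ₑ ≤ B * θ l) (A₁ A₂ : Op P) :
    pn w θ' (ENNReal.ofReal κ) (mulEntry m A₁, mulEntry m A₂)
      ≤ B * pn w θ (ENNReal.ofReal κ) (A₁, A₂) := by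
  have := pn_mulEntry_le (B' := 0) hw hκ h₁ h₁ (fun l j j' => by simp) A₁ A₂
  rwa [add_zero] at this

lemma pn_weight_le (hw : PosFin w) (hκ : 0 < κ) {B : ℝ≥0∞} (h : ∀ l, θ' l ≤ B * θ l)
    (A : Op P × Op P) : pn w θ' (ENNReal.ofReal κ) A ≤ B * pn w θ (ENNReal.ofReal κ) A := by
  have := pn_mask_le (m := fun _ _ _ => 1) hw hκ (θ := θ) (θ' := θ') (B := B)
    (fun l _ _ => by simpa using h l) A.1 A.2
  have e : ∀ A : Op P, mulEntry (fun _ _ _ => 1) A = A := fun A => by funext l j j'; simp [mulEntry]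
  rwa [e, e] at this

lemma pn_weight_add_le (hw : PosFin w) (A : Op P × Op P) {κ : ℝ≥0∞} :
    pn w (θ + θ') κ A ≤ pn w θ κ A + pn w θ' κ A := by
  have single : ∀ B : Op P, kn w (θ + θ') B ≤ kn w θ B + kn w θ' B := fun B => by
    have := kn_le_add (c := 1) (c' := 1) hw (θ := θ + θ') (θ₁ := θ) (θ₂ := θ') (A := B) (B := B)
      (C := B) fun l j j' => by rw [one_mul, one_mul, Pi.add_apply, add_mul]
    simpa using this
  refine pn_le_iff.2 ⟨(single _).trans (add_le_add (kn_fst_le A) (kn_fst_le A)),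
    (single _).trans (add_le_add (kn_snd_le A) (kn_snd_le A)), ?_⟩
  refine (mul_le_mul_right (single _) _).trans ?_
  rw [mul_add]
  exact add_le_add (kn_diff_le A) (kn_diff_le A)

lemma tailOp_eq (N : ℝ) (R : Op P) : tailOp N R =
    mulEntry (open Classical in fun l _ _ => if ‖l‖ ≤ N then 0 else 1) R := by
  funext l j j'; simp [tailOp, mulEntry]

lemma diagPart_eq_mulEntry (R : Op P) : diagPart R =
    mulEntry (open Classical in fun l j j' => if l = 0 ∧ j = j' then 1 else 0) R := by
  funext l j j'; simp [diagPart, mulEntry]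

lemma resonantPart_eq {N : ℝ} (hN : 0 ≤ N) (R : Op P) : R - tailOp N R - diagPart R =
    mulEntry (open Classical in fun l j j' =>
      if ‖l‖ ≤ N ∧ ¬(l = 0 ∧ j = j') then 1 else 0) R := by
  funext l j j'
  simp only [tailOp, diagPart, mulEntry, Pi.sub_apply]
  by_cases h1 : ‖l‖ ≤ N
  · by_cases h2 : l = 0 ∧ j = j'
    · rw [if_pos h1, if_pos h2, if_neg (by simp [h2])]; simp
    · rw [if_pos h1, if_neg h2, if_pos ⟨h1, h2⟩]; simp
  · have h2 : ¬(l = 0 ∧ j = j') := fun h2 => h1 (by rw [h2.1, norm_zero]; exact hN)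
    simp [h1, h2]

lemma psiOp_eq (N : ℝ) (ω : Freq P) (μ : Site P → ℝ) (R : Op P) : psiOp N ω μ R =
    mulEntry (open Classical in fun l j j' => if ‖l‖ ≤ N ∧ ¬(l = 0 ∧ j = j') then
      (Complex.I * (del ω μ μ l j j' : ℂ))⁻¹ else 0) R := by
  funext l j j'
  simp only [psiOp, mulEntry]
  split_ifs
  · rw [div_eq_inv_mul]
  · simp

/-- Lower bounds for the divisors of two operators, and an upper bound for their difference. -/
structure PairRes (N γ κ c τ : ℝ) (ω₁ ω₂ : Freq P) (μ₁ μ₂ : Site P → ℝ) : Prop where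
  lower : ∀ l j j', ‖l‖ ≤ N → ¬(l = 0 ∧ j = j') → ∃ D : ℝ, 1 ≤ D ∧
    γ / 2 * D / N ^ τ ≤ |del ω₁ μ₁ μ₁ l j j'| ∧ γ / 2 * D / N ^ τ ≤ |del ω₂ μ₂ μ₂ l j j'| ∧
    |del ω₁ μ₁ μ₁ l j j' - del ω₂ μ₂ μ₂ l j j'| ≤ κ * γ * c * N * D

/-- The product of the two divisors supplies `D²`, which absorbs the growth `D` of their difference.
Hence the variation of the inverse is bounded uniformly in the sites, at the price `T²N`, the origin
of the exponent `τ₁ = 2τ + 1`. -/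
lemma abs_inv_sub_inv_le {x y D γ κ c N T : ℝ} (hγ : 0 < γ) (hκ : 0 ≤ κ) (hc : 0 ≤ c) (hN : 0 ≤ N)
    (hT : 0 < T) (hD : 1 ≤ D) (hx : γ / 2 * D / T ≤ |x|) (hy : γ / 2 * D / T ≤ |y|)
    (hxy : |x - y| ≤ κ * γ * c * N * D) : |x⁻¹ - y⁻¹| ≤ κ * (4 * c / γ * (T * T * N)) := by
  have hpos : 0 < γ / 2 * D / T := by positivity
  have hx0 : x ≠ 0 := abs_pos.1 (hpos.trans_le hx)
  have hy0 : y ≠ 0 := abs_pos.1 (hpos.trans_le hy)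
  rw [inv_sub_inv hx0 hy0, abs_div, abs_mul, abs_sub_comm]
  rw [div_le_iff₀ (by positivity)]
  calc |x - y| ≤ κ * γ * c * N * D := hxy
    _ ≤ κ * γ * c * N * (D * D) := by gcongr; nlinarith
    _ = κ * (4 * c / γ * (T * T * N)) * ((γ / 2 * D / T) * (γ / 2 * D / T)) := by
        field_simp; ring
    _ ≤ _ := by gcongr

lemma abs_inv_le {x D γ T : ℝ} (hγ : 0 < γ) (hT : 0 < T) (hD : 1 ≤ D)
    (hx : γ / 2 * D / T ≤ |x|) : |x⁻¹| ≤ 2 / γ * T := by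
  rw [abs_inv]
  have hpos : 0 < γ / 2 * 1 / T := by positivity
  have h : γ / 2 * 1 / T ≤ |x| := le_trans (by gcongr) hx
  refine (inv_anti₀ hpos h).trans (le_of_eq ?_)
  field_simp

/-- The generator is the remainder times the truncated inverse divisors. Their size `2γ⁻¹N^τ` and
the scaled variation `4cγ⁻¹N^{2τ+1}` combine to the constant `4c + 2`. -/
lemma pn_psiOp_le {N γ c τ : ℝ} {ω₁ ω₂ : Freq P} {μ₁ μ₂ : Site P → ℝ} (hw : PosFin w) (hκ : 0 < κ)
    (hγ : 0 < γ) (hc : 0 ≤ c) (hN : 1 ≤ N) (hτ : 0 ≤ τ)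
    (h : PairRes N γ κ c τ ω₁ ω₂ μ₁ μ₂) (R₁ R₂ : Op P) :
    pn w θ (ENNReal.ofReal κ) (psiOp N ω₁ μ₁ R₁, psiOp N ω₂ μ₂ R₂)
      ≤ ENNReal.ofReal ((4 * c + 2) / γ * N ^ (2 * τ + 1))
        * pn w θ (ENNReal.ofReal κ) (R₁, R₂) := by
  have hT : 0 < N ^ τ := by positivity
  have hT1 : N ^ τ ≤ N ^ (2 * τ + 1) := Real.rpow_le_rpow_of_exponent_le hN (by linarith)
  have hTT : N ^ τ * N ^ τ * N = N ^ (2 * τ + 1) := by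
    rw [← Real.rpow_add (by positivity), ← Real.rpow_add_one (by positivity)]; ring_nf
  have enI : ∀ d : ℝ, ‖(Complex.I * (d : ℂ))⁻¹‖ₑ = ENNReal.ofReal |d⁻¹| := fun d => by
    rw [← ofReal_norm]; simp [abs_inv]
  have enI2 : ∀ d d' : ℝ, ‖(Complex.I * (d : ℂ))⁻¹ - (Complex.I * (d' : ℂ))⁻¹‖ₑ
      = ENNReal.ofReal |d⁻¹ - d'⁻¹| := fun d d' => by
    rw [← ofReal_norm, mul_inv, mul_inv, ← mul_sub, norm_mul, ← Complex.ofReal_inv,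
      ← Complex.ofReal_inv, ← Complex.ofReal_sub, Complex.norm_real]
    simp
  rw [psiOp_eq, psiOp_eq]
  refine (pn_mulEntry_le (θ := θ) (B := ENNReal.ofReal (2 / γ * N ^ (2 * τ + 1)))
    (B' := ENNReal.ofReal (4 * c / γ * N ^ (2 * τ + 1))) hw hκ ?_ ?_ ?_ R₁ R₂).trans ?_
  · intro l j j'
    rw [mul_comm]
    gcongr
    split_ifs with hm
    · obtain ⟨D, hD, h1, -, -⟩ := h.lower l j j' hm.1 hm.2
      rw [enI]
      exact ENNReal.ofReal_le_ofReal ((abs_inv_le hγ hT hD h1).trans (by gcongr))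
    · simp
  · intro l j j'
    rw [mul_comm]
    gcongr
    split_ifs with hm
    · obtain ⟨D, hD, -, h2, -⟩ := h.lower l j j' hm.1 hm.2
      rw [enI]
      exact ENNReal.ofReal_le_ofReal ((abs_inv_le hγ hT hD h2).trans (by gcongr))
    · simp
  · intro l j j'
    rw [mul_comm, ← ENNReal.ofReal_mul hκ.le]
    gcongr
    split_ifs with hm
    · obtain ⟨D, hD, h1, h2, h3⟩ := h.lower l j j' hm.1 hm.2
      rw [enI2, ← hTT]
      exact ENNReal.ofReal_le_ofReal
        (abs_inv_sub_inv_le hγ hκ.le hc (by linarith) hT hD h1 h2 h3)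
    · simp
  · rw [← ENNReal.ofReal_add (by positivity) (by positivity)]
    gcongr
    exact le_of_eq (by ring)

end estimates

/-- The elements of the algebra of pairs describing a step, and the estimate of the new
remainder. -/
lemma exists_stepElt {W : Wt P} {κ : ℝ} (hκ : 0 < κ) (hWκ : W.κ = ENNReal.ofReal κ)
    {N : ℝ} {ω₁ ω₂ : Freq P} {μ₁ μ₂ : Site P → ℝ} {R₁ R₂ : Op P}
    (h₁ : NonRes N ω₁ μ₁ R₁) (h₂ : NonRes N ω₂ μ₂ R₂) {r₀ X : ℝ} (hr₀ : 0 ≤ r₀) (hX0 : 0 ≤ X)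
    (hR : pn W.w W.θ W.κ (R₁, R₂) ≤ ENNReal.ofReal r₀)
    (hX : pn W.w W.θ W.κ (psiOp N ω₁ μ₁ R₁, psiOp N ω₂ μ₂ R₂) ≤ ENNReal.ofReal X)
    (hX1 : X ≤ 1 / 2) :
    ∃ x x' r z : BA W, StepElt true N ω₁ μ₁ R₁ x x' r z ∧ StepElt false N ω₂ μ₂ R₂ x x' r z ∧
      ‖x‖ ≤ X ∧ pn W.w W.θ W.κ (newR N ω₁ μ₁ R₁ - tailOp N R₁, newR N ω₂ μ₂ R₂ - tailOp N R₂)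
        ≤ ENNReal.ofReal (14 * (X * r₀)) := by
  have hm : ∀ (m : Mode P → Site P → Site P → ℂ), (∀ l j j', ‖m l j j'‖ₑ ≤ 1) →
      pn W.w W.θ W.κ (mulEntry m R₁, mulEntry m R₂) ≤ pn W.w W.θ W.κ (R₁, R₂) := fun m hm => by
    have := pn_mask_le (B := 1) W.hw hκ (θ := W.θ) (θ' := W.θ) (m := m)
      (fun l j j' => by rw [mul_comm]; gcongr; exact hm l j j') R₁ R₂
    rwa [one_mul, ← hWκ] at this
  have tR := ne_top_of_le_ne_top ENNReal.ofReal_ne_top hR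
  have mT : pn W.w W.θ W.κ (tailOp N R₁, tailOp N R₂) ≤ pn W.w W.θ W.κ (R₁, R₂) := by
    rw [tailOp_eq, tailOp_eq]; exact hm _ fun l j j' => by split_ifs <;> simp
  have mZ : pn W.w W.θ W.κ (diagPart R₁, diagPart R₂) ≤ pn W.w W.θ W.κ (R₁, R₂) := by
    rw [diagPart_eq_mulEntry, diagPart_eq_mulEntry]; exact hm _ fun l j j' => by split_ifs <;> simp
  have mX : pn W.w W.θ W.κ (R₁ - tailOp N R₁ - diagPart R₁, R₂ - tailOp N R₂ - diagPart R₂)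
      ≤ pn W.w W.θ W.κ (R₁, R₂) := by
    rw [resonantPart_eq h₁.nonneg, resonantPart_eq h₁.nonneg]
    exact hm _ fun l j j' => by split_ifs <;> simp
  let x : BA W := BA.mk _ _ (ne_top_of_le_ne_top ENNReal.ofReal_ne_top hX)
  let r : BA W := BA.mk _ _ tR
  let t : BA W := BA.mk _ _ (ne_top_of_le_ne_top tR mT)
  let z : BA W := BA.mk _ _ (ne_top_of_le_ne_top tR mZ)
  have hxn : ‖x‖ ≤ X := (BA.norm_le_iff hX0).2 hX
  have hrn : ‖r‖ ≤ r₀ := (BA.norm_le_iff hr₀).2 hR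
  have cmp : ∀ A B : BA W, A.en ≤ B.en → ‖A‖ ≤ ‖B‖ := fun A B h =>
    ENNReal.toReal_mono B.en_ne_top h
  have s1 : StepElt true N ω₁ μ₁ R₁ x (r - t - z) r z :=
    ⟨h₁, rfl, rfl, rfl, (adD_psiOp h₁).symm, hxn.trans hX1⟩
  have s2 : StepElt false N ω₂ μ₂ R₂ x (r - t - z) r z :=
    ⟨h₂, rfl, rfl, rfl, (adD_psiOp h₂).symm, hxn.trans hX1⟩
  refine ⟨x, r - t - z, r, z, s1, s2, hxn, ?_⟩
  have key := norm_newRemainder_sub_tail_le (x := x) (R := r) (T := t) (Z := z) (hxn.trans hX1) rfl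
    (cmp _ _ mX) (cmp _ _ mZ) (cmp _ _ mT)
  have key2 : ‖newElt x (r - t - z) r z - t‖ ≤ 14 * (X * r₀) :=
    key.trans (by gcongr)
  have := (BA.norm_le_iff (by positivity)).1 key2
  have e1 : (newElt x (r - t - z) r z - t).fst = newR N ω₁ μ₁ R₁ - tailOp N R₁ := by
    rw [BA.fst_sub, ← BA.pr_true, s1.pr_newElt]; rfl
  have e2 : (newElt x (r - t - z) r z - t).snd = newR N ω₂ μ₂ R₂ - tailOp N R₂ := by
    rw [BA.snd_sub, ← BA.pr_false, s2.pr_newElt]; rfl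
  rwa [e1, e2] at this

/-! ### The scales -/

lemma scaleN_zero_sub_one (N₀ : ℕ) : scaleN N₀ (((0 : ℕ) : ℤ) - 1) = 1 := by simp [scaleN]

lemma scaleN_natCast (N₀ ν : ℕ) : scaleN N₀ (ν : ℤ) = (N₀ : ℝ) ^ ((3 / 2 : ℝ) ^ ν) := by
  simp [scaleN]

lemma scaleN_succ_sub_one (N₀ ν : ℕ) : scaleN N₀ (((ν + 1 : ℕ) : ℤ) - 1) = scaleN N₀ (ν : ℤ) := by
  simp

lemma scaleN_cases (N₀ : ℕ) (hN : 1 ≤ N₀) (ν : ℕ) :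
    (scaleN N₀ ((ν : ℤ) - 1) = 1 ∧ scaleN N₀ (ν : ℤ) = N₀) ∨
    (scaleN N₀ (ν : ℤ) = scaleN N₀ ((ν : ℤ) - 1) ^ (3 / 2 : ℝ) ∧
      (N₀ : ℝ) ≤ scaleN N₀ ((ν : ℤ) - 1)) := by
  cases ν with
  | zero => left; simp [scaleN]
  | succ ν =>
    right
    rw [scaleN_succ_sub_one, scaleN_natCast, scaleN_natCast, ← Real.rpow_mul (by positivity),
      pow_succ]
    refine ⟨rfl, ?_⟩
    have h1 : (1 : ℝ) ≤ N₀ := by exact_mod_cast hN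
    calc (N₀ : ℝ) = (N₀ : ℝ) ^ (1 : ℝ) := (Real.rpow_one _).symm
      _ ≤ _ := Real.rpow_le_rpow_of_exponent_le h1 (one_le_pow₀ (by norm_num))

/-- The inequalities between consecutive scales used in the iteration; `ξ` is the smallness
parameter. -/
lemma scale_ineq {N₀ : ℕ} {τ ξ M N : ℝ} (hτ : 0 < τ) (hN₀ : 4 ≤ N₀) (hξ0 : 0 ≤ ξ)
    (hξ : ξ ≤ 1 / 2 * (N₀ : ℝ) ^ (-(tauOne τ + aExp τ)))
    (h : (M = 1 ∧ N = N₀) ∨ (N = M ^ (3 / 2 : ℝ) ∧ (N₀ : ℝ) ≤ M)) :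
    1 ≤ M ∧ 2 * M ≤ N ∧ ξ * N ^ tauOne τ * M ^ (-aExp τ) ≤ 1 / 2 ∧
    N ^ (-(bExp τ : ℝ)) * M + ξ * N ^ tauOne τ * M ^ (-aExp τ) * M ^ (-aExp τ) ≤ N ^ (-aExp τ) ∧
    M + ξ * N ^ tauOne τ * M ^ (-aExp τ) * M ^ (-aExp τ) * M ^ (aExp τ + 1) ≤ N := by
  have h4 : (4 : ℝ) ≤ N₀ := by exact_mod_cast hN₀
  have ha : aExp τ = 3 * tauOne τ + 1 := rfl
  have ht : 1 ≤ tauOne τ := by rw [tauOne]; linarith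
  have hb : aExp τ + 1 ≤ (bExp τ : ℝ) := by
    rw [bExp]; push_cast
    have := (Nat.lt_floor_add_one (aExp τ)).le
    linarith
  have hξ' : ξ ≤ 1 / 2 := hξ.trans (by
    have : (N₀ : ℝ) ^ (-(tauOne τ + aExp τ)) ≤ 1 :=
      Real.rpow_le_one_of_one_le_of_nonpos (by linarith) (by rw [ha]; linarith)
    linarith)
  -- The first step (`M = 1`, `N = N₀`) is where the full smallness `ξN₀^{τ₁+a} ≤ 1/2` is needed. In
  -- later steps `N = M^{3/2}`, and the exponents leave room with `ξ ≤ 1/2` alone.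
  rcases h with ⟨rfl, rfl⟩ | ⟨rfl, hM⟩
  · have hp : (0 : ℝ) < N₀ := by linarith
    simp only [Real.one_rpow, mul_one]
    have key : ∀ p : ℝ, p ≤ tauOne τ + aExp τ → ξ * (N₀ : ℝ) ^ p ≤ 1 / 2 := fun p hp' => by
      calc ξ * (N₀ : ℝ) ^ p ≤ 1 / 2 * (N₀ : ℝ) ^ (-(tauOne τ + aExp τ)) * (N₀ : ℝ) ^ p := by gcongr
        _ = 1 / 2 * (N₀ : ℝ) ^ (-(tauOne τ + aExp τ) + p) := by rw [Real.rpow_add hp]; ring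
        _ ≤ 1 / 2 * 1 := by
            gcongr
            exact Real.rpow_le_one_of_one_le_of_nonpos (by linarith) (by linarith)
        _ = 1 / 2 := by norm_num
    have k1 := key (tauOne τ) (by rw [ha]; linarith)
    have k2 := key (tauOne τ + aExp τ) le_rfl
    refine ⟨le_rfl, by linarith, k1, ?_, by linarith⟩
    have e1 : (N₀ : ℝ) ^ (-(bExp τ : ℝ)) ≤ 1 / 2 * (N₀ : ℝ) ^ (-aExp τ) := by
      calc (N₀ : ℝ) ^ (-(bExp τ : ℝ)) ≤ (N₀ : ℝ) ^ (-1 + -aExp τ) :=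
            Real.rpow_le_rpow_of_exponent_le (by linarith) (by linarith)
        _ = (N₀ : ℝ)⁻¹ * (N₀ : ℝ) ^ (-aExp τ) := by rw [Real.rpow_add hp, Real.rpow_neg_one]
        _ ≤ _ := by
            gcongr
            rw [one_div]
            exact inv_anti₀ (by norm_num) (by linarith)
    have e2 : ξ * (N₀ : ℝ) ^ tauOne τ = (ξ * (N₀ : ℝ) ^ (tauOne τ + aExp τ)) * (N₀ : ℝ) ^ (-aExp τ) := by
      rw [mul_assoc, ← Real.rpow_add hp]; ring_nf
    rw [e2]
    have : 0 < (N₀ : ℝ) ^ (-aExp τ) := by positivity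
    nlinarith
  · have hp : (0 : ℝ) < M := by linarith
    have h1M : 1 ≤ M := by linarith
    have hpow : ∀ p : ℝ, (M ^ (3 / 2 : ℝ)) ^ p = M ^ (3 / 2 * p) := fun p => by
      rw [← Real.rpow_mul hp.le]
    have hle1 : ∀ p : ℝ, p ≤ 0 → ξ * M ^ p ≤ 1 / 2 := fun p hp' => by
      have := Real.rpow_le_one_of_one_le_of_nonpos h1M hp'
      have : 0 < M ^ p := by positivity
      nlinarith
    have hhalf : M ^ (-(1 / 2) : ℝ) ≤ 1 / 2 := by
      rw [Real.rpow_neg hp.le, ← Real.sqrt_eq_rpow, one_div]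
      refine inv_anti₀ (by norm_num) (Real.le_sqrt_of_sq_le (by linarith))
    have h2M : 2 * M ≤ M ^ (3 / 2 : ℝ) := by
      have e : M = M ^ (-(1 / 2) : ℝ) * M ^ (3 / 2 : ℝ) := by
        rw [← Real.rpow_add hp]; norm_num
      have : 0 < M ^ (3 / 2 : ℝ) := by positivity
      nlinarith
    simp only [hpow]
    refine ⟨h1M, h2M, ?_, ?_, ?_⟩
    · rw [mul_assoc, ← Real.rpow_add hp]
      exact hle1 _ (by rw [ha]; linarith)
    -- The tail: `-3b/2 + 1 ≤ -1/2 - 3a/2` because `b ≥ a + 1`; the spare `M^{-1/2} ≤ 1/2` comes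
    -- from `N₀ ≥ 4`.
    · have e1 : M ^ (3 / 2 * -(bExp τ : ℝ)) * M ≤ 1 / 2 * M ^ (3 / 2 * -aExp τ) := by
        calc M ^ (3 / 2 * -(bExp τ : ℝ)) * M = M ^ (3 / 2 * -(bExp τ : ℝ) + 1) := by
              rw [Real.rpow_add hp, Real.rpow_one]
          _ ≤ M ^ (-(1 / 2) + 3 / 2 * -aExp τ) :=
              Real.rpow_le_rpow_of_exponent_le h1M (by linarith)
          _ = M ^ (-(1 / 2) : ℝ) * M ^ (3 / 2 * -aExp τ) := Real.rpow_add hp _ _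
          _ ≤ _ := by gcongr
      -- The quadratic part: the total exponent `3τ₁/2 - 2a + 3a/2` is nonpositive since `a = 3τ₁ +
      -- 1`.
      have e2 : ξ * M ^ (3 / 2 * tauOne τ) * M ^ (-aExp τ) * M ^ (-aExp τ)
          ≤ 1 / 2 * M ^ (3 / 2 * -aExp τ) := by
        have e3 : ξ * M ^ (3 / 2 * tauOne τ) * M ^ (-aExp τ) * M ^ (-aExp τ)
            = (ξ * M ^ (3 / 2 * tauOne τ + (-aExp τ) + (-aExp τ) + 3 / 2 * aExp τ))
              * M ^ (3 / 2 * -aExp τ) := by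
          rw [mul_assoc, mul_assoc, ← Real.rpow_add hp, ← Real.rpow_add hp, mul_assoc,
            ← Real.rpow_add hp]
          ring_nf
        rw [e3]
        gcongr
        exact hle1 _ (by rw [ha]; linarith)
      linarith
    · have e2 : ξ * M ^ (3 / 2 * tauOne τ) * M ^ (-aExp τ) * M ^ (-aExp τ) * M ^ (aExp τ + 1)
          ≤ 1 / 2 := by
        rw [mul_assoc, mul_assoc, mul_assoc, ← Real.rpow_add hp, ← Real.rpow_add hp,
          ← Real.rpow_add hp]
        exact hle1 _ (by rw [ha]; linarith)
      linarith

/-! ### Weights on the time frequencies -/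

lemma one_le_jap (l : Mode P) : 1 ≤ jap l := le_max_left _ _

lemma jap_add_le (l l' : Mode P) : jap (l + l') ≤ jap l + jap l' := by
  have h1 := one_le_jap l
  have h2 := one_le_jap l'
  refine max_le (by linarith) ((norm_add_le l l').trans (add_le_add ?_ ?_)) <;>
  exact le_max_right _ _

/-- The weight `⟨ℓ⟩^b`. -/
def thB (b : ℕ) (l : Mode P) : ℝ≥0∞ := ENNReal.ofReal (jap l ^ b)

/-- The trivial weight. -/
def thOne (_ : Mode P) : ℝ≥0∞ := 1

/-- The weight `2^{b+1} (1 + t ⟨ℓ⟩^b)`. -/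
def thT (b : ℕ) (t : ℝ) (l : Mode P) : ℝ≥0∞ := ENNReal.ofReal (2 ^ (b + 1) * (1 + t * jap l ^ b))

/-- The norm parameters with the weight `2^{b+1} (1 + t ⟨ℓ⟩^b)`. -/
def wtT (w : Idx P → ℝ≥0∞) (hw : PosFin w) (b : ℕ) (t : ℝ) (ht : 0 ≤ t) (κ : ℝ) : Wt P where
  w := w
  θ := thT b t
  κ := ENNReal.ofReal κ
  hw := hw
  one_le l := by
    rw [thT, ENNReal.one_le_ofReal]
    have h1 := one_le_jap l
    have : (1 : ℝ) ≤ 2 ^ (b + 1) := one_le_pow₀ (by norm_num)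
    have : 0 ≤ t * jap l ^ b := by positivity
    nlinarith
  ne_top l := ENNReal.ofReal_ne_top
  submul l l' := by
    have h1 := one_le_jap l
    have h2 := one_le_jap l'
    have h3 := one_le_jap (l + l')
    -- The prefactor `2^{b+1}` in the weight is chosen to absorb both this `2^b` and the factor `2`
    -- required of submultiplicative weights.
    have hp : (jap (l + l')) ^ b ≤ 2 ^ b * (jap l ^ b + jap l' ^ b) :=
      (pow_le_pow_left₀ (by linarith) (jap_add_le l l') b).trans
        ((add_pow_le (by linarith) (by linarith) b).trans (by
          gcongr
          exacts [by norm_num, Nat.sub_le b 1]))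
    rw [thT, thT, thT, ← ENNReal.ofReal_mul (by positivity), show (2 : ℝ≥0∞) = ENNReal.ofReal 2 by simp,
      ← ENNReal.ofReal_mul (by norm_num)]
    refine ENNReal.ofReal_le_ofReal ?_
    have hb1 : (1 : ℝ) ≤ 2 ^ b := one_le_pow₀ (by norm_num)
    set x := jap l ^ b
    set y := jap l' ^ b
    have hx : 0 ≤ x := by positivity
    have hy : 0 ≤ y := by positivity
    calc 2 * (2 ^ (b + 1) * (1 + t * jap (l + l') ^ b))
        ≤ 2 * (2 ^ (b + 1) * (2 ^ b * 1 + t * (2 ^ b * (x + y)))) := by gcongr; linarith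
      _ = 2 ^ (b + 1) * 2 ^ (b + 1) * (1 + t * x + t * y) := by ring
      _ ≤ 2 ^ (b + 1) * 2 ^ (b + 1) * ((1 + t * x) * (1 + t * y)) := by
          gcongr
          have : 0 ≤ (t * x) * (t * y) := by positivity
          linarith
      _ = _ := by ring

/-! ### The iteration for a pair of operators -/

/-- The corrections of the eigenvalues and the remainders, starting from
`ω·∂_φ + i diag(μ) + R`. -/
def run (N₀ : ℕ) (ω : Freq P) (μ : Site P → ℝ) (R : Op P) : ℕ → (Site P → ℝ) × Op P
  | 0 => (0, R)
  | ν + 1 => ((run N₀ ω μ R ν).1 + corr (run N₀ ω μ R ν).2,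
      newR (scaleN N₀ ν) ω (μ + (run N₀ ω μ R ν).1) (run N₀ ω μ R ν).2)

/-- The second order Melnikov conditions for the first `ν` steps. -/
def Mel (τ g : ℝ) (N₀ : ℕ) (ω : Freq P) (μ : Site P → ℝ) (R : Op P) (ν : ℕ) : Prop :=
  ∀ n < ν, ∀ l : Mode P, ‖l‖ ≤ scaleN N₀ (n : ℤ) → ∀ j j' : Site P,
    g * |(j.1 : ℝ) ^ 3 - (j'.1 : ℝ) ^ 3| / jap l ^ τ
      ≤ |del ω (μ + (run N₀ ω μ R n).1) (μ + (run N₀ ω μ R n).1) l j j'|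

/-- The hypotheses on the two initial operators. -/
structure PairStart (w : Idx P → ℝ≥0∞) (τ γ κ c₀ c₁ e : ℝ) (ω : Bool → Freq P)
    (μ : Bool → Site P → ℝ) (R : Bool → Op P) : Prop where
  odd : ∀ b j, μ b (-j) = -μ b j
  ham : ∀ b, IsHam (R b)
  dioph : ∀ b, ∀ l : Mode P, l ≠ 0 → γ / 2 / jap l ^ τ ≤ |dot (ω b) l|
  dot_diff : ∀ l : Mode P, |dot (ω true) l - dot (ω false) l| ≤ κ * γ * c₀ * ‖l‖
  mu_diff : ∀ j j', |(μ true j - μ true j') - (μ false j - μ false j')|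
    ≤ κ * γ * c₁ * |(j.1 : ℝ) ^ 3 - (j'.1 : ℝ) ^ 3|
  pn_one : pn w thOne (ENNReal.ofReal κ) (R true, R false) ≤ ENNReal.ofReal e
  pn_b : pn w (thB (bExp τ)) (ENNReal.ofReal κ) (R true, R false) ≤ ENNReal.ofReal e

/-- The estimates for the two operators after `ν` steps. -/
structure PairInv (w : Idx P → ℝ≥0∞) (τ κ e : ℝ) (N₀ : ℕ) (ω : Bool → Freq P)
    (μ : Bool → Site P → ℝ) (R : Bool → Op P) (ν : ℕ) : Prop where
  odd : ∀ b j, (run N₀ (ω b) (μ b) (R b) ν).1 (-j) = -(run N₀ (ω b) (μ b) (R b) ν).1 j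
  ham : ∀ b, IsHam (run N₀ (ω b) (μ b) (R b) ν).2
  pn_one : pn w thOne (ENNReal.ofReal κ) ((run N₀ (ω true) (μ true) (R true) ν).2,
    (run N₀ (ω false) (μ false) (R false) ν).2)
      ≤ ENNReal.ofReal (e * scaleN N₀ ((ν : ℤ) - 1) ^ (-aExp τ))
  pn_b : pn w (thB (bExp τ)) (ENNReal.ofReal κ) ((run N₀ (ω true) (μ true) (R true) ν).2,
    (run N₀ (ω false) (μ false) (R false) ν).2)
      ≤ ENNReal.ofReal (e * scaleN N₀ ((ν : ℤ) - 1))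
  r_diff : ∀ j, |(run N₀ (ω true) (μ true) (R true) ν).1 j
    - (run N₀ (ω false) (μ false) (R false) ν).1 j| ≤ κ * e * (2 - 2 * (1 / 2) ^ ν)

/-- The constant in the estimate of the homological equation. -/
def homC (c₀ c₁ : ℝ) : ℝ := 4 * (c₀ + c₁ + 2) + 2

/-- The constant in the smallness condition. -/
def smallC (τ c₀ c₁ : ℝ) : ℝ := 14 * homC c₀ c₁ * 2 ^ (2 * bExp τ + 4)

/-- The smallness condition of the iteration. -/
structure Small (τ γ c₀ c₁ e E : ℝ) (N₀ : ℕ) : Prop where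
  four_le : 4 ≤ N₀
  γ_pos : 0 < γ
  τ_pos : 0 < τ
  c₀_nonneg : 0 ≤ c₀
  c₁_nonneg : 0 ≤ c₁
  e_nonneg : 0 ≤ e
  e_le : e ≤ γ * E
  small : smallC τ c₀ c₁ * E ≤ 1 / 2 * (N₀ : ℝ) ^ (-(tauOne τ + aExp τ))

lemma Small.E_nonneg {τ γ c₀ c₁ e E : ℝ} {N₀ : ℕ} (h : Small τ γ c₀ c₁ e E N₀) : 0 ≤ E := by
  by_contra hE
  have := mul_neg_of_pos_of_neg h.γ_pos (not_le.1 hE)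
  linarith [h.e_le, h.e_nonneg]

lemma Small.homC_ge {τ γ c₀ c₁ e E : ℝ} {N₀ : ℕ} (h : Small τ γ c₀ c₁ e E N₀) :
    2 ≤ homC c₀ c₁ := by
  have := h.c₀_nonneg; have := h.c₁_nonneg; rw [homC]; linarith

lemma aExp_ge_one {τ : ℝ} (hτ : 0 < τ) : 1 ≤ aExp τ := by rw [aExp, tauOne]; linarith

lemma Small.ineq {τ γ c₀ c₁ e E : ℝ} {N₀ : ℕ} (h : Small τ γ c₀ c₁ e E N₀) (ν : ℕ) :
    1 ≤ scaleN N₀ ((ν : ℤ) - 1) ∧ 2 * scaleN N₀ ((ν : ℤ) - 1) ≤ scaleN N₀ (ν : ℤ) ∧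
    smallC τ c₀ c₁ * E * scaleN N₀ (ν : ℤ) ^ tauOne τ * scaleN N₀ ((ν : ℤ) - 1) ^ (-aExp τ) ≤ 1 / 2 ∧
    scaleN N₀ (ν : ℤ) ^ (-(bExp τ : ℝ)) * scaleN N₀ ((ν : ℤ) - 1)
      + smallC τ c₀ c₁ * E * scaleN N₀ (ν : ℤ) ^ tauOne τ * scaleN N₀ ((ν : ℤ) - 1) ^ (-aExp τ)
        * scaleN N₀ ((ν : ℤ) - 1) ^ (-aExp τ) ≤ scaleN N₀ (ν : ℤ) ^ (-aExp τ) ∧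
    scaleN N₀ ((ν : ℤ) - 1)
      + smallC τ c₀ c₁ * E * scaleN N₀ (ν : ℤ) ^ tauOne τ * scaleN N₀ ((ν : ℤ) - 1) ^ (-aExp τ)
        * scaleN N₀ ((ν : ℤ) - 1) ^ (-aExp τ) * scaleN N₀ ((ν : ℤ) - 1) ^ (aExp τ + 1)
      ≤ scaleN N₀ (ν : ℤ) := by
  have h1 := h.homC_ge
  have h2 := h.E_nonneg
  exact scale_ineq h.τ_pos h.four_le (by rw [smallC]; positivity) h.small
    (scaleN_cases N₀ (le_trans (by norm_num) h.four_le) ν)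

lemma two_pow_le_scaleN {N₀ : ℕ} (hN : 4 ≤ N₀) (ν : ℕ) :
    (2 : ℝ) ^ ν ≤ scaleN N₀ ((ν : ℤ) - 1) := by
  have aux : ∀ ν : ℕ, 2 * scaleN N₀ ((ν : ℤ) - 1) ≤ scaleN N₀ (ν : ℤ) := fun ν =>
    (scale_ineq (τ := 1) (ξ := 0) one_pos hN le_rfl (by positivity)
      (scaleN_cases N₀ (le_trans (by norm_num) hN) ν)).2.1
  induction ν with
  | zero => rw [scaleN_zero_sub_one]; simp
  | succ ν ih =>
    rw [scaleN_succ_sub_one, pow_succ]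
    linarith [aux ν]

lemma scaleN_rpow_le {N₀ : ℕ} (hN : 4 ≤ N₀) {τ : ℝ} (hτ : 0 < τ) (ν : ℕ) :
    scaleN N₀ ((ν : ℤ) - 1) ^ (-aExp τ) ≤ (1 / 2) ^ ν := by
  have h := two_pow_le_scaleN hN ν
  have h1 : (1 : ℝ) ≤ 2 ^ ν := one_le_pow₀ (by norm_num)
  calc scaleN N₀ ((ν : ℤ) - 1) ^ (-aExp τ) ≤ scaleN N₀ ((ν : ℤ) - 1) ^ (-1 : ℝ) :=
        Real.rpow_le_rpow_of_exponent_le (h1.trans h) (by linarith [aExp_ge_one hτ])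
    _ = (scaleN N₀ ((ν : ℤ) - 1))⁻¹ := Real.rpow_neg_one _
    _ ≤ (2 ^ ν)⁻¹ := inv_anti₀ (by positivity) h
    _ = _ := by rw [one_div, inv_pow]

lemma one_le_abs_cube_sub {j j' : Site P} (h : j ≠ j') :
    1 ≤ |(j.1 : ℝ) ^ 3 - (j'.1 : ℝ) ^ 3| := by
  have h1 : j.1 ^ 3 - j'.1 ^ 3 ≠ 0 := fun h0 => h (Subtype.ext
    ((Odd.strictMono_pow (by decide : Odd 3)).injective (sub_eq_zero.1 h0)))
  have h2 : (1 : ℤ) ≤ |j.1 ^ 3 - j'.1 ^ 3| := Int.one_le_abs h1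
  exact_mod_cast h2

/-! ### The induction step for a pair of operators -/

section step

variable {w : Idx P → ℝ≥0∞} {τ γ κ c₀ c₁ e E : ℝ} {N₀ : ℕ} {ω : Bool → Freq P}
  {μ : Bool → Site P → ℝ} {R : Bool → Op P} {ν : ℕ}

/-- Off the diagonal in the sites, the Melnikov condition gives the cube difference `D` as lower
factor, and the difference of unperturbed eigenvalues grows at most like `D`. On the diagonal the
eigenvalues cancel, the Diophantine condition is used and `D = 1`. The `2` in `c₀ + c₁ + 2` accounts
for the eigenvalue corrections at the two sites. -/
lemma pairRes_of_inv (hκ : 0 < κ) (hs : Small τ γ c₀ c₁ e E N₀)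
    (h0 : PairStart w τ γ κ c₀ c₁ e ω μ R) (hi : PairInv w τ κ e N₀ ω μ R ν)
    (hm : ∀ b, Mel τ (γ / 2) N₀ (ω b) (μ b) (R b) (ν + 1)) :
    PairRes (scaleN N₀ (ν : ℤ)) γ κ (c₀ + c₁ + 2) τ (ω true) (ω false)
      (μ true + (run N₀ (ω true) (μ true) (R true) ν).1)
      (μ false + (run N₀ (ω false) (μ false) (R false) ν).1) := by
  obtain ⟨hM1, hMN, -⟩ := hs.ineq ν
  have hγ := hs.γ_pos
  set N := scaleN N₀ (ν : ℤ) with hN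
  have hN1 : 1 ≤ N := by linarith
  have hc0 := hs.c₀_nonneg
  have hc1 := hs.c₁_nonneg
  have hjap : ∀ l : Mode P, ‖l‖ ≤ N → jap l ^ τ ≤ N ^ τ := fun l hl =>
    Real.rpow_le_rpow (by linarith [one_le_jap l]) (max_le hN1 hl) hs.τ_pos.le
  have hjpos : ∀ l : Mode P, 0 < jap l ^ τ := fun l =>
    Real.rpow_pos_of_pos (by linarith [one_le_jap l]) _
  have hsmallE : e ≤ γ / 2 := by
    have hE : smallC τ c₀ c₁ * E ≤ 1 / 2 := hs.small.trans (by
      have : (N₀ : ℝ) ^ (-(tauOne τ + aExp τ)) ≤ 1 :=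
        Real.rpow_le_one_of_one_le_of_nonpos
          (by exact_mod_cast le_trans (by norm_num) hs.four_le)
          (by have := aExp_ge_one hs.τ_pos; have := hs.τ_pos; rw [tauOne]; linarith)
      linarith)
    have hC : 1 ≤ smallC τ c₀ c₁ := by
      have := hs.homC_ge
      have : (1 : ℝ) ≤ 2 ^ (2 * bExp τ + 4) := one_le_pow₀ (by norm_num)
      rw [smallC]; nlinarith
    have : E ≤ 1 / 2 := by nlinarith [hs.E_nonneg]
    have := hs.e_le
    nlinarith
  -- The accumulated corrections sum to at most `2κe`, and `e ≤ γ/2`.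
  have hr : ∀ j, |(run N₀ (ω true) (μ true) (R true) ν).1 j
      - (run N₀ (ω false) (μ false) (R false) ν).1 j| ≤ κ * γ := fun j => by
    refine (hi.r_diff j).trans ?_
    have : (0 : ℝ) < (1 / 2) ^ ν := by positivity
    have he := hs.e_nonneg
    calc κ * e * (2 - 2 * (1 / 2) ^ ν) ≤ κ * e * 2 := by gcongr; linarith
      _ ≤ κ * (γ / 2) * 2 := by gcongr
      _ = κ * γ := by ring
  refine ⟨fun l j j' hl hnd => ?_⟩
  by_cases hj : j = j'
  · subst hj
    have hl0 : l ≠ 0 := fun h => hnd ⟨h, rfl⟩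
    have low : ∀ b, γ / 2 * 1 / N ^ τ ≤ |dot (ω b) l| := fun b => by
      refine le_trans ?_ (h0.dioph b l hl0)
      rw [mul_one]
      exact div_le_div_of_nonneg_left (by positivity) (hjpos l) (hjap l hl)
    refine ⟨1, le_rfl, ?_, ?_, ?_⟩
    · simpa [del] using low true
    · simpa [del] using low false
    · simp only [del, add_sub_cancel_right, mul_one]
      refine (h0.dot_diff l).trans ?_
      have : 0 ≤ κ * γ := by positivity
      calc κ * γ * c₀ * ‖l‖ ≤ κ * γ * c₀ * N := by gcongr
        _ ≤ κ * γ * (c₀ + c₁ + 2) * N := by gcongr; linarith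
  · set D := |(j.1 : ℝ) ^ 3 - (j'.1 : ℝ) ^ 3| with hD
    have hD1 : 1 ≤ D := one_le_abs_cube_sub hj
    have low : ∀ b, γ / 2 * D / N ^ τ ≤ |del (ω b) (μ b + (run N₀ (ω b) (μ b) (R b) ν).1)
        (μ b + (run N₀ (ω b) (μ b) (R b) ν).1) l j j'| := fun b => by
      refine le_trans ?_ (hm b ν (Nat.lt_succ_self ν) l hl j j')
      exact div_le_div_of_nonneg_left (by positivity) (hjpos l) (hjap l hl)
    refine ⟨D, hD1, low true, low false, ?_⟩
    have e1 : del (ω true) (μ true + (run N₀ (ω true) (μ true) (R true) ν).1)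
          (μ true + (run N₀ (ω true) (μ true) (R true) ν).1) l j j'
        - del (ω false) (μ false + (run N₀ (ω false) (μ false) (R false) ν).1)
          (μ false + (run N₀ (ω false) (μ false) (R false) ν).1) l j j'
        = (dot (ω true) l - dot (ω false) l)
          + ((μ true j - μ true j') - (μ false j - μ false j'))
          + (((run N₀ (ω true) (μ true) (R true) ν).1 j
              - (run N₀ (ω false) (μ false) (R false) ν).1 j)
            - ((run N₀ (ω true) (μ true) (R true) ν).1 j'
              - (run N₀ (ω false) (μ false) (R false) ν).1 j')) := by
      simp only [del, Pi.add_apply]; ring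
    rw [e1]
    calc _ ≤ κ * γ * c₀ * ‖l‖ + κ * γ * c₁ * D + (κ * γ + κ * γ) := by
          refine (abs_add_le _ _).trans (add_le_add ((abs_add_le _ _).trans
            (add_le_add (h0.dot_diff l) (h0.mu_diff j j'))) ((abs_sub _ _).trans
            (add_le_add (hr j) (hr j'))))
      _ ≤ κ * γ * c₀ * (N * D) + κ * γ * c₁ * (N * D) + (κ * γ * (N * D) + κ * γ * (N * D)) := by
          have : ‖l‖ ≤ N * D := hl.trans (by nlinarith)
          have : D ≤ N * D := by nlinarith
          have h1 : 1 ≤ N * D := by nlinarith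
          have : κ * γ ≤ κ * γ * (N * D) := le_mul_of_one_le_right (by positivity) h1
          gcongr
      _ = _ := by ring

lemma nonRes_of_inv (hκ : 0 < κ) (hs : Small τ γ c₀ c₁ e E N₀)
    (h0 : PairStart w τ γ κ c₀ c₁ e ω μ R) (hi : PairInv w τ κ e N₀ ω μ R ν)
    (hm : ∀ b, Mel τ (γ / 2) N₀ (ω b) (μ b) (R b) (ν + 1)) (b : Bool) :
    NonRes (scaleN N₀ (ν : ℤ)) (ω b) (μ b + (run N₀ (ω b) (μ b) (R b) ν).1)
      (run N₀ (ω b) (μ b) (R b) ν).2 := by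
  obtain ⟨hM1, hMN, -⟩ := hs.ineq ν
  have hγ := hs.γ_pos
  have hpos : 0 < scaleN N₀ (ν : ℤ) := by linarith
  refine ⟨hpos.le, fun j => ?_, hi.ham b, fun l j j' hl hnd => ?_⟩
  · simp only [Pi.add_apply, h0.odd b j, hi.odd b j]; ring
  · obtain ⟨D, hD, h1, h2, -⟩ := (pairRes_of_inv hκ hs h0 hi hm).lower l j j' hl hnd
    have : 0 < γ / 2 * D / scaleN N₀ (ν : ℤ) ^ τ := by positivity
    cases b
    exacts [abs_pos.1 (this.trans_le h2), abs_pos.1 (this.trans_le h1)]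

lemma pn_psi_of_inv (hw : PosFin w) (hκ : 0 < κ) (hs : Small τ γ c₀ c₁ e E N₀)
    (h0 : PairStart w τ γ κ c₀ c₁ e ω μ R) (hi : PairInv w τ κ e N₀ ω μ R ν)
    (hm : ∀ b, Mel τ (γ / 2) N₀ (ω b) (μ b) (R b) (ν + 1)) (θ : Mode P → ℝ≥0∞) :
    pn w θ (ENNReal.ofReal κ)
      (psiOp (scaleN N₀ (ν : ℤ)) (ω true) (μ true + (run N₀ (ω true) (μ true) (R true) ν).1)
        (run N₀ (ω true) (μ true) (R true) ν).2,
       psiOp (scaleN N₀ (ν : ℤ)) (ω false) (μ false + (run N₀ (ω false) (μ false) (R false) ν).1)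
        (run N₀ (ω false) (μ false) (R false) ν).2)
      ≤ ENNReal.ofReal (homC c₀ c₁ / γ * scaleN N₀ (ν : ℤ) ^ tauOne τ)
        * pn w θ (ENNReal.ofReal κ) ((run N₀ (ω true) (μ true) (R true) ν).2,
          (run N₀ (ω false) (μ false) (R false) ν).2) := by
  obtain ⟨hM1, hMN, -⟩ := hs.ineq ν
  have := hs.c₀_nonneg
  have := hs.c₁_nonneg
  exact pn_psiOp_le hw hκ hs.γ_pos (by linarith) (by linarith) hs.τ_pos.le
    (pairRes_of_inv hκ hs h0 hi hm) _ _

/-- The parameter of the weight in the time frequencies at the step `ν`. -/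
def tPar (τ : ℝ) (N₀ ν : ℕ) : ℝ := scaleN N₀ ((ν : ℤ) - 1) ^ (-(aExp τ + 1))

lemma scaleN_nonneg (N₀ : ℕ) (ν : ℤ) : 0 ≤ scaleN N₀ ν := by
  unfold scaleN; split_ifs <;> positivity

lemma tPar_nonneg (τ : ℝ) (N₀ ν : ℕ) : 0 ≤ tPar τ N₀ ν :=
  Real.rpow_nonneg (scaleN_nonneg _ _) _

/-- The combined weight is a sum of multiples of the low and the high weight, so bounds in both
norms give a bound in the single submultiplicative norm where the Banach algebra estimates apply. -/
lemma pn_thT_le (hw : PosFin w) (hκ : 0 < κ) {b : ℕ} {t x y : ℝ} (ht : 0 ≤ t) (hx : 0 ≤ x)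
    (hy : 0 ≤ y) {A : Op P × Op P} (h1 : pn w thOne (ENNReal.ofReal κ) A ≤ ENNReal.ofReal x)
    (h2 : pn w (thB b) (ENNReal.ofReal κ) A ≤ ENNReal.ofReal y) :
    pn w (thT b t) (ENNReal.ofReal κ) A ≤ ENNReal.ofReal (2 ^ (b + 1) * (x + t * y)) := by
  have e : (thT b t : Mode P → ℝ≥0∞) = (fun _ => ENNReal.ofReal (2 ^ (b + 1)))
      + fun l => ENNReal.ofReal (2 ^ (b + 1) * t) * thB b l := by
    funext l
    have := one_le_jap l
    rw [thT, Pi.add_apply, thB, ← ENNReal.ofReal_mul (by positivity),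
      ← ENNReal.ofReal_add (by positivity) (by positivity)]
    ring_nf
  have e2 : ENNReal.ofReal (2 ^ (b + 1) * (x + t * y))
      = ENNReal.ofReal (2 ^ (b + 1)) * ENNReal.ofReal x
        + ENNReal.ofReal (2 ^ (b + 1) * t) * ENNReal.ofReal y := by
    rw [← ENNReal.ofReal_mul (by positivity), ← ENNReal.ofReal_mul (by positivity),
      ← ENNReal.ofReal_add (by positivity) (by positivity)]
    ring_nf
  rw [e, e2]
  refine (pn_weight_add_le hw A).trans (add_le_add ?_ ?_)
  · exact (pn_weight_le (B := ENNReal.ofReal (2 ^ (b + 1))) (θ := thOne)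
      (θ' := fun _ => ENNReal.ofReal (2 ^ (b + 1))) hw hκ
      (fun l => by simp [thOne]) A).trans (mul_le_mul_right h1 _)
  · exact (pn_weight_le (B := ENNReal.ofReal (2 ^ (b + 1) * t)) (θ := thB b)
      (θ' := fun l => ENNReal.ofReal (2 ^ (b + 1) * t) * thB b l) hw hκ
      (fun l => le_rfl) A).trans (mul_le_mul_right h2 _)

/-- The elements describing the step `ν`. -/
lemma exists_stepElt_of_inv (hw : PosFin w) (hκ : 0 < κ) (hs : Small τ γ c₀ c₁ e E N₀)
    (h0 : PairStart w τ γ κ c₀ c₁ e ω μ R) (hi : PairInv w τ κ e N₀ ω μ R ν)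
    (hm : ∀ b, Mel τ (γ / 2) N₀ (ω b) (μ b) (R b) (ν + 1)) :
    ∃ x x' r z : BA (wtT w hw (bExp τ) (tPar τ N₀ ν) (tPar_nonneg τ N₀ ν) κ),
      (∀ b, StepElt b (scaleN N₀ (ν : ℤ)) (ω b) (μ b + (run N₀ (ω b) (μ b) (R b) ν).1)
        (run N₀ (ω b) (μ b) (R b) ν).2 x x' r z) ∧
      pn w (thT (bExp τ) (tPar τ N₀ ν)) (ENNReal.ofReal κ)
        (newR (scaleN N₀ (ν : ℤ)) (ω true) (μ true + (run N₀ (ω true) (μ true) (R true) ν).1)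
          (run N₀ (ω true) (μ true) (R true) ν).2
            - tailOp (scaleN N₀ (ν : ℤ)) (run N₀ (ω true) (μ true) (R true) ν).2,
         newR (scaleN N₀ (ν : ℤ)) (ω false) (μ false + (run N₀ (ω false) (μ false) (R false) ν).1)
          (run N₀ (ω false) (μ false) (R false) ν).2
            - tailOp (scaleN N₀ (ν : ℤ)) (run N₀ (ω false) (μ false) (R false) ν).2)
        ≤ ENNReal.ofReal (e * (smallC τ c₀ c₁ * E * scaleN N₀ (ν : ℤ) ^ tauOne τ
          * scaleN N₀ ((ν : ℤ) - 1) ^ (-aExp τ) * scaleN N₀ ((ν : ℤ) - 1) ^ (-aExp τ))) := by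
  obtain ⟨hM1, hMN, hA, -, -⟩ := hs.ineq ν
  have hγ := hs.γ_pos
  have he := hs.e_nonneg
  have hE := hs.E_nonneg
  have hh := hs.homC_ge
  set M := scaleN N₀ ((ν : ℤ) - 1) with hM
  set N := scaleN N₀ (ν : ℤ) with hN
  have hMp : 0 < M := by linarith
  have hNp : 0 < N := by linarith
  have hr := pn_thT_le (t := tPar τ N₀ ν) hw hκ (tPar_nonneg τ N₀ ν) (by positivity)
    (by positivity) hi.pn_one hi.pn_b
  -- Here the choice of the weight parameter pays off: `tM = M^{-a}`, so the low and the high norm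
  -- contribute equally.
  have e1 : (2 : ℝ) ^ (bExp τ + 1) * (e * M ^ (-aExp τ) + tPar τ N₀ ν * (e * M))
      = 2 ^ (bExp τ + 2) * e * M ^ (-aExp τ) := by
    have : tPar τ N₀ ν * M = M ^ (-aExp τ) := by
      rw [tPar, ← hM, ← Real.rpow_add_one hMp.ne']; ring_nf
    calc _ = (2 : ℝ) ^ (bExp τ + 1) * (e * M ^ (-aExp τ) + e * (tPar τ N₀ ν * M)) := by ring
      _ = _ := by rw [this]; ring
  rw [e1] at hr
  -- The bound for the generator in the combined norm: `homC γ⁻¹N^{τ₁}` times the bound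
  -- `2^{b+2}eM^{-a}` of the remainder, with `e/γ ≤ E`. The constant `smallC` is defined so that
  -- `14X` times that bound equals the asserted quadratic estimate.
  set X := homC c₀ c₁ * 2 ^ (bExp τ + 2) * E * N ^ tauOne τ * M ^ (-aExp τ) with hXdef
  have hX0 : 0 ≤ X := by positivity
  have hX1 : X ≤ 1 / 2 := by
    refine le_trans ?_ hA
    rw [hXdef, smallC]
    have : (2 : ℝ) ^ (bExp τ + 2) ≤ 2 ^ (2 * bExp τ + 4) :=
      pow_le_pow_right₀ (by norm_num) (by omega)
    gcongr
    nlinarith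
  have hX : pn w (thT (bExp τ) (tPar τ N₀ ν)) (ENNReal.ofReal κ)
      (psiOp N (ω true) (μ true + (run N₀ (ω true) (μ true) (R true) ν).1)
        (run N₀ (ω true) (μ true) (R true) ν).2,
       psiOp N (ω false) (μ false + (run N₀ (ω false) (μ false) (R false) ν).1)
        (run N₀ (ω false) (μ false) (R false) ν).2) ≤ ENNReal.ofReal X := by
    refine (pn_psi_of_inv hw hκ hs h0 hi hm _).trans ((mul_le_mul_right hr _).trans ?_)
    rw [← ENNReal.ofReal_mul (by positivity)]
    refine ENNReal.ofReal_le_ofReal ?_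
    have heE : e / γ ≤ E := by rw [div_le_iff₀ hγ, mul_comm]; exact hs.e_le
    calc homC c₀ c₁ / γ * N ^ tauOne τ * (2 ^ (bExp τ + 2) * e * M ^ (-aExp τ))
        = homC c₀ c₁ * 2 ^ (bExp τ + 2) * (e / γ) * N ^ tauOne τ * M ^ (-aExp τ) := by
          field_simp
      _ ≤ X := by rw [hXdef]; gcongr
  obtain ⟨x, x', r, z, s1, s2, -, hQ⟩ := exists_stepElt
    (W := wtT w hw (bExp τ) (tPar τ N₀ ν) (tPar_nonneg τ N₀ ν) κ) hκ rfl
    (nonRes_of_inv hκ hs h0 hi hm true) (nonRes_of_inv hκ hs h0 hi hm false)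
    (by positivity) hX0 hr hX hX1
  refine ⟨x, x', r, z, fun b => by cases b; exacts [s2, s1], hQ.trans (le_of_eq ?_)⟩
  congr 1
  rw [hXdef, smallC]
  have : (2 : ℝ) ^ (2 * bExp τ + 4) = 2 ^ (bExp τ + 2) * 2 ^ (bExp τ + 2) := by
    rw [← pow_add]; congr 1; ring
  rw [this]; ring

/-- Split the new remainder into the ultraviolet tail of the old one and a quadratic part controlled
in the combined norm. The tail contracts in the low norm by means of the high norm and does not grow
in the high norm; the scale inequalities then close both bounds. -/
lemma pairInv_succ (hw : PosFin w) (hκ : 0 < κ) (hs : Small τ γ c₀ c₁ e E N₀)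
    (h0 : PairStart w τ γ κ c₀ c₁ e ω μ R) (hi : PairInv w τ κ e N₀ ω μ R ν)
    (hm : ∀ b, Mel τ (γ / 2) N₀ (ω b) (μ b) (R b) (ν + 1)) :
    PairInv w τ κ e N₀ ω μ R (ν + 1) := by
  obtain ⟨x, x', r, z, hst, hQ⟩ := exists_stepElt_of_inv hw hκ hs h0 hi hm
  obtain ⟨hM1, hMN, -, hB, hC⟩ := hs.ineq ν
  have he := hs.e_nonneg
  have hE := hs.E_nonneg
  have hh := hs.homC_ge
  have htail : ∀ θ : Mode P → ℝ≥0∞, ∀ A B : Op P,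
      pn w θ (ENNReal.ofReal κ) (tailOp (scaleN N₀ (ν : ℤ)) A, tailOp (scaleN N₀ (ν : ℤ)) B)
      ≤ pn w θ (ENNReal.ofReal κ) (A, B) := fun θ A B => by
    rw [tailOp_eq, tailOp_eq]
    have := pn_mask_le (B := 1) hw hκ (θ := θ) (θ' := θ)
      (m := open Classical in fun l _ _ => if ‖l‖ ≤ scaleN N₀ (ν : ℤ) then 0 else 1)
      (fun l j j' => by rw [mul_comm]; gcongr; split_ifs <;> simp) A B
    rwa [one_mul] at this
  have hsplit : ∀ θ : Mode P → ℝ≥0∞, ∀ A B A' B' : Op P, pn w θ (ENNReal.ofReal κ) (A, B)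
      ≤ pn w θ (ENNReal.ofReal κ) (A', B') + pn w θ (ENNReal.ofReal κ) (A - A', B - B') :=
    fun θ A B A' B' => by
      have := pn_add_le (θ := θ) (κ := ENNReal.ofReal κ) hw (A', B') (A - A', B - B')
      simpa using this
  set M := scaleN N₀ ((ν : ℤ) - 1) with hM
  set N := scaleN N₀ (ν : ℤ) with hN
  have hMp : 0 < M := by linarith
  have hNp : 0 < N := by linarith
  set Q := smallC τ c₀ c₁ * E * N ^ tauOne τ * M ^ (-aExp τ) * M ^ (-aExp τ) with hQdef
  have hQ0 : 0 ≤ Q := by rw [hQdef, smallC]; positivity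
  refine ⟨fun b j => ?_, fun b => ?_, ?_, ?_, fun j => ?_⟩
  · simp only [run, Pi.add_apply, hi.odd b j, corr_neg (hi.ham b) j]; ring
  · exact (hst b).isHam_newR
  · rw [scaleN_succ_sub_one, ← hN]
    simp only [run]
    refine (hsplit thOne _ _ (tailOp N (run N₀ (ω true) (μ true) (R true) ν).2)
      (tailOp N (run N₀ (ω false) (μ false) (R false) ν).2)).trans ((add_le_add ?_ ?_).trans
      (le_of_eq_of_le (ENNReal.ofReal_add (p := N ^ (-(bExp τ : ℝ)) * (e * M)) (q := e * Q)
        (by positivity) (by positivity)).symm (ENNReal.ofReal_le_ofReal ?_)))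
    · rw [tailOp_eq, tailOp_eq, ENNReal.ofReal_mul (by positivity)]
      -- Outside the truncation `⟨ℓ⟩ ≥ N`, so the high weight exceeds the low one by at least `N^b`.
      refine (pn_mask_le (B := ENNReal.ofReal (N ^ (-(bExp τ : ℝ)))) (θ := thB (bExp τ)) hw hκ
        (fun l j j' => ?_) _ _).trans (mul_le_mul_right hi.pn_b _)
      split_ifs with hl
      · simp
      · have hl' : N ≤ jap l := (not_le.1 hl).le.trans (le_max_right _ _)
        rw [thOne, thB, enorm_one, one_mul, ← ENNReal.ofReal_mul (by positivity),
          ENNReal.one_le_ofReal, Real.rpow_neg hNp.le, Real.rpow_natCast,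
          inv_mul_eq_div, one_le_div (by positivity)]
        gcongr
    · refine le_trans ?_ hQ
      have := pn_weight_le (B := 1) (θ := thT (bExp τ) (tPar τ N₀ ν)) (θ' := thOne) hw hκ
        (fun l => by
          rw [one_mul]
          exact (wtT w hw (bExp τ) (tPar τ N₀ ν) (tPar_nonneg τ N₀ ν) κ).one_le l)
      refine (this _).trans (le_of_eq (one_mul _))
    · calc N ^ (-(bExp τ : ℝ)) * (e * M) + e * Q = e * (N ^ (-(bExp τ : ℝ)) * M + Q) := by ring
        _ ≤ e * N ^ (-aExp τ) := by gcongr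
  · rw [scaleN_succ_sub_one, ← hN]
    simp only [run]
    refine (hsplit (thB (bExp τ)) _ _ (tailOp N (run N₀ (ω true) (μ true) (R true) ν).2)
      (tailOp N (run N₀ (ω false) (μ false) (R false) ν).2)).trans ((add_le_add ?_ ?_).trans
      (le_of_eq_of_le (ENNReal.ofReal_add (p := e * M) (q := M ^ (aExp τ + 1) * (e * Q))
        (by positivity) (by positivity)).symm (ENNReal.ofReal_le_ofReal ?_)))
    · exact (htail _ _ _).trans hi.pn_b
    · rw [ENNReal.ofReal_mul (by positivity)]
      refine le_trans ?_ (mul_le_mul_right hQ _)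
      refine pn_weight_le hw hκ (fun l => ?_) _
      have := one_le_jap l
      rw [thB, thT, ← ENNReal.ofReal_mul (by positivity)]
      refine ENNReal.ofReal_le_ofReal ?_
      -- Returning from the combined norm to the high norm costs the inverse of the weight
      -- parameter, which explains the factor `M^{a+1}` in the last scale inequality.
      have h1 : M ^ (aExp τ + 1) * tPar τ N₀ ν = 1 := by
        rw [tPar, ← hM, ← Real.rpow_add hMp, add_neg_cancel, Real.rpow_zero]
      have h2 : (1 : ℝ) ≤ 2 ^ (bExp τ + 1) := one_le_pow₀ (by norm_num)
      calc jap l ^ bExp τ = 1 * (1 * jap l ^ bExp τ) := by ring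
        _ ≤ 2 ^ (bExp τ + 1) * (M ^ (aExp τ + 1) + 1 * jap l ^ bExp τ) := by
            gcongr
            have : 0 < M ^ (aExp τ + 1) := by positivity
            linarith
        _ = 2 ^ (bExp τ + 1)
            * (M ^ (aExp τ + 1) + (M ^ (aExp τ + 1) * tPar τ N₀ ν) * jap l ^ bExp τ) := by
            rw [h1]
        _ = _ := by ring
    · calc e * M + M ^ (aExp τ + 1) * (e * Q) = e * (M + Q * M ^ (aExp τ + 1)) := by ring
        _ ≤ e * N := by gcongr
  · simp only [run, Pi.add_apply]
    -- The increment of the correction is read off a diagonal matrix element. It is at most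
    -- `κe2^{-ν}`, which advances the geometric bound `2 - 2·2^{-ν}` by exactly one step.
    have hcorr : |corr (run N₀ (ω true) (μ true) (R true) ν).2 j
        - corr (run N₀ (ω false) (μ false) (R false) ν).2 j| ≤ κ * (e * M ^ (-aExp τ)) := by
      have h1 := (kn_diff_le (w := w) (θ := thOne) (κ := ENNReal.ofReal κ)
        ((run N₀ (ω true) (μ true) (R true) ν).2, (run N₀ (ω false) (μ false) (R false) ν).2)).trans
        hi.pn_one
      rw [ENNReal.inv_mul_le_iff (by simpa using hκ) ENNReal.ofReal_ne_top,
        ← ENNReal.ofReal_mul hκ.le] at h1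
      have h2 := (diag_entry_le hw _ j).trans h1
      simp only [thOne, one_mul] at h2
      rw [← ofReal_norm, ENNReal.ofReal_le_ofReal_iff (by positivity)] at h2
      refine le_trans ?_ h2
      rw [corr, corr, ← Complex.sub_im]
      exact Complex.abs_im_le_norm _
    have hM2 : M ^ (-aExp τ) ≤ (1 / 2) ^ ν := scaleN_rpow_le hs.four_le hs.τ_pos ν
    have e1 : ∀ a b c d : ℝ, a + b - (c + d) = (a - c) + (b - d) := fun a b c d => by ring
    rw [e1]
    calc _ ≤ κ * e * (2 - 2 * (1 / 2) ^ ν) + κ * (e * M ^ (-aExp τ)) :=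
          (abs_add_le _ _).trans (add_le_add (hi.r_diff j) hcorr)
      _ ≤ κ * e * (2 - 2 * (1 / 2) ^ ν) + κ * (e * (1 / 2) ^ ν) := by gcongr
      _ = _ := by rw [pow_succ]; ring

theorem pairInv_of_mel (hw : PosFin w) (hκ : 0 < κ) (hs : Small τ γ c₀ c₁ e E N₀)
    (h0 : PairStart w τ γ κ c₀ c₁ e ω μ R) (ν : ℕ)
    (hm : ∀ b, Mel τ (γ / 2) N₀ (ω b) (μ b) (R b) ν) : PairInv w τ κ e N₀ ω μ R ν := by
  induction ν with
  | zero =>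
    refine ⟨fun b j => by simp [run], h0.ham, ?_, ?_, fun j => by simp [run]⟩
    · rw [scaleN_zero_sub_one, Real.one_rpow, mul_one]; exact h0.pn_one
    · rw [scaleN_zero_sub_one, mul_one]; exact h0.pn_b
  | succ ν ih =>
    exact pairInv_succ hw hκ hs h0 (ih fun b n hn => hm b n (hn.trans (Nat.lt_succ_self ν))) hm

end step

/-! ### Sums over the index sets -/

/-- Integer vectors embed in the lattice spanned by the standard basis of `ℝ^P`, whose rank is
`|P|`; the embedding preserves the maximum norm. -/
lemma summable_norm_mode {n : ℕ} (hn : P.card < n) : Summable fun l : Mode P => ‖l‖⁻¹ ^ n := by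
  classical
  let L := Submodule.span ℤ (Set.range (Pi.basisFun ℝ P))
  have hL : Module.finrank ℤ L < n := by
    rw [ZLattice.rank ℝ L]; simpa using hn
  have hmem : ∀ l : Mode P, (fun m => (l m : ℝ)) ∈ L := fun l => by
    rw [Module.Basis.mem_span_iff_repr_mem ℤ]
    intro m
    exact ⟨l m, by simp⟩
  have h := (ZLattice.summable_norm_pow_inv L n hL).comp_injective
    (i := fun l : Mode P => (⟨fun m => (l m : ℝ), hmem l⟩ : L)) (fun l l' h => by
      funext m
      have : (l m : ℝ) = l' m := congrFun (congrArg Subtype.val h) m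
      exact_mod_cast this)
  refine h.congr fun l => ?_
  have hle : ‖fun m => (l m : ℝ)‖ = ‖l‖ :=
    le_antisymm ((pi_norm_le_iff_of_nonneg (norm_nonneg _)).2 fun m => by
        have := norm_le_pi_norm l m
        rwa [Int.norm_eq_abs] at this)
      ((pi_norm_le_iff_of_nonneg (norm_nonneg _)).2 fun m => by
        have := norm_le_pi_norm (fun m => (l m : ℝ)) m
        rwa [Int.norm_eq_abs])
  change ‖fun m => (l m : ℝ)‖⁻¹ ^ n = ‖l‖⁻¹ ^ n
  rw [hle]

lemma one_le_norm_mode {l : Mode P} (h : l ≠ 0) : 1 ≤ ‖l‖ := by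
  obtain ⟨m, hm⟩ := Function.ne_iff.1 h
  refine le_trans ?_ (norm_le_pi_norm l m)
  rw [Int.norm_eq_abs]
  exact_mod_cast Int.one_le_abs hm

lemma tsum_jap_ne_top {n : ℕ} (hn : P.card < n) :
    ∑' l : Mode P, ENNReal.ofReal ((jap l ^ n)⁻¹) ≠ ⊤ := by
  classical
  have h : Summable fun l : Mode P => (jap l ^ n)⁻¹ := by
    refine Summable.of_nonneg_of_le (fun l => by have := one_le_jap l; positivity) (fun l => ?_)
      ((summable_norm_mode hn).add (summable_of_hasFiniteSupport
        (f := fun l : Mode P => if l = 0 then (1 : ℝ) else 0)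
        ((Set.finite_singleton 0).subset fun l hl => by simpa using hl)))
    by_cases hl : l = 0
    · simp [hl, jap]
    · have : jap l = ‖l‖ := max_eq_right (one_le_norm_mode hl)
      simp [hl, this]
  exact h.tsum_ofReal_ne_top

lemma card_lt_two_mul_sZero : P.card < 2 * sZero P := by unfold sZero; omega

lemma tsum_site_le (j' : Site P) (f : ℤ → ℝ≥0∞) :
    ∑' j : Site P, f (j.1 - j'.1) ≤ ∑' m, f m :=
  ENNReal.tsum_comp_le_tsum_of_injective (f := fun j : Site P => j.1 - j'.1)
    (fun a b h => Subtype.ext (by simpa using h)) f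

/-! ### The kernel summed over the time frequencies -/

lemma jap_le_japIdx (k : Idx P) : jap k.1 ≤ japIdx k := le_max_left _ _
lemma one_le_japIdx (k : Idx P) : 1 ≤ japIdx k := (one_le_jap _).trans (jap_le_japIdx k)
lemma norm_le_jap (l : Mode P) : ‖l‖ ≤ jap l := le_max_right _ _

/-- The Sobolev weight `⟨ℓ, j⟩^s`. -/
def sobW (s : ℝ) (k : Idx P) : ℝ≥0∞ := ENNReal.ofReal (japIdx k ^ s)

lemma posFin_sobW (s : ℝ) : PosFin (sobW s : Idx P → ℝ≥0∞) where
  ne_zero k := by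
    have := one_le_japIdx k
    simp only [sobW, ne_eq, ENNReal.ofReal_eq_zero, not_le]
    positivity
  ne_top _ := ENNReal.ofReal_ne_top

/-- `(Λ + |ℓ|)^{-p}`. -/
def bump (p Λ : ℕ) (l : Mode P) : ℝ≥0∞ := ENNReal.ofReal (((Λ + ‖l‖) ^ p)⁻¹)

/-- The part of `bump ^ 2` with `|ℓ| ≥ Λ`. -/
def bumpFar (p Λ : ℕ) (l : Mode P) : ℝ≥0∞ := open Classical in
  if (Λ : ℝ) ≤ ‖l‖ then bump p Λ l ^ 2 else 0

/-- A translation by `2Λ` along one coordinate moves the ball of radius `Λ` outside itself and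
changes the bump by at most a factor `3^p`. Thus the region `|ℓ| ≥ Λ` carries a fixed share of the
sum, uniformly in `Λ`. A coordinate direction must exist, whence the non-emptiness of `P`. -/
lemma tsum_bump_le (hne : P.Nonempty) (p : ℕ) {Λ : ℕ} (hΛ : 1 ≤ Λ) :
    ∑' l : Mode P, bump p Λ l ^ 2
      ≤ ENNReal.ofReal (1 + 9 ^ p) * ∑' l : Mode P, bumpFar p Λ l := by
  classical
  obtain ⟨n, hn⟩ := hne
  have hΛ' : (1 : ℝ) ≤ Λ := by exact_mod_cast hΛ
  let X : Mode P := Pi.single ⟨n, hn⟩ (2 * Λ : ℤ)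
  have hX : ‖X‖ = 2 * Λ := by
    rw [Pi.norm_single, Int.norm_eq_abs]; push_cast
    rw [abs_of_nonneg (by positivity)]
  have key : ∀ l : Mode P, bump p Λ l ^ 2
      ≤ bumpFar p Λ l + ENNReal.ofReal (9 ^ p) * bumpFar p Λ (l + X) := fun l => by
    by_cases h : (Λ : ℝ) ≤ ‖l‖
    · simp [bumpFar, h]
    · have h1 : (Λ : ℝ) ≤ ‖l + X‖ := by
        have := norm_sub_norm_le X (-l)
        rw [norm_neg, sub_neg_eq_add, add_comm X l] at this
        linarith
      have h2 : ‖l + X‖ ≤ ‖l‖ + 2 * Λ := (norm_add_le _ _).trans (by rw [hX])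
      refine le_add_left ?_
      rw [bumpFar, if_pos h1, bump, bump, ← ENNReal.ofReal_pow (by positivity),
        ← ENNReal.ofReal_pow (by positivity), ← ENNReal.ofReal_mul (by positivity)]
      refine ENNReal.ofReal_le_ofReal ?_
      have h3 : (Λ + ‖l + X‖) ^ p ≤ 3 ^ p * (Λ + ‖l‖) ^ p := by
        rw [← mul_pow]
        refine pow_le_pow_left₀ (by positivity) ?_ p
        linarith [norm_nonneg l]
      have h4 : ((Λ + ‖l‖) ^ p)⁻¹ ≤ 3 ^ p * ((Λ + ‖l + X‖) ^ p)⁻¹ := by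
        rw [← div_eq_mul_inv, le_div_iff₀ (by positivity), inv_mul_le_iff₀ (by positivity), mul_comm]
        exact h3
      calc (((Λ + ‖l‖) ^ p)⁻¹) ^ 2 ≤ (3 ^ p * ((Λ + ‖l + X‖) ^ p)⁻¹) ^ 2 := by gcongr
        _ = _ := by rw [mul_pow, ← pow_mul, mul_comm p 2, pow_mul]; norm_num
  refine (ENNReal.tsum_le_tsum key).trans (le_of_eq ?_)
  have e : ∑' l : Mode P, bumpFar p Λ (l + X) = ∑' l, bumpFar p Λ l :=
    (Equiv.addRight X).tsum_eq (bumpFar p Λ)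
  rw [ENNReal.tsum_add, ENNReal.tsum_mul_left, e,
    ENNReal.ofReal_add (by norm_num) (by positivity), ENNReal.ofReal_one, add_mul, one_mul]

lemma tsum_bumpFar_ne_top {p Λ : ℕ} (hp : P.card < 2 * p) (hΛ : 1 ≤ Λ) :
    ∑' l : Mode P, bumpFar p Λ l ≠ ⊤ := by
  refine ne_top_of_le_ne_top (tsum_jap_ne_top hp) (ENNReal.tsum_le_tsum fun l => ?_)
  have hΛ' : (1 : ℝ) ≤ Λ := by exact_mod_cast hΛ
  have hj := one_le_jap l
  unfold bumpFar
  split_ifs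
  · rw [bump, ← ENNReal.ofReal_pow (by positivity)]
    refine ENNReal.ofReal_le_ofReal ?_
    rw [inv_pow, ← pow_mul, mul_comm p 2]
    refine inv_anti₀ (by positivity) (pow_le_pow_left₀ (by positivity) ?_ _)
    exact max_le (by linarith [norm_nonneg l]) (by linarith)
  · exact zero_le

lemma tsum_bumpFar_ne_zero (hne : P.Nonempty) {p Λ : ℕ} (hΛ : 1 ≤ Λ) :
    ∑' l : Mode P, bumpFar p Λ l ≠ 0 := by
  intro h
  have h1 := tsum_bump_le hne p hΛ
  rw [h, mul_zero, nonpos_iff_eq_zero, ENNReal.tsum_eq_zero] at h1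
  have h2 := h1 0
  have hΛ' : (1 : ℝ) ≤ Λ := by exact_mod_cast hΛ
  rw [bump, sq_eq_zero_iff, ENNReal.ofReal_eq_zero] at h2
  have : 0 < ((Λ + ‖(0 : Mode P)‖) ^ p)⁻¹ := by positivity
  linarith

/-- The bound for finitely many time frequencies and sites. -/
lemma section_bound_finset (hne : P.Nonempty) {s : ℝ} (hs : 0 ≤ s) (E : Ker P)
    (T : Finset (Idx P)) {a : Site P → ℝ≥0∞} (ha : ∑' j, a j ^ 2 ≠ ⊤) :
    ENNReal.ofReal ((2 ^ sZero P * 4 ^ s)⁻¹) ^ 2 * ∑' j, (∑ k ∈ T, E k.1 j k.2 * a k.2) ^ 2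
      ≤ kop (sobW s) E ^ 2 * ENNReal.ofReal (1 + 9 ^ sZero P) * ∑' j, a j ^ 2 := by
  classical
  -- The scale `Λ` dominates the finitely many frequencies and sites involved, so translations by
  -- these frequencies barely affect functions varying on the scale `Λ`.
  obtain ⟨Λ, hΛ1, hΛ⟩ : ∃ Λ : ℕ, 1 ≤ Λ ∧ ∀ k ∈ T, ‖k.1‖ ≤ Λ ∧ |(k.2.1 : ℝ)| ≤ Λ := by
    obtain ⟨Λ, hΛ⟩ := exists_nat_ge (∑ k ∈ T, (‖k.1‖ + |(k.2.1 : ℝ)|))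
    refine ⟨Λ + 1, by omega, fun k hk => ?_⟩
    have h := Finset.single_le_sum (f := fun k : Idx P => ‖k.1‖ + |(k.2.1 : ℝ)|)
      (fun k _ => by positivity) hk
    have h1 := norm_nonneg k.1
    have h2 := abs_nonneg (k.2.1 : ℝ)
    push_cast
    constructor <;> linarith
  have hΛ' : (1 : ℝ) ≤ Λ := by exact_mod_cast hΛ1
  set p := sZero P with hp
  set c := ENNReal.ofReal ((2 ^ p * 4 ^ s)⁻¹) with hc
  let J : Finset (Site P) := T.image Prod.snd
  -- The test function is `a` times a slowly varying profile in `ℓ`. The factor `(Λ+|ℓ|)^{-s}`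
  -- compensates the Sobolev weight, and the power `p = s₀` makes the profile square summable.
  let u : Idx P → ℝ≥0∞ := fun k => bump p Λ k.1 * ENNReal.ofReal (((Λ + ‖k.1‖) ^ s)⁻¹)
    * if k.2 ∈ J then a k.2 else 0
  have hu : wn (sobW s) u ^ 2 ≤ (∑' l : Mode P, bump p Λ l ^ 2) * ∑' j, a j ^ 2 := by
    rw [wn_sq, ← ENNReal.tsum_mul_right]
    simp_rw [← ENNReal.tsum_mul_left]
    rw [← ENNReal.tsum_prod]
    refine ENNReal.tsum_le_tsum fun k => ?_
    rw [← mul_pow]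
    refine pow_le_pow_left' ?_ 2
    by_cases hk : k.2 ∈ J
    · simp only [u, hk, if_true]
      obtain ⟨k', hk', e⟩ := Finset.mem_image.1 hk
      have h1 : japIdx k ≤ Λ + ‖k.1‖ := by
        refine max_le (max_le ?_ ?_) ?_
        · linarith [norm_nonneg k.1]
        · linarith
        · rw [← e]; linarith [(hΛ k' hk').2, norm_nonneg k.1]
      have h2 : sobW s k * ENNReal.ofReal (((Λ + ‖k.1‖) ^ s)⁻¹) ≤ 1 := by
        have h0 := one_le_japIdx k
        rw [sobW, ← ENNReal.ofReal_mul (by positivity), ENNReal.ofReal_le_one, ← div_eq_mul_inv,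
          div_le_one (by positivity)]
        exact Real.rpow_le_rpow (by linarith) h1 hs
      calc sobW s k * (bump p Λ k.1 * ENNReal.ofReal (((Λ + ‖k.1‖) ^ s)⁻¹) * a k.2)
          = (sobW s k * ENNReal.ofReal (((Λ + ‖k.1‖) ^ s)⁻¹)) * (bump p Λ k.1 * a k.2) := by ring
        _ ≤ 1 * (bump p Λ k.1 * a k.2) := by gcongr
        _ = _ := one_mul _
    · simp [u, hk]
  have hbne := tsum_bumpFar_ne_top (P := P) (p := p) card_lt_two_mul_sZero hΛ1
  have hufin : wn (sobW s) u ≠ ⊤ := by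
    intro h
    rw [h] at hu
    have h1 : (⊤ : ℝ≥0∞) ^ 2 = ⊤ := by simp
    rw [h1, top_le_iff] at hu
    exact ENNReal.mul_ne_top (ne_top_of_le_ne_top (ENNReal.mul_ne_top ENNReal.ofReal_ne_top hbne)
      (tsum_bump_le hne p hΛ1)) ha hu
  -- In the region `|ℓ| ≥ Λ` the Sobolev weight is comparable to `(Λ+|ℓ|)^s`, and the profile is
  -- comparable to its translates; the losses are collected in `c`.
  have hlow : ∀ k : Idx P, bumpFar p Λ k.1 * (c ^ 2 * (∑ m ∈ T, E m.1 k.2 m.2 * a m.2) ^ 2)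
      ≤ (sobW s k * kapp E u k) ^ 2 := fun k => by
    unfold bumpFar
    split_ifs with hk
    · rw [← mul_pow, ← mul_pow]
      refine pow_le_pow_left' ?_ 2
      have h1 : ∑ m ∈ T, E m.1 k.2 m.2 * u (k.1 - m.1, m.2) ≤ kapp E u k := by
        unfold kapp
        rw [← ((Equiv.subLeft k.1).prodCongr (Equiv.refl (Site P))).tsum_eq]
        simp only [Equiv.prodCongr_apply, Prod.map, Equiv.subLeft_apply, Equiv.refl_apply,
          sub_sub_cancel]
        exact ENNReal.sum_le_tsum T
      refine le_trans ?_ (mul_le_mul_right h1 (sobW s k))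
      rw [Finset.mul_sum, Finset.mul_sum, Finset.mul_sum]
      refine Finset.sum_le_sum fun m hm => ?_
      have hmJ : m.2 ∈ J := Finset.mem_image_of_mem _ hm
      simp only [u, hmJ, if_true]
      have hreal : bump p Λ k.1 * c
          ≤ sobW s k * (bump p Λ (k.1 - m.1) * ENNReal.ofReal (((Λ + ‖k.1 - m.1‖) ^ s)⁻¹)) := by
        have h0 := one_le_japIdx k
        rw [bump, bump, sobW, hc, ← ENNReal.ofReal_mul (by positivity),
          ← ENNReal.ofReal_mul (by positivity), ← ENNReal.ofReal_mul (by positivity)]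
        refine ENNReal.ofReal_le_ofReal ?_
        have hn : ‖k.1 - m.1‖ ≤ ‖k.1‖ + Λ := (norm_sub_le _ _).trans (by linarith [(hΛ m hm).1])
        have hkj : ‖k.1‖ ≤ japIdx k := (norm_le_jap _).trans (jap_le_japIdx k)
        have hG : (Λ + ‖k.1 - m.1‖) ^ p ≤ 2 ^ p * (Λ + ‖k.1‖) ^ p := by
          rw [← mul_pow]
          exact pow_le_pow_left₀ (by positivity) (by linarith [norm_nonneg k.1]) p
        have hS : (Λ + ‖k.1 - m.1‖) ^ s ≤ 4 ^ s * japIdx k ^ s := by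
          rw [← Real.mul_rpow (by norm_num) (by linarith)]
          exact Real.rpow_le_rpow (by positivity) (by linarith) hs
        calc ((Λ + ‖k.1‖) ^ p)⁻¹ * (2 ^ p * 4 ^ s)⁻¹
            = japIdx k ^ s * ((2 ^ p * (Λ + ‖k.1‖) ^ p)⁻¹ * (4 ^ s * japIdx k ^ s)⁻¹) := by
              have : japIdx k ^ s ≠ 0 := by positivity
              field_simp
          _ ≤ _ := by gcongr
      calc bump p Λ k.1 * (c * (E m.1 k.2 m.2 * a m.2))
          = (bump p Λ k.1 * c) * (E m.1 k.2 m.2 * a m.2) := by ring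
        _ ≤ (sobW s k * (bump p Λ (k.1 - m.1) * ENNReal.ofReal (((Λ + ‖k.1 - m.1‖) ^ s)⁻¹)))
              * (E m.1 k.2 m.2 * a m.2) := by gcongr
        _ = _ := by ring
    · rw [zero_mul]; exact zero_le
  have hmain := (ENNReal.tsum_le_tsum hlow).trans_eq (wn_sq (sobW s) (kapp E u)).symm
  rw [ENNReal.tsum_prod' (f := fun k : Idx P => bumpFar p Λ k.1 * (c ^ 2 *
    (∑ m ∈ T, E m.1 k.2 m.2 * a m.2) ^ 2))] at hmain
  simp_rw [ENNReal.tsum_mul_left] at hmain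
  rw [ENNReal.tsum_mul_right] at hmain
  have h2 : wn (sobW s) (kapp E u) ^ 2 ≤ (∑' l : Mode P, bumpFar p Λ l) *
      (kop (sobW s) E ^ 2 * ENNReal.ofReal (1 + 9 ^ p) * ∑' j, a j ^ 2) := by
    calc wn (sobW s) (kapp E u) ^ 2 ≤ (kop (sobW s) E * wn (sobW s) u) ^ 2 :=
          pow_le_pow_left' (wn_kapp_le (posFin_sobW s) E hufin) 2
      _ = kop (sobW s) E ^ 2 * wn (sobW s) u ^ 2 := mul_pow _ _ _
      _ ≤ kop (sobW s) E ^ 2 * ((ENNReal.ofReal (1 + 9 ^ p) * ∑' l : Mode P, bumpFar p Λ l)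
            * ∑' j, a j ^ 2) := by
          gcongr
          exact hu.trans (by gcongr; exact tsum_bump_le hne p hΛ1)
      _ = _ := by ring
  -- Both sides contain the mass of the profile in the far region. It is finite and nonzero, so it
  -- cancels and leaves a bound independent of `Λ`.
  exact (ENNReal.mul_le_mul_iff_right (tsum_bumpFar_ne_zero hne hΛ1) hbne).1 (hmain.trans h2)

/-- A kernel which is bounded in a Sobolev space, summed over the time frequencies, is bounded
in `ℓ²`. -/
lemma exists_section_bound (hne : P.Nonempty) {s : ℝ} (hs : 0 ≤ s) {E : Ker P}
    (hE : kop (sobW s) E ≠ ⊤) : ∃ c : ℝ≥0∞, c ≠ ⊤ ∧ ∀ a : Site P → ℝ≥0∞, ∑' j, a j ^ 2 ≠ ⊤ →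
      ∑' j, (∑' k : Idx P, E k.1 j k.2 * a k.2) ^ 2 ≤ c * ∑' j, a j ^ 2 := by
  have hpos : 0 < ((2 : ℝ) ^ sZero P * 4 ^ s)⁻¹ := by positivity
  have hc0 : ENNReal.ofReal (((2 : ℝ) ^ sZero P * 4 ^ s)⁻¹) ^ 2 ≠ 0 := by
    simp only [ne_eq, sq_eq_zero_iff, ENNReal.ofReal_eq_zero, not_le]; exact hpos
  have hct : ENNReal.ofReal (((2 : ℝ) ^ sZero P * 4 ^ s)⁻¹) ^ 2 ≠ ⊤ := by simp
  refine ⟨(kop (sobW s) E ^ 2 * ENNReal.ofReal (1 + 9 ^ sZero P))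
    / ENNReal.ofReal (((2 : ℝ) ^ sZero P * 4 ^ s)⁻¹) ^ 2, ?_, fun a ha => ?_⟩
  · exact ENNReal.div_ne_top (ENNReal.mul_ne_top (by simpa using hE) ENNReal.ofReal_ne_top) hc0
  · rw [ENNReal.tsum_eq_iSup_sum]
    refine iSup_le fun K => ?_
    have hlim : Filter.Tendsto
        (fun T : Finset (Idx P) => ∑ j ∈ K, (∑ k ∈ T, E k.1 j k.2 * a k.2) ^ 2)
        Filter.atTop (nhds (∑ j ∈ K, (∑' k : Idx P, E k.1 j k.2 * a k.2) ^ 2)) :=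
      tendsto_finsetSum _ fun j _ =>
        ((ENNReal.continuous_pow 2).tendsto _).comp ENNReal.summable.hasSum
    refine le_of_tendsto' hlim fun T => (ENNReal.sum_le_tsum K).trans ?_
    rw [ENNReal.mul_comm_div, ← mul_div_assoc, ENNReal.le_div_iff_mul_le (Or.inl hc0) (Or.inl hct),
      mul_comm]
    exact section_bound_finset hne hs E T ha

/-! ### Symplectic operators -/

/-- The majorant of the matrix element `A_j^{j'}(φ)`. -/
def bk (A : Op P) (j j' : Site P) : ℝ≥0∞ := ∑' l, ‖A l j j'‖ₑ

/-- The matrix `bk A` is bounded in `ℓ²`. -/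
def SecBdd (A : Op P) : Prop := ∃ c : ℝ≥0∞, c ≠ ⊤ ∧ ∀ a : Site P → ℝ≥0∞, ∑' j, a j ^ 2 ≠ ⊤ →
  ∑' j, (∑' j', bk A j j' * a j') ^ 2 ≤ c * ∑' j, a j ^ 2

lemma secBdd_of_kop (hne : P.Nonempty) {s : ℝ} (hs : 0 ≤ s) {A : Op P}
    (hA : kop (sobW s) (ak A) ≠ ⊤) : SecBdd A := by
  obtain ⟨c, hc, h⟩ := exists_section_bound hne hs hA
  refine ⟨c, hc, fun a ha => ?_⟩
  have := h a ha
  have e : ∀ j, ∑' k : Idx P, ak A k.1 j k.2 * a k.2 = ∑' j', bk A j j' * a j' := fun j => by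
    rw [ENNReal.tsum_prod' (f := fun k : Idx P => ak A k.1 j k.2 * a k.2), ENNReal.tsum_comm]
    simp only [bk, ak, ENNReal.tsum_mul_right]
  simpa only [e] using this

lemma SecBdd.tsum_ne_top {A : Op P} (h : SecBdd A) {a : Site P → ℝ≥0∞} (ha : ∑' j, a j ^ 2 ≠ ⊤) :
    ∑' j, (∑' j', bk A j j' * a j') ^ 2 ≠ ⊤ := by
  obtain ⟨c, hc, hh⟩ := h
  exact ne_top_of_le_ne_top (ENNReal.mul_ne_top hc ha) (hh a ha)

lemma SecBdd.tsum_sq_ne_top {A : Op P} (h : SecBdd A) (j' : Site P) :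
    ∑' j, bk A j j' ^ 2 ≠ ⊤ := by
  classical
  have h1 : ∑' j, (Pi.single j' 1 : Site P → ℝ≥0∞) j ^ 2 ≠ ⊤ := by
    rw [tsum_eq_single j' fun j hj => by simp [Pi.single_eq_of_ne hj]]
    simp
  have := h.tsum_ne_top h1
  have e : ∀ j, ∑' i, bk A j i * (Pi.single j' 1 : Site P → ℝ≥0∞) i = bk A j j' := fun j => by
    rw [tsum_eq_single j' fun i hi => by simp [Pi.single_eq_of_ne hi]]
    simp
  simpa only [e] using this

lemma ne_top_of_tsum_sq {ι : Type*} {x : ι → ℝ≥0∞} (h : ∑' i, x i ^ 2 ≠ ⊤) (i : ι) : x i ≠ ⊤ := by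
  have := ENNReal.ne_top_of_tsum_ne_top h i
  intro hi
  simp [hi] at this

lemma SecBdd.bk_ne_top {A : Op P} (h : SecBdd A) (j j' : Site P) : bk A j j' ≠ ⊤ :=
  ne_top_of_tsum_sq (h.tsum_sq_ne_top j') j

lemma mul_le_sq_add_sq (x y : ℝ≥0∞) : x * y ≤ x ^ 2 + y ^ 2 := by
  rcases le_total x y with h | h
  · exact (mul_le_mul_left h y).trans (by rw [← sq]; exact le_add_self)
  · exact (mul_le_mul_right h x).trans (by rw [← sq]; exact le_self_add)

lemma tsum_mul_ne_top {ι : Type*} {x y : ι → ℝ≥0∞} (hx : ∑' i, x i ^ 2 ≠ ⊤)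
    (hy : ∑' i, y i ^ 2 ≠ ⊤) : ∑' i, x i * y i ≠ ⊤ := by
  refine ne_top_of_le_ne_top (ENNReal.add_ne_top.2 ⟨hx, hy⟩) ?_
  rw [← ENNReal.tsum_add]
  exact ENNReal.tsum_le_tsum fun i => mul_le_sq_add_sq _ _

lemma tsum_enorm_sq_ne_top {ι : Type*} {x : ι → ℂ} (h : Summable fun i => ‖x i‖ ^ 2) :
    ∑' i, ‖x i‖ₑ ^ 2 ≠ ⊤ := by
  have := h.tsum_ofReal_ne_top
  simpa only [ENNReal.ofReal_pow (norm_nonneg _), ofReal_norm] using this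

lemma summable_norm_sq {ι : Type*} {x : ι → ℂ} (h : ∑' i, ‖x i‖ₑ ^ 2 ≠ ⊤) :
    Summable fun i => ‖x i‖ ^ 2 := by
  refine (ENNReal.summable_toReal h).congr fun i => ?_
  rw [ENNReal.toReal_pow, toReal_enorm]

/-- `e^{iℓ·φ}`. -/
def eph (φ : P → ℝ) (l : Mode P) : ℂ :=
  Complex.exp (Complex.I * ((∑ n, (l n : ℝ) * φ n : ℝ) : ℂ))

lemma enorm_eph (φ : P → ℝ) (l : Mode P) : ‖eph φ l‖ₑ = 1 := by
  rw [← ofReal_norm, eph, mul_comm, Complex.norm_exp_ofReal_mul_I, ENNReal.ofReal_one]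

lemma eph_add (φ : P → ℝ) (l l' : Mode P) : eph φ (l + l') = eph φ l * eph φ l' := by
  simp only [eph, ← Complex.exp_add, Pi.add_apply]
  congr 1
  push_cast
  rw [← mul_add, ← Finset.sum_add_distrib]
  congr 1
  exact Finset.sum_congr rfl fun n _ => by ring

lemma evalPhi_eq (A : Op P) (φ : P → ℝ) (j j' : Site P) :
    evalPhi A φ j j' = ∑' l, A l j j' * eph φ l := rfl

lemma enorm_evalPhi_le (A : Op P) (φ : P → ℝ) (j j' : Site P) :
    ‖evalPhi A φ j j'‖ₑ ≤ bk A j j' := by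
  rw [evalPhi_eq]
  refine enorm_tsum_le_tsum_enorm.trans (le_of_eq (tsum_congr fun l => ?_))
  rw [enorm_mul, enorm_eph, mul_one]

lemma evalPhi_idOp (φ : P → ℝ) (a b : Site P) :
    evalPhi idOp φ a b = open Classical in if a = b then 1 else 0 := by
  classical
  rw [evalPhi_eq, tsum_eq_single 0 fun l hl => by simp [idOp, hl]]
  simp [idOp, eph]

/-- Convolution in `ℓ` becomes multiplication at fixed `φ`. The hypothesis is the absolute
convergence of the whole multiple series, which allows the sums to be reordered. -/
lemma evalPhi_comp {B A : Op P} (φ : P → ℝ) {a b : Site P}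
    (h : ∑' j, bk B a j * bk A j b ≠ ⊤) :
    evalPhi (comp B A) φ a b = ∑' j, evalPhi B φ a j * evalPhi A φ j b := by
  let f : Idx P → Mode P → ℂ := fun k l => (B (l - k.1) a k.2 * A k.1 k.2 b) * eph φ l
  have hnorm : ∑' p : Idx P × Mode P, ‖f p.1 p.2‖ₑ = ∑' j, bk B a j * bk A j b := by
    rw [ENNReal.tsum_prod' (f := fun p : Idx P × Mode P => ‖f p.1 p.2‖ₑ)]
    have e : ∀ k : Idx P, ∑' l, ‖f k l‖ₑ = ‖A k.1 k.2 b‖ₑ * bk B a k.2 := fun k => by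
      simp only [f, enorm_mul, enorm_eph, mul_one]
      rw [ENNReal.tsum_mul_right, mul_comm, bk]
      congr 1
      exact (Equiv.subRight k.1).tsum_eq fun l => ‖B l a k.2‖ₑ
    simp_rw [e]
    rw [ENNReal.tsum_prod' (f := fun k : Idx P => ‖A k.1 k.2 b‖ₑ * bk B a k.2), ENNReal.tsum_comm]
    refine tsum_congr fun j => ?_
    dsimp only
    rw [ENNReal.tsum_mul_right, mul_comm]; rfl
  have hs : Summable (Function.uncurry f) :=
    summable_of_tsum_enorm (f := Function.uncurry f) (by rw [← hnorm] at h; exact h)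
  have e1 : evalPhi (comp B A) φ a b = ∑' l, ∑' k, f k l := by
    rw [evalPhi_eq]
    refine tsum_congr fun l => ?_
    simp only [f, comp, tsum_mul_right]
  have e2 : ∀ k : Idx P, ∑' l, f k l = A k.1 k.2 b * eph φ k.1 * evalPhi B φ a k.2 := fun k => by
    rw [evalPhi_eq, ← tsum_mul_left,
      ← (Equiv.subRight k.1).tsum_eq fun l => A k.1 k.2 b * eph φ k.1 * (B l a k.2 * eph φ l)]
    refine tsum_congr fun l => ?_
    simp only [f, Equiv.subRight_apply]
    rw [show eph φ l = eph φ (l - k.1) * eph φ k.1 by rw [← eph_add, sub_add_cancel]]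
    ring
  have hs2 : Summable fun k : Idx P => A k.1 k.2 b * eph φ k.1 * evalPhi B φ a k.2 := by
    have := hs.prod
    simpa only [Function.uncurry, e2] using this
  rw [e1, hs.tsum_comm]
  simp_rw [e2]
  have hs3 := (Equiv.prodComm (Site P) (Mode P)).summable_iff.2 hs2
  have e3 := (Equiv.prodComm (Site P) (Mode P)).tsum_eq
    fun k : Idx P => A k.1 k.2 b * eph φ k.1 * evalPhi B φ a k.2
  rw [← e3]
  refine (hs3.tsum_prod).trans (tsum_congr fun j => ?_)
  simp only [Function.comp, Equiv.prodComm_apply, Prod.fst_swap, Prod.snd_swap]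
  rw [tsum_mul_right, mul_comm, evalPhi_eq A]

lemma evalPhi_sharp (A : Op P) (φ : P → ℝ) (a b : Site P) :
    evalPhi (sharp A) φ a b = ((a.1 : ℂ) / (b.1 : ℂ)) * evalPhi A φ (-b) (-a) := by
  simp only [evalPhi_eq, sharp, mul_assoc, tsum_mul_left]

lemma bk_sharp (A : Op P) (a b : Site P) :
    bk (sharp A) a b = ‖(a.1 : ℂ) / (b.1 : ℂ)‖ₑ * bk A (-b) (-a) := by
  simp only [bk, sharp, enorm_mul, ENNReal.tsum_mul_left]

lemma enorm_inv_site_le_one (j : Site P) : ‖((j.1 : ℂ))⁻¹‖ₑ ≤ 1 := by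
  rw [← ofReal_norm, ENNReal.ofReal_le_one, norm_inv]
  refine inv_le_one_of_one_le₀ ?_
  rw [Complex.norm_intCast]
  exact_mod_cast Int.one_le_abs j.2.1

/-- The symplectic identity for the matrix elements. -/
lemma tsum_evalPhi_mul {A : Op P} (hA : SecBdd A) (h : comp (sharp A) A = idOp) (φ : P → ℝ)
    (a b : Site P) :
    ∑' j : Site P, ((j.1 : ℂ))⁻¹ * evalPhi A φ j a * evalPhi A φ (-j) b
      = open Classical in if b = -a then ((a.1 : ℂ))⁻¹ else 0 := by
  classical
  have hfin : ∑' j, bk (sharp A) (-b) j * bk A j a ≠ ⊤ := by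
    have h1 : ∑' j, bk A (-j) b * bk A j a ≠ ⊤ := by
      refine tsum_mul_ne_top ?_ (hA.tsum_sq_ne_top a)
      have := hA.tsum_sq_ne_top b
      rwa [← negSite.tsum_eq] at this
    refine ne_top_of_le_ne_top (ENNReal.mul_ne_top (enorm_ne_top (x := (b.1 : ℂ))) h1) ?_
    rw [← ENNReal.tsum_mul_left]
    refine ENNReal.tsum_le_tsum fun j => ?_
    rw [bk_sharp, site_neg_neg, div_eq_mul_inv, enorm_mul, mul_assoc, mul_assoc]
    simp only [site_neg_val, Int.cast_neg, enorm_neg]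
    refine mul_le_mul_right ?_ _
    exact mul_le_of_le_one_left' (enorm_inv_site_le_one j)
  have h1 := evalPhi_comp φ hfin
  rw [h, evalPhi_idOp] at h1
  have hb := site_cast_ne_zero b
  have ha := site_cast_ne_zero a
  have e : ∀ j : Site P, ((j.1 : ℂ))⁻¹ * evalPhi A φ j a * evalPhi A φ (-j) b
      = -((b.1 : ℂ))⁻¹ * (evalPhi (sharp A) φ (-b) j * evalPhi A φ j a) := fun j => by
    have hj := site_cast_ne_zero j
    rw [evalPhi_sharp, site_neg_neg]
    simp only [site_neg_val, Int.cast_neg]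
    field_simp
  simp_rw [e]
  rw [tsum_mul_left, ← h1]
  by_cases hab : b = -a
  · subst hab
    simp [site_neg_neg]
  · have : ¬(-b = a) := fun h => hab (by rw [← h, site_neg_neg])
    simp [hab, this]

/-- Expanding the form gives a triple series that is absolutely convergent by the `ℓ²` bound of the
summed majorant. Summing first over the common site uses `tsum_evalPhi_mul` and leaves only the
pairs `(a, -a)`, that is, the original form. -/
lemma isSymp_of_sharp {A : Op P} (hA : SecBdd A) (h : comp (sharp A) A = idOp) : IsSymp A := by
  classical
  refine ⟨fun j j' => summable_of_tsum_enorm (hA.bk_ne_top j j'), fun φ => ?_⟩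
  have hmaj : ∀ u : Site P → ℂ, ∀ j, ∑' j', ‖evalPhi A φ j j' * u j'‖ₑ
      ≤ ∑' j', bk A j j' * ‖u j'‖ₑ := fun u j => ENNReal.tsum_le_tsum fun j' => by
    rw [enorm_mul]; gcongr; exact enorm_evalPhi_le A φ j j'
  have hsq : ∀ u : Site P → ℂ, (Summable fun j => ‖u j‖ ^ 2) →
      ∑' j, (∑' j', bk A j j' * ‖u j'‖ₑ) ^ 2 ≠ ⊤ := fun u hu =>
    hA.tsum_ne_top (tsum_enorm_sq_ne_top hu)
  have hsum : ∀ u : Site P → ℂ, (Summable fun j => ‖u j‖ ^ 2) → ∀ j,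
      ∑' j', ‖evalPhi A φ j j' * u j'‖ₑ ≠ ⊤ := fun u hu j =>
    ne_top_of_le_ne_top (ne_top_of_tsum_sq (hsq u hu) j) (hmaj u j)
  refine ⟨fun u hu => ⟨fun j => summable_of_tsum_enorm (hsum u hu j), ?_⟩, fun u v hu hv => ?_⟩
  · refine summable_norm_sq (ne_top_of_le_ne_top (hsq u hu) (ENNReal.tsum_le_tsum fun j => ?_))
    exact pow_le_pow_left' (enorm_tsum_le_tsum_enorm.trans (hmaj u j)) 2
  · let F : Site P → Site P × Site P → ℂ := fun j p => (2 * Real.pi * Complex.I * (j.1 : ℂ))⁻¹ *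
      ((evalPhi A φ j p.1 * u p.1) * (evalPhi A φ (-j) p.2 * v p.2))
    have hc : ∀ j : Site P, ‖(2 * Real.pi * Complex.I * (j.1 : ℂ))⁻¹‖ₑ
        ≤ ‖((2 * Real.pi * Complex.I : ℂ))⁻¹‖ₑ := fun j => by
      rw [mul_inv, enorm_mul]
      exact mul_le_of_le_one_right' (enorm_inv_site_le_one j)
    have hF : ∑' p : Site P × (Site P × Site P), ‖F p.1 p.2‖ₑ ≠ ⊤ := by
      rw [ENNReal.tsum_prod' (f := fun p : Site P × (Site P × Site P) => ‖F p.1 p.2‖ₑ)]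
      have hXY : ∑' j, (∑' j', bk A j j' * ‖u j'‖ₑ) * (∑' j', bk A (-j) j' * ‖v j'‖ₑ) ≠ ⊤ := by
        refine tsum_mul_ne_top (hsq u hu) ?_
        have := hsq v hv
        rwa [← negSite.tsum_eq] at this
      refine ne_top_of_le_ne_top (ENNReal.mul_ne_top
        (enorm_ne_top (x := ((2 * Real.pi * Complex.I : ℂ))⁻¹)) hXY) ?_
      rw [← ENNReal.tsum_mul_left]
      refine ENNReal.tsum_le_tsum fun j => ?_
      simp only [F]
      simp_rw [enorm_mul (_⁻¹ : ℂ)]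
      rw [ENNReal.tsum_mul_left]
      refine mul_le_mul' (hc j) ?_
      rw [ENNReal.tsum_prod' (f := fun p : Site P × Site P =>
        ‖(evalPhi A φ j p.1 * u p.1) * (evalPhi A φ (-j) p.2 * v p.2)‖ₑ)]
      simp_rw [enorm_mul (_ * _ : ℂ) (_ * _), ENNReal.tsum_mul_left, ENNReal.tsum_mul_right]
      exact mul_le_mul' (hmaj u j) (hmaj v (-j))
    have hFs : Summable (Function.uncurry F) := summable_of_tsum_enorm hF
    have e1 : sympForm (fun j => ∑' j', evalPhi A φ j j' * u j')
        (fun j => ∑' j', evalPhi A φ j j' * v j') = ∑' j, ∑' p, F j p := by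
      unfold sympForm
      refine tsum_congr fun j => ?_
      simp only [F]
      rw [tsum_mul_left, mul_assoc]
      congr 1
      have hn : ∀ w : Site P → ℂ, (Summable fun j => ‖w j‖ ^ 2) → ∀ i,
          Summable fun j' => ‖evalPhi A φ i j' * w j'‖ := fun w hw i =>
        (ENNReal.summable_toReal (hsum w hw i)).congr fun j' => toReal_enorm _
      exact tsum_mul_tsum_of_summable_norm (hn u hu j) (hn v hv (-j))
    have e2 : ∀ p : Site P × Site P, ∑' j, F j p
        = if p.2 = -p.1 then (2 * Real.pi * Complex.I * (p.1.1 : ℂ))⁻¹ * u p.1 * v p.2 else 0 :=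
      fun p => by
        have e3 : ∀ j : Site P, F j p = ((2 * Real.pi * Complex.I : ℂ)⁻¹ * u p.1 * v p.2) *
            (((j.1 : ℂ))⁻¹ * evalPhi A φ j p.1 * evalPhi A φ (-j) p.2) := fun j => by
          simp only [F, mul_inv]; ring
        simp_rw [e3]
        rw [tsum_mul_left, tsum_evalPhi_mul hA h φ p.1 p.2]
        split_ifs
        · rw [mul_inv _ (p.1.1 : ℂ)]; ring
        · simp
    have hs2 : Summable fun p : Site P × Site P =>
        if p.2 = -p.1 then (2 * Real.pi * Complex.I * (p.1.1 : ℂ))⁻¹ * u p.1 * v p.2 else 0 := by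
      have := hFs.prod_symm.prod
      simpa only [Function.uncurry, Prod.swap, e2] using this
    rw [e1, hFs.tsum_comm.symm]
    simp_rw [e2]
    rw [hs2.tsum_prod]
    unfold sympForm
    refine tsum_congr fun a => ?_
    rw [tsum_eq_single (-a) fun b hb => by simp [hb]]
    simp

/-! ### From column bounds to bounds of the majorant -/

lemma tsum_mul_sq_le {ι : Type*} (x y : ι → ℝ≥0∞) :
    (∑' i, x i * y i) ^ 2 ≤ (∑' i, x i ^ 2) * ∑' i, y i ^ 2 := by
  let _ : MeasurableSpace ι := ⊤
  have h := ENNReal.lintegral_mul_le_Lp_mul_Lq (MeasureTheory.Measure.count) (p := 2) (q := 2)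
    ((Real.holderConjugate_iff).2 (by norm_num)) (f := x) (g := y)
    (measurable_from_top).aemeasurable (measurable_from_top).aemeasurable
  simp only [MeasureTheory.lintegral_count, Pi.mul_apply, ENNReal.rpow_ofNat] at h
  refine (pow_le_pow_left' h 2).trans (le_of_eq ?_)
  rw [mul_pow, ← ENNReal.rpow_natCast, ← ENNReal.rpow_natCast, ← ENNReal.rpow_mul,
    ← ENNReal.rpow_mul]
  norm_num

/-- The columns of `A` are bounded by `m` in the weighted `ℓ²` norm. -/
def Col (w : Idx P → ℝ≥0∞) (m : ℝ≥0∞) (A : Op P) : Prop :=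
  ∀ k' : Idx P, wn w (fun k => ‖A (k.1 - k'.1) k.2 k'.2‖ₑ) ≤ m * w k'

/-- `max {1, |n|}`. -/
def japInt (n : ℤ) : ℝ := max 1 |(n : ℝ)|

lemma tsum_japInt_ne_top : ∑' n : ℤ, ENNReal.ofReal ((japInt n ^ 2)⁻¹) ≠ ⊤ := by
  have h : Summable fun n : ℤ => (japInt n ^ 2)⁻¹ := by
    refine Summable.of_nonneg_of_le (fun n => by unfold japInt; positivity) (fun n => ?_)
      ((Real.summable_one_div_int_pow.2 (by norm_num : 1 < 2)).add (summable_of_hasFiniteSupport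
        (f := fun n : ℤ => if n = 0 then (1 : ℝ) else 0)
        ((Set.finite_singleton 0).subset fun l hl => by simpa using hl)))
    by_cases hn : n = 0
    · simp [hn, japInt]
    · have h1 : (1 : ℝ) ≤ |(n : ℝ)| := by exact_mod_cast Int.one_le_abs hn
      simp [hn, japInt, max_eq_right h1]
  exact h.tsum_ofReal_ne_top

/-- `∑ ⟨ℓ⟩^{-2s₀} ⟨n⟩^{-2}`. -/
def sumH (P : Finset ℕ) : ℝ≥0∞ :=
  (∑' l : Mode P, ENNReal.ofReal ((jap l ^ (2 * sZero P))⁻¹))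
    * ∑' n : ℤ, ENNReal.ofReal ((japInt n ^ 2)⁻¹)

lemma sumH_ne_top : sumH P ≠ ⊤ :=
  ENNReal.mul_ne_top (tsum_jap_ne_top card_lt_two_mul_sZero) tsum_japInt_ne_top

/-- `⟨ℓ⟩^{s₀} ⟨j - j'⟩`. -/
def hW (l : Mode P) (j j' : Site P) : ℝ := jap l ^ sZero P * japInt (j.1 - j'.1)

lemma hW_pos (l : Mode P) (j j' : Site P) : 0 < hW l j j' := by
  have := one_le_jap l
  have : 1 ≤ japInt (j.1 - j'.1) := le_max_left _ _
  unfold hW; positivity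

lemma tsum_hW_le (k : Idx P) :
    ∑' k' : Idx P, ENNReal.ofReal ((hW (k.1 - k'.1) k.2 k'.2)⁻¹) ^ 2 ≤ sumH P := by
  have e : ∀ k' : Idx P, ENNReal.ofReal ((hW (k.1 - k'.1) k.2 k'.2)⁻¹) ^ 2
      = ENNReal.ofReal ((jap (k.1 - k'.1) ^ (2 * sZero P))⁻¹)
        * ENNReal.ofReal ((japInt (k'.2.1 - k.2.1) ^ 2)⁻¹) := fun k' => by
    have := one_le_jap (k.1 - k'.1)
    have h2 : japInt (k'.2.1 - k.2.1) = japInt (k.2.1 - k'.2.1) := by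
      unfold japInt; push_cast; rw [abs_sub_comm]
    rw [← ENNReal.ofReal_pow (inv_nonneg.2 (hW_pos _ _ _).le),
      ← ENNReal.ofReal_mul (by positivity), h2, hW]
    congr 1
    rw [mul_inv, mul_pow, inv_pow, inv_pow, ← pow_mul, mul_comm (sZero P) 2]
  simp_rw [e]
  rw [ENNReal.tsum_prod' (f := fun k' : Idx P => ENNReal.ofReal ((jap (k.1 - k'.1) ^ (2 * sZero P))⁻¹)
        * ENNReal.ofReal ((japInt (k'.2.1 - k.2.1) ^ 2)⁻¹))]
  dsimp only
  simp_rw [ENNReal.tsum_mul_left]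
  rw [ENNReal.tsum_mul_right, sumH]
  refine mul_le_mul' (le_of_eq ?_)
    (tsum_site_le k.2 fun n => ENNReal.ofReal ((japInt n ^ 2)⁻¹))
  exact (Equiv.subLeft k.1).tsum_eq fun l => ENNReal.ofReal ((jap l ^ (2 * sZero P))⁻¹)

/-- Cauchy-Schwarz with the factor `hW⁻¹`, whose squares are summable uniformly in the row, followed
by exchanging the sums over rows and columns. Column bounds of a kernel thus control its norm once
`⟨ℓ⟩^{s₀}⟨j-j'⟩` of additional decay is available. -/
lemma kop_le_of_col {w : Idx P → ℝ≥0∞} {E : Ker P} {m : ℝ≥0∞}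
    (h : ∀ k' : Idx P, wn w (fun k => ENNReal.ofReal (hW (k.1 - k'.1) k.2 k'.2)
      * E (k.1 - k'.1) k.2 k'.2) ≤ m * w k') : kop w E ≤ sumH P ^ (1 / 2 : ℝ) * m := by
  refine kop_le fun u _ => ?_
  rw [wn_le_iff]
  have hsq : (sumH P ^ (1 / 2 : ℝ) * m * wn w u) ^ 2
      = sumH P * ∑' k', u k' ^ 2 * (m * w k') ^ 2 := by
    rw [mul_pow, mul_pow, wn_sq, ← ENNReal.rpow_natCast (sumH P ^ (1 / 2 : ℝ)), ← ENNReal.rpow_mul,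
      mul_assoc, ← ENNReal.tsum_mul_left]
    norm_num
    congr 1
    exact tsum_congr fun k' => by ring
  rw [hsq]
  have hk : ∀ k : Idx P, (w k * kapp E u k) ^ 2 ≤ sumH P * ∑' k' : Idx P, u k' ^ 2 *
      (w k * (ENNReal.ofReal (hW (k.1 - k'.1) k.2 k'.2) * E (k.1 - k'.1) k.2 k'.2)) ^ 2 := fun k => by
    have e : kapp E u k = ∑' k' : Idx P, ENNReal.ofReal ((hW (k.1 - k'.1) k.2 k'.2)⁻¹)
        * (ENNReal.ofReal (hW (k.1 - k'.1) k.2 k'.2) * E (k.1 - k'.1) k.2 k'.2 * u k') := by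
      refine tsum_congr fun k' => ?_
      have h0 := hW_pos (k.1 - k'.1) k.2 k'.2
      rw [← mul_assoc, ← mul_assoc, ← ENNReal.ofReal_mul (inv_nonneg.2 h0.le),
        inv_mul_cancel₀ h0.ne', ENNReal.ofReal_one, one_mul]
    rw [e, mul_pow]
    refine (mul_le_mul_right ((tsum_mul_sq_le _ _).trans
      (mul_le_mul_left (tsum_hW_le k) _)) _).trans (le_of_eq ?_)
    rw [mul_left_comm, ← ENNReal.tsum_mul_left]
    congr 1
    exact tsum_congr fun k' => by ring
  refine (ENNReal.tsum_le_tsum hk).trans ?_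
  rw [ENNReal.tsum_mul_left, ENNReal.tsum_comm]
  refine mul_le_mul_right (ENNReal.tsum_le_tsum fun k' => ?_) _
  rw [ENNReal.tsum_mul_left, ← wn_sq]
  exact mul_le_mul_right (pow_le_pow_left' (h k') 2) _

lemma jap_pow_le (l : Mode P) (n : ℕ) : jap l ^ n ≤ 1 + ∑ m, |(l m : ℝ)| ^ n := by
  have hnn : 0 ≤ ∑ m, |(l m : ℝ)| ^ n := Finset.sum_nonneg fun m _ => by positivity
  by_cases h : ‖l‖ ≤ 1
  · rw [jap, max_eq_left h, one_pow]; linarith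
  · rw [jap, max_eq_right (not_le.1 h).le]
    have hP : Nonempty P := by
      by_contra hc
      rw [not_nonempty_iff] at hc
      exact h (by rw [Subsingleton.elim l 0, norm_zero]; norm_num)
    obtain ⟨m₀, hm⟩ := Finite.exists_max fun m => ‖l m‖
    have h1 : ‖l‖ ≤ |(l m₀ : ℝ)| := by
      rw [← Int.norm_eq_abs]
      exact (pi_norm_le_iff_of_nonneg (norm_nonneg _)).2 hm
    have h2 : ‖l‖ ^ n ≤ |(l m₀ : ℝ)| ^ n := by gcongr
    have h3 := Finset.single_le_sum (f := fun m => |(l m : ℝ)| ^ n) (fun m _ => by positivity)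
      (Finset.mem_univ m₀)
    linarith

lemma enorm_dPhi (m : P) (n : ℕ) (A : Op P) (l : Mode P) (j j' : Site P) :
    ‖dPhi m n A l j j'‖ₑ = ENNReal.ofReal (|(l m : ℝ)| ^ n) * ‖A l j j'‖ₑ := by
  rw [dPhi, enorm_mul, ← ofReal_norm, norm_pow, norm_mul, Complex.norm_I, one_mul,
    Complex.norm_intCast]

lemma abs_sub_mul_enorm_le (A : Op P) (l : Mode P) (j j' : Site P) :
    ENNReal.ofReal |((j.1 - j'.1 : ℤ) : ℝ)| * ‖A l j j'‖ₑ ≤ ‖commDx A l j j'‖ₑ := by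
  have e : commDx A l j j' = (2 * Real.pi * Complex.I) * (((j'.1 - j.1 : ℤ) : ℂ)) * A l j j' := by
    rw [commDx]; push_cast; ring
  rw [e, enorm_mul]
  refine mul_le_mul_left ?_ _
  rw [← ofReal_norm, norm_mul, Complex.norm_intCast]
  refine ENNReal.ofReal_le_ofReal ?_
  have h1 : ‖(2 * Real.pi * Complex.I : ℂ)‖ = 2 * Real.pi := by
    simp [abs_of_pos Real.pi_pos]
  rw [h1]
  push_cast
  rw [abs_sub_comm]
  exact le_mul_of_one_le_left (abs_nonneg _) (by linarith [Real.pi_gt_three])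

/-- The decay `⟨j-j'⟩` comes from the commutator with `∂_x`, the decay `⟨ℓ⟩^{s₀+b}` from the time
derivatives in each coordinate direction. Only the derivatives of order `s₀ + b` are needed, since
the operator itself covers the bounded frequencies. -/
lemma weighted_entry_le (b : ℕ) (A : Op P) (l : Mode P) (j j' : Site P) :
    ENNReal.ofReal (hW l j j') * (thB b l * ‖A l j j'‖ₑ) ≤
      (‖A l j j'‖ₑ + ‖commDx A l j j'‖ₑ) + ∑ m, (‖dPhi m (sZero P + b) A l j j'‖ₑ
        + ‖dPhi m (sZero P + b) (commDx A) l j j'‖ₑ) := by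
  have hj := one_le_jap l
  have h1 : ENNReal.ofReal (hW l j j') * (thB b l * ‖A l j j'‖ₑ)
      = ENNReal.ofReal (jap l ^ (sZero P + b))
        * (ENNReal.ofReal (japInt (j.1 - j'.1)) * ‖A l j j'‖ₑ) := by
    rw [hW, thB, pow_add, ENNReal.ofReal_mul (by positivity), ENNReal.ofReal_mul (by positivity)]
    ring
  have h2 : ENNReal.ofReal (japInt (j.1 - j'.1)) * ‖A l j j'‖ₑ
      ≤ ‖A l j j'‖ₑ + ‖commDx A l j j'‖ₑ := by
    have : japInt (j.1 - j'.1) ≤ 1 + |((j.1 - j'.1 : ℤ) : ℝ)| :=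
      max_le (by linarith [abs_nonneg ((j.1 - j'.1 : ℤ) : ℝ)]) (by linarith)
    refine (mul_le_mul_left (ENNReal.ofReal_le_ofReal this) _).trans ?_
    rw [ENNReal.ofReal_add (by norm_num) (abs_nonneg _), ENNReal.ofReal_one, add_mul, one_mul]
    gcongr
    exact abs_sub_mul_enorm_le A l j j'
  have h3 : ENNReal.ofReal (jap l ^ (sZero P + b))
      ≤ 1 + ∑ m, ENNReal.ofReal (|(l m : ℝ)| ^ (sZero P + b)) := by
    refine (ENNReal.ofReal_le_ofReal (jap_pow_le l _)).trans ?_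
    rw [ENNReal.ofReal_add (by norm_num) (Finset.sum_nonneg fun m _ => by positivity),
      ENNReal.ofReal_one, ENNReal.ofReal_sum_of_nonneg fun m _ => by positivity]
  rw [h1]
  refine (mul_le_mul' h3 h2).trans (le_of_eq ?_)
  simp only [add_mul, one_mul, Finset.sum_mul, enorm_dPhi, mul_add, Finset.sum_add_distrib]
  ring

/-- The constant in the estimate of the majorant of the initial remainder. -/
def initC (P : Finset ℕ) : ℝ := (sumH P ^ (1 / 2 : ℝ)).toReal * (2 + 2 * P.card) + 1

lemma initC_pos : 0 < initC P := by unfold initC; positivity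

lemma wn_sum_le {ι α : Type*} (w : ι → ℝ≥0∞) (s : Finset α) (u : α → ι → ℝ≥0∞) :
    wn w (fun k => ∑ a ∈ s, u a k) ≤ ∑ a ∈ s, wn w (u a) := by
  classical
  induction s using Finset.induction_on with
  | empty => simp [wn]
  | insert a F ha ih =>
    simp only [Finset.sum_insert ha]
    exact (wn_add_le w (u a) fun k => ∑ n ∈ F, u n k).trans (by gcongr)

/-- The number `2 + 2|P|` counts the operators involved: the operator and its commutator, each alone
and with one derivative per coordinate. -/
lemma kn_thB_le_of_col {w : Idx P → ℝ≥0∞} {b : ℕ} {A : Op P} {m : ℝ≥0∞}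
    (h : ∀ T : Op P → Op P, (T = id ∨ T = commDx) → Col w m (T A) ∧
      ∀ i : P, Col w m (dPhi i (sZero P + b) (T A))) :
    kn w (thB b) A ≤ ENNReal.ofReal (initC P) * m := by
  obtain ⟨h1, h2⟩ := h id (Or.inl rfl)
  obtain ⟨h3, h4⟩ := h commDx (Or.inr rfl)
  have hcol : ∀ k' : Idx P, wn w (fun k => ENNReal.ofReal (hW (k.1 - k'.1) k.2 k'.2)
      * (thB b (k.1 - k'.1) * ‖A (k.1 - k'.1) k.2 k'.2‖ₑ))
      ≤ ((2 + 2 * P.card : ℕ) * m) * w k' := fun k' => by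
    refine (wn_mono (w' := w) fun k => mul_le_mul_right (weighted_entry_le b A _ _ _) _).trans ?_
    refine (wn_add_le w (fun k => ‖A (k.1 - k'.1) k.2 k'.2‖ₑ + ‖commDx A (k.1 - k'.1) k.2 k'.2‖ₑ)
      (fun k => ∑ i, (‖dPhi i (sZero P + b) A (k.1 - k'.1) k.2 k'.2‖ₑ
        + ‖dPhi i (sZero P + b) (commDx A) (k.1 - k'.1) k.2 k'.2‖ₑ))).trans ?_
    have e1 := (wn_add_le w (fun k => ‖A (k.1 - k'.1) k.2 k'.2‖ₑ)
      fun k => ‖commDx A (k.1 - k'.1) k.2 k'.2‖ₑ).trans (add_le_add (h1 k') (h3 k'))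
    have e2 := (wn_sum_le w Finset.univ fun (i : P) k =>
      (‖dPhi i (sZero P + b) A (k.1 - k'.1) k.2 k'.2‖ₑ
        + ‖dPhi i (sZero P + b) (commDx A) (k.1 - k'.1) k.2 k'.2‖ₑ)).trans
      (Finset.sum_le_sum fun i _ => (wn_add_le w
        (fun k => ‖dPhi i (sZero P + b) A (k.1 - k'.1) k.2 k'.2‖ₑ)
        fun k => ‖dPhi i (sZero P + b) (commDx A) (k.1 - k'.1) k.2 k'.2‖ₑ).trans
        (add_le_add (h2 i k') (h4 i k')))
    refine (add_le_add e1 e2).trans (le_of_eq ?_)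
    rw [Finset.sum_const, Finset.card_univ, Fintype.card_coe, nsmul_eq_mul]
    push_cast
    ring
  refine (kop_le_of_col hcol).trans ?_
  rw [← mul_assoc]
  refine mul_le_mul_left ?_ _
  have hfin : sumH P ^ (1 / 2 : ℝ) ≠ ⊤ := ENNReal.rpow_ne_top_of_nonneg (by norm_num) sumH_ne_top
  have e : sumH P ^ (1 / 2 : ℝ) * ((2 + 2 * P.card : ℕ) : ℝ≥0∞)
      = ENNReal.ofReal ((sumH P ^ (1 / 2 : ℝ)).toReal * (2 + 2 * P.card)) := by
    rw [ENNReal.ofReal_mul ENNReal.toReal_nonneg, ENNReal.ofReal_toReal hfin]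
    congr 1
    rw [← ENNReal.ofReal_natCast]; push_cast; rfl
  rw [e]
  exact ENNReal.ofReal_le_ofReal (by unfold initC; linarith)

lemma kn_thOne_le_thB {w : Idx P → ℝ≥0∞} (b : ℕ) (A : Op P) : kn w thOne A ≤ kn w (thB b) A :=
  kn_mono fun l j j' => by
    refine mul_le_mul_left ?_ _
    rw [thOne, thB, ENNReal.one_le_ofReal]
    exact one_le_pow₀ (one_le_jap l)

lemma pn_thOne_le_thB {w : Idx P → ℝ≥0∞} {κ : ℝ≥0∞} (b : ℕ) (A : Op P × Op P) :
    pn w thOne κ A ≤ pn w (thB b) κ A :=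
  pn_le_iff.2 ⟨(kn_thOne_le_thB b _).trans (kn_fst_le A), (kn_thOne_le_thB b _).trans (kn_snd_le A),
    (mul_le_mul_right (kn_thOne_le_thB b _) _).trans (kn_diff_le A)⟩

/-! ### Column bounds from tame estimates and operator norms -/

open Classical in
lemma app_single (A : Op P) (k' : Idx P) (c : ℂ) :
    app A (Pi.single k' c) = fun k => A (k.1 - k'.1) k.2 k'.2 * c := by
  funext k
  unfold app
  rw [tsum_eq_single k' fun m hm => by simp [Pi.single_eq_of_ne hm]]
  simp

lemma sob_eq_wn (s : ℝ) (u : Idx P → ℂ) : sob s u = wn (sobW s) fun k => ‖u k‖ₑ := rfl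

open Classical in
lemma sob_single (s : ℝ) (k' : Idx P) (c : ℂ) : sob s (Pi.single k' c) = sobW s k' * ‖c‖ₑ := by
  have e : (fun k => ‖(Pi.single k' c : Idx P → ℂ) k‖ₑ)
      = fun k => ‖c‖ₑ * (Pi.single k' 1 : Idx P → ℝ≥0∞) k := by
    funext k
    by_cases h : k = k'
    · subst h; simp
    · simp [Pi.single_eq_of_ne h]
  rw [sob_eq_wn, e, wn_const_mul, wn_single, mul_comm]

open Classical in
lemma wn_col_le_appNorm (s : ℝ) (A : Op P) (k' : Idx P) (c : ℂ) :
    ‖c‖ₑ * wn (sobW s) (fun k => ‖A (k.1 - k'.1) k.2 k'.2‖ₑ) ≤ appNorm s (Pi.single k' c) A := by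
  unfold appNorm
  split_ifs
  · rw [app_single, sob_eq_wn, ← wn_const_mul]
    exact le_of_eq (congrArg _ (funext fun k => by rw [enorm_mul, mul_comm]))
  · exact le_top

/-- A column is the image of a unit vector, normalized here in the Sobolev norm. -/
lemma col_of_opNorm {s : ℝ} {A : Op P} {m : ℝ≥0∞} (h : opNorm s A ≤ m) : Col (sobW s) m A := by
  classical
  intro k'
  have hpos : 0 < japIdx k' ^ s := Real.rpow_pos_of_pos (by linarith [one_le_japIdx k']) s
  set c : ℂ := (((japIdx k' ^ s)⁻¹ : ℝ) : ℂ) with hc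
  have hce : ‖c‖ₑ = (sobW s k')⁻¹ := by
    rw [← ofReal_norm, hc, Complex.norm_real, Real.norm_of_nonneg (inv_nonneg.2 hpos.le),
      ENNReal.ofReal_inv_of_pos hpos, sobW]
  have h0 := (posFin_sobW s).ne_zero k'
  have h1 := (posFin_sobW s).ne_top k'
  have hs : sob s (Pi.single k' c) ≤ 1 := by
    rw [sob_single, hce, ENNReal.mul_inv_cancel h0 h1]
  have h2 := (wn_col_le_appNorm s A k' c).trans
    ((le_iSup₂ (f := fun (u : Idx P → ℂ) (_ : sob s u ≤ 1) => appNorm s u A) _ hs).trans h)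
  rwa [hce, ENNReal.inv_mul_le_iff h0 h1, mul_comm] at h2

/-! ### Lipschitz norms as bounds of values and scaled increments -/

section lipNorm

variable {X : Type*} [Sub X] {N : X → ℝ≥0∞} {γ : ℝ} {O : Set (Freq P)} {f : Freq P → X} {c : ℝ≥0∞}

lemma le_lipNorm {ω : Freq P} (hω : ω ∈ O) : N (f ω) ≤ lipNorm N γ O f :=
  (le_iSup₂ (f := fun ω (_ : ω ∈ O) => N (f ω)) ω hω).trans le_self_add

lemma diff_le_lipSemi {ω₁ ω₂ : Freq P} (h₁ : ω₁ ∈ O) (h₂ : ω₂ ∈ O) (h : ω₁ ≠ ω₂) :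
    N (f ω₁ - f ω₂) ≤ ENNReal.ofReal ‖ω₁ - ω₂‖ * lipSemi N O f := by
  have hpos : 0 < ‖ω₁ - ω₂‖ := norm_pos_iff.2 (sub_ne_zero.2 h)
  rw [mul_comm, ← ENNReal.div_le_iff (by simpa using hpos) ENNReal.ofReal_ne_top]
  exact le_iSup₂_of_le ω₁ h₁ (le_iSup₂_of_le ω₂ h₂ (le_iSup_of_le h le_rfl))

lemma diff_le_lipNorm (hγ : 0 < γ) {ω₁ ω₂ : Freq P} (h₁ : ω₁ ∈ O) (h₂ : ω₂ ∈ O) (h : ω₁ ≠ ω₂) :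
    N (f ω₁ - f ω₂) ≤ ENNReal.ofReal (‖ω₁ - ω₂‖ / γ) * lipNorm N γ O f := by
  refine (diff_le_lipSemi (N := N) h₁ h₂ h).trans ?_
  have e : ENNReal.ofReal ‖ω₁ - ω₂‖ = ENNReal.ofReal (‖ω₁ - ω₂‖ / γ) * ENNReal.ofReal γ := by
    rw [← ENNReal.ofReal_mul (by positivity), div_mul_cancel₀ _ hγ.ne']
  rw [e, mul_assoc]
  exact mul_le_mul_right le_add_self _

lemma lipNorm_le (hγ : 0 < γ) {c' : ℝ≥0∞} (h₁ : ∀ ω ∈ O, N (f ω) ≤ c)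
    (h₂ : ∀ ω₁ ∈ O, ∀ ω₂ ∈ O, ω₁ ≠ ω₂ →
      N (f ω₁ - f ω₂) ≤ ENNReal.ofReal (‖ω₁ - ω₂‖ / γ) * c') : lipNorm N γ O f ≤ c + c' := by
  refine add_le_add (iSup₂_le h₁) ?_
  rw [mul_comm, ← ENNReal.le_div_iff_mul_le (Or.inl (by simpa using hγ)) (Or.inl ENNReal.ofReal_ne_top)]
  refine iSup₂_le fun ω₁ hω₁ => iSup₂_le fun ω₂ hω₂ => iSup_le fun h => ?_
  have hpos : 0 < ‖ω₁ - ω₂‖ := norm_pos_iff.2 (sub_ne_zero.2 h)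
  refine ENNReal.div_le_of_le_mul ((h₂ ω₁ hω₁ ω₂ hω₂ h).trans (le_of_eq ?_))
  rw [ENNReal.ofReal_div_of_pos hγ]
  simp only [div_eq_mul_inv]
  ring

end lipNorm

/-- The weight `⟨k⟩^{s₁} + t ⟨k⟩^s`. -/
def tameW (s₁ s t : ℝ) : Idx P → ℝ≥0∞ := sobW s₁ + fun k => ENNReal.ofReal t * sobW s k

lemma posFin_tameW (s₁ s t : ℝ) : PosFin (tameW s₁ s t : Idx P → ℝ≥0∞) where
  ne_zero k := by
    have := (posFin_sobW (P := P) s₁).ne_zero k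
    simp [tameW, this]
  ne_top k := ENNReal.add_ne_top.2 ⟨ENNReal.ofReal_ne_top,
    ENNReal.mul_ne_top ENNReal.ofReal_ne_top ENNReal.ofReal_ne_top⟩

lemma wn_tameW_le (s₁ s t : ℝ) (u : Idx P → ℝ≥0∞) :
    wn (tameW s₁ s t) u ≤ wn (sobW s₁) u + ENNReal.ofReal t * wn (sobW s) u := by
  rw [← wn_const_mul_weight]; exact wn_add_weight_le _ _ _

/-- Column bounds in the weight `⟨k⟩^{s₁} + t ⟨k⟩^s` from tame bounds of the columns. -/
lemma col_tameW {s₁ s t m M : ℝ} (ht : 0 ≤ t) (htM : t * M ≤ m) {A : Op P}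
    {κ : ℝ≥0∞}
    (h₁ : ∀ k' : Idx P, wn (sobW s₁) (fun k => ‖A (k.1 - k'.1) k.2 k'.2‖ₑ)
      ≤ κ * (ENNReal.ofReal m * sobW s₁ k' + ENNReal.ofReal m * sobW s₁ k'))
    (h₂ : ∀ k' : Idx P, wn (sobW s) (fun k => ‖A (k.1 - k'.1) k.2 k'.2‖ₑ)
      ≤ κ * (ENNReal.ofReal m * sobW s k' + ENNReal.ofReal M * sobW s₁ k')) :
    Col (tameW s₁ s t) (κ * ENNReal.ofReal (3 * m)) A := by
  intro k'
  refine (wn_tameW_le s₁ s t _).trans ((add_le_add (h₁ k') (mul_le_mul_right (h₂ k') _)).trans ?_)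
  -- The weight parameter satisfies `tM ≤ m`, so the high tame constant falls on the low weight with
  -- coefficient `m`. Three such terms occur, whence the factor `3`.
  have e1 : ENNReal.ofReal t * ENNReal.ofReal M ≤ ENNReal.ofReal m := by
    rw [← ENNReal.ofReal_mul ht]; exact ENNReal.ofReal_le_ofReal htM
  have e2 : ENNReal.ofReal (3 * m) = 3 * ENNReal.ofReal m := by
    rw [ENNReal.ofReal_mul (by norm_num)]; norm_num
  rw [e2]
  simp only [tameW, Pi.add_apply]
  calc κ * (ENNReal.ofReal m * sobW s₁ k' + ENNReal.ofReal m * sobW s₁ k')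
      + ENNReal.ofReal t * (κ * (ENNReal.ofReal m * sobW s k' + ENNReal.ofReal M * sobW s₁ k'))
      = κ * (ENNReal.ofReal m * sobW s₁ k' + ENNReal.ofReal m * sobW s₁ k'
        + ENNReal.ofReal m * (ENNReal.ofReal t * sobW s k')
        + (ENNReal.ofReal t * ENNReal.ofReal M) * sobW s₁ k') := by ring
    _ ≤ κ * (ENNReal.ofReal m * sobW s₁ k' + ENNReal.ofReal m * sobW s₁ k'
        + 3 * (ENNReal.ofReal m * (ENNReal.ofReal t * sobW s k'))
        + ENNReal.ofReal m * sobW s₁ k') := by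
        exact mul_le_mul_right (add_le_add (add_le_add le_rfl
          (le_mul_of_one_le_left' (by norm_num))) (mul_le_mul_left e1 _)) _
    _ = _ := by ring

/-- Column bounds for a family of tame operators and for its increments. -/
lemma LipTame.col {γ : ℝ} (hγ : 0 < γ) {O : Set (Freq P)} {s₁ S s : ℝ} {A : Freq P → Op P}
    {M : ℝ → ℝ} (h : LipTame γ O s₁ S A M) (hs : s ∈ Set.Icc s₁ S) {t m : ℝ} (ht : 0 ≤ t)
    (hm : M s₁ ≤ m) (htM : t * M s ≤ m) :
    (∀ ω ∈ O, Col (tameW s₁ s t) (ENNReal.ofReal (3 * m)) (A ω)) ∧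
    ∀ ω₁ ∈ O, ∀ ω₂ ∈ O, ω₁ ≠ ω₂ → Col (tameW s₁ s t)
      (ENNReal.ofReal (‖ω₁ - ω₂‖ / γ) * ENNReal.ofReal (3 * m)) (A ω₁ - A ω₂) := by
  classical
  obtain ⟨-, hpos, hb⟩ := h
  have hs₁ : s₁ ∈ Set.Icc s₁ S := ⟨le_rfl, hs.1.trans hs.2⟩
  have hm0 : 0 ≤ m := (hpos s₁ hs₁).trans hm
  -- Only unit vectors are tested. From here on, the tame hypotheses are used solely through their
  -- columns.
  have key : ∀ r ∈ Set.Icc s₁ S, ∀ k' : Idx P,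
      lipNorm (fun B => appNorm r (Pi.single k' 1) B) γ O A
        ≤ ENNReal.ofReal m * sobW r k' + ENNReal.ofReal (M r) * sobW s₁ k' := fun r hr k' => by
    have := hb r hr (Pi.single k' 1) (by
      rw [sob_single]; exact ENNReal.mul_lt_top ENNReal.ofReal_lt_top enorm_lt_top)
    rw [sob_single, sob_single, enorm_one, mul_one, mul_one] at this
    refine this.trans ?_
    gcongr
  have hcol : ∀ r B (k' : Idx P), wn (sobW r) (fun k => ‖(B : Op P) (k.1 - k'.1) k.2 k'.2‖ₑ)
      ≤ appNorm r (Pi.single k' 1) B := fun r B k' => by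
    simpa using wn_col_le_appNorm r B k' 1
  have hmm : ENNReal.ofReal (M s₁) ≤ ENNReal.ofReal m := ENNReal.ofReal_le_ofReal hm
  refine ⟨fun ω hω => ?_, fun ω₁ h₁ ω₂ h₂ hne => ?_⟩
  · have := col_tameW (s₁ := s₁) (s := s) (A := A ω) (κ := 1) ht htM
      (fun k' => by
        rw [one_mul]
        exact (hcol _ _ _).trans ((le_lipNorm (N := fun B => appNorm s₁ (Pi.single k' 1) B)
          (γ := γ) hω).trans ((key s₁ hs₁ k').trans (by gcongr))))
      (fun k' => by
        rw [one_mul]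
        exact (hcol _ _ _).trans ((le_lipNorm (N := fun B => appNorm s (Pi.single k' 1) B)
          (γ := γ) hω).trans (key s hs k')))
    rwa [one_mul] at this
  · exact col_tameW (s₁ := s₁) (s := s) ht htM
      (fun k' => (hcol _ _ _).trans ((diff_le_lipNorm
          (N := fun B => appNorm s₁ (Pi.single k' 1) B) hγ h₁ h₂ hne).trans
          (mul_le_mul_right ((key s₁ hs₁ k').trans (by gcongr)) _)))
      (fun k' => (hcol _ _ _).trans ((diff_le_lipNorm
          (N := fun B => appNorm s (Pi.single k' 1) B) hγ h₁ h₂ hne).trans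
          (mul_le_mul_right (key s hs k') _)))

/-! ### Modulo-tame estimates from weighted norms of the majorant -/

lemma ak_maj (A : Op P) : ak (maj A) = ak A := by
  funext l j j'
  simp [ak, maj, ← ofReal_norm]

lemma appNorm_maj_le {w : Idx P → ℝ≥0∞} (hw : PosFin w) {A : Op P} (hA : kop w (ak A) ≠ ⊤)
    {u : Idx P → ℂ} (hu : wn w (fun k => ‖u k‖ₑ) ≠ ⊤) (s : ℝ) :
    appNorm s u (maj A) ≤ wn (sobW s) (kapp (ak A) fun k => ‖u k‖ₑ) := by
  have hact : Acts (maj A) u := fun k => summable_app (by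
    rw [ak_maj]; exact hw.lt_top_of_wn (wn_app_ne_top hw hA hu) k)
  rw [appNorm, if_pos hact, sob_eq_wn]
  refine wn_mono fun k => mul_le_mul_right ?_ _
  have := enorm_app_le (maj A) u k
  rwa [ak_maj] at this

lemma sobW_mono {s₁ s : ℝ} (h : s₁ ≤ s) (k : Idx P) : sobW s₁ k ≤ sobW s k :=
  ENNReal.ofReal_le_ofReal (Real.rpow_le_rpow_of_exponent_le (one_le_japIdx k) h)

lemma sob_mono {s₁ s : ℝ} (h : s₁ ≤ s) (u : Idx P → ℂ) : sob s₁ u ≤ sob s u :=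
  wn_mono fun k => mul_le_mul_left (sobW_mono h k) _

lemma opNorm_maj_le (s : ℝ) (A : Op P) : opNorm s (maj A) ≤ kop (sobW s) (ak A) := by
  by_cases hA : kop (sobW s) (ak A) = ⊤
  · rw [hA]; exact le_top
  refine iSup₂_le fun u hu => ?_
  have hu' : wn (sobW s) (fun k => ‖u k‖ₑ) ≠ ⊤ := ne_top_of_le_ne_top ENNReal.one_ne_top hu
  exact (appNorm_maj_le (posFin_sobW s) hA hu' s).trans
    ((wn_kapp_le (posFin_sobW s) _ hu').trans (mul_le_of_le_one_right' hu))

/-- The diagonal entry belongs to the column at `(0, j)`, where input and output carry the same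
weight, so the weights cancel. -/
lemma diag_le_opNorm_maj (s : ℝ) (A : Op P) (j : Site P) : ‖A 0 j j‖ₑ ≤ opNorm s (maj A) := by
  have h := (mul_le_wn _ _ ((0 : Mode P), j)).trans
    (col_of_opNorm (A := maj A) (le_refl (opNorm s (maj A))) ((0 : Mode P), j))
  rw [mul_comm] at h
  have h2 := (ENNReal.mul_le_mul_iff_left ((posFin_sobW s).ne_zero _) ((posFin_sobW s).ne_top _)).1 h
  simpa [maj, ← ofReal_norm] using h2

/-- The tame estimate of `|A|` from its norm in the weight `⟨k⟩^{s₁} + t ⟨k⟩^s`. -/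
lemma appNorm_maj_le_tame {s₁ s m M : ℝ} (hs : s₁ ≤ s) (hm : 0 < m) (hM : 0 < M) {c : ℝ}
    {κ : ℝ≥0∞} (hκ : κ ≠ ⊤) {A : Op P}
    (hA : kop (tameW s₁ s (m / M)) (ak A) ≤ κ * ENNReal.ofReal (c * m)) {u : Idx P → ℂ}
    (hu : sob s u < ⊤) : appNorm s u (maj A)
      ≤ κ * (ENNReal.ofReal (c * m) * sob s u + ENNReal.ofReal (c * M) * sob s₁ u) := by
  have hw := posFin_tameW (P := P) s₁ s (m / M)
  have hu₁ : sob s₁ u < ⊤ := (sob_mono hs u).trans_lt hu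
  have hwu := wn_tameW_le s₁ s (m / M) fun k => ‖u k‖ₑ
  have hwt : wn (tameW s₁ s (m / M)) (fun k => ‖u k‖ₑ) ≠ ⊤ :=
    ne_top_of_le_ne_top (ENNReal.add_ne_top.2 ⟨hu₁.ne, ENNReal.mul_ne_top ENNReal.ofReal_ne_top hu.ne⟩)
      hwu
  have hAt := ne_top_of_le_ne_top (ENNReal.mul_ne_top hκ ENNReal.ofReal_ne_top) hA
  refine (appNorm_maj_le hw hAt hwt s).trans ?_
  have ht0 : ENNReal.ofReal (m / M) ≠ 0 := by simpa using div_pos hm hM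
  rw [← ENNReal.mul_le_mul_iff_right ht0 ENNReal.ofReal_ne_top]
  calc ENNReal.ofReal (m / M) * wn (sobW s) (kapp (ak A) fun k => ‖u k‖ₑ)
      ≤ wn (tameW s₁ s (m / M)) (kapp (ak A) fun k => ‖u k‖ₑ) := by
        rw [← wn_const_mul_weight]
        exact wn_mono fun k => mul_le_mul_left (by simp only [tameW, Pi.add_apply]; exact le_add_self) _
    _ ≤ (κ * ENNReal.ofReal (c * m)) * (sob s₁ u + ENNReal.ofReal (m / M) * sob s u) :=
        (wn_kapp_le hw _ hwt).trans (mul_le_mul' hA hwu)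
    _ = ENNReal.ofReal (m / M) * (κ * (ENNReal.ofReal (c * m) * sob s u
          + ENNReal.ofReal (c * M) * sob s₁ u)) := by
        have e : ENNReal.ofReal (c * m) = ENNReal.ofReal (m / M) * ENNReal.ofReal (c * M) := by
          rw [← ENNReal.ofReal_mul (by positivity)]
          congr 1
          field_simp
        calc _ = κ * (ENNReal.ofReal (m / M) * (ENNReal.ofReal (c * m) * sob s u)
              + ENNReal.ofReal (c * m) * sob s₁ u) := by ring
          _ = κ * (ENNReal.ofReal (m / M) * (ENNReal.ofReal (c * m) * sob s u)
              + (ENNReal.ofReal (m / M) * ENNReal.ofReal (c * M)) * sob s₁ u) := by rw [e]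
          _ = _ := by ring

/-- The weight parameter is a quotient of tame constants, which may vanish. Both are therefore
shifted by `η > 0`, and the tame inequality is obtained as `η → 0`. The factor `2` adds the sup part
and the Lipschitz part. -/
lemma lipModTame_of_kop {γ : ℝ} (hγ : 0 < γ) {O : Set (Freq P)} {s₁ S : ℝ} {A : Freq P → Op P}
    {M M' : ℝ → ℝ} {c c' η₀ : ℝ} (hc : 0 ≤ c) (hcc : 2 * c ≤ c') (hη₀ : 0 < η₀)
    (hM' : ∀ s, M' s = c' * M s)
    (hmono : MonotoneOn M (Set.Icc s₁ S)) (hpos : ∀ s ∈ Set.Icc s₁ S, 0 ≤ M s)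
    (h₁ : ∀ s ∈ Set.Icc s₁ S, ∀ η, 0 < η → η ≤ η₀ → ∀ ω ∈ O,
      kop (tameW s₁ s ((M s₁ + η) / (M s + η))) (ak (A ω)) ≤ ENNReal.ofReal (c * (M s₁ + η)))
    (h₂ : ∀ s ∈ Set.Icc s₁ S, ∀ η, 0 < η → η ≤ η₀ → ∀ ω₁ ∈ O, ∀ ω₂ ∈ O, ω₁ ≠ ω₂ →
      kop (tameW s₁ s ((M s₁ + η) / (M s + η))) (ak (A ω₁ - A ω₂))
        ≤ ENNReal.ofReal (‖ω₁ - ω₂‖ / γ) * ENNReal.ofReal (c * (M s₁ + η))) :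
    LipModTame γ O s₁ S A M' := by
  have hc' : 0 ≤ c' := by linarith
  refine ⟨fun x hx y hy hxy => ?_, fun s hs => ?_, fun s hs u hu => ?_⟩
  · rw [hM', hM']; exact mul_le_mul_of_nonneg_left (hmono hx hy hxy) hc'
  · rw [hM']; exact mul_nonneg hc' (hpos s hs)
  have hs₁ : s₁ ∈ Set.Icc s₁ S := ⟨le_rfl, hs.1.trans hs.2⟩
  have hu₁ : sob s₁ u < ⊤ := (sob_mono hs.1 u).trans_lt hu
  have key : ∀ η, 0 < η → η ≤ η₀ → lipNorm (fun B => appNorm s u (maj B)) γ O A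
      ≤ ENNReal.ofReal (c' * (M s₁ + η)) * sob s u + ENNReal.ofReal (c' * (M s + η)) * sob s₁ u := by
    intro η hη hη'
    have hm : 0 < M s₁ + η := by linarith [hpos s₁ hs₁]
    have hMs : 0 < M s + η := by linarith [hpos s hs]
    refine (lipNorm_le hγ (c := 1 * (ENNReal.ofReal (c * (M s₁ + η)) * sob s u
        + ENNReal.ofReal (c * (M s + η)) * sob s₁ u))
      (c' := ENNReal.ofReal (c * (M s₁ + η)) * sob s u
        + ENNReal.ofReal (c * (M s + η)) * sob s₁ u) (fun ω hω => ?_)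
      fun ω₁ hω₁ ω₂ hω₂ hne => ?_).trans ?_
    · exact appNorm_maj_le_tame hs.1 hm hMs ENNReal.one_ne_top
        (by rw [one_mul]; exact h₁ s hs η hη hη' ω hω) hu
    · exact appNorm_maj_le_tame hs.1 hm hMs ENNReal.ofReal_ne_top
        (h₂ s hs η hη hη' ω₁ hω₁ ω₂ hω₂ hne) hu
    · have e : ∀ x : ℝ, 0 < x → 2 * ENNReal.ofReal (c * x) ≤ ENNReal.ofReal (c' * x) := fun x hx => by
        rw [show (2 : ℝ≥0∞) = ENNReal.ofReal 2 by simp, ← ENNReal.ofReal_mul (by norm_num)]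
        refine ENNReal.ofReal_le_ofReal ?_
        rw [← mul_assoc]; gcongr
      calc _ = (2 * ENNReal.ofReal (c * (M s₁ + η))) * sob s u
            + (2 * ENNReal.ofReal (c * (M s + η))) * sob s₁ u := by ring
        _ ≤ _ := by gcongr; exacts [e _ hm, e _ hMs]
  have lim : ∀ x a : ℝ, Filter.Tendsto (fun η => ENNReal.ofReal (c' * (x + η)))
      (nhdsWithin 0 (Set.Ioi 0)) (nhds (ENNReal.ofReal (c' * x))) := fun x _ => by
    have : Filter.Tendsto (fun η : ℝ => c' * (x + η)) (nhds 0) (nhds (c' * x)) := by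
      have h : Continuous fun η : ℝ => c' * (x + η) := by fun_prop
      simpa using h.tendsto 0
    exact ENNReal.tendsto_ofReal (this.mono_left nhdsWithin_le_nhds)
  rw [hM', hM']
  refine ge_of_tendsto ((ENNReal.Tendsto.mul_const (lim (M s₁) 0) (Or.inr hu.ne)).add
    (ENNReal.Tendsto.mul_const (lim (M s) 0) (Or.inr hu₁.ne))) ?_
  filter_upwards [Ioc_mem_nhdsGT hη₀] with η hη
  exact key η hη.1 hη.2

/-! ### Real Lipschitz functions -/

lemma lipR_le {γ : ℝ} (hγ : 0 < γ) {O : Set (Freq P)} {f : Freq P → ℝ} {a b : ℝ}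
    (h₁ : ∀ ω ∈ O, |f ω| ≤ a)
    (h₂ : ∀ ω₁ ∈ O, ∀ ω₂ ∈ O, ω₁ ≠ ω₂ → |f ω₁ - f ω₂| ≤ ‖ω₁ - ω₂‖ / γ * b) :
    lipR γ O f ≤ ENNReal.ofReal a + ENNReal.ofReal b := by
  refine lipNorm_le hγ (fun ω hω => ?_) fun ω₁ hω₁ ω₂ hω₂ hne => ?_
  · rw [Real.enorm_eq_ofReal_abs]; exact ENNReal.ofReal_le_ofReal (h₁ ω hω)
  · rw [Real.enorm_eq_ofReal_abs, ← ENNReal.ofReal_mul (by positivity)]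
    exact ENNReal.ofReal_le_ofReal (h₂ ω₁ hω₁ ω₂ hω₂ hne)

lemma lipR_add_le (γ : ℝ) (O : Set (Freq P)) (f g : Freq P → ℝ) :
    lipR γ O (fun ω => f ω + g ω) ≤ lipR γ O f + lipR γ O g := by
  have h1 : supNorm (fun x : ℝ => ‖x‖ₑ) O (fun ω => f ω + g ω)
      ≤ supNorm (fun x : ℝ => ‖x‖ₑ) O f + supNorm (fun x : ℝ => ‖x‖ₑ) O g :=
    iSup₂_le fun ω hω => (enorm_add_le _ _).trans (add_le_add
      (le_iSup₂ (f := fun ω (_ : ω ∈ O) => ‖f ω‖ₑ) ω hω)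
      (le_iSup₂ (f := fun ω (_ : ω ∈ O) => ‖g ω‖ₑ) ω hω))
  have h2 : lipSemi (fun x : ℝ => ‖x‖ₑ) O (fun ω => f ω + g ω)
      ≤ lipSemi (fun x : ℝ => ‖x‖ₑ) O f + lipSemi (fun x : ℝ => ‖x‖ₑ) O g := by
    refine iSup₂_le fun ω₁ hω₁ => iSup₂_le fun ω₂ hω₂ => iSup_le fun hne => ?_
    have hpos : 0 < ‖ω₁ - ω₂‖ := norm_pos_iff.2 (sub_ne_zero.2 hne)
    refine ENNReal.div_le_of_le_mul ?_
    rw [show f ω₁ + g ω₁ - (f ω₂ + g ω₂) = (f ω₁ - f ω₂) + (g ω₁ - g ω₂) by ring, mul_comm, mul_add]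
    exact (enorm_add_le _ _).trans (add_le_add
      (diff_le_lipSemi (N := fun x : ℝ => ‖x‖ₑ) hω₁ hω₂ hne)
      (diff_le_lipSemi (N := fun x : ℝ => ‖x‖ₑ) hω₁ hω₂ hne))
  refine (add_le_add h1 (mul_le_mul_right h2 _)).trans (le_of_eq ?_)
  simp only [lipR, lipNorm]
  ring

lemma lipR_mono_set {γ : ℝ} {O O' : Set (Freq P)} (h : O ⊆ O') (f : Freq P → ℝ) :
    lipR γ O f ≤ lipR γ O' f :=
  add_le_add (iSup₂_le fun ω hω => le_iSup₂ (f := fun ω (_ : ω ∈ O') => ‖f ω‖ₑ) ω (h hω))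
    (mul_le_mul_right (iSup₂_le fun ω₁ h₁ => iSup₂_le fun ω₂ h₂ => iSup_le fun hne =>
      ENNReal.div_le_of_le_mul (by
        rw [mul_comm]
        exact diff_le_lipSemi (N := fun x : ℝ => ‖x‖ₑ) (h h₁) (h h₂) hne)) _)

lemma lipR_congr {γ : ℝ} {O : Set (Freq P)} {f g : Freq P → ℝ} (h : ∀ ω ∈ O, f ω = g ω) :
    lipR γ O f = lipR γ O g := by
  have e1 : supNorm (fun x : ℝ => ‖x‖ₑ) O f = supNorm (fun x : ℝ => ‖x‖ₑ) O g :=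
    iSup_congr fun ω => iSup_congr fun hω => by rw [h ω hω]
  have e2 : lipSemi (fun x : ℝ => ‖x‖ₑ) O f = lipSemi (fun x : ℝ => ‖x‖ₑ) O g :=
    iSup_congr fun ω₁ => iSup_congr fun h₁ => iSup_congr fun ω₂ => iSup_congr fun h₂ => by
      rw [h ω₁ h₁, h ω₂ h₂]
  rw [lipR, lipNorm, e1, e2]; rfl

lemma lipR_const (γ : ℝ) (O : Set (Freq P)) (c : ℝ) : lipR γ O (fun _ => c) ≤ ‖c‖ₑ := by
  have e2 : lipSemi (fun x : ℝ => ‖x‖ₑ) O (fun _ => c) = 0 := by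
    simp [lipSemi]
  rw [lipR, lipNorm, e2, mul_zero, add_zero]
  exact iSup₂_le fun _ _ => le_rfl

lemma lipR_const_mul_le {γ : ℝ} (hγ : 0 < γ) (O : Set (Freq P)) (c : ℝ) (f : Freq P → ℝ) :
    lipR γ O (fun ω => c * f ω) ≤ ‖c‖ₑ * lipR γ O f + ‖c‖ₑ * lipR γ O f := by
  refine lipNorm_le hγ (fun ω hω => ?_) fun ω₁ h₁ ω₂ h₂ hne => ?_
  · rw [enorm_mul]
    exact mul_le_mul_right (le_lipNorm (N := fun x : ℝ => ‖x‖ₑ) hω) _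
  · rw [← mul_sub, enorm_mul, mul_left_comm]
    exact mul_le_mul_right (diff_le_lipNorm (N := fun x : ℝ => ‖x‖ₑ) hγ h₁ h₂ hne) _

lemma lipR_sum_le {α : Type*} (γ : ℝ) (O : Set (Freq P)) (s : Finset α) (f : α → Freq P → ℝ) :
    lipR γ O (fun ω => ∑ a ∈ s, f a ω) ≤ ∑ a ∈ s, lipR γ O (f a) := by
  classical
  induction s using Finset.induction_on with
  | empty =>
    simp only [Finset.sum_empty]
    simpa using lipR_const γ O 0
  | insert a F ha ih =>
    simp only [Finset.sum_insert ha]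
    exact (lipR_add_le γ O (f a) fun ω => ∑ n ∈ F, f n ω).trans (by gcongr)

lemma abs_sub_le_of_lipR {γ c : ℝ} (hγ : 0 < γ) (hc : 0 ≤ c) {O : Set (Freq P)} {f : Freq P → ℝ}
    (h : lipR γ O f ≤ ENNReal.ofReal c) {ω₁ ω₂ : Freq P} (h₁ : ω₁ ∈ O) (h₂ : ω₂ ∈ O) :
    |f ω₁ - f ω₂| ≤ ‖ω₁ - ω₂‖ / γ * c := by
  by_cases hne : ω₁ = ω₂
  · subst hne; simp
  have := (diff_le_lipNorm (N := fun x : ℝ => ‖x‖ₑ) (f := f) hγ h₁ h₂ hne).trans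
    (mul_le_mul_right h _)
  rwa [Real.enorm_eq_ofReal_abs, ← ENNReal.ofReal_mul (by positivity),
    ENNReal.ofReal_le_ofReal_iff (by positivity)] at this

/-- Extension of a bounded Lipschitz function, with the same bounds. -/
lemma exists_lipR_extension {γ : ℝ} (hγ : 0 < γ) {O : Set (Freq P)} {f : Freq P → ℝ}
    (h : lipR γ O f < ⊤) : ∃ g : Freq P → ℝ, (∀ ω ∈ O, g ω = f ω) ∧
      ∀ O' : Set (Freq P), lipR γ O' g ≤ lipR γ O f := by
  set a := supNorm (fun x : ℝ => ‖x‖ₑ) O f with ha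
  set L := lipSemi (fun x : ℝ => ‖x‖ₑ) O f with hL
  have hfin : a ≠ ⊤ ∧ ENNReal.ofReal γ * L ≠ ⊤ := ENNReal.add_ne_top.1 h.ne
  have hLt : L ≠ ⊤ := fun hc => by
    rw [hc, ENNReal.mul_top (by simpa using hγ)] at hfin
    exact hfin.2 rfl
  have hlip : LipschitzOnWith L.toNNReal f O := by
    refine LipschitzOnWith.of_dist_le_mul fun x hx y hy => ?_
    by_cases hne : x = y
    · subst hne; simp
    have := diff_le_lipSemi (N := fun x : ℝ => ‖x‖ₑ) (f := f) hx hy hne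
    rw [← hL, Real.enorm_eq_ofReal_abs, ← ENNReal.ofReal_toReal hLt,
      ← ENNReal.ofReal_mul (norm_nonneg _), ENNReal.ofReal_le_ofReal_iff (by positivity)] at this
    rw [Real.dist_eq, dist_eq_norm, mul_comm]
    exact this
  obtain ⟨g, hg, hgf⟩ := hlip.extend_real
  have hbd : ∀ ω ∈ O, |f ω| ≤ a.toReal := fun ω hω => by
    have : ‖f ω‖ₑ ≤ a := le_iSup₂ (f := fun ω (_ : ω ∈ O) => ‖f ω‖ₑ) ω hω
    rwa [Real.enorm_eq_ofReal_abs, ENNReal.ofReal_le_iff_le_toReal hfin.1] at this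
  have ha0 : 0 ≤ a.toReal := ENNReal.toReal_nonneg
  -- The Lipschitz extension is truncated at the sup norm of the original function; truncation is a
  -- contraction, so neither bound deteriorates.
  refine ⟨fun ω => max (-a.toReal) (min a.toReal (g ω)), fun ω hω => ?_, fun O' => ?_⟩
  · have h1 := hbd ω hω
    rw [abs_le] at h1
    rw [hgf hω] at h1 ⊢
    dsimp only
    rw [min_eq_right h1.2, max_eq_right h1.1]
  · have e : lipR γ O f = ENNReal.ofReal a.toReal + ENNReal.ofReal (γ * L.toReal) := by
      rw [ENNReal.ofReal_mul hγ.le, ENNReal.ofReal_toReal hfin.1, ENNReal.ofReal_toReal hLt]; rfl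
    rw [e]
    refine lipR_le hγ (fun ω _ => ?_) fun ω₁ _ ω₂ _ _ => ?_
    · rw [abs_le]
      exact ⟨le_max_left _ _, max_le (by linarith) (min_le_left _ _)⟩
    · have h1 := hg.dist_le_mul ω₁ ω₂
      rw [Real.dist_eq, dist_eq_norm] at h1
      have h2 : |max (-a.toReal) (min a.toReal (g ω₁)) - max (-a.toReal) (min a.toReal (g ω₂))|
          ≤ |g ω₁ - g ω₂| := by
        refine (abs_max_sub_max_le_max _ _ _ _).trans (max_le (by simp) ?_)
        exact (abs_min_sub_min_le_max _ _ _ _).trans (max_le (by simp) le_rfl)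
      refine h2.trans (h1.trans (le_of_eq ?_))
      rw [ENNReal.coe_toNNReal_eq_toReal]
      field_simp

/-! ### Symplectic conjugations -/

lemma kn_thOne (w : Idx P → ℝ≥0∞) (A : Op P) : kn w thOne A = kop w (ak A) := by
  simp [kn, thOne]; rfl

/-- `Φ` is a bounded symplectic conjugation of `ω·∂_φ + i diag(μ) + R` to
`ω·∂_φ + i diag(μ') + R'`, with inverse `Φi`. -/
structure SympConj (w : Idx P → ℝ≥0∞) (ω : Freq P) (μ : Site P → ℝ) (R : Op P)
    (μ' : Site P → ℝ) (R' : Op P) (Φ Φi : Op P) : Prop where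
  inv : IsInv Φ Φi
  fin : kop w (ak Φ) ≠ ⊤
  fin_inv : kop w (ak Φi) ≠ ⊤
  sharp_eq : sharp Φ = Φi
  sharp_inv_eq : sharp Φi = Φ
  conj : ∀ u : Idx P → ℂ, wn w (fun k => ‖u k‖ₑ) ≠ ⊤ →
    wn w (fun k => ‖linOp ω μ R u k‖ₑ) ≠ ⊤ → linOp ω μ' R' (app Φ u) = app Φ (linOp ω μ R u)
  conj_inv : ∀ u : Idx P → ℂ, wn w (fun k => ‖u k‖ₑ) ≠ ⊤ →
    wn w (fun k => ‖linOp ω μ' R' u k‖ₑ) ≠ ⊤ → linOp ω μ R (app Φi u) = app Φi (linOp ω μ' R' u)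

namespace SympConj

variable {w : Idx P → ℝ≥0∞} {ω : Freq P} {μ μ' μ'' : Site P → ℝ} {R R' R'' Φ Φi Φ' Φi' : Op P}

lemma refl (w : Idx P → ℝ≥0∞) (ω : Freq P) (μ : Site P → ℝ) (R : Op P) :
    SympConj w ω μ R μ R idOp idOp := by
  have h : kop w (ak (idOp : Op P)) ≠ ⊤ := by
    rw [← kn_thOne]
    exact ne_top_of_le_ne_top ENNReal.one_ne_top (kn_idOp_le (w := w) (θ := thOne))
  exact ⟨⟨idOp_comp _, idOp_comp _⟩, h, h, sharp_idOp, sharp_idOp,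
    fun u _ _ => by rw [app_idOp, app_idOp], fun u _ _ => by rw [app_idOp, app_idOp]⟩

lemma comp_ne_top (hw : PosFin w) {A B : Op P} (hA : kop w (ak A) ≠ ⊤) (hB : kop w (ak B) ≠ ⊤) :
    kop w (ak (comp A B)) ≠ ⊤ :=
  ne_top_of_le_ne_top (ENNReal.mul_ne_top hA hB) ((kop_mono (enorm_comp_le A B)).trans
    (kop_kcomp_le hw _ hB))

lemma trans (hw : PosFin w) (h : SympConj w ω μ R μ' R' Φ Φi)
    (h' : SympConj w ω μ' R' μ'' R'' Φ' Φi') :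
    SympConj w ω μ R μ'' R'' (comp Φ' Φ) (comp Φi Φi') := by
  have assoc : ∀ {A B C : Op P}, kop w (ak A) ≠ ⊤ → kop w (ak B) ≠ ⊤ → kop w (ak C) ≠ ⊤ →
      comp (comp A B) C = comp A (comp B C) := fun {A B C} hA hB hC =>
    comp_assoc (θ := thOne) hw (fun _ => le_rfl) (by rwa [kn_thOne]) (by rwa [kn_thOne])
      (by rwa [kn_thOne])
  have inv_comp : ∀ {A Ai B Bi : Op P}, kop w (ak A) ≠ ⊤ → kop w (ak Ai) ≠ ⊤ →
      kop w (ak B) ≠ ⊤ → kop w (ak Bi) ≠ ⊤ → comp A Ai = idOp → comp B Bi = idOp →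
      comp (comp B A) (comp Ai Bi) = idOp := fun {A Ai B Bi} hA hAi hB hBi e e' => by
    rw [assoc hB hA (comp_ne_top hw hAi hBi), ← assoc hA hAi hBi, e, idOp_comp, e']
  have app_fin : ∀ {A : Op P} {u : Idx P → ℂ}, kop w (ak A) ≠ ⊤ → wn w (fun k => ‖u k‖ₑ) ≠ ⊤ →
      wn w (fun k => ‖app A u k‖ₑ) ≠ ⊤ := fun {A u} hA hu =>
    ne_top_of_le_ne_top (ENNReal.mul_ne_top hA hu) (wn_enorm_app_le hw A hu)
  refine ⟨⟨inv_comp h.fin h.fin_inv h'.fin h'.fin_inv h.inv.1 h'.inv.1,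
    inv_comp h'.fin_inv h'.fin h.fin_inv h.fin h'.inv.2 h.inv.2⟩,
    comp_ne_top hw h'.fin h.fin, comp_ne_top hw h.fin_inv h'.fin_inv, ?_, ?_,
    fun u hu hLu => ?_, fun u hu hLu => ?_⟩
  · rw [sharp_comp, h.sharp_eq, h'.sharp_eq]
  · rw [sharp_comp, h.sharp_inv_eq, h'.sharp_inv_eq]
  · rw [app_comp_of_kop hw h'.fin h.fin hu, app_comp_of_kop hw h'.fin h.fin hLu,
      ← h.conj u hu hLu, h'.conj _ (app_fin h.fin hu)]
    rw [h.conj u hu hLu]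
    exact app_fin h.fin hLu
  · rw [app_comp_of_kop hw h.fin_inv h'.fin_inv hu, app_comp_of_kop hw h.fin_inv h'.fin_inv hLu,
      ← h'.conj_inv u hu hLu, h.conj_inv _ (app_fin h'.fin_inv hu)]
    rw [h'.conj_inv u hu hLu]
    exact app_fin h'.fin_inv hLu

lemma isSymp (hne : P.Nonempty) {s : ℝ} (hs : 0 ≤ s) (h : SympConj (sobW s) ω μ R μ' R' Φ Φi) :
    IsSymp Φ :=
  isSymp_of_sharp (secBdd_of_kop hne hs h.fin) (by rw [h.sharp_eq]; exact h.inv.2)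

lemma isSymp_inv (hne : P.Nonempty) {s : ℝ} (hs : 0 ≤ s)
    (h : SympConj (sobW s) ω μ R μ' R' Φ Φi) : IsSymp Φi :=
  isSymp_of_sharp (secBdd_of_kop hne hs h.fin_inv) (by rw [h.sharp_inv_eq]; exact h.inv.1)

/-- The intertwining relation is an identity of coefficients, so it suffices to prove it in the
largest of the spaces, that with the smallest regularity. -/
lemma toConj {s₁ : ℝ} (h : SympConj (sobW s₁) ω μ R μ' R' Φ Φi) (S : ℝ) :
    Conj s₁ S ω μ R μ' R' Φ Φi :=
  ⟨h.inv, fun _ hs u hu =>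
    ⟨fun hL => h.conj u ((sob_mono hs.1 u).trans_lt hu).ne ((sob_mono hs.1 _).trans_lt hL).ne,
      fun hL => h.conj_inv u ((sob_mono hs.1 u).trans_lt hu).ne
        ((sob_mono hs.1 _).trans_lt hL).ne⟩⟩

end SympConj

lemma StepElt.sympConj {W : Wt P} {b : Bool} {N : ℝ} {ω : Freq P} {μ : Site P → ℝ} {R : Op P}
    {x x' r z : BA W} (h : StepElt b N ω μ R x x' r z) :
    SympConj W.w ω μ R (μ + corr R) (newR N ω μ R) (expOp (psiOp N ω μ R))
      (expOp (-psiOp N ω μ R)) := by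
  have e1 : (NormedSpace.exp x).pr b = expOp (psiOp N ω μ R) := by rw [BA.pr_exp, h.x_eq]
  have e2 : (NormedSpace.exp (-x)).pr b = expOp (-psiOp N ω μ R) := by rw [BA.pr_exp_neg, h.x_eq]
  refine ⟨h.isInv, ?_, ?_, ?_, ?_, fun u hu hLu => h.linOp_exp hu hLu,
    fun u hu hLu => h.linOp_exp_neg hu hLu⟩
  · rw [← e1]; exact StepElt.kop_ak_pr_ne_top _
  · rw [← e2]; exact StepElt.kop_ak_pr_ne_top _
  · rw [← e1, ← e2]; exact h.sharp_exp
  · rw [← e1, ← e2]; exact h.sharp_exp_neg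

/-! ### Products of exponentials -/

/-- `exp(Ψ_{n-1}) ∘ ⋯ ∘ exp(Ψ_0)`. -/
def prodU (Ψ : ℕ → Op P) : ℕ → Op P
  | 0 => idOp
  | n + 1 => comp (expOp (Ψ n)) (prodU Ψ n)

/-- `exp(-Ψ_0) ∘ ⋯ ∘ exp(-Ψ_{n-1})`. -/
def prodUi (Ψ : ℕ → Op P) : ℕ → Op P
  | 0 => idOp
  | n + 1 => comp (prodUi Ψ n) (expOp (-Ψ n))

/-- The mixed term is absorbed because `‖u - 1‖ ≤ 1`. It costs a second `2ξ`, which gives the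
increment `4ξ` in the bound. -/
lemma norm_mul_sub_one_le {𝔸 : Type*} [NormedRing 𝔸] {y u : 𝔸} {ξ σ : ℝ} (hσ : 4 * σ ≤ 1)
    (hy : ‖y - 1‖ ≤ 2 * ξ) (hu : ‖u - 1‖ ≤ 4 * σ) :
    ‖y * u - 1‖ ≤ 4 * (σ + ξ) ∧ ‖u * y - 1‖ ≤ 4 * (σ + ξ) := by
  have hprod : ‖y - 1‖ * ‖u - 1‖ ≤ 2 * ξ := by
    have := norm_nonneg (y - 1)
    calc ‖y - 1‖ * ‖u - 1‖ ≤ ‖y - 1‖ * 1 := by gcongr; linarith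
      _ ≤ 2 * ξ := by linarith
  constructor
  · have e : y * u - 1 = (y - 1) * (u - 1) + (y - 1) + (u - 1) := by noncomm_ring
    rw [e]
    have h1 := norm_add₃_le (a := (y - 1) * (u - 1)) (b := y - 1) (c := u - 1)
    have h2 := norm_mul_le (y - 1) (u - 1)
    linarith
  · have e : u * y - 1 = (u - 1) * (y - 1) + (y - 1) + (u - 1) := by noncomm_ring
    rw [e]
    have h1 := norm_add₃_le (a := (u - 1) * (y - 1)) (b := y - 1) (c := u - 1)
    have h2 := norm_mul_le (u - 1) (y - 1)
    rw [mul_comm ‖u - 1‖] at h2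
    linarith

/-- Both products are built within the algebra of pairs, so the distance of the two transformations
from the identity and their mutual difference are estimated at once. -/
lemma exists_prodU {W : Wt P} {Ψ : Bool → ℕ → Op P} {ξ : ℕ → ℝ} {n : ℕ} (hξ0 : ∀ k, 0 ≤ ξ k)
    (hξ : ∀ m ≤ n, 4 * ∑ k ∈ Finset.range m, ξ k ≤ 1)
    (h : ∀ k < n, pn W.w W.θ W.κ (Ψ true k, Ψ false k) ≤ ENNReal.ofReal (ξ k)) :
    ∃ u v : BA W, (∀ b, u.pr b = prodU (Ψ b) n) ∧ (∀ b, v.pr b = prodUi (Ψ b) n) ∧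
      ‖u - 1‖ ≤ 4 * ∑ k ∈ Finset.range n, ξ k ∧ ‖v - 1‖ ≤ 4 * ∑ k ∈ Finset.range n, ξ k := by
  induction n with
  | zero =>
    exact ⟨1, 1, fun b => BA.pr_one b, fun b => BA.pr_one b, by simp, by simp⟩
  | succ n ih =>
    obtain ⟨u, v, hu, hv, hun, hvn⟩ := ih (fun m hm => hξ m (by omega)) fun k hk => h k (by omega)
    have hn := h n (Nat.lt_succ_self n)
    let x : BA W := BA.mk (Ψ true n) (Ψ false n) (ne_top_of_le_ne_top ENNReal.ofReal_ne_top hn)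
    have hx : ‖x‖ ≤ ξ n := (BA.norm_le_iff (hξ0 n)).2 hn
    have hsum := hξ (n + 1) le_rfl
    have hsn := hξ n (Nat.le_succ n)
    rw [Finset.sum_range_succ] at hsum
    have hnn : 0 ≤ ∑ k ∈ Finset.range n, ξ k := Finset.sum_nonneg fun k _ => hξ0 k
    have hx2 : ‖x‖ ≤ 1 / 2 := hx.trans (by linarith)
    have hxb : ∀ b, x.pr b = Ψ b n := fun b => by cases b <;> rfl
    have e1 : ‖NormedSpace.exp x - 1‖ ≤ 2 * ξ n := (norm_exp_sub_one_le hx2).trans (by linarith)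
    have e2 : ‖NormedSpace.exp (-x) - 1‖ ≤ 2 * ξ n :=
      (norm_exp_sub_one_le (by rwa [norm_neg])).trans (by rw [norm_neg]; linarith)
    refine ⟨NormedSpace.exp x * u, v * NormedSpace.exp (-x), fun b => ?_, fun b => ?_, ?_, ?_⟩
    · rw [BA.pr_mul, BA.pr_exp, hxb, hu]; rfl
    · rw [BA.pr_mul, BA.pr_exp_neg, hxb, hv]; rfl
    · rw [Finset.sum_range_succ]; exact (norm_mul_sub_one_le hsn e1 hun).1
    · rw [Finset.sum_range_succ]; exact (norm_mul_sub_one_le hsn e2 hvn).2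

/-- Beyond the first step the exponent `3τ₁/2 - a` is at most `-1`, so the sizes of the generators
decay geometrically and their sum is dominated by the first one, of order `N₀^{τ₁}`. -/
lemma scaleN_rpow_mul_le {N₀ : ℕ} (hN : 4 ≤ N₀) {τ : ℝ} (hτ : 0 < τ) (k : ℕ) :
    scaleN N₀ (k : ℤ) ^ tauOne τ * scaleN N₀ ((k : ℤ) - 1) ^ (-aExp τ)
      ≤ (N₀ : ℝ) ^ tauOne τ * (1 / 2) ^ k := by
  have hN1 : (1 : ℝ) ≤ N₀ := by exact_mod_cast le_trans (by norm_num) hN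
  have ht : 1 ≤ tauOne τ := by rw [tauOne]; linarith
  cases k with
  | zero =>
    rw [scaleN_zero_sub_one, Real.one_rpow, scaleN_natCast]; simp
  | succ k =>
    rcases scaleN_cases N₀ (le_trans (by norm_num) hN) (k + 1) with ⟨h1, h2⟩ | ⟨h1, h2⟩
    · have := two_pow_le_scaleN hN (k + 1)
      rw [h1] at this
      have h3 : (1 : ℝ) < 2 ^ (k + 1) := one_lt_pow₀ (by norm_num) (by omega)
      linarith
    · have h4 := two_pow_le_scaleN hN (k + 1)
      set M := scaleN N₀ (((k + 1 : ℕ) : ℤ) - 1) with hM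
      have hM1 : 1 ≤ M := hN1.trans h2
      have hMp : 0 < M := by linarith
      rw [h1, ← Real.rpow_mul hMp.le, ← Real.rpow_add hMp]
      calc M ^ (3 / 2 * tauOne τ + -aExp τ) ≤ M ^ (-1 : ℝ) :=
            Real.rpow_le_rpow_of_exponent_le hM1 (by rw [aExp]; linarith)
        _ = M⁻¹ := Real.rpow_neg_one M
        _ ≤ (2 ^ (k + 1))⁻¹ := inv_anti₀ (by positivity) h4
        _ = 1 * (1 / 2) ^ (k + 1) := by rw [one_mul, one_div, inv_pow]
        _ ≤ _ := by
            gcongr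
            exact Real.one_le_rpow hN1 (by linarith)

lemma sum_geom_half_le (n : ℕ) : ∑ k ∈ Finset.range n, (1 / 2 : ℝ) ^ k ≤ 2 := by
  have h := Summable.sum_le_tsum (Finset.range n) (fun k _ => by positivity) summable_geometric_two
  rwa [tsum_geometric_two] at h

/-- The generators along the iteration. -/
def psiRun (N₀ : ℕ) (ω : Freq P) (μ : Site P → ℝ) (R : Op P) (ν : ℕ) : Op P :=
  psiOp (scaleN N₀ (ν : ℤ)) ω (μ + (run N₀ ω μ R ν).1) (run N₀ ω μ R ν).2

/-! ### The accumulated transformation for a pair of operators -/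

section iteration

variable {w : Idx P → ℝ≥0∞} {τ γ κ c₀ c₁ e E : ℝ} {N₀ : ℕ} {ω : Bool → Freq P}
  {μ : Bool → Site P → ℝ} {R : Bool → Op P} {ν n : ℕ}

lemma pn_prodU_le (hw : PosFin w) (hκ : 0 < κ) (hs : Small τ γ c₀ c₁ e E N₀)
    (h0 : PairStart w τ γ κ c₀ c₁ e ω μ R)
    (hm : ∀ b, Mel τ (γ / 2) N₀ (ω b) (μ b) (R b) n) :
    pn w thOne (ENNReal.ofReal κ)
      (prodU (psiRun N₀ (ω true) (μ true) (R true)) n - idOp,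
        prodU (psiRun N₀ (ω false) (μ false) (R false)) n - idOp)
      ≤ ENNReal.ofReal (2 ^ (bExp τ + 4) * homC c₀ c₁ * γ⁻¹ * (N₀ : ℝ) ^ tauOne τ * e) ∧
    pn w thOne (ENNReal.ofReal κ)
      (prodUi (psiRun N₀ (ω true) (μ true) (R true)) n - idOp,
        prodUi (psiRun N₀ (ω false) (μ false) (R false)) n - idOp)
      ≤ ENNReal.ofReal (2 ^ (bExp τ + 4) * homC c₀ c₁ * γ⁻¹ * (N₀ : ℝ) ^ tauOne τ * e) := by
  have hγ := hs.γ_pos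
  have he := hs.e_nonneg
  have hE := hs.E_nonneg
  have hh := hs.homC_ge
  have hN0 : (0 : ℝ) < N₀ := by exact_mod_cast lt_of_lt_of_le (by norm_num) hs.four_le
  set B := 2 ^ (bExp τ + 1) * homC c₀ c₁ * γ⁻¹ * (N₀ : ℝ) ^ tauOne τ * e with hB
  have hB0 : 0 ≤ B := by positivity
  -- Only the low norm is needed here, so the parameter is zero and the weight is the constant
  -- `2^{b+1}`, which still satisfies the submultiplicativity condition.
  let W := wtT w hw (bExp τ) 0 le_rfl κ
  have hθ : ∀ l : Mode P, W.θ l = ENNReal.ofReal (2 ^ (bExp τ + 1)) := fun l => by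
    change thT (bExp τ) 0 l = _
    simp [thT]
  have hsum : ∀ m, 4 * ∑ k ∈ Finset.range m, B * (1 / 2) ^ k ≤ 8 * B := fun m => by
    rw [← Finset.mul_sum]
    nlinarith [sum_geom_half_le m]
  -- This keeps the partial sums of the generators below the threshold of `exists_prodU`; the final
  -- constant `2^{b+4}` is `8 · 2^{b+1}`.
  have hsmall : 8 * B ≤ 1 := by
    have heE : γ⁻¹ * e ≤ E := by rw [inv_mul_le_iff₀ hγ]; exact hs.e_le
    have h1 := hs.small
    have h2 : (N₀ : ℝ) ^ (-(tauOne τ + aExp τ)) * (N₀ : ℝ) ^ tauOne τ ≤ 1 := by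
      rw [← Real.rpow_add hN0]
      refine Real.rpow_le_one_of_one_le_of_nonpos ?_ (by linarith [aExp_ge_one hs.τ_pos])
      exact_mod_cast le_trans (by norm_num) hs.four_le
    have h3 : 0 ≤ (N₀ : ℝ) ^ tauOne τ := by positivity
    have h4 : (2 : ℝ) ^ (bExp τ + 1) ≤ 2 ^ (2 * bExp τ + 4) :=
      pow_le_pow_right₀ (by norm_num) (by omega)
    calc 8 * B = 8 * (2 ^ (bExp τ + 1) * homC c₀ c₁ * (γ⁻¹ * e) * (N₀ : ℝ) ^ tauOne τ) := by
          rw [hB]; ring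
      _ ≤ 14 * (2 ^ (2 * bExp τ + 4) * homC c₀ c₁ * E * (N₀ : ℝ) ^ tauOne τ) := by
          gcongr; norm_num
      _ = smallC τ c₀ c₁ * E * (N₀ : ℝ) ^ tauOne τ := by rw [smallC]; ring
      _ ≤ 1 / 2 * (N₀ : ℝ) ^ (-(tauOne τ + aExp τ)) * (N₀ : ℝ) ^ tauOne τ := by gcongr
      _ ≤ 1 := by linarith
  have hpn : ∀ k < n, pn W.w W.θ W.κ (psiRun N₀ (ω true) (μ true) (R true) k,
      psiRun N₀ (ω false) (μ false) (R false) k) ≤ ENNReal.ofReal (B * (1 / 2) ^ k) := by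
    intro k hk
    have hmk : ∀ b, Mel τ (γ / 2) N₀ (ω b) (μ b) (R b) (k + 1) := fun b m hm' =>
      hm b m (by omega)
    have hik := pairInv_of_mel hw hκ hs h0 k fun b m hm' => hm b m (by omega)
    have h1 := (pn_psi_of_inv hw hκ hs h0 hik hmk thOne).trans (mul_le_mul_right hik.pn_one _)
    have h2 := pn_weight_le (B := ENNReal.ofReal (2 ^ (bExp τ + 1))) (θ := thOne) (θ' := W.θ) hw hκ
      (fun l => by rw [hθ, thOne, mul_one]) (psiRun N₀ (ω true) (μ true) (R true) k,
        psiRun N₀ (ω false) (μ false) (R false) k)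
    refine h2.trans ((mul_le_mul_right h1 _).trans ?_)
    have hsN := scaleN_nonneg N₀ (k : ℤ)
    have hsN' := scaleN_nonneg N₀ ((k : ℤ) - 1)
    rw [← ENNReal.ofReal_mul (by positivity), ← ENNReal.ofReal_mul (by positivity)]
    refine ENNReal.ofReal_le_ofReal ?_
    calc 2 ^ (bExp τ + 1) * (homC c₀ c₁ / γ * scaleN N₀ (k : ℤ) ^ tauOne τ
          * (e * scaleN N₀ ((k : ℤ) - 1) ^ (-aExp τ)))
        = 2 ^ (bExp τ + 1) * homC c₀ c₁ * γ⁻¹ * e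
          * (scaleN N₀ (k : ℤ) ^ tauOne τ * scaleN N₀ ((k : ℤ) - 1) ^ (-aExp τ)) := by
          rw [div_eq_mul_inv]; ring
      _ ≤ 2 ^ (bExp τ + 1) * homC c₀ c₁ * γ⁻¹ * e * ((N₀ : ℝ) ^ tauOne τ * (1 / 2) ^ k) := by
          exact mul_le_mul_of_nonneg_left (scaleN_rpow_mul_le hs.four_le hs.τ_pos k)
            (by positivity)
      _ = _ := by rw [hB]; ring
  obtain ⟨u, v, hu, hv, hun, hvn⟩ := exists_prodU (W := W)
    (Ψ := fun b => psiRun N₀ (ω b) (μ b) (R b)) (ξ := fun k => B * (1 / 2) ^ k)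
    (fun k => by positivity) (fun m _ => (hsum m).trans hsmall) hpn
  have conv : ∀ x : BA W, ‖x‖ ≤ 4 * ∑ k ∈ Finset.range n, B * (1 / 2) ^ k →
      pn w thOne (ENNReal.ofReal κ) (x.pr true, x.pr false)
        ≤ ENNReal.ofReal (2 ^ (bExp τ + 4) * homC c₀ c₁ * γ⁻¹ * (N₀ : ℝ) ^ tauOne τ * e) :=
    fun x hx => by
      have h1 := (BA.norm_le_iff (by positivity)).1 (hx.trans (hsum n))
      have h2 := pn_weight_le (B := 1) (θ := W.θ) (θ' := thOne) hw hκ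
        (fun l => by rw [one_mul]; exact W.one_le l) (x.fst, x.snd)
      rw [one_mul] at h2
      refine h2.trans (h1.trans (le_of_eq ?_))
      congr 1
      rw [hB, pow_add _ _ 1, pow_add _ _ 4]; ring
  refine ⟨?_, ?_⟩
  · have := conv (u - 1) hun
    simpa only [BA.pr_sub, BA.pr_one, hu] using this
  · have := conv (v - 1) hvn
    simpa only [BA.pr_sub, BA.pr_one, hv] using this

end iteration

/-! ### Conjugations for a single operator -/

section single

variable {w : Idx P → ℝ≥0∞} {τ γ c₀ c₁ e E : ℝ} {N₀ : ℕ} {ω : Freq P}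
  {μ : Site P → ℝ} {R : Op P} {ν n : ℕ}

/-- The algebraic facts for one operator are the pair statement applied to the constant pair, with
`κ = 1`. -/
lemma sympConj_of_mel (hw : PosFin w) (hs : Small τ γ c₀ c₁ e E N₀)
    (h0 : PairStart w τ γ 1 c₀ c₁ e (fun _ => ω) (fun _ => μ) (fun _ => R))
    (hm : Mel τ (γ / 2) N₀ ω μ R (ν + 1)) :
    IsHam (psiRun N₀ ω μ R ν) ∧
    SympConj w ω (μ + (run N₀ ω μ R ν).1) (run N₀ ω μ R ν).2 (μ + (run N₀ ω μ R (ν + 1)).1)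
      (run N₀ ω μ R (ν + 1)).2 (expOp (psiRun N₀ ω μ R ν)) (expOp (-psiRun N₀ ω μ R ν)) := by
  have hi := pairInv_of_mel hw one_pos hs h0 ν fun _ m hm' => hm m (by omega)
  obtain ⟨x, x', r, z, hst, -⟩ := exists_stepElt_of_inv hw one_pos hs h0 hi fun _ => hm
  refine ⟨by rw [psiRun, ← (hst true).x_eq]; exact (hst true).isHam_psi, ?_⟩
  have := (hst true).sympConj
  simp only [run, psiRun]
  rw [← add_assoc]
  exact this

lemma sympConj_prodU (hw : PosFin w) (hs : Small τ γ c₀ c₁ e E N₀)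
    (h0 : PairStart w τ γ 1 c₀ c₁ e (fun _ => ω) (fun _ => μ) (fun _ => R))
    (hm : Mel τ (γ / 2) N₀ ω μ R n) :
    SympConj w ω μ R (μ + (run N₀ ω μ R n).1) (run N₀ ω μ R n).2 (prodU (psiRun N₀ ω μ R) n)
      (prodUi (psiRun N₀ ω μ R) n) := by
  induction n with
  | zero =>
    have := SympConj.refl w ω μ R
    simpa [run, prodU, prodUi] using this
  | succ n ih =>
    exact (ih fun m hm' => hm m (by omega)).trans hw (sympConj_of_mel hw hs h0 hm).2

end single

/-! ### The initial operators as starting point of the iteration -/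

/-- The exponent in the smallness condition. -/
def tauBar (τ : ℝ) : ℝ := tauOne τ + aExp τ + 1

/-- The constant in the Lipschitz estimate of the unperturbed eigenvalues. -/
def muC (K : ℝ) : ℝ := K * ((2 * Real.pi) ^ 3 + 2 * Real.pi + 2)

/-- The standing assumptions. -/
structure Setting (d : InitData P) (τ σ μ₀ ε γ K S KS : ℝ) (N₀ : ℕ) : Prop where
  adm : Admissible d τ σ μ₀ ε γ K S KS
  τ_pos : 0 < τ
  ε_pos : 0 < ε
  γ_pos : 0 < γ
  γ_lt : γ < 1
  ε_le : ε * γ⁻¹ ^ 3 ≤ 1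
  K_pos : 0 < K
  KS_pos : 0 < KS
  lt_S : sM P τ < S
  le_μ₀ : sM P τ + muB P τ σ ≤ μ₀
  four_le : 4 ≤ N₀
  N_ge : 12 * smallC τ P.card (muC K) * initC P ≤ N₀

/-- The tori satisfying the ansatz and the smallness condition. -/
structure Good (d : InitData P) (τ μ₀ ε γ K : ℝ) (N₀ : ℕ) (i : Torus P) : Prop where
  ansatz : Ansatz d τ μ₀ ε γ K i
  small : (N₀ : ℝ) ^ tauBar τ * d.M0 i (sM P τ) * γ⁻¹ ≤ 1

/-- The size `γ N₀^{-τbar}`. -/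
def eta (τ γ : ℝ) (N₀ : ℕ) : ℝ := γ * (N₀ : ℝ) ^ (-tauBar τ)

lemma muC_nonneg {K : ℝ} (hK : 0 ≤ K) : 0 ≤ muC K := by
  have := Real.pi_pos
  unfold muC; positivity

lemma abs_site_ge_one (j : Site P) : (1 : ℝ) ≤ |(j.1 : ℝ)| := by
  exact_mod_cast Int.one_le_abs j.2.1

lemma abs_sub_le_abs_cube_sub (j j' : Site P) :
    |(j.1 : ℝ) - (j'.1 : ℝ)| ≤ |(j.1 : ℝ) ^ 3 - (j'.1 : ℝ) ^ 3| := by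
  have h1 : (1 : ℝ) ≤ (j.1 : ℝ) ^ 2 := by
    rw [← sq_abs]; exact one_le_pow₀ (abs_site_ge_one j)
  have h2 : (1 : ℝ) ≤ (j'.1 : ℝ) ^ 2 := by
    rw [← sq_abs]; exact one_le_pow₀ (abs_site_ge_one j')
  have e : (j.1 : ℝ) ^ 3 - (j'.1 : ℝ) ^ 3
      = ((j.1 : ℝ) - (j'.1 : ℝ)) * ((j.1 : ℝ) ^ 2 + (j.1 : ℝ) * (j'.1 : ℝ) + (j'.1 : ℝ) ^ 2) := by
    ring
  rw [e, abs_mul]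
  refine le_mul_of_one_le_right (abs_nonneg _) (le_trans ?_ (le_abs_self _))
  nlinarith [sq_nonneg ((j.1 : ℝ) + (j'.1 : ℝ))]

lemma abs_dot_sub_le (ω₁ ω₂ : Freq P) (l : Mode P) :
    |dot ω₁ l - dot ω₂ l| ≤ ‖ω₁ - ω₂‖ * P.card * ‖l‖ := by
  have e : dot ω₁ l - dot ω₂ l = ∑ n, (ω₁ n - ω₂ n) * (l n : ℝ) := by
    simp only [dot, ← Finset.sum_sub_distrib, sub_mul]
  rw [e]
  refine (Finset.abs_sum_le_sum_abs _ _).trans ?_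
  have h : ∀ n ∈ (Finset.univ : Finset P), |(ω₁ n - ω₂ n) * (l n : ℝ)| ≤ ‖ω₁ - ω₂‖ * ‖l‖ :=
    fun n _ => by
      rw [abs_mul]
      refine mul_le_mul ?_ ?_ (abs_nonneg _) (norm_nonneg _)
      · have := PiLp.norm_apply_le (ω₁ - ω₂) n
        simpa using this
      · have := norm_le_pi_norm l n
        rwa [Int.norm_eq_abs] at this
  refine (Finset.sum_le_sum h).trans (le_of_eq ?_)
  rw [Finset.sum_const, Finset.card_univ, Fintype.card_coe, nsmul_eq_mul]
  ring

lemma commDx_sub (A B : Op P) : commDx (A - B) = commDx A - commDx B := by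
  funext l j j'; simp only [commDx, Pi.sub_apply]; ring

lemma dPhi_sub (m : P) (k : ℕ) (A B : Op P) : dPhi m k (A - B) = dPhi m k A - dPhi m k B := by
  funext l j j'; simp only [dPhi, Pi.sub_apply]; ring

/-- The cubic and the linear terms scale with `|j³-j'³|` and `|j-j'| ≤ |j³-j'³|`, and the bounded
terms with `1 ≤ |j³-j'³|` for distinct sites. This makes the variation of eigenvalue differences
proportional to the factor in the Melnikov conditions. -/
lemma abs_eigZero_diff_le {a b a' b' : ℝ} {q q' : Site P → ℝ} {x y : ℝ} (j j' : Site P)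
    (ha : |a - a'| ≤ x) (hb : |b - b'| ≤ x) (hq : ∀ k, |q k - q' k| ≤ y) (hyx : y ≤ x) :
    |(eigZero a b q j - eigZero a b q j') - (eigZero a' b' q' j - eigZero a' b' q' j')|
      ≤ x * ((2 * Real.pi) ^ 3 + 2 * Real.pi + 2) * |(j.1 : ℝ) ^ 3 - (j'.1 : ℝ) ^ 3| := by
  by_cases hjj : j = j'
  · subst hjj; simp
  have hD := one_le_abs_cube_sub hjj
  have hD' := abs_sub_le_abs_cube_sub j j'
  set D := |(j.1 : ℝ) ^ 3 - (j'.1 : ℝ) ^ 3| with hDdef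
  have hπ := Real.pi_pos
  have hx : 0 ≤ x := (abs_nonneg _).trans ha
  have e : (eigZero a b q j - eigZero a b q j') - (eigZero a' b' q' j - eigZero a' b' q' j')
      = (a - a') * ((2 * Real.pi) ^ 3 * ((j.1 : ℝ) ^ 3 - (j'.1 : ℝ) ^ 3))
        - (b - b') * (2 * Real.pi * ((j.1 : ℝ) - (j'.1 : ℝ)))
        - ((q j - q' j) - (q j' - q' j')) := by
    simp only [eigZero]; ring
  rw [e]
  have h1 : |(a - a') * ((2 * Real.pi) ^ 3 * ((j.1 : ℝ) ^ 3 - (j'.1 : ℝ) ^ 3))|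
      ≤ x * ((2 * Real.pi) ^ 3 * D) := by
    rw [abs_mul, abs_mul, abs_of_pos (by positivity : 0 < (2 * Real.pi) ^ 3)]
    gcongr
  have h2 : |(b - b') * (2 * Real.pi * ((j.1 : ℝ) - (j'.1 : ℝ)))| ≤ x * (2 * Real.pi * D) := by
    rw [abs_mul, abs_mul, abs_of_pos (by positivity : 0 < 2 * Real.pi)]
    gcongr
  have h3 : |(q j - q' j) - (q j' - q' j')| ≤ x * D + x * D :=
    (abs_sub _ _).trans (add_le_add ((hq j).trans (by nlinarith)) ((hq j').trans (by nlinarith)))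
  calc _ ≤ x * ((2 * Real.pi) ^ 3 * D) + x * (2 * Real.pi * D) + (x * D + x * D) :=
        (abs_sub _ _).trans (add_le_add ((abs_sub _ _).trans (add_le_add h1 h2)) h3)
    _ = _ := by ring

lemma DC_subset {Om : Set (Freq P)} {g g' τ : ℝ} (h : g ≤ g') : DC Om g' τ ⊆ DC Om g τ := by
  rintro ω ⟨h1, h2⟩
  refine ⟨h1, fun l hl => le_trans ?_ (h2 l hl)⟩
  have := one_le_jap l
  gcongr

/-! ### Initial estimates under the standing assumptions -/

section setting

variable {d : InitData P} {τ σ μ₀ ε γ K S KS : ℝ} {N₀ : ℕ}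

namespace Setting

lemma one_le_N (h : Setting d τ σ μ₀ ε γ K S KS N₀) : (1 : ℝ) ≤ N₀ := by
  exact_mod_cast le_trans (by norm_num) h.four_le

lemma eta_pos (h : Setting d τ σ μ₀ ε γ K S KS N₀) : 0 < eta τ γ N₀ := by
  have := h.one_le_N
  have := h.γ_pos
  unfold eta; positivity

/-- The condition `εγ⁻³ ≤ 1` is what makes the `Lip(γ)` size `εγ⁻²` of `m₁` at most `γ`, as required
for the variation of the divisors. -/
lemma ε_div_le (h : Setting d τ σ μ₀ ε γ K S KS N₀) : ε * γ⁻¹ ^ 2 ≤ γ := by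
  have hγ := h.γ_pos
  have h1 := h.ε_le
  have e : ε * γ⁻¹ ^ 2 = (ε * γ⁻¹ ^ 3) * γ := by field_simp
  rw [e]
  exact mul_le_of_le_one_left hγ.le h1

lemma ε_le_div (h : Setting d τ σ μ₀ ε γ K S KS N₀) : ε ≤ ε * γ⁻¹ ^ 2 := by
  have hγ := h.γ_pos
  refine le_mul_of_one_le_right h.ε_pos.le (one_le_pow₀ ?_)
  exact (one_le_inv₀ hγ).2 h.γ_lt.le

lemma sM_mem (h : Setting d τ σ μ₀ ε γ K S KS N₀) : sM P τ ∈ Set.Icc (sM P τ) S :=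
  ⟨le_rfl, h.lt_S.le⟩

lemma M0_mono (h : Setting d τ σ μ₀ ε γ K S KS N₀) {i : Torus P} (hi : Ansatz d τ μ₀ ε γ K i) :
    MonotoneOn (d.M0 i) (Set.Icc (sM P τ) S) := (h.adm.R0_tame i hi id (Or.inl rfl)).1.1

lemma M0_nonneg (h : Setting d τ σ μ₀ ε γ K S KS N₀) {i : Torus P} (hi : Ansatz d τ μ₀ ε γ K i) :
    ∀ s ∈ Set.Icc (sM P τ) S, 0 ≤ d.M0 i s := (h.adm.R0_tame i hi id (Or.inl rfl)).1.2.1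

lemma M0_le_eta (h : Setting d τ σ μ₀ ε γ K S KS N₀) {i : Torus P}
    (hi : Good d τ μ₀ ε γ K N₀ i) : d.M0 i (sM P τ) ≤ eta τ γ N₀ := by
  have hγ := h.γ_pos
  have hN : (0 : ℝ) < N₀ := by linarith [h.one_le_N]
  have h1 := hi.small
  have hp : 0 < (N₀ : ℝ) ^ tauBar τ := by positivity
  rw [eta, Real.rpow_neg hN.le, ← div_eq_mul_inv, le_div_iff₀ hp]
  rw [← div_eq_mul_inv, div_le_one hγ, mul_comm] at h1
  exact h1

/-- The last `1` in the exponent `τbar = τ₁ + a + 1` supplies a factor `N₀⁻¹`, which absorbs all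
constants through the lower bound on `N₀`. The margin `m ≤ 2η` leaves room for perturbing the tame
constants by up to `η`. -/
lemma toSmall (h : Setting d τ σ μ₀ ε γ K S KS N₀) {m : ℝ} (hm0 : 0 ≤ m)
    (hm : m ≤ 2 * eta τ γ N₀) :
    Small τ γ P.card (muC K) (3 * initC P * m) (6 * initC P * (N₀ : ℝ) ^ (-tauBar τ)) N₀ := by
  have hc := initC_pos (P := P)
  have hN1 := h.one_le_N
  have hN : (0 : ℝ) < N₀ := by linarith
  refine ⟨h.four_le, h.γ_pos, h.τ_pos, Nat.cast_nonneg _, muC_nonneg h.K_pos.le, by positivity, ?_, ?_⟩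
  · calc 3 * initC P * m ≤ 3 * initC P * (2 * eta τ γ N₀) := by gcongr
      _ = _ := by rw [eta]; ring
  · have e : (N₀ : ℝ) ^ (-tauBar τ) = (N₀ : ℝ) ^ (-(tauOne τ + aExp τ)) * (N₀ : ℝ)⁻¹ := by
      rw [tauBar, neg_add, Real.rpow_add hN, Real.rpow_neg_one]
    have hp : 0 < (N₀ : ℝ) ^ (-(tauOne τ + aExp τ)) := by positivity
    have hg := h.N_ge
    calc smallC τ P.card (muC K) * (6 * initC P * (N₀ : ℝ) ^ (-tauBar τ))
        = 1 / 2 * (12 * smallC τ P.card (muC K) * initC P)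
          * ((N₀ : ℝ) ^ (-(tauOne τ + aExp τ)) * (N₀ : ℝ)⁻¹) := by rw [e]; ring
      _ ≤ 1 / 2 * N₀ * ((N₀ : ℝ) ^ (-(tauOne τ + aExp τ)) * (N₀ : ℝ)⁻¹) := by gcongr
      _ = _ := by field_simp

lemma mu0_odd (h : Setting d τ σ μ₀ ε γ K S KS N₀) (i : Torus P) {ω : Freq P} (hω : ω ∈ d.Om)
    (j : Site P) : d.mu0 i ω (-j) = -d.mu0 i ω j := by
  simp only [InitData.mu0, eigZero, site_neg_val, Int.cast_neg, h.adm.q_odd j ω hω]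
  ring

lemma abs_q_sub_le (h : Setting d τ σ μ₀ ε γ K S KS N₀) {ω₁ ω₂ : Freq P} (h₁ : ω₁ ∈ d.Om)
    (h₂ : ω₂ ∈ d.Om) (j : Site P) : |d.q j ω₁ - d.q j ω₂| ≤ K * ‖ω₁ - ω₂‖ := by
  by_cases hne : ω₁ = ω₂
  · subst hne; simp
  have hK := h.K_pos
  have h3 : lipSemi (fun x : ℝ => ‖x‖ₑ) d.Om (d.q j) ≤ ENNReal.ofReal K :=
    le_trans (le_mul_of_one_le_left' (by
      rw [ENNReal.one_le_ofReal]; exact abs_site_ge_one j)) (h.adm.q_lip j)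
  have h4 := (diff_le_lipSemi (N := fun x : ℝ => ‖x‖ₑ) (f := d.q j) h₁ h₂ hne).trans
    (mul_le_mul_right h3 _)
  rw [Real.enorm_eq_ofReal_abs, ← ENNReal.ofReal_mul (norm_nonneg _),
    ENNReal.ofReal_le_ofReal_iff (by positivity), mul_comm] at h4
  exact h4

/-- Column bounds for the initial remainder. -/
lemma col_init (h : Setting d τ σ μ₀ ε γ K S KS N₀) {i : Torus P} (hi : Ansatz d τ μ₀ ε γ K i)
    {s t m : ℝ} (hs : s ∈ Set.Icc (sM P τ) S) (ht : 0 ≤ t) (hm : d.M0 i (sM P τ) ≤ m)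
    (htm : t * d.M0 i s ≤ m) :
    (∀ ω ∈ DC d.Om (γ / 2) τ, kn (tameW (sM P τ) s t) (thB (bExp τ)) (d.R0 i ω)
      ≤ ENNReal.ofReal (3 * initC P * m)) ∧
    ∀ ω₁ ∈ DC d.Om (γ / 2) τ, ∀ ω₂ ∈ DC d.Om (γ / 2) τ,
      kn (tameW (sM P τ) s t) (thB (bExp τ)) (d.R0 i ω₁ - d.R0 i ω₂)
      ≤ ENNReal.ofReal (‖ω₁ - ω₂‖ / γ) * ENNReal.ofReal (3 * initC P * m) := by
  have hγ := h.γ_pos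
  have hc := initC_pos (P := P)
  have key := fun T hT => h.adm.R0_tame i hi T hT
  have e : ENNReal.ofReal (3 * initC P * m)
      = ENNReal.ofReal (initC P) * ENNReal.ofReal (3 * m) := by
    rw [← ENNReal.ofReal_mul hc.le]; congr 1; ring
  refine ⟨fun ω hω => ?_, fun ω₁ h₁ ω₂ h₂ => ?_⟩
  · rw [e]
    exact kn_thB_le_of_col fun T hT => ⟨((key T hT).1.col hγ hs ht hm htm).1 ω hω,
      fun n => (((key T hT).2 n).2.col hγ hs ht hm htm).1 ω hω⟩
  · by_cases hne : ω₁ = ω₂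
    · subst hne; rw [sub_self, kn_zero]; exact zero_le
    rw [e, mul_left_comm]
    refine kn_thB_le_of_col fun T hT => ?_
    have hT' : T (d.R0 i ω₁ - d.R0 i ω₂) = T (d.R0 i ω₁) - T (d.R0 i ω₂) := by
      rcases hT with rfl | rfl
      · rfl
      · exact commDx_sub _ _
    refine ⟨?_, fun n => ?_⟩
    · rw [hT']
      exact ((key T hT).1.col hγ hs ht hm htm).2 ω₁ h₁ ω₂ h₂ hne
    · rw [hT', dPhi_sub]
      exact (((key T hT).2 n).2.col hγ hs ht hm htm).2 ω₁ h₁ ω₂ h₂ hne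

/-- Two frequencies and one torus. -/
lemma pairStart_freq (h : Setting d τ σ μ₀ ε γ K S KS N₀) {i : Torus P}
    (hi : Ansatz d τ μ₀ ε γ K i)
    {s t m κ : ℝ} (hs : s ∈ Set.Icc (sM P τ) S) (ht : 0 ≤ t) (hm : d.M0 i (sM P τ) ≤ m)
    (htm : t * d.M0 i s ≤ m) (hκ : 0 < κ) {ω : Bool → Freq P}
    (hω : ∀ b, ω b ∈ DC d.Om (γ / 2) τ) (hωκ : ‖ω true - ω false‖ ≤ κ * γ) :
    PairStart (tameW (sM P τ) s t) τ γ κ P.card (muC K) (3 * initC P * m) ω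
      (fun b => d.mu0 i (ω b)) (fun b => d.R0 i (ω b)) := by
  have hγ := h.γ_pos
  have hK := h.K_pos
  have hε := h.ε_pos
  obtain ⟨c1, c2⟩ := h.col_init hi hs ht hm htm
  have hpn : pn (tameW (sM P τ) s t) (thB (bExp τ)) (ENNReal.ofReal κ)
      (d.R0 i (ω true), d.R0 i (ω false)) ≤ ENNReal.ofReal (3 * initC P * m) := by
    refine pn_le_iff.2 ⟨c1 _ (hω true), c1 _ (hω false), ?_⟩
    rw [ENNReal.inv_mul_le_iff (by simpa using hκ) ENNReal.ofReal_ne_top]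
    refine (c2 _ (hω true) _ (hω false)).trans (mul_le_mul_left (ENNReal.ofReal_le_ofReal ?_) _)
    rw [div_le_iff₀ hγ]; exact hωκ
  refine ⟨fun b j => h.mu0_odd i (hω b).1 j, fun b => h.adm.R0_ham i hi _ (hω b),
    fun b l hl => (hω b).2 l hl, fun l => ?_, fun j j' => ?_, (pn_thOne_le_thB _ _).trans hpn, hpn⟩
  · refine (abs_dot_sub_le _ _ l).trans ?_
    gcongr
  · have hx : ‖ω true - ω false‖ / γ ≤ κ := by rw [div_le_iff₀ hγ]; exact hωκ
    have hεγ := h.ε_div_le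
    have hεl := h.ε_le_div
    have e1 : |d.m3 i (ω true) - d.m3 i (ω false)| ≤ K * (κ * γ) := by
      have := abs_sub_le_of_lipR hγ (by positivity) (h.adm.m3_lip i hi) (hω true).1 (hω false).1
      rw [add_sub_add_right_eq_sub] at this
      calc _ ≤ ‖ω true - ω false‖ / γ * (K * ε) := this
        _ ≤ κ * (K * γ) := by gcongr; linarith
        _ = _ := by ring
    have e2 : |d.m1 i (ω true) - d.m1 i (ω false)| ≤ K * (κ * γ) := by
      have := abs_sub_le_of_lipR hγ (by positivity) (h.adm.m1_lip i hi) (hω true) (hω false)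
      calc _ ≤ ‖ω true - ω false‖ / γ * (K * ε * γ⁻¹ ^ 2) := this
        _ ≤ κ * (K * γ) := by rw [mul_assoc K]; gcongr
        _ = _ := by ring
    have := abs_eigZero_diff_le j j' e1 e2
      (fun k => h.abs_q_sub_le (hω true).1 (hω false).1 k) (by gcongr)
    refine this.trans (le_of_eq ?_)
    rw [muC]; ring

/-- Two tori and one frequency. -/
lemma pairStart_torus (h : Setting d τ σ μ₀ ε γ K S KS N₀) {i : Bool → Torus P}
    (hi : ∀ b, Good d τ μ₀ ε γ K N₀ (i b)) {κ D : ℝ} (hκ : 0 < κ) (hD : 0 ≤ D) {ω : Freq P}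
    (hω : ω ∈ DC d.Om (γ / 2) τ)
    (hdist : Torus.dist (sM P τ + muB P τ σ) (i true) (i false) ω ≤ ENNReal.ofReal D)
    (hDκ : D ≤ κ * γ) (hKD : initC P * (KS * D) ≤ κ * (3 * initC P * (2 * eta τ γ N₀))) :
    PairStart (sobW (sM P τ)) τ γ κ P.card (muC K) (3 * initC P * (2 * eta τ γ N₀)) (fun _ => ω)
      (fun b => d.mu0 (i b) ω) (fun b => d.R0 (i b) ω) := by
  have hγ := h.γ_pos
  have hK := h.K_pos
  have hKS := h.KS_pos
  have hη := h.eta_pos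
  have hc := initC_pos (P := P)
  have hw : tameW (sM P τ) (sM P τ) 0 = (sobW (sM P τ) : Idx P → ℝ≥0∞) := by
    funext k; simp [tameW]
  have c1 : ∀ b, kn (sobW (sM P τ)) (thB (bExp τ)) (d.R0 (i b) ω)
      ≤ ENNReal.ofReal (3 * initC P * (2 * eta τ γ N₀)) := fun b => by
    -- The two tori have different tame constants. Both are replaced by the common bound `2η`, so
    -- that the pair starts from one size.
    have hle : d.M0 (i b) (sM P τ) ≤ 2 * eta τ γ N₀ := (h.M0_le_eta (hi b)).trans (by linarith)
    have := (h.col_init (hi b).ansatz h.sM_mem le_rfl hle (by rw [zero_mul]; positivity)).1 ω hω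
    rwa [hw] at this
  have c2 : kn (sobW (sM P τ)) (thB (bExp τ)) (d.R0 (i true) ω - d.R0 (i false) ω)
      ≤ ENNReal.ofReal (initC P) * ENNReal.ofReal (KS * D) := by
    have hb : ENNReal.ofReal KS * Torus.dist (sM P τ + muB P τ σ) (i true) (i false) ω
        ≤ ENNReal.ofReal (KS * D) := by
      rw [ENNReal.ofReal_mul hKS.le]; gcongr
    refine kn_thB_le_of_col fun T hT => ?_
    obtain ⟨h1, h2⟩ := h.adm.R0_diff _ _ (hi true).ansatz (hi false).ansatz ω hω T hT
    exact ⟨col_of_opNorm (h1.trans hb), fun n => col_of_opNorm ((h2 n _ le_rfl).trans hb)⟩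
  have hpn : pn (sobW (sM P τ)) (thB (bExp τ)) (ENNReal.ofReal κ)
      (d.R0 (i true) ω, d.R0 (i false) ω)
      ≤ ENNReal.ofReal (3 * initC P * (2 * eta τ γ N₀)) := by
    refine pn_le_iff.2 ⟨c1 _, c1 _, ?_⟩
    rw [ENNReal.inv_mul_le_iff (by simpa using hκ) ENNReal.ofReal_ne_top,
      ← ENNReal.ofReal_mul hκ.le]
    refine c2.trans ?_
    rw [← ENNReal.ofReal_mul hc.le]
    exact ENNReal.ofReal_le_ofReal hKD
  have real_le : ∀ x : ℝ, ENNReal.ofReal |x|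
      ≤ ENNReal.ofReal K * Torus.dist (sM P τ + muB P τ σ) (i true) (i false) ω →
      |x| ≤ K * (κ * γ) := fun x hx => by
    have := hx.trans (mul_le_mul_right hdist _)
    rw [← ENNReal.ofReal_mul hK.le, ENNReal.ofReal_le_ofReal_iff (by positivity)] at this
    exact this.trans (by gcongr)
  refine ⟨fun b j => h.mu0_odd _ hω.1 j, fun b => h.adm.R0_ham _ (hi b).ansatz _ hω,
    fun b l hl => hω.2 l hl, fun l => ?_, fun j j' => ?_, (pn_thOne_le_thB _ _).trans hpn, hpn⟩
  · rw [sub_self, abs_zero]; positivity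
  · have := abs_eigZero_diff_le j j'
      (real_le _ (h.adm.m3_diff _ _ (hi true).ansatz (hi false).ansatz ω hω))
      (real_le _ (h.adm.m1_diff _ _ (hi true).ansatz (hi false).ansatz ω hω))
      (q := fun j => d.q j ω) (q' := fun j => d.q j ω) (y := 0) (fun k => by simp) (by positivity)
    refine this.trans (le_of_eq ?_)
    rw [muC]; ring

end Setting

end setting

/-! ### The scheme -/

/-- The scheme defined by the iteration, for a given constant `C` in the modulo-tame constants. -/
def scheme (d : InitData P) (τ : ℝ) (N₀ : ℕ) (C : ℝ) : Scheme P where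
  r ν i ω := (run N₀ ω (d.mu0 i ω) (d.R0 i ω) ν).1
  R ν i ω := (run N₀ ω (d.mu0 i ω) (d.R0 i ω) ν).2
  Psi ν i ω := psiRun N₀ ω (d.mu0 i ω) (d.R0 i ω) ν
  Ms ν i s := C * d.M0 i s * scaleN N₀ ((ν : ℤ) - 1) ^ (-aExp τ)
  Msb ν i s := C * d.M0 i s * scaleN N₀ ((ν : ℤ) - 1)

lemma scheme_mu (d : InitData P) (τ : ℝ) (N₀ : ℕ) (C : ℝ) (ν : ℕ) (i : Torus P) (ω : Freq P) :
    (scheme d τ N₀ C).mu d ν i ω = d.mu0 i ω + (run N₀ ω (d.mu0 i ω) (d.R0 i ω) ν).1 := rfl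

/-- The recursive sets are unfolded into one Diophantine condition and a list of Melnikov
conditions. The eigenvalues do not depend on `g`, so the conditions are monotone in `g` and in the
number of steps. -/
lemma mem_scheme_set {d : InitData P} {τ : ℝ} {N₀ : ℕ} {C g : ℝ} {i : Torus P} {ν : ℕ}
    {ω : Freq P} : ω ∈ (scheme d τ N₀ C).set d τ N₀ g i ν ↔
      ω ∈ DC d.Om g τ ∧ Mel τ g N₀ ω (d.mu0 i ω) (d.R0 i ω) ν := by
  induction ν with
  | zero => simp [Scheme.set, Mel]
  | succ ν ih =>
    rw [Scheme.set, Set.mem_ofPred_eq, ih, and_assoc, and_congr_right_iff]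
    intro _
    constructor
    · rintro ⟨h1, h2⟩ n hn
      rcases Nat.lt_succ_iff_lt_or_eq.1 hn with h | rfl
      exacts [h1 n h, h2]
    · exact fun h => ⟨fun n hn => h n (by omega), h ν (Nat.lt_succ_self ν)⟩

lemma Mel.mono {τ g g' : ℝ} {N₀ : ℕ} {ω : Freq P} {μ : Site P → ℝ} {R : Op P} {ν ν' : ℕ}
    (h : Mel τ g' N₀ ω μ R ν') (hg : g ≤ g') (hν : ν ≤ ν') : Mel τ g N₀ ω μ R ν :=
  fun n hn l hl j j' => le_trans (by
    have := one_le_jap l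
    gcongr) (h n (hn.trans_le hν) l hl j j')

lemma lipNorm_mono {X : Type*} [Sub X] {N N' : X → ℝ≥0∞} (h : ∀ x, N x ≤ N' x) (γ : ℝ)
    (O : Set (Freq P)) (f : Freq P → X) : lipNorm N γ O f ≤ lipNorm N' γ O f :=
  add_le_add (iSup₂_mono fun _ _ => h _) (mul_le_mul_right (iSup₂_mono fun _ _ =>
    iSup₂_mono fun _ _ => iSup_mono fun _ => ENNReal.div_le_div_right (h _) _) _)

lemma sobVec_mono {s s' : ℝ} (h : s ≤ s') (u : Mode P → P → ℂ) : sobVec s u ≤ sobVec s' u := by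
  refine ENNReal.rpow_le_rpow (ENNReal.tsum_le_tsum fun l => Finset.sum_le_sum fun n _ => ?_)
    (by norm_num)
  have := Real.rpow_le_rpow_of_exponent_le (one_le_jap l) h
  gcongr

lemma Torus.lip_mono {s s' : ℝ} (h : s ≤ s') (γ : ℝ) (O : Set (Freq P)) (i : Torus P) :
    i.lip s γ O ≤ i.lip s' γ O :=
  add_le_add (add_le_add (lipNorm_mono (sobVec_mono h) _ _ _) (lipNorm_mono (sobVec_mono h) _ _ _))
    (lipNorm_mono (sob_mono h) _ _ _)

lemma japD_sub (b : ℕ) (A B : Op P) : japD b A - japD b B = japD b (A - B) := by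
  funext l j j'; simp only [japD, Pi.sub_apply]; ring

lemma kop_ak_japD (w : Idx P → ℝ≥0∞) (b : ℕ) (A : Op P) :
    kop w (ak (japD b A)) = kn w (thB b) A := by
  rw [kn]
  congr 1
  funext l j j'
  have := one_le_jap l
  rw [ak, japD, enorm_mul, thB, ← ofReal_norm, Complex.norm_real, Real.norm_of_nonneg (by positivity)]

lemma tameW_self_zero (s : ℝ) : tameW s s 0 = (sobW s : Idx P → ℝ≥0∞) := by
  funext k; simp [tameW]

/-! ### Modulo-tame bounds and the operators of the scheme -/

section setting

variable {d : InitData P} {τ σ μ₀ ε γ K S KS : ℝ} {N₀ : ℕ}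

/-- Modulo-tame constants from estimates for pairs of frequencies. -/
lemma Setting.lipModTame (h : Setting d τ σ μ₀ ε γ K S KS N₀) {i : Torus P}
    (hi : Good d τ μ₀ ε γ K N₀ i) {O : Set (Freq P)} (hO : O ⊆ DC d.Om (γ / 2) τ)
    {T : Op P → Op P} {θ : Mode P → ℝ≥0∞} (hT : ∀ w A, kop w (ak (T A)) = kn w θ A)
    (hTs : ∀ A B, T A - T B = T (A - B)) {F : Freq P → Op P} {c c' : ℝ} (hc : 0 ≤ c)
    (hcc : 6 * initC P * c ≤ c') {M' : ℝ → ℝ} (hM' : ∀ s, M' s = c' * d.M0 i s)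
    (H : ∀ (w : Idx P → ℝ≥0∞) (κ e E : ℝ) (ω : Bool → Freq P), PosFin w → 0 < κ →
      Small τ γ P.card (muC K) e E N₀ → (∀ b, ω b ∈ O) →
      PairStart w τ γ κ P.card (muC K) e ω (fun b => d.mu0 i (ω b)) (fun b => d.R0 i (ω b)) →
      pn w θ (ENNReal.ofReal κ) (F (ω true), F (ω false)) ≤ ENNReal.ofReal (c * e)) :
    LipModTame γ O (sM P τ) S (fun ω => T (F ω)) M' := by
  have hγ := h.γ_pos
  have hη₀ := h.eta_pos
  have hC := initC_pos (P := P)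
  have key : ∀ s ∈ Set.Icc (sM P τ) S, ∀ η, 0 < η → η ≤ eta τ γ N₀ → ∀ κ, 0 < κ →
      ∀ ω : Bool → Freq P, (∀ b, ω b ∈ O) → ‖ω true - ω false‖ ≤ κ * γ →
      pn (tameW (sM P τ) s ((d.M0 i (sM P τ) + η) / (d.M0 i s + η))) θ (ENNReal.ofReal κ)
        (F (ω true), F (ω false)) ≤ ENNReal.ofReal (3 * initC P * c * (d.M0 i (sM P τ) + η)) := by
    intro s hs η hη hη' κ hκ ω hω hωκ
    have h1 := h.M0_nonneg hi.ansatz _ h.sM_mem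
    have h2 := h.M0_nonneg hi.ansatz s hs
    have h3 := h.M0_le_eta hi
    -- With this weight parameter the initial tame constants at both regularities are balanced; the
    -- shift by `η` keeps both positive.
    have hst := h.pairStart_freq hi.ansatz (t := (d.M0 i (sM P τ) + η) / (d.M0 i s + η))
      (m := d.M0 i (sM P τ) + η) hs (by positivity) (by linarith) (by
        rw [div_mul_eq_mul_div, div_le_iff₀ (by positivity)]
        gcongr
        linarith) hκ (fun b => hO (hω b)) hωκ
    refine (H _ κ _ _ ω (posFin_tameW _ _ _) hκ (h.toSmall (by positivity) (by linarith)) hω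
      hst).trans (le_of_eq ?_)
    congr 1; ring
  refine lipModTame_of_kop hγ (M := d.M0 i) (c := 3 * initC P * c) (c' := c') (by positivity)
    (by linarith) hη₀ hM' (h.M0_mono hi.ansatz) (h.M0_nonneg hi.ansatz) ?_ ?_
  · intro s hs η hη hη' ω hω
    rw [hT]
    -- The sup bound uses the constant pair `(ω, ω)`, for which the increment is trivial.
    exact (kn_fst_le (κ := ENNReal.ofReal 1) (F ω, F ω)).trans
      (key s hs η hη hη' 1 one_pos (fun _ => ω) (fun _ => hω) (by simpa using hγ.le))
  · intro s hs η hη hη' ω₁ h₁ ω₂ h₂ hne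
    have hpos : 0 < ‖ω₁ - ω₂‖ := norm_pos_iff.2 (sub_ne_zero.2 hne)
    have hκ : 0 < ‖ω₁ - ω₂‖ / γ := by positivity
    rw [hTs, hT, ← ENNReal.inv_mul_le_iff (by simpa using hκ) ENNReal.ofReal_ne_top]
    -- The increment bound uses two frequencies with `κ = ‖ω₁ - ω₂‖/γ`, the scale of the `Lip(γ)`
    -- norm.
    exact (kn_diff_le (F ω₁, F ω₂)).trans (key s hs η hη hη' _ hκ (fun b => bif b then ω₁ else ω₂)
      (fun b => by cases b <;> simpa) (by
        rw [div_mul_cancel₀ _ hγ.ne']; rfl))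

lemma Setting.pairStart_sob (h : Setting d τ σ μ₀ ε γ K S KS N₀) {i : Torus P}
    (hi : Good d τ μ₀ ε γ K N₀ i) {κ : ℝ} (hκ : 0 < κ) {ω : Bool → Freq P}
    (hω : ∀ b, ω b ∈ DC d.Om (γ / 2) τ) (hωκ : ‖ω true - ω false‖ ≤ κ * γ) :
    PairStart (sobW (sM P τ)) τ γ κ P.card (muC K) (3 * initC P * d.M0 i (sM P τ)) ω
      (fun b => d.mu0 i (ω b)) (fun b => d.R0 i (ω b)) := by
  have := h.pairStart_freq hi.ansatz (t := 0) (m := d.M0 i (sM P τ)) h.sM_mem le_rfl le_rfl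
    (by rw [zero_mul]; exact h.M0_nonneg hi.ansatz _ h.sM_mem) hκ hω hωκ
  rwa [tameW_self_zero] at this

lemma Setting.small_sob (h : Setting d τ σ μ₀ ε γ K S KS N₀) {i : Torus P}
    (hi : Good d τ μ₀ ε γ K N₀ i) : Small τ γ P.card (muC K) (3 * initC P * d.M0 i (sM P τ))
      (6 * initC P * (N₀ : ℝ) ^ (-tauBar τ)) N₀ :=
  h.toSmall (h.M0_nonneg hi.ansatz _ h.sM_mem) (by linarith [h.M0_le_eta hi, h.eta_pos])

lemma Setting.pairStart_one (h : Setting d τ σ μ₀ ε γ K S KS N₀) {i : Torus P}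
    (hi : Good d τ μ₀ ε γ K N₀ i) {ω : Freq P} (hω : ω ∈ DC d.Om (γ / 2) τ) :
    PairStart (sobW (sM P τ)) τ γ 1 P.card (muC K) (3 * initC P * d.M0 i (sM P τ)) (fun _ => ω)
      (fun _ => d.mu0 i ω) (fun _ => d.R0 i ω) :=
  h.pairStart_sob hi one_pos (fun _ => hω) (by simpa using h.γ_pos.le)

lemma abs_corr_le {w : Idx P → ℝ≥0∞} (hw : PosFin w) {A : Op P} {c : ℝ} (hc : 0 ≤ c)
    (hA : kn w thOne A ≤ ENNReal.ofReal c) (j : Site P) : |corr A j| ≤ c := by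
  have h2 := (diag_entry_le hw _ j).trans hA
  simp only [thOne, one_mul] at h2
  rw [← ofReal_norm, ENNReal.ofReal_le_ofReal_iff hc] at h2
  exact (Complex.abs_im_le_norm _).trans h2

lemma corr_sub (A B : Op P) (j : Site P) : corr (A - B) j = corr A j - corr B j := rfl

/-- The corrections of the eigenvalues are Lipschitz. -/
lemma Setting.lipR_corr_le (h : Setting d τ σ μ₀ ε γ K S KS N₀) {i : Torus P}
    (hi : Good d τ μ₀ ε γ K N₀ i) {O : Set (Freq P)} (hO : O ⊆ DC d.Om (γ / 2) τ) {ν : ℕ}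
    (hm : ∀ ω ∈ O, Mel τ (γ / 2) N₀ ω (d.mu0 i ω) (d.R0 i ω) ν) (j : Site P) :
    lipR γ O (fun ω => corr (run N₀ ω (d.mu0 i ω) (d.R0 i ω) ν).2 j)
      ≤ ENNReal.ofReal (6 * initC P * d.M0 i (sM P τ) * scaleN N₀ ((ν : ℤ) - 1) ^ (-aExp τ)) := by
  have hγ := h.γ_pos
  have hC := initC_pos (P := P)
  have hM := h.M0_nonneg hi.ansatz _ h.sM_mem
  have hN := scaleN_nonneg N₀ ((ν : ℤ) - 1)
  have hw := posFin_sobW (P := P) (sM P τ)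
  have hc : 0 ≤ 3 * initC P * d.M0 i (sM P τ) * scaleN N₀ ((ν : ℤ) - 1) ^ (-aExp τ) := by positivity
  refine (lipR_le hγ
    (a := 3 * initC P * d.M0 i (sM P τ) * scaleN N₀ ((ν : ℤ) - 1) ^ (-aExp τ))
    (b := 3 * initC P * d.M0 i (sM P τ) * scaleN N₀ ((ν : ℤ) - 1) ^ (-aExp τ))
    (fun ω hω => ?_) fun ω₁ h₁ ω₂ h₂ hne => ?_).trans (le_of_eq ?_)
  · have hp := pairInv_of_mel hw one_pos (h.small_sob hi) (h.pairStart_one hi (hO hω)) ν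
      fun _ => hm ω hω
    exact abs_corr_le hw hc ((kn_fst_le _).trans hp.pn_one) j
  · have hpos : 0 < ‖ω₁ - ω₂‖ := norm_pos_iff.2 (sub_ne_zero.2 hne)
    have hκ : 0 < ‖ω₁ - ω₂‖ / γ := by positivity
    have hp := pairInv_of_mel hw hκ (h.small_sob hi) (h.pairStart_sob hi hκ
      (ω := fun b => bif b then ω₁ else ω₂) (fun b => by cases b <;> exact hO (by assumption))
      (by rw [div_mul_cancel₀ _ hγ.ne']; rfl)) ν
      (fun b => by cases b <;> exact hm _ (by assumption))
    rw [← corr_sub]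
    have h3 := (kn_diff_le _).trans hp.pn_one
    rw [ENNReal.inv_mul_le_iff (by simpa using hκ) ENNReal.ofReal_ne_top,
      ← ENNReal.ofReal_mul hκ.le] at h3
    exact abs_corr_le hw (by positivity) h3 j
  · rw [← ENNReal.ofReal_add hc hc]; congr 1; ring

/-- At the lowest regularity the tame constant involves the torus in a norm that is controlled by
the ansatz. -/
lemma Setting.M0_sM_le (h : Setting d τ σ μ₀ ε γ K S KS N₀) {i : Torus P}
    (hi : Ansatz d τ μ₀ ε γ K i) : d.M0 i (sM P τ) ≤ KS * (1 + K) * (ε * γ⁻¹ ^ 2) := by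
  have hγ := h.γ_pos
  have hK := h.K_pos
  have hKS := h.KS_pos
  have hε := h.ε_pos
  have h1 := (h.adm.M0_le i hi _ h.sM_mem).trans (mul_le_mul_right (add_le_add le_rfl
    ((Torus.lip_mono h.le_μ₀ _ _ _).trans hi)) _)
  rw [← ENNReal.ofReal_add hε.le (by positivity), ← ENNReal.ofReal_mul hKS.le,
    ENNReal.ofReal_le_ofReal_iff (by positivity)] at h1
  refine h1.trans ?_
  have := h.ε_le_div
  calc KS * (ε + K * ε * γ⁻¹ ^ 2) ≤ KS * (ε * γ⁻¹ ^ 2 + K * ε * γ⁻¹ ^ 2) := by gcongr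
    _ = _ := by ring

lemma run_fst_eq_sum (N₀ : ℕ) (ω : Freq P) (μ : Site P → ℝ) (R : Op P) (ν : ℕ) (j : Site P) :
    (run N₀ ω μ R ν).1 j = ∑ n ∈ Finset.range ν, corr (run N₀ ω μ R n).2 j := by
  induction ν with
  | zero => rfl
  | succ ν ih => rw [Finset.sum_range_succ, ← ih]; rfl

section scheme

variable {C g : ℝ} {i : Torus P} {ν : ℕ}

lemma scheme_set_subset (hg : γ / 2 ≤ g) :
    (scheme d τ N₀ C).set d τ N₀ g i ν ⊆ DC d.Om (γ / 2) τ :=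
  fun _ hω => DC_subset hg (mem_scheme_set.1 hω).1

lemma scheme_mel {ν' : ℕ} (hg : γ / 2 ≤ g) (hν : ν' ≤ ν) {ω : Freq P}
    (hω : ω ∈ (scheme d τ N₀ C).set d τ N₀ g i ν) :
    Mel τ (γ / 2) N₀ ω (d.mu0 i ω) (d.R0 i ω) ν' :=
  (mem_scheme_set.1 hω).2.mono hg hν

/-- The remainder of step `ν` is estimated on any later set, since almost reducibility asks for it
on the set of the next step. -/
lemma Setting.scheme_R_tame (h : Setting d τ σ μ₀ ε γ K S KS N₀) (hi : Good d τ μ₀ ε γ K N₀ i)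
    {ν' : ℕ} (hg : γ / 2 ≤ g) (hν : ν ≤ ν') (hC : 6 * initC P ≤ C) :
    LipModTame γ ((scheme d τ N₀ C).set d τ N₀ g i ν') (sM P τ) S ((scheme d τ N₀ C).R ν i)
      ((scheme d τ N₀ C).Ms ν i) := by
  have hN := scaleN_nonneg N₀ ((ν : ℤ) - 1)
  refine h.lipModTame hi (scheme_set_subset hg) (T := id) (θ := thOne)
    (F := (scheme d τ N₀ C).R ν i) (c := scaleN N₀ ((ν : ℤ) - 1) ^ (-aExp τ))
    (c' := C * scaleN N₀ ((ν : ℤ) - 1) ^ (-aExp τ)) (fun w A => (kn_thOne w A).symm)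
    (fun _ _ => rfl) (by positivity) (by gcongr) (fun s => by simp only [scheme]; ring) ?_
  intro w κ e E ω hw hκ hs hω h0
  have := (pairInv_of_mel hw hκ hs h0 ν fun b => scheme_mel hg hν (hω b)).pn_one
  rwa [mul_comm] at this

lemma Setting.scheme_ham (h : Setting d τ σ μ₀ ε γ K S KS N₀) (hi : Good d τ μ₀ ε γ K N₀ i)
    (hg : γ / 2 ≤ g) {ω : Freq P} (hω : ω ∈ (scheme d τ N₀ C).set d τ N₀ g i ν) :
    (∀ j, (scheme d τ N₀ C).mu d ν i ω (-j) = -(scheme d τ N₀ C).mu d ν i ω j) ∧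
    IsHam (diagOp ((scheme d τ N₀ C).mu d ν i ω) + (scheme d τ N₀ C).R ν i ω) := by
  have hDC := scheme_set_subset hg hω
  have hp := pairInv_of_mel (posFin_sobW _) one_pos (h.small_sob hi) (h.pairStart_one hi hDC) ν
    fun _ => scheme_mel hg le_rfl hω
  have hodd : ∀ j, (scheme d τ N₀ C).mu d ν i ω (-j) = -(scheme d τ N₀ C).mu d ν i ω j := fun j => by
    rw [scheme_mu, Pi.add_apply, Pi.add_apply, h.mu0_odd i hDC.1 j]
    have : (run N₀ ω (d.mu0 i ω) (d.R0 i ω) ν).1 (-j) = _ := hp.odd true j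
    rw [this]; ring
  exact ⟨hodd, isHam_add (isHam_diagOp hodd) (hp.ham true)⟩

/-- The estimates of the operators `L_ν`. -/
theorem Setting.scheme_S1 (h : Setting d τ σ μ₀ ε γ K S KS N₀) (hi : Good d τ μ₀ ε γ K N₀ i)
    (hg : γ / 2 ≤ g) {CS : ℝ} (hC : 6 * initC P ≤ C) (hCS : 12 * initC P * (KS * (1 + K)) ≤ CS)
    (hmu : ∀ j, lipR γ ((scheme d τ N₀ C).set d τ N₀ g i ν)
      (fun ω => (scheme d τ N₀ C).mu d ν i ω j) < ⊤) :
    (scheme d τ N₀ C).S1 d τ N₀ ε γ S C CS g i ν where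
  ham _ hω := (h.scheme_ham hi hg hω).2
  mu_lip := hmu
  mu_odd _ hω := (h.scheme_ham hi hg hω).1
  r_lip j := by
    have hγ := h.γ_pos
    have hε := h.ε_pos
    have hc := initC_pos (P := P)
    have hM := h.M0_nonneg hi.ansatz _ h.sM_mem
    have e : (fun ω => (scheme d τ N₀ C).r ν i ω j) = fun ω => ∑ n ∈ Finset.range ν,
        corr (run N₀ ω (d.mu0 i ω) (d.R0 i ω) n).2 j := by
      funext ω; exact run_fst_eq_sum _ _ _ _ _ _
    rw [e]
    refine (lipR_sum_le _ _ _ _).trans ((Finset.sum_le_sum fun n hn => (h.lipR_corr_le hi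
      (scheme_set_subset hg) (fun ω hω => scheme_mel hg (Finset.mem_range.1 hn).le hω) j)).trans ?_)
    rw [← ENNReal.ofReal_sum_of_nonneg fun n _ => by
      have := scaleN_nonneg N₀ ((n : ℤ) - 1); positivity]
    refine ENNReal.ofReal_le_ofReal ?_
    rw [← Finset.mul_sum]
    calc 6 * initC P * d.M0 i (sM P τ)
          * ∑ n ∈ Finset.range ν, scaleN N₀ ((n : ℤ) - 1) ^ (-aExp τ)
        ≤ 6 * initC P * d.M0 i (sM P τ) * ∑ n ∈ Finset.range ν, (1 / 2 : ℝ) ^ n := by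
          refine mul_le_mul_of_nonneg_left (Finset.sum_le_sum fun n _ =>
            scaleN_rpow_le h.four_le h.τ_pos n) (by positivity)
      _ ≤ 6 * initC P * d.M0 i (sM P τ) * 2 := by gcongr; exact sum_geom_half_le ν
      _ ≤ 6 * initC P * (KS * (1 + K) * (ε * γ⁻¹ ^ 2)) * 2 := by
          gcongr; exact h.M0_sM_le hi.ansatz
      _ = 12 * initC P * (KS * (1 + K)) * (ε * γ⁻¹ ^ 2) := by ring
      _ ≤ CS * (ε * γ⁻¹ ^ 2) := by gcongr
      _ = _ := by ring
  R_tame := h.scheme_R_tame hi hg le_rfl hC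
  Rb_tame := by
    have hN := scaleN_nonneg N₀ ((ν : ℤ) - 1)
    refine h.lipModTame hi (scheme_set_subset hg) (T := japD (bExp τ)) (θ := thB (bExp τ))
      (F := (scheme d τ N₀ C).R ν i) (c := scaleN N₀ ((ν : ℤ) - 1))
      (c' := C * scaleN N₀ ((ν : ℤ) - 1)) (fun w A => kop_ak_japD w _ A)
      (fun A B => japD_sub _ A B) hN (by gcongr) (fun s => by simp only [scheme]; ring) ?_
    intro w κ e E ω hw hκ hs hω h0
    have := (pairInv_of_mel hw hκ hs h0 ν fun b => scheme_mel hg le_rfl (hω b)).pn_b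
    rwa [mul_comm] at this
  Ms_le _ _ := le_rfl
  Msb_le _ _ := le_rfl

lemma sM_nonneg (P : Finset ℕ) (τ : ℝ) : 0 ≤ sM P τ := le_max_of_le_left (Nat.cast_nonneg _)

/-- The conjugation of `L_ν` to `L_{ν+1}`. -/
theorem Setting.scheme_S1step (h : Setting d τ σ μ₀ ε γ K S KS N₀) (hne : P.Nonempty)
    (hi : Good d τ μ₀ ε γ K N₀ i) (hg : γ / 2 ≤ g)
    (hC : 6 * initC P * homC P.card (muC K) ≤ C) :
    (scheme d τ N₀ C).S1step d τ N₀ γ S C g i ν := by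
  have hγ := h.γ_pos
  have hN := scaleN_nonneg N₀ ((ν : ℤ) - 1)
  have hN' := scaleN_nonneg N₀ (ν : ℤ)
  have hh : 2 ≤ homC P.card (muC K) := (h.small_sob hi).homC_ge
  have hsc : ∀ ω ∈ (scheme d τ N₀ C).set d τ N₀ g i (ν + 1), _ := fun ω hω =>
    sympConj_of_mel (posFin_sobW _) (h.small_sob hi)
      (h.pairStart_one hi (scheme_set_subset hg hω)) (scheme_mel hg le_rfl hω)
  have hx : ∀ x : ℝ, 0 ≤ x → 6 * initC P * (homC P.card (muC K) / γ * scaleN N₀ (ν : ℤ) ^ tauOne τ * x)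
      ≤ C / γ * scaleN N₀ (ν : ℤ) ^ tauOne τ * x := fun x hx => by
    calc _ = 6 * initC P * homC P.card (muC K) / γ * scaleN N₀ (ν : ℤ) ^ tauOne τ * x := by ring
      _ ≤ _ := by gcongr
  -- One estimate serves both the trivial weight and `⟨ℓ⟩^b`, because solving the homological
  -- equation costs the same factor for every weight on the time frequencies.
  have hpsi : ∀ (w : Idx P → ℝ≥0∞) (κ e E : ℝ) (ω : Bool → Freq P), PosFin w → 0 < κ →
      Small τ γ P.card (muC K) e E N₀ →
      (∀ b, ω b ∈ (scheme d τ N₀ C).set d τ N₀ g i (ν + 1)) →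
      PairStart w τ γ κ P.card (muC K) e ω (fun b => d.mu0 i (ω b)) (fun b => d.R0 i (ω b)) →
      ∀ (θ : Mode P → ℝ≥0∞) (x : ℝ), 0 ≤ x → pn w θ (ENNReal.ofReal κ)
        ((scheme d τ N₀ C).R ν i (ω true), (scheme d τ N₀ C).R ν i (ω false))
        ≤ ENNReal.ofReal (e * x) →
      pn w θ (ENNReal.ofReal κ)
        ((scheme d τ N₀ C).Psi ν i (ω true), (scheme d τ N₀ C).Psi ν i (ω false))
        ≤ ENNReal.ofReal (homC P.card (muC K) / γ * scaleN N₀ (ν : ℤ) ^ tauOne τ * x * e) := by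
    intro w κ e E ω hw hκ hs hω h0 θ x hx0 hR
    have hp := pairInv_of_mel hw hκ hs h0 ν fun b => scheme_mel hg (Nat.le_succ ν) (hω b)
    refine ((pn_psi_of_inv hw hκ hs h0 hp (fun b => scheme_mel hg le_rfl (hω b)) θ).trans
      (mul_le_mul_right hR _)).trans (le_of_eq ?_)
    rw [← ENNReal.ofReal_mul (by positivity)]
    congr 1; ring
  refine ⟨fun ω hω => (hsc ω hω).1, fun ω hω => (hsc ω hω).2.isSymp hne (sM_nonneg P τ),
    fun ω hω => (hsc ω hω).2.toConj S, ?_, ?_⟩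
  · refine h.lipModTame hi (scheme_set_subset hg) (T := id) (θ := thOne)
      (F := (scheme d τ N₀ C).Psi ν i) (c := homC P.card (muC K) / γ * scaleN N₀ (ν : ℤ) ^ tauOne τ
        * scaleN N₀ ((ν : ℤ) - 1) ^ (-aExp τ)) (fun w A => (kn_thOne w A).symm)
      (fun _ _ => rfl) (by positivity) (hx _ (by positivity)) (fun s => rfl) ?_
    intro w κ e E ω hw hκ hs hω h0
    exact hpsi w κ e E ω hw hκ hs hω h0 thOne _ (by positivity)
      (pairInv_of_mel hw hκ hs h0 ν fun b => scheme_mel hg (Nat.le_succ ν) (hω b)).pn_one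
  · refine h.lipModTame hi (scheme_set_subset hg) (T := japD (bExp τ)) (θ := thB (bExp τ))
      (F := (scheme d τ N₀ C).Psi ν i) (c := homC P.card (muC K) / γ * scaleN N₀ (ν : ℤ) ^ tauOne τ
        * scaleN N₀ ((ν : ℤ) - 1)) (fun w A => kop_ak_japD w _ A)
      (fun A B => japD_sub _ A B) (by positivity) (hx _ hN) (fun s => rfl) ?_
    intro w κ e E ω hw hκ hs hω h0
    exact hpsi w κ e E ω hw hκ hs hω h0 (thB (bExp τ)) _ hN
      (pairInv_of_mel hw hκ hs h0 ν fun b => scheme_mel hg (Nat.le_succ ν) (hω b)).pn_b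

end scheme

end setting

/-! ### Extensions of the eigenvalues -/

section setting

variable {d : InitData P} {τ σ μ₀ ε γ K S KS : ℝ} {N₀ : ℕ}

lemma Setting.lipR_q_lt_top (h : Setting d τ σ μ₀ ε γ K S KS N₀) (j : Site P) :
    lipR γ d.Om (d.q j) < ⊤ := by
  have h1 : ∀ x : ℝ≥0∞, ENNReal.ofReal |(j.1 : ℝ)| * x ≤ ENNReal.ofReal K → x < ⊤ := fun x hx =>
    ((le_mul_of_one_le_left' (by
      rw [ENNReal.one_le_ofReal]; exact abs_site_ge_one j)).trans hx).trans_lt ENNReal.ofReal_lt_top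
  exact ENNReal.add_lt_top.2 ⟨h1 _ (h.adm.q_sup j),
    ENNReal.mul_lt_top ENNReal.ofReal_lt_top (h1 _ (h.adm.q_lip j))⟩

lemma Setting.lipR_eigZero_lt_top (h : Setting d τ σ μ₀ ε γ K S KS N₀) {i : Torus P}
    (hi : Ansatz d τ μ₀ ε γ K i) {m : Freq P → ℝ} (hm : lipR γ d.Om m < ⊤) (j : Site P) :
    lipR γ d.Om (fun ω => eigZero (d.m3 i ω) (m ω) (fun j => d.q j ω) j) < ⊤ := by
  set a : ℝ := 2 * Real.pi * (j.1 : ℝ) with ha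
  have e : (fun ω => eigZero (d.m3 i ω) (m ω) (fun j => d.q j ω) j)
      = fun ω => a ^ 3 * (d.m3 i ω + 1) + ((-a) * m ω + ((-1) * d.q j ω + -a ^ 3)) := by
    funext ω; simp only [eigZero, ← ha]; ring
  have hmul : ∀ (c : ℝ) (f : Freq P → ℝ), lipR γ d.Om f < ⊤ →
      lipR γ d.Om (fun ω => c * f ω) < ⊤ := fun c f hf =>
    (lipR_const_mul_le h.γ_pos _ c f).trans_lt (ENNReal.add_lt_top.2
      ⟨ENNReal.mul_lt_top enorm_lt_top hf, ENNReal.mul_lt_top enorm_lt_top hf⟩)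
  have hadd : ∀ f f' : Freq P → ℝ, lipR γ d.Om f < ⊤ → lipR γ d.Om f' < ⊤ →
      lipR γ d.Om (fun ω => f ω + f' ω) < ⊤ := fun f f' hf hf' =>
    (lipR_add_le _ _ f f').trans_lt (ENNReal.add_lt_top.2 ⟨hf, hf'⟩)
  rw [e]
  exact hadd _ _ (hmul _ _ ((h.adm.m3_lip i hi).trans_lt ENNReal.ofReal_lt_top))
    (hadd _ _ (hmul _ _ hm) (hadd _ _ (hmul _ _ (h.lipR_q_lt_top j))
      ((lipR_const γ d.Om _).trans_lt enorm_lt_top)))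

/-- Extend `m₁` and each correction of the eigenvalues separately, and add the extended corrections.
Consecutive extended eigenvalues then differ by exactly one extended correction, which keeps its
`Lip(γ)` bound. -/
theorem Setting.scheme_S2 (h : Setting d τ σ μ₀ ε γ K S KS N₀) {C g : ℝ} {i : Torus P}
    (hi : Good d τ μ₀ ε γ K N₀ i) (hg : γ / 2 ≤ g) (h1C : 1 ≤ C) (hKC : K ≤ C)
    (hC : 6 * initC P ≤ C) : (scheme d τ N₀ C).S2 d τ N₀ ε γ C g i := by
  have hγ := h.γ_pos
  have hε := h.ε_pos
  have hM := h.M0_nonneg hi.ansatz _ h.sM_mem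
  have hm1 : lipR γ (DC d.Om g τ) (d.m1 i) ≤ ENNReal.ofReal (K * ε * γ⁻¹ ^ 2) :=
    (lipR_mono_set (DC_subset hg) _).trans (h.adm.m1_lip i hi.ansatz)
  obtain ⟨m1t, hm1t, hm1l⟩ := exists_lipR_extension hγ (hm1.trans_lt ENNReal.ofReal_lt_top)
  have hcorr : ∀ (n : ℕ) (j : Site P), lipR γ ((scheme d τ N₀ C).set d τ N₀ g i n)
      (fun ω => corr (run N₀ ω (d.mu0 i ω) (d.R0 i ω) n).2 j) ≤ _ := fun n j =>
    h.lipR_corr_le hi (scheme_set_subset hg) (fun ω hω => scheme_mel hg le_rfl hω) j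
  choose f hf hfl using fun n j =>
    exists_lipR_extension hγ ((hcorr n j).trans_lt ENNReal.ofReal_lt_top)
  refine ⟨m1t, fun ν ω j => eigZero (d.m3 i ω) (m1t ω) (fun j => d.q j ω) j
    + ∑ n ∈ Finset.range ν, f n j ω, hm1t, ((hm1l _).trans hm1).trans ?_, fun ω _ => ?_,
    fun ν j => ⟨fun ω hω => ?_, ?_, ?_, le_rfl⟩⟩
  · exact ENNReal.ofReal_le_ofReal (by gcongr)
  · funext j; simp
  · rw [mem_scheme_set] at hω
    simp only [scheme_mu, Pi.add_apply, InitData.mu0, hm1t ω hω.1]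
    congr 1
    rw [run_fst_eq_sum]
    exact Finset.sum_congr rfl fun n hn => hf n j ω
      (mem_scheme_set.2 ⟨hω.1, hω.2.mono le_rfl (Finset.mem_range.1 hn).le⟩)
  · refine (lipR_add_le _ _ _ _).trans_lt (ENNReal.add_lt_top.2 ⟨h.lipR_eigZero_lt_top hi.ansatz
      ((hm1l _).trans_lt (hm1.trans_lt ENNReal.ofReal_lt_top)) j, ?_⟩)
    exact (lipR_sum_le _ _ _ _).trans_lt (ENNReal.sum_lt_top.2 fun n _ =>
      (hfl n j _).trans_lt ((hcorr n j).trans_lt ENNReal.ofReal_lt_top))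
  · have e : (fun ω => eigZero (d.m3 i ω) (m1t ω) (fun j => d.q j ω) j
          + ∑ n ∈ Finset.range (ν + 1), f n j ω
          - (eigZero (d.m3 i ω) (m1t ω) (fun j => d.q j ω) j + ∑ n ∈ Finset.range ν, f n j ω))
        = f ν j := by
      funext ω; rw [Finset.sum_range_succ]; ring
    rw [e]
    refine (hfl ν j _).trans ((hcorr ν j).trans (ENNReal.ofReal_le_ofReal ?_))
    have hN := scaleN_nonneg N₀ ((ν : ℤ) - 1)
    calc 6 * initC P * d.M0 i (sM P τ) * scaleN N₀ ((ν : ℤ) - 1) ^ (-aExp τ)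
        ≤ C * d.M0 i (sM P τ) * scaleN N₀ ((ν : ℤ) - 1) ^ (-aExp τ) := by gcongr
      _ ≤ C * (C * d.M0 i (sM P τ) * scaleN N₀ ((ν : ℤ) - 1) ^ (-aExp τ)) :=
          le_mul_of_one_le_left (by positivity) h1C

lemma Scheme.S2.lipR_mu_lt_top {X : Scheme P} {C g : ℝ} {i : Torus P}
    (h : X.S2 d τ N₀ ε γ C g i) (hX : ∀ ν, X.set d τ N₀ g i ν ⊆ d.Om) (ν : ℕ) (j : Site P) :
    lipR γ (X.set d τ N₀ g i ν) (fun ω => X.mu d ν i ω j) < ⊤ := by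
  obtain ⟨m1t, mue, -, -, -, hmue⟩ := h
  obtain ⟨h1, h2, -⟩ := hmue ν j
  rw [← lipR_congr h1]
  exact (lipR_mono_set (hX ν) _).trans_lt h2

end setting

/-! ### Dependence on the torus -/

/-- The scale `κ` of a pair has to be positive and finite, whereas the distance of two tori may be
zero or infinite; real bounds `D > 0` of the distance are used and then sent to it. -/
lemma le_ofReal_mul_of_forall {x δ : ℝ≥0∞} {c : ℝ} (hc : 0 < c)
    (h : ∀ D : ℝ, 0 < D → δ ≤ ENNReal.ofReal D → x ≤ ENNReal.ofReal (c * D)) :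
    x ≤ ENNReal.ofReal c * δ := by
  by_cases hδ : δ = ⊤
  · rw [hδ, ENNReal.mul_top (by simpa using hc)]; exact le_top
  rw [← ENNReal.ofReal_toReal hδ, ← ENNReal.ofReal_mul hc.le]
  have lim : Filter.Tendsto (fun η : ℝ => ENNReal.ofReal (c * (δ.toReal + η)))
      (nhdsWithin 0 (Set.Ioi 0)) (nhds (ENNReal.ofReal (c * δ.toReal))) := by
    have hcont : Continuous fun η : ℝ => c * (δ.toReal + η) := by fun_prop
    have := hcont.tendsto 0
    rw [add_zero] at this
    exact ENNReal.tendsto_ofReal (this.mono_left nhdsWithin_le_nhds)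
  refine ge_of_tendsto lim ?_
  filter_upwards [self_mem_nhdsWithin] with η hη
  have hη' : 0 < η := hη
  refine h _ (by positivity) ?_
  rw [ENNReal.le_ofReal_iff_toReal_le hδ (by positivity)]
  linarith

section setting

variable {d : InitData P} {τ σ μ₀ ε γ K S KS : ℝ} {N₀ : ℕ}

/-- The constant in the estimates of differences of tori. -/
def torC (P : Finset ℕ) (KS : ℝ) : ℝ := 6 * initC P * max KS 1

lemma torC_pos (KS : ℝ) : 0 < torC P KS := by
  have := initC_pos (P := P)
  have : 0 < max KS 1 := lt_max_of_lt_right one_pos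
  unfold torC; positivity

/-- The pair of tori enters the iteration with a small size `e` and a scale `κ` proportional to
their distance. The estimates for increments involve only the product `κe`, in which the powers of
`N₀` and `γ` cancel. -/
lemma Setting.torus_diff (h : Setting d τ σ μ₀ ε γ K S KS N₀) {i : Bool → Torus P}
    (hi : ∀ b, Good d τ μ₀ ε γ K N₀ (i b)) {ω : Freq P} (hω : ω ∈ DC d.Om (γ / 2) τ) {ν : ℕ}
    (hm : ∀ b, Mel τ (γ / 2) N₀ ω (d.mu0 (i b) ω) (d.R0 (i b) ω) ν) :
    let δ := Torus.dist (sM P τ + muB P τ σ) (i true) (i false) ω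
    let x := fun b => run N₀ ω (d.mu0 (i b) ω) (d.R0 (i b) ω) ν
    kn (sobW (sM P τ)) thOne ((x true).2 - (x false).2)
      ≤ ENNReal.ofReal (torC P KS * scaleN N₀ ((ν : ℤ) - 1) ^ (-aExp τ)) * δ ∧
    kn (sobW (sM P τ)) (thB (bExp τ)) ((x true).2 - (x false).2)
      ≤ ENNReal.ofReal (torC P KS * scaleN N₀ ((ν : ℤ) - 1)) * δ ∧
    ∀ j, ENNReal.ofReal |(x true).1 j - (x false).1 j| ≤ ENNReal.ofReal (2 * torC P KS) * δ := by
  intro δ x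
  have hγ := h.γ_pos
  have hc := initC_pos (P := P)
  have hN1 := h.one_le_N
  have hN : (0 : ℝ) < N₀ := by linarith
  have hη := h.eta_pos
  have hk1 : (1 : ℝ) ≤ max KS 1 := le_max_right _ _
  have hT := torC_pos (P := P) KS
  have hM : (1 : ℝ) ≤ scaleN N₀ ((ν : ℤ) - 1) :=
    le_trans (one_le_pow₀ (by norm_num)) (two_pow_le_scaleN h.four_le ν)
  have hNt : 1 ≤ (N₀ : ℝ) ^ tauBar τ := Real.one_le_rpow hN1 (by
    have := h.τ_pos; rw [tauBar, aExp, tauOne]; linarith)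
  have key : ∀ D : ℝ, 0 < D → δ ≤ ENNReal.ofReal D → ∃ κ e : ℝ, 0 < κ ∧ κ * e = torC P KS * D ∧
      PairInv (sobW (sM P τ)) τ κ e N₀ (fun _ => ω) (fun b => d.mu0 (i b) ω)
        (fun b => d.R0 (i b) ω) ν := by
    intro D hD hδ
    have hκ : 0 < max KS 1 * D * (N₀ : ℝ) ^ tauBar τ / γ := by positivity
    have hκe : max KS 1 * D * (N₀ : ℝ) ^ tauBar τ / γ * (3 * initC P * (2 * eta τ γ N₀))
        = torC P KS * D := by
      rw [eta, torC, Real.rpow_neg hN.le]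
      field_simp
      ring
    -- The value of `κ` solves `κe = torC · D`. It satisfies `D ≤ κγ`, needed for the unperturbed
    -- eigenvalues, because `max KS 1` and `N₀^{τbar}` are at least one.
    refine ⟨max KS 1 * D * (N₀ : ℝ) ^ tauBar τ / γ, 3 * initC P * (2 * eta τ γ N₀), hκ, hκe,
      pairInv_of_mel (posFin_sobW _) hκ (h.toSmall (by positivity) le_rfl)
      (h.pairStart_torus hi hκ hD.le hω hδ ?_ ?_) ν hm⟩
    · rw [div_mul_cancel₀ _ hγ.ne']
      calc D = 1 * D * 1 := by ring
        _ ≤ _ := by gcongr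
    · rw [hκe, torC]
      have : KS ≤ max KS 1 := le_max_left _ _
      calc initC P * (KS * D) ≤ initC P * (max KS 1 * D) := by gcongr
        _ ≤ 6 * (initC P * (max KS 1 * D)) := by
            have : 0 ≤ initC P * (max KS 1 * D) := by positivity
            linarith
        _ = _ := by ring
  have conv : ∀ (θ : Mode P → ℝ≥0∞) (κ e y D : ℝ), 0 < κ → κ * e = torC P KS * D →
      pn (sobW (sM P τ)) θ (ENNReal.ofReal κ) ((x true).2, (x false).2) ≤ ENNReal.ofReal (e * y) →
      kn (sobW (sM P τ)) θ ((x true).2 - (x false).2) ≤ ENNReal.ofReal (torC P KS * y * D) := by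
    intro θ κ e y D hκ hκe hp
    have h1 := (kn_diff_le _).trans hp
    rw [ENNReal.inv_mul_le_iff (by simpa using hκ) ENNReal.ofReal_ne_top,
      ← ENNReal.ofReal_mul hκ.le] at h1
    refine h1.trans (le_of_eq ?_)
    congr 1
    rw [← mul_assoc, hκe]; ring
  refine ⟨le_ofReal_mul_of_forall (by positivity) fun D hD hδ => ?_,
    le_ofReal_mul_of_forall (by positivity) fun D hD hδ => ?_,
    fun j => le_ofReal_mul_of_forall (by positivity) fun D hD hδ => ?_⟩
  all_goals obtain ⟨κ, e, hκ, hκe, hp⟩ := key D hD hδ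
  · exact conv thOne κ e _ D hκ hκe hp.pn_one
  · exact conv (thB (bExp τ)) κ e _ D hκ hκe hp.pn_b
  · refine ENNReal.ofReal_le_ofReal ((hp.r_diff j).trans ?_)
    rw [hκe]
    have h1 : (0 : ℝ) < (1 / 2) ^ ν := by positivity
    calc torC P KS * D * (2 - 2 * (1 / 2) ^ ν) ≤ torC P KS * D * 2 := by gcongr; linarith
      _ = _ := by ring

section scheme

variable {C CS g : ℝ} {i₁ i₂ : Torus P} {ν : ℕ}

theorem Setting.scheme_S3 (h : Setting d τ σ μ₀ ε γ K S KS N₀) (h₁ : Good d τ μ₀ ε γ K N₀ i₁)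
    (h₂ : Good d τ μ₀ ε γ K N₀ i₂) (hC : 1 ≤ C) (hCS : 2 * torC P KS ≤ CS) (ν : ℕ) :
    (scheme d τ N₀ C).S3 d τ σ N₀ γ C CS i₁ i₂ ν := by
  intro g₁ hg₁ g₂ hg₂
  have hT := torC_pos (P := P) KS
  have hN := scaleN_nonneg N₀ ((ν : ℤ) - 1)
  have diff : ∀ n : ℕ, ∀ ω ∈ (scheme d τ N₀ C).set d τ N₀ g₁ i₁ n
      ∩ (scheme d τ N₀ C).set d τ N₀ g₂ i₂ n, _ := fun n ω hω =>
    h.torus_diff (i := fun b => bif b then i₁ else i₂) (by rintro (_ | _) <;> assumption)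
      (scheme_set_subset hg₁.1 hω.1) (ν := n)
      (by
        rintro (_ | _)
        exacts [scheme_mel hg₂.1 le_rfl hω.2, scheme_mel hg₁.1 le_rfl hω.1])
  refine ⟨fun ω hω => ?_, fun ω hω j => ⟨?_, ?_⟩⟩
  · obtain ⟨e1, e2, -⟩ := diff ν ω hω
    rw [kn_thOne] at e1
    rw [← kop_ak_japD] at e2
    constructor
    · refine (opNorm_maj_le _ _).trans (e1.trans (mul_le_mul_left (ENNReal.ofReal_le_ofReal ?_) _))
      gcongr; linarith
    · refine (opNorm_maj_le _ _).trans (e2.trans (mul_le_mul_left (ENNReal.ofReal_le_ofReal ?_) _))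
      gcongr; linarith
  · have e : ((scheme d τ N₀ C).r (ν + 1) i₁ ω j - (scheme d τ N₀ C).r (ν + 1) i₂ ω j)
        - ((scheme d τ N₀ C).r ν i₁ ω j - (scheme d τ N₀ C).r ν i₂ ω j)
        = corr ((scheme d τ N₀ C).R ν i₁ ω - (scheme d τ N₀ C).R ν i₂ ω) j := by
      rw [corr_sub]
      simp only [scheme, run, Pi.add_apply]
      ring
    rw [e]
    refine le_trans ?_ (le_mul_of_one_le_left' (by rwa [ENNReal.one_le_ofReal]))
    -- The increment of the correction is a diagonal element of the difference of the remainders, so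
    -- no constant is lost.
    refine le_trans ?_ (diag_le_opNorm_maj (sM P τ) _ j)
    rw [← ofReal_norm]
    exact ENNReal.ofReal_le_ofReal (Complex.abs_im_le_norm _)
  · exact ((diff (ν + 1) ω hω).2.2 j).trans (mul_le_mul_left (ENNReal.ofReal_le_ofReal hCS) _)

lemma Setting.abs_mu_diff_le (h : Setting d τ σ μ₀ ε γ K S KS N₀) (h₁ : Good d τ μ₀ ε γ K N₀ i₁)
    (h₂ : Good d τ μ₀ ε γ K N₀ i₂) {ω : Freq P} (hω : ω ∈ DC d.Om (γ / 2) τ)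
    (hm₁ : Mel τ (γ / 2) N₀ ω (d.mu0 i₁ ω) (d.R0 i₁ ω) ν)
    (hm₂ : Mel τ (γ / 2) N₀ ω (d.mu0 i₂ ω) (d.R0 i₂ ω) ν) {D : ℝ} (hD : 0 ≤ D)
    (hdist : Torus.dist (sM P τ + muB P τ σ) i₁ i₂ ω ≤ ENNReal.ofReal D) (j j' : Site P) :
    |((scheme d τ N₀ C).mu d ν i₁ ω j - (scheme d τ N₀ C).mu d ν i₁ ω j')
      - ((scheme d τ N₀ C).mu d ν i₂ ω j - (scheme d τ N₀ C).mu d ν i₂ ω j')|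
      ≤ (muC K + 4 * torC P KS) * D * |(j.1 : ℝ) ^ 3 - (j'.1 : ℝ) ^ 3| := by
  by_cases hjj : j = j'
  · subst hjj; simp
  have hcube := one_le_abs_cube_sub hjj
  have hK := h.K_pos
  have hT := torC_pos (P := P) KS
  have hr := (h.torus_diff (i := fun b => bif b then i₁ else i₂) (by rintro (_ | _) <;> assumption)
      hω (ν := ν) (by rintro (_ | _) <;> assumption)).2.2
  have real_le : ∀ (x c : ℝ), 0 ≤ c → ENNReal.ofReal |x|
      ≤ ENNReal.ofReal c * Torus.dist (sM P τ + muB P τ σ) i₁ i₂ ω → |x| ≤ c * D :=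
    fun x c hc hx => by
      have := hx.trans (mul_le_mul_right hdist _)
      rwa [← ENNReal.ofReal_mul hc, ENNReal.ofReal_le_ofReal_iff (by positivity)] at this
  have hr' : ∀ k : Site P, |(run N₀ ω (d.mu0 i₁ ω) (d.R0 i₁ ω) ν).1 k
      - (run N₀ ω (d.mu0 i₂ ω) (d.R0 i₂ ω) ν).1 k| ≤ 2 * torC P KS * D := fun k =>
    real_le _ _ (by positivity) (hr k)
  have h0 := abs_eigZero_diff_le j j'
    (real_le _ K hK.le (h.adm.m3_diff _ _ h₁.ansatz h₂.ansatz ω hω))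
    (real_le _ K hK.le (h.adm.m1_diff _ _ h₁.ansatz h₂.ansatz ω hω))
    (q := fun j => d.q j ω) (q' := fun j => d.q j ω) (y := 0) (fun k => by simp) (by positivity)
  have e : ((scheme d τ N₀ C).mu d ν i₁ ω j - (scheme d τ N₀ C).mu d ν i₁ ω j')
      - ((scheme d τ N₀ C).mu d ν i₂ ω j - (scheme d τ N₀ C).mu d ν i₂ ω j')
      = ((d.mu0 i₁ ω j - d.mu0 i₁ ω j') - (d.mu0 i₂ ω j - d.mu0 i₂ ω j'))
        + (((run N₀ ω (d.mu0 i₁ ω) (d.R0 i₁ ω) ν).1 j - (run N₀ ω (d.mu0 i₂ ω) (d.R0 i₂ ω) ν).1 j)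
        - ((run N₀ ω (d.mu0 i₁ ω) (d.R0 i₁ ω) ν).1 j'
          - (run N₀ ω (d.mu0 i₂ ω) (d.R0 i₂ ω) ν).1 j')) := by
    simp only [scheme_mu, Pi.add_apply]; ring
  rw [e]
  set cube := |(j.1 : ℝ) ^ 3 - (j'.1 : ℝ) ^ 3|
  have h4 : 4 * torC P KS * D ≤ 4 * torC P KS * D * cube :=
    le_mul_of_one_le_right (by positivity) hcube
  calc _ ≤ K * D * ((2 * Real.pi) ^ 3 + 2 * Real.pi + 2) * cube
          + (2 * torC P KS * D + 2 * torC P KS * D) :=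
        (abs_add_le _ _).trans (add_le_add h0 ((abs_sub _ _).trans (add_le_add (hr' j) (hr' j'))))
    _ ≤ K * D * ((2 * Real.pi) ^ 3 + 2 * Real.pi + 2) * cube + 4 * torC P KS * D * cube := by
        linarith
    _ = _ := by rw [muC]; ring

/-- By induction `ω` already lies in the set of order `ν` for the second torus, with constant `γ - ρ
> γ/2`, so the eigenvalues of the two tori can be compared. Their differences move by at most
`ρ|j³-j'³|N_ν^{-τ}`, and `⟨ℓ⟩ ≤ N_ν` in the conditions of this step, so the lower bound decreases
from `γ` to `γ - ρ`. -/
theorem Setting.scheme_S4 (h : Setting d τ σ μ₀ ε γ K S KS N₀) (h₁ : Good d τ μ₀ ε γ K N₀ i₁)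
    (h₂ : Good d τ μ₀ ε γ K N₀ i₂) (hCS : muC K + 4 * torC P KS ≤ CS) (ν : ℕ) :
    (scheme d τ N₀ C).S4 d τ σ N₀ γ CS i₁ i₂ ν := by
  intro ρ hρ hργ
  have hγ := h.γ_pos
  have hT := torC_pos (P := P) KS
  have hmu := muC_nonneg h.K_pos.le
  have hCS0 : 0 < CS := by linarith
  induction ν with
  | zero => exact fun _ => DC_subset (by linarith)
  | succ ν ih =>
    intro hsmall
    rw [scaleN_succ_sub_one] at hsmall
    have hM : (1 : ℝ) ≤ scaleN N₀ ((ν : ℤ) - 1) :=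
      le_trans (one_le_pow₀ (by norm_num)) (two_pow_le_scaleN h.four_le ν)
    have hMN := (h.small_sob h₁).ineq ν |>.2.1
    have hN1 : 1 ≤ scaleN N₀ (ν : ℤ) := by linarith
    have hNτ : 0 < scaleN N₀ (ν : ℤ) ^ τ := by positivity
    -- The scales increase, so the smallness condition of this order implies the one of the previous
    -- order.
    have hih := ih (le_trans (mul_le_mul_left (ENNReal.ofReal_le_ofReal (by
      have := Real.rpow_le_rpow (by linarith) (by linarith :
        scaleN N₀ ((ν : ℤ) - 1) ≤ scaleN N₀ (ν : ℤ)) h.τ_pos.le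
      gcongr)) _) hsmall)
    intro ω hω
    have hω' := mem_scheme_set.1 hω
    have hω₁ : ω ∈ (scheme d τ N₀ C).set d τ N₀ γ i₁ ν :=
      mem_scheme_set.2 ⟨hω'.1, hω'.2.mono le_rfl (Nat.le_succ ν)⟩
    have hω₂ := hih hω₁
    refine ⟨hω₂, fun l hl j j' => ?_⟩
    have hdist : Torus.dist (sM P τ + muB P τ σ) i₁ i₂ ω
        ≤ ENNReal.ofReal (ρ / (CS * scaleN N₀ (ν : ℤ) ^ τ)) := by
      refine (le_iSup₂ (f := fun ω (_ : ω ∈ DC d.Om γ τ) =>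
        Torus.dist (sM P τ + muB P τ σ) i₁ i₂ ω) ω hω'.1).trans ?_
      rw [ENNReal.ofReal_div_of_pos (by positivity), ENNReal.le_div_iff_mul_le
        (Or.inl (by simpa using by positivity)) (Or.inl ENNReal.ofReal_ne_top), mul_comm]
      exact hsmall
    have hdiff := h.abs_mu_diff_le (C := C) h₁ h₂ (scheme_set_subset (by linarith) hω)
      (scheme_mel (by linarith) le_rfl hω₁) (scheme_mel (by linarith) le_rfl hω₂)
      (by positivity) hdist j j'
    have hres : γ * |(j.1 : ℝ) ^ 3 - (j'.1 : ℝ) ^ 3| / jap l ^ τ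
        ≤ |dot ω l + (scheme d τ N₀ C).mu d ν i₁ ω j - (scheme d τ N₀ C).mu d ν i₁ ω j'| :=
      hω.2 l hl j j'
    set cube := |(j.1 : ℝ) ^ 3 - (j'.1 : ℝ) ^ 3|
    have hj := one_le_jap l
    have hjN : jap l ^ τ ≤ scaleN N₀ (ν : ℤ) ^ τ :=
      Real.rpow_le_rpow (by linarith) (max_le hN1 hl) h.τ_pos.le
    have hjp : 0 < jap l ^ τ := by positivity
    have hcube : 0 ≤ cube := abs_nonneg _
    have hle : (muC K + 4 * torC P KS) * (ρ / (CS * scaleN N₀ (ν : ℤ) ^ τ)) * cube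
        ≤ ρ * cube / jap l ^ τ := by
      calc _ ≤ CS * (ρ / (CS * scaleN N₀ (ν : ℤ) ^ τ)) * cube := by gcongr
        _ = ρ * cube / scaleN N₀ (ν : ℤ) ^ τ := by field_simp
        _ ≤ _ := by gcongr
    set a := dot ω l + (scheme d τ N₀ C).mu d ν i₁ ω j - (scheme d τ N₀ C).mu d ν i₁ ω j'
    set a' := dot ω l + (scheme d τ N₀ C).mu d ν i₂ ω j - (scheme d τ N₀ C).mu d ν i₂ ω j'
    have e : a - a' = ((scheme d τ N₀ C).mu d ν i₁ ω j - (scheme d τ N₀ C).mu d ν i₁ ω j')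
        - ((scheme d τ N₀ C).mu d ν i₂ ω j - (scheme d τ N₀ C).mu d ν i₂ ω j') := by
      simp only [a, a']; ring
    rw [← e] at hdiff
    have := abs_sub_abs_le_abs_sub a a'
    calc (γ - ρ) * cube / jap l ^ τ = γ * cube / jap l ^ τ - ρ * cube / jap l ^ τ := by ring
      _ ≤ |a'| := by linarith

end scheme

end setting

/-! ### Almost reducibility -/

section setting

variable {d : InitData P} {τ σ μ₀ ε γ K S KS : ℝ} {N₀ : ℕ} {C CS g : ℝ} {i : Torus P}

lemma scheme_U (d : InitData P) (τ : ℝ) (N₀ : ℕ) (C : ℝ) (i : Torus P) (ω : Freq P) (n : ℕ) :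
    (scheme d τ N₀ C).U i ω n = prodU (psiRun N₀ ω (d.mu0 i ω) (d.R0 i ω)) n := by
  induction n with
  | zero => rfl
  | succ n ih => rw [Scheme.U, ih]; rfl

lemma scheme_Ui (d : InitData P) (τ : ℝ) (N₀ : ℕ) (C : ℝ) (i : Torus P) (ω : Freq P) (n : ℕ) :
    (scheme d τ N₀ C).Ui i ω n = prodUi (psiRun N₀ ω (d.mu0 i ω) (d.R0 i ω)) n := by
  induction n with
  | zero => rfl
  | succ n ih => rw [Scheme.Ui, ih]; rfl

lemma Setting.good_of_small (h : Setting d τ σ μ₀ ε γ K S KS N₀) (hi : Ansatz d τ μ₀ ε γ K i)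
    (hs : KS * (1 + K) * ((N₀ : ℝ) ^ tauBar τ * ε * γ⁻¹ ^ 3) ≤ 1) : Good d τ μ₀ ε γ K N₀ i := by
  refine ⟨hi, le_trans ?_ hs⟩
  have hγ := h.γ_pos
  calc (N₀ : ℝ) ^ tauBar τ * d.M0 i (sM P τ) * γ⁻¹
      ≤ (N₀ : ℝ) ^ tauBar τ * (KS * (1 + K) * (ε * γ⁻¹ ^ 2)) * γ⁻¹ := by
        gcongr; exact h.M0_sM_le hi
    _ = _ := by ring

lemma Setting.ofReal_mul_M0_le (h : Setting d τ σ μ₀ ε γ K S KS N₀) (hi : Ansatz d τ μ₀ ε γ K i)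
    {s x y : ℝ} (hs : s ∈ Set.Icc (sM P τ) S) (hx : 0 ≤ x) (hy : x * KS ≤ y) :
    ENNReal.ofReal (x * d.M0 i s) ≤ ENNReal.ofReal y
      * (ENNReal.ofReal ε + i.lip (s + muB P τ σ) γ (DC d.Om (γ / 2) τ)) := by
  rw [ENNReal.ofReal_mul hx]
  refine (mul_le_mul_right (h.adm.M0_le i hi s hs) _).trans ?_
  rw [← mul_assoc, ← ENNReal.ofReal_mul hx]
  exact mul_le_mul_left (ENNReal.ofReal_le_ofReal hy) _

/-- The transformation is a composition of bounded symplectic conjugations, and its distance from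
the identity is a pair estimate. Hence the same passage to modulo-tame constants applies to it and
to its inverse, with one common constant. -/
theorem Setting.scheme_almostRed (h : Setting d τ σ μ₀ ε γ K S KS N₀) (hne : P.Nonempty)
    (hi : Good d τ μ₀ ε γ K N₀ i) (hg : γ / 2 ≤ g) (hC : 6 * initC P ≤ C) (hCK : C * KS ≤ CS)
    (hCS : 6 * initC P * (2 ^ (bExp τ + 4) * homC P.card (muC K)) * KS ≤ CS) (n : ℕ) :
    (scheme d τ N₀ C).AlmostRed d τ σ N₀ ε γ S CS g i n := by
  have hγ := h.γ_pos
  have hKS := h.KS_pos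
  have hc := initC_pos (P := P)
  have hh : 2 ≤ homC P.card (muC K) := (h.small_sob hi).homC_ge
  have hmel : ∀ ω ∈ (scheme d τ N₀ C).set d τ N₀ g i (n + 1),
      Mel τ (γ / 2) N₀ ω (d.mu0 i ω) (d.R0 i ω) n := fun ω hω => scheme_mel hg (Nat.le_succ n) hω
  have hsc : ∀ ω ∈ (scheme d τ N₀ C).set d τ N₀ g i (n + 1), _ := fun ω hω =>
    sympConj_prodU (posFin_sobW _) (h.small_sob hi)
      (h.pairStart_one hi (scheme_set_subset hg hω)) (hmel ω hω)
  set c := 2 ^ (bExp τ + 4) * homC P.card (muC K) * γ⁻¹ * (N₀ : ℝ) ^ tauOne τ with hcdef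
  have hc0 : 0 ≤ c := by positivity
  have hN := scaleN_nonneg N₀ ((n : ℤ) - 1)
  refine ⟨fun ω hω => ?_, fun ω hω => ?_, fun ω hω => ?_, h.scheme_R_tame hi hg (Nat.le_succ n) hC,
    fun s hs => ?_, fun s => 6 * initC P * c * d.M0 i s, ?_, ?_, fun s hs => ?_⟩
  · rw [scheme_U, scheme_Ui]
    exact (hsc ω hω).toConj S
  · exact (h.scheme_ham hi hg (mem_scheme_set.2 ⟨(mem_scheme_set.1 hω).1,
      (mem_scheme_set.1 hω).2.mono le_rfl (Nat.le_succ n)⟩)).2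
  · rw [scheme_U, scheme_Ui]
    exact ⟨(hsc ω hω).isSymp hne (sM_nonneg P τ), (hsc ω hω).isSymp_inv hne (sM_nonneg P τ)⟩
  · have e : (scheme d τ N₀ C).Ms n i s
        = C * scaleN N₀ ((n : ℤ) - 1) ^ (-aExp τ) * d.M0 i s := by simp only [scheme]; ring
    rw [e]
    have hC0 : 0 ≤ C := by linarith
    refine h.ofReal_mul_M0_le hi.ansatz hs (by positivity) ?_
    calc _ = C * KS * scaleN N₀ ((n : ℤ) - 1) ^ (-aExp τ) := by ring
      _ ≤ _ := by gcongr
  · refine h.lipModTame hi (scheme_set_subset hg) (T := id) (θ := thOne)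
      (F := fun ω => (scheme d τ N₀ C).U i ω n - idOp) (c := c) (fun w A => (kn_thOne w A).symm)
      (fun _ _ => rfl) hc0 le_rfl (fun _ => rfl) ?_
    intro w κ e E ω hw hκ hs hω h0
    simp only [scheme_U]
    exact (pn_prodU_le hw hκ hs h0 fun b => hmel _ (hω b)).1
  · refine h.lipModTame hi (scheme_set_subset hg) (T := id) (θ := thOne)
      (F := fun ω => (scheme d τ N₀ C).Ui i ω n - idOp) (c := c) (fun w A => (kn_thOne w A).symm)
      (fun _ _ => rfl) hc0 le_rfl (fun _ => rfl) ?_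
    intro w κ e E ω hw hκ hs hω h0
    simp only [scheme_Ui]
    exact (pn_prodU_le hw hκ hs h0 fun b => hmel _ (hω b)).2
  · refine h.ofReal_mul_M0_le hi.ansatz hs (by positivity) ?_
    calc _ = 6 * initC P * (2 ^ (bExp τ + 4) * homC P.card (muC K)) * KS * γ⁻¹
          * (N₀ : ℝ) ^ tauOne τ := by rw [hcdef]; ring
      _ ≤ _ := by gcongr

end setting

end KamRed

end

theorem mainTheorem4 (P : Finset ℕ) (hP : ∀ n ∈ P, 0 < n) (hne : P.Nonempty) (τ : ℝ) (hτ : 0 < τ) :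
    ∃ τbar : ℝ, 0 < τbar ∧
    ∀ σ K : ℝ, 0 ≤ σ → 0 < K → ∃ C : ℝ, 0 < C ∧
    ∀ S KS : ℝ, KamRed.sM P τ < S → 0 < KS →
    ∃ (Nmin : ℕ) (CS δ₀ : ℝ), 0 < CS ∧ 0 < δ₀ ∧ δ₀ < 1 ∧
    ∀ N₀ : ℕ, Nmin ≤ N₀ →
    ∀ ε γ μ₀ : ℝ, 0 < ε → 0 < γ → γ < 1 → ε * γ⁻¹ ^ 3 ≤ 1 →
      KamRed.sM P τ + KamRed.muB P τ σ ≤ μ₀ →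
    ∀ d : KamRed.InitData P, KamRed.Admissible d τ σ μ₀ ε γ K S KS →
    ∃ X : KamRed.Scheme P,
      X.r 0 = 0 ∧ X.R 0 = d.R0 ∧
      (∀ i : KamRed.Torus P, KamRed.Ansatz d τ μ₀ ε γ K i →
        (N₀ : ℝ) ^ τbar * d.M0 i (KamRed.sM P τ) * γ⁻¹ ≤ 1 →
        ∀ g ∈ Set.Icc (γ / 2) (2 * γ),
          (∀ ν : ℕ, X.S1 d τ N₀ ε γ S C CS g i ν ∧ X.S1step d τ N₀ γ S C g i ν) ∧
          X.S2 d τ N₀ ε γ C g i) ∧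
      (∀ i₁ i₂ : KamRed.Torus P,
        KamRed.Ansatz d τ μ₀ ε γ K i₁ → KamRed.Ansatz d τ μ₀ ε γ K i₂ →
        (N₀ : ℝ) ^ τbar * d.M0 i₁ (KamRed.sM P τ) * γ⁻¹ ≤ 1 →
        (N₀ : ℝ) ^ τbar * d.M0 i₂ (KamRed.sM P τ) * γ⁻¹ ≤ 1 →
        ∀ ν : ℕ, X.S3 d τ σ N₀ γ C CS i₁ i₂ ν ∧ X.S4 d τ σ N₀ γ CS i₁ i₂ ν) ∧
      ((N₀ : ℝ) ^ τbar * ε * γ⁻¹ ^ 3 ≤ δ₀ →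
        ∀ i : KamRed.Torus P, KamRed.Ansatz d τ μ₀ ε γ K i →
        ∀ g ∈ Set.Icc (γ / 2) (2 * γ), ∀ n : ℕ,
          X.AlmostRed d τ σ N₀ ε γ S CS g i n) := by
  have hc := KamRed.initC_pos (P := P)
  refine ⟨KamRed.tauBar τ, by rw [KamRed.tauBar, KamRed.aExp, KamRed.tauOne]; linarith,
    fun σ K _ hK => ?_⟩
  have hmu := KamRed.muC_nonneg hK.le
  have hhom : 2 ≤ KamRed.homC P.card (KamRed.muC K) := by
    have : (0 : ℝ) ≤ P.card := Nat.cast_nonneg _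
    rw [KamRed.homC]; linarith
  set H := KamRed.homC P.card (KamRed.muC K)
  set I := KamRed.initC P
  have hC1 : 6 * I ≤ 1 + K + 6 * I * H := by nlinarith
  -- The summands serve `C ≥ 1`, the bound `K` of the extension of `m₁`, and the generators; as `H ≥
  -- 2` the last one also covers the remainders. Nothing here depends on `S` or `KS`.
  refine ⟨1 + K + 6 * I * H, by positivity, fun S KS hS hKS => ?_⟩
  set C := 1 + K + 6 * I * H with hCdef
  have hIH : 0 < 6 * I * H := by positivity
  have hT := KamRed.torC_pos (P := P) KS
  have hx : 0 < KS * (1 + K) := by positivity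
  set a₁ := 12 * I * (KS * (1 + K))
  set a₂ := 6 * I * (2 ^ (KamRed.bExp τ + 4) * H) * KS
  have ha₁ : 0 < a₁ := by positivity
  have ha₂ : 0 < a₂ := by positivity
  have ha₃ : 0 < C * KS := by positivity
  -- The threshold for `N₀` combines the growth of the scales with the absorption of the constants
  -- in `toSmall`. The summands of `CS` are for the corrections, the total transformation, the
  -- remainders, and the dependence on the torus; `δ₀` is chosen so that `KS(1+K)δ₀ < 1`, which
  -- yields the smallness of the initial tame constant.
  refine ⟨max 4 ⌈12 * KamRed.smallC τ P.card (KamRed.muC K) * I⌉₊,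
    a₁ + a₂ + C * KS + (KamRed.muC K + 4 * KamRed.torC P KS), (KS * (1 + K) + 1)⁻¹,
    by positivity, by positivity, inv_lt_one_of_one_lt₀ (by linarith), ?_⟩
  intro N₀ hN₀ ε γ μ₀ hε hγ hγ1 hεγ hμ₀ d hd
  have hset : KamRed.Setting d τ σ μ₀ ε γ K S KS N₀ :=
    ⟨hd, hτ, hε, hγ, hγ1, hεγ, hK, hKS, hS, hμ₀, (le_max_left _ _).trans hN₀,
      (Nat.le_ceil _).trans (by exact_mod_cast (le_max_right _ _).trans hN₀)⟩
  refine ⟨KamRed.scheme d τ N₀ C, rfl, rfl, fun i hi hs g hg => ?_,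
    fun i₁ i₂ hi₁ hi₂ hs₁ hs₂ ν => ?_, fun hδ i hi g hg n => ?_⟩
  · have hgood : KamRed.Good d τ μ₀ ε γ K N₀ i := ⟨hi, hs⟩
    have hS2 := hset.scheme_S2 (C := C) hgood hg.1 (by linarith) (by linarith) hC1
    exact ⟨fun ν => ⟨hset.scheme_S1 hgood hg.1 hC1 (by linarith)
      (hS2.lipR_mu_lt_top (fun _ ω hω => (KamRed.mem_scheme_set.1 hω).1.1) ν),
      hset.scheme_S1step hne hgood hg.1 (by linarith)⟩, hS2⟩
  · exact ⟨hset.scheme_S3 ⟨hi₁, hs₁⟩ ⟨hi₂, hs₂⟩ (by linarith) (by linarith) ν,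
      hset.scheme_S4 ⟨hi₁, hs₁⟩ ⟨hi₂, hs₂⟩ (by linarith) ν⟩
  · refine hset.scheme_almostRed hne (hset.good_of_small hi ?_) hg.1 hC1 (by linarith)
      (by linarith) n
    calc KS * (1 + K) * ((N₀ : ℝ) ^ KamRed.tauBar τ * ε * γ⁻¹ ^ 3)
        ≤ KS * (1 + K) * (KS * (1 + K) + 1)⁻¹ := by gcongr
      _ ≤ 1 := by rw [← div_eq_mul_inv, div_le_one (by positivity)]; linarith
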